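/- Let $\mathcal E$ be a locally cartesian closed category (a category with pullbacks in which, for each morphism $f\colon A\to B$, the pullback functor $\Delta_f\colon\mathcal E/B\to\mathcal E/A$ has a right adjoint), with chosen pullbacks and chosen distributivity pullbacks. Here a *pullback around* a composable pair $X\xrightarrow{u}A\xrightarrow{f}B$ consists of $p\colon T\to X$, $q\colon T\to Y$, $r\colon Y\to B$ such that $(up,q,f,r)$ is a pullback square, $f\circ(up)=r\circ q$; a morphism from $(p,q,r)$ to $(p',q',r')$ is a pair $s\colon T\to T'$, $t\colon Y\to Y'$ with $p's=p$, $q's=tq$, $r't=r$; a *distributivity pullback* around $(f,u)$ is a terminal object of the resulting category. Let $\mathbf{Poly}(\mathcal E)$ be the bicategory whose objects are those of $\mathcal E$, whose 1-cells $I\nrightarrow J$ are polynomials $I\xleftarrow{s}A\xrightarrow{p}B\xrightarrow{t}J$, composed by means of the chosen pullbacks and distributivity pullbacks, and whose 2-cells $(s,p,t)\Rightarrow(u,q,v)$, where $I\xleftarrow{u}M\xrightarrow{q}N\xrightarrow{v}J$, are given by $g\colon B\to N$ with $vg=t$ and a pullback $S$ of $g$ and $q$, with projection $f\colon S\to M$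 and other projection of the form $pe\colon S\to B$ for some $e\colon S\to A$ with $se=uf$, modulo isomorphism of $S$ compatible with $e$ and $f$. Let $(-)_\Sigma\colon\mathcal E\to\mathbf{Poly}(\mathcal E)$ be the canonical embedding, the identity on objects, which sends $f\colon X\to Y$ to $X\xleftarrow{1}X\xrightarrow{1}X\xrightarrow{f}Y$; here $\mathcal E$ is regarded as a locally discrete 2-category. Let $\mathscr C$ be any bicategory. An oplax functor $F$ is *gregarious* if its nullary constraints are invertible and the constraint $F(gf)\to Fg\cdot Ff$ is invertible whenever $g$ has a right adjoint. An *icon* between oplax functors that agree on objects is a family of 2-cells $Ff\to Gf$, natural in the 1-cell $f$ and compatible with the constraints. Write $\mathbf{Greg}(\mathbf{Poly}(\mathcal E),\mathscr C)$ and $\mathbf{Icon}(\mathbf{Poly}(\mathcal E),\mathscr C)$ for the categories of gregarious functors, respectively pseudofunctors, $\mathbf{Poly}(\mathcal E)\to\mathscr C$ and icons. Let $\mathbf{2Beck}(\mathcal E,\mathscr C)$ be the category whose morphisms are the invertible icons and whose objects are the pseudofunctors $F\colon\mathcal E\to\mathscr C$ such that (i) for every morphism $f$ there are successive right adjoints $Ff\dashv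 F_\Delta f\dashv F_\Pi f$ in $\mathscr C$, and (ii) (Beck condition) for every pullback square $gf'=fg'$ in $\mathcal E$, the mate $Ff'\cdot F_\Delta g'\Rightarrow F_\Delta g\cdot Ff$ of the isomorphism $Fg\cdot Ff'\cong Ff\cdot Fg'$ is invertible. Let $\mathbf{DistBeck}(\mathcal E,\mathscr C)$ be the full subcategory of those $F$ that also satisfy the distributivity condition: for every distributivity pullback $(p,q,r)$ around $(f,u)$, the 2-cell $$Fr\cdot F_\Pi q\cdot F_\Delta p\Longrightarrow F_\Pi f\cdot Fu$$ is invertible, which is obtained by pasting the unit of $Fu\dashv F_\Delta u$, the 2-cell $F_\Pi q\cdot F_\Delta p\cdot F_\Delta u\Rightarrow F_\Delta r\cdot F_\Pi f$ and the counit of $Fr\dashv F_\Delta r$, where the second 2-cell is the mate, under the composite adjunctions, of the inverse $F_\Delta f\cdot Fr\cong F(up)\cdot F_\Delta q\cong Fu\cdot Fp\cdot F_\Delta q$ of the invertible Beck 2-cell of the pullback square $(up,q,f,r)$. Then composition with $(-)_\Sigma$ defines an equivalence of categories $$\mathbf{Greg}(\mathbf{Poly}(\mathcal E),\mathscr C)\simeq\mathbf{2Beck}(\mathcal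 E,\mathscr C),$$ which restricts to an equivalence $$\mathbf{Icon}(\mathbf{Poly}(\mathcal E),\mathscr C)\simeq\mathbf{DistBeck}(\mathcal E,\mathscr C).$$ -/

import Mathlib

open CategoryTheory Limits

universe v u w₁ w₂ w₃ v₁ v₂ v₃ u₁ u₂ u₃

namespace PolyUniv

section DistributivityPullbacks

variable {E : Type u} [Category.{v} E]

/-- A pullback around `(f, u)`: a diagram `T --p--> X --u--> A --f--> B`,
`T --q--> Y --r--> B` whose outer rectangle is a pullback. -/
structure PullbackAround {X A B : E} (f : A ⟶ B) (u : X ⟶ A) where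
  T : E
  Y : E
  p : T ⟶ X
  q : T ⟶ Y
  r : Y ⟶ B
  isPullback : IsPullback (p ≫ u) q f r

namespace PullbackAround

variable {X A B : E} {f : A ⟶ B} {u : X ⟶ A}

/-- A morphism of pullbacks around `(f, u)`. -/
@[ext]
structure Hom (D D' : PullbackAround f u) where
  s : D.T ⟶ D'.T
  t : D.Y ⟶ D'.Y
  s_p : s ≫ D'.p = D.p
  s_q : s ≫ D'.q = D.q ≫ t
  t_r : t ≫ D'.r = D.r

instance : Category (PullbackAround f u) where
  Hom := Hom
  id D := ⟨𝟙 _, 𝟙 _, by simp, by simp, by simp⟩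
  comp a b := ⟨a.s ≫ b.s, a.t ≫ b.t, by simp [b.s_p, a.s_p], by
    rw [Category.assoc, b.s_q, ← Category.assoc, a.s_q, Category.assoc], by
    simp [b.t_r, a.t_r]⟩
  id_comp _ := Hom.ext (Category.id_comp _) (Category.id_comp _)
  comp_id _ := Hom.ext (Category.comp_id _) (Category.comp_id _)
  assoc _ _ _ := Hom.ext (Category.assoc _ _ _) (Category.assoc _ _ _)

/-- A distributivity pullback around `(f, u)` is a terminal pullback around `(f, u)`. -/
def IsDistributivityPullback (D : PullbackAround f u) : Prop := Nonempty (IsTerminal D)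

section Elements

variable {X A B : E} {f : A ⟶ B} {u : X ⟶ A} (D : PullbackAround f u)

/-- The generalised element of `D.T` lying over `m` and `x`. -/
noncomputable def lft {W : E} (x : W ⟶ D.Y) (m : W ⟶ A) (h : x ≫ D.r = m ≫ f) : W ⟶ D.T :=
  D.isPullback.lift m x h.symm

lemma lft_p_u {W : E} (x : W ⟶ D.Y) (m : W ⟶ A) (h : x ≫ D.r = m ≫ f) :
    D.lft x m h ≫ D.p ≫ u = m :=
  IsPullback.lift_fst _ _ _ _

lemma lft_q {W : E} (x : W ⟶ D.Y) (m : W ⟶ A) (h : x ≫ D.r = m ≫ f) :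
    D.lft x m h ≫ D.q = x :=
  IsPullback.lift_snd _ _ _ _

lemma T_ext {W : E} {y y' : W ⟶ D.T} (h : y ≫ D.q = y' ≫ D.q)
    (h' : y ≫ D.p ≫ u = y' ≫ D.p ≫ u) : y = y' :=
  D.isPullback.hom_ext h' h

lemma precomp_lft {V W : E} (z : V ⟶ W) (x : W ⟶ D.Y) (m : W ⟶ A) (h : x ≫ D.r = m ≫ f) :
    z ≫ D.lft x m h = D.lft (z ≫ x) (z ≫ m) (by simp only [Category.assoc, h]) := by
  apply D.T_ext <;> simp only [Category.assoc, lft_p_u, lft_q]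

/-- The pullback around `(f, u)` given by an element `n` of `B` and a section of `u` over the
fibre of `f` at `n`. -/
def around [ChosenPullbacks E] {W : E} (n : W ⟶ B)
    (k : ∀ (V : E) (z : V ⟶ W) (m : V ⟶ A), z ≫ n = m ≫ f → (V ⟶ X))
    (ku : ∀ (V : E) (z : V ⟶ W) (m : V ⟶ A) (h : z ≫ n = m ≫ f), k V z m h ≫ u = m) :
    PullbackAround f u where
  T := ChosenPullbacksAlong.pullbackObj n f
  Y := W
  p := k _ (ChosenPullbacksAlong.fst n f) (ChosenPullbacksAlong.snd n f)
    ChosenPullbacksAlong.condition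
  q := ChosenPullbacksAlong.fst n f
  r := n
  isPullback := by
    rw [ku]
    exact (ChosenPullbacksAlong.isPullback n f).flip

variable {D} (hD : IsTerminal D) [ChosenPullbacks E]

/-- The generalised element of `D.Y` given by an element `n` of `B` and a section of `u` over the
fibre of `f` at `n`. -/
def mkY {W : E} (n : W ⟶ B)
    (k : ∀ (V : E) (z : V ⟶ W) (m : V ⟶ A), z ≫ n = m ≫ f → (V ⟶ X))
    (ku : ∀ (V : E) (z : V ⟶ W) (m : V ⟶ A) (h : z ≫ n = m ≫ f), k V z m h ≫ u = m) :
    W ⟶ D.Y :=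
  (hD.from (around n k ku)).t

lemma mkY_r {W : E} (n : W ⟶ B)
    (k : ∀ (V : E) (z : V ⟶ W) (m : V ⟶ A), z ≫ n = m ≫ f → (V ⟶ X))
    (ku : ∀ (V : E) (z : V ⟶ W) (m : V ⟶ A) (h : z ≫ n = m ≫ f), k V z m h ≫ u = m) :
    mkY hD n k ku ≫ D.r = n :=
  (hD.from (around n k ku)).t_r

lemma lft_mkY {W : E} (n : W ⟶ B)
    (k : ∀ (V : E) (z : V ⟶ W) (m : V ⟶ A), z ≫ n = m ≫ f → (V ⟶ X))
    (ku : ∀ (V : E) (z : V ⟶ W) (m : V ⟶ A) (h : z ≫ n = m ≫ f), k V z m h ≫ u = m)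
    (nat : ∀ (U V : E) (w : U ⟶ V) (z : V ⟶ W) (m : V ⟶ A) (h : z ≫ n = m ≫ f),
      w ≫ k V z m h = k U (w ≫ z) (w ≫ m) (by simp only [Category.assoc, h]))
    {V : E} (z : V ⟶ W) (m : V ⟶ A) (h : z ≫ n = m ≫ f)
    (h' : (z ≫ mkY hD n k ku) ≫ D.r = m ≫ f) :
    D.lft (z ≫ mkY hD n k ku) m h' ≫ D.p = k V z m h := by
  let τ := hD.from (around n k ku)
  let l : V ⟶ (around n k ku).T := ChosenPullbacksAlong.lift z m h
  have l1 : l ≫ (around n k ku).q = z := ChosenPullbacksAlong.lift_fst z m h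
  have l2 : l ≫ ChosenPullbacksAlong.snd n f = m := ChosenPullbacksAlong.lift_snd z m h
  have l3 : l ≫ (around n k ku).p = k V z m h := by
    refine (nat _ _ _ _ _ _).trans ?_
    congr 1
  have h1 : D.lft (z ≫ mkY hD n k ku) m h' = l ≫ τ.s := by
    apply D.T_ext
    · rw [lft_q, Category.assoc, τ.s_q, ← Category.assoc, l1]
      rfl
    · rw [lft_p_u, Category.assoc, ← Category.assoc τ.s, τ.s_p, ← Category.assoc, l3, ku]
  rw [h1, Category.assoc, τ.s_p, l3]

lemma Y_ext (hD : IsTerminal D) {W : E} {x y : W ⟶ D.Y} (h : x ≫ D.r = y ≫ D.r)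
    (hp : ∀ {V : E} (z : V ⟶ W) (m : V ⟶ A) (h₁ : (z ≫ x) ≫ D.r = m ≫ f)
      (h₂ : (z ≫ y) ≫ D.r = m ≫ f), D.lft (z ≫ x) m h₁ ≫ D.p = D.lft (z ≫ y) m h₂ ≫ D.p) :
    x = y := by
  let F : PullbackAround f u := around (x ≫ D.r)
    (fun V z m h => D.lft (z ≫ x) m (by simpa using h) ≫ D.p)
    (fun V z m h => by rw [Category.assoc, lft_p_u])
  let a : F.T ⟶ W := ChosenPullbacksAlong.fst (x ≫ D.r) f
  let b : F.T ⟶ A := ChosenPullbacksAlong.snd (x ≫ D.r) f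
  have hab : a ≫ x ≫ D.r = b ≫ f := ChosenPullbacksAlong.condition
  have hab' : a ≫ y ≫ D.r = b ≫ f := by rw [← h]; exact hab
  let τ : F ⟶ D :=
    { s := D.lft (a ≫ x) b (by simpa using hab)
      t := x
      s_p := rfl
      s_q := lft_q _ _ _ _
      t_r := rfl }
  let σ : F ⟶ D :=
    { s := D.lft (a ≫ y) b (by simpa using hab')
      t := y
      s_p := (hp a b _ _).symm
      s_q := lft_q _ _ _ _
      t_r := h.symm }
  exact congrArg Hom.t (hD.hom_ext τ σ)

end Elements

end PullbackAround

/-- A choice of a distributivity pullback around every composable pair. -/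
class ChosenDistributivityPullbacks (E : Type u) [Category.{v} E] where
  dpb {X A B : E} (f : A ⟶ B) (u : X ⟶ A) : PullbackAround f u
  isTerminal {X A B : E} (f : A ⟶ B) (u : X ⟶ A) : IsTerminal (dpb f u)

end DistributivityPullbacks

open ChosenPullbacksAlong ChosenDistributivityPullbacks

section Polynomials

variable {E : Type u} [Category.{v} E]

/-- A polynomial `I <--s-- tot --p--> base --t--> J`. -/
structure PolyMor (I J : E) where
  tot : E
  base : E
  s : tot ⟶ I
  p : tot ⟶ base
  t : base ⟶ J

variable [ChosenPullbacks E]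

namespace PolyMor

variable {I J K L : E}

/-- A 2-cell `P ⟶ Q` of polynomials: a morphism `g` of bases over `J` and a morphism `e` over `P.base`
and `I` from the pullback of `g` and `Q.p` to `P.tot`. Diagrams with an arbitrary pullback in place
of the chosen one, modulo isomorphism of this pullback, are the same thing
(`PolyMor.Diagram.toHom_surjective`, `PolyMor.Diagram.toHom_eq_iff`). -/
structure Hom (P Q : PolyMor I J) where
  g : P.base ⟶ Q.base
  e : pullbackObj g Q.p ⟶ P.tot
  g_t : g ≫ Q.t = P.t
  e_p : e ≫ P.p = fst g Q.p
  e_s : e ≫ P.s = snd g Q.p ≫ Q.s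

namespace Hom

variable {P Q R : PolyMor I J}

/-- The action of a 2-cell on generalised elements of the base. -/
def ap (φ : Hom P Q) {W : E} (b : W ⟶ P.base) : W ⟶ Q.base := b ≫ φ.g

@[simp] lemma precomp_ap (φ : Hom P Q) {V W : E} (w : V ⟶ W) (b : W ⟶ P.base) :
    w ≫ φ.ap b = φ.ap (w ≫ b) := by simp only [ap, Category.assoc]

@[simp] lemma precomp_ap_assoc (φ : Hom P Q) {V W Z : E} (w : V ⟶ W) (b : W ⟶ P.base)
    (k : Q.base ⟶ Z) : w ≫ φ.ap b ≫ k = φ.ap (w ≫ b) ≫ k := by simp only [ap, Category.assoc]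

@[simp] lemma ap_t (φ : Hom P Q) {W : E} (b : W ⟶ P.base) : φ.ap b ≫ Q.t = b ≫ P.t := by
  simp only [ap, Category.assoc, φ.g_t]

@[simp] lemma ap_t_assoc (φ : Hom P Q) {W Z : E} (b : W ⟶ P.base) (k : J ⟶ Z) :
    φ.ap b ≫ Q.t ≫ k = b ≫ P.t ≫ k := by
  rw [← Category.assoc, ap_t, Category.assoc]

/-- The action of a 2-cell on generalised elements of the fibres. -/
def act (φ : Hom P Q) {W : E} (b : W ⟶ P.base) (m : W ⟶ Q.tot) (h : φ.ap b = m ≫ Q.p) :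
    W ⟶ P.tot :=
  lift b m h ≫ φ.e

@[simp]
lemma act_p (φ : Hom P Q) {W : E} (b : W ⟶ P.base) (m : W ⟶ Q.tot) (h : φ.ap b = m ≫ Q.p) :
    φ.act b m h ≫ P.p = b := by
  rw [act, Category.assoc, φ.e_p, lift_fst b m h]

@[simp]
lemma act_p_assoc (φ : Hom P Q) {W Z : E} (b : W ⟶ P.base) (m : W ⟶ Q.tot)
    (h : φ.ap b = m ≫ Q.p) (k : P.base ⟶ Z) :
    φ.act b m h ≫ P.p ≫ k = b ≫ k := by
  rw [← Category.assoc, act_p]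

@[simp]
lemma act_s (φ : Hom P Q) {W : E} (b : W ⟶ P.base) (m : W ⟶ Q.tot) (h : φ.ap b = m ≫ Q.p) :
    φ.act b m h ≫ P.s = m ≫ Q.s := by
  rw [act, Category.assoc, φ.e_s, ← Category.assoc, lift_snd b m h]

@[simp]
lemma act_s_assoc (φ : Hom P Q) {W Z : E} (b : W ⟶ P.base) (m : W ⟶ Q.tot)
    (h : φ.ap b = m ≫ Q.p) (k : I ⟶ Z) :
    φ.act b m h ≫ P.s ≫ k = m ≫ Q.s ≫ k := by
  rw [← Category.assoc, act_s, Category.assoc]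

@[simp]
lemma precomp_act (φ : Hom P Q) {V W : E} (w : V ⟶ W) (b : W ⟶ P.base) (m : W ⟶ Q.tot)
    (h : φ.ap b = m ≫ Q.p) :
    w ≫ φ.act b m h = φ.act (w ≫ b) (w ≫ m) (by simp only [Category.assoc, ← h, precomp_ap]) := by
  unfold act
  rw [← Category.assoc]
  congr 1
  apply ChosenPullbacksAlong.hom_ext
  · exact (Category.assoc _ _ _).trans ((congrArg (w ≫ ·) (lift_fst b m h)).trans
      (lift_fst _ _ _).symm)
  · exact (Category.assoc _ _ _).trans ((congrArg (w ≫ ·) (lift_snd b m h)).trans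
      (lift_snd _ _ _).symm)

@[simp]
lemma precomp_act_assoc (φ : Hom P Q) {V W Z : E} (w : V ⟶ W) (b : W ⟶ P.base) (m : W ⟶ Q.tot)
    (h : φ.ap b = m ≫ Q.p) (k : P.tot ⟶ Z) :
    w ≫ φ.act b m h ≫ k = φ.act (w ≫ b) (w ≫ m) (by simp only [Category.assoc, ← h, precomp_ap]) ≫ k := by
  rw [← Category.assoc, precomp_act]

lemma e_eq_act (φ : Hom P Q) : φ.e = φ.act (fst φ.g Q.p) (snd φ.g Q.p) condition := by
  have : lift (fst φ.g Q.p) (snd φ.g Q.p) condition = 𝟙 _ := by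
    apply ChosenPullbacksAlong.hom_ext
    · exact (lift_fst _ _ _).trans (Category.id_comp _).symm
    · exact (lift_snd _ _ _).trans (Category.id_comp _).symm
  exact (Category.id_comp _).symm.trans (congrArg (· ≫ φ.e) this.symm)

lemma ext_act {φ ψ : Hom P Q} (hg : ∀ {W : E} (b : W ⟶ P.base), φ.ap b = ψ.ap b)
    (h : ∀ {W : E} (b : W ⟶ P.base) (m : W ⟶ Q.tot) (h₁ : φ.ap b = m ≫ Q.p)
      (h₂ : ψ.ap b = m ≫ Q.p), φ.act b m h₁ = ψ.act b m h₂) : φ = ψ := by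
  have he := e_eq_act φ
  have he' := e_eq_act ψ
  obtain ⟨g, e, h1, h2, h3⟩ := φ
  obtain ⟨g', e', h1', h2', h3'⟩ := ψ
  obtain rfl : g = g' := by simpa [ap] using hg (𝟙 _)
  obtain rfl : e = e' := he.trans ((h _ _ _ _).trans he'.symm)
  rfl

/-- The 2-cell given by a morphism of bases and a family of maps on generalised elements of the
fibres, evaluated at the universal element. -/
def ofAct (g : P.base ⟶ Q.base) (hg : g ≫ Q.t = P.t)
    (k : ∀ (W : E) (b : W ⟶ P.base) (m : W ⟶ Q.tot), b ≫ g = m ≫ Q.p → (W ⟶ P.tot))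
    (kp : ∀ (W : E) (b : W ⟶ P.base) (m : W ⟶ Q.tot) (h : b ≫ g = m ≫ Q.p),
      k W b m h ≫ P.p = b)
    (ks : ∀ (W : E) (b : W ⟶ P.base) (m : W ⟶ Q.tot) (h : b ≫ g = m ≫ Q.p),
      k W b m h ≫ P.s = m ≫ Q.s) :
    Hom P Q where
  g := g
  e := k _ (fst g Q.p) (snd g Q.p) condition
  g_t := hg
  e_p := kp _ _ _ _
  e_s := ks _ _ _ _

lemma ofAct_g (g : P.base ⟶ Q.base) (hg : g ≫ Q.t = P.t)
    (k : ∀ (W : E) (b : W ⟶ P.base) (m : W ⟶ Q.tot), b ≫ g = m ≫ Q.p → (W ⟶ P.tot))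
    (kp) (ks) : (ofAct (P := P) (Q := Q) g hg k kp ks).g = g := rfl

lemma ofAct_act (g : P.base ⟶ Q.base) (hg : g ≫ Q.t = P.t)
    (k : ∀ (W : E) (b : W ⟶ P.base) (m : W ⟶ Q.tot), b ≫ g = m ≫ Q.p → (W ⟶ P.tot))
    (kp) (ks)
    (nat : ∀ (V W : E) (w : V ⟶ W) (b : W ⟶ P.base) (m : W ⟶ Q.tot) (h : b ≫ g = m ≫ Q.p),
      w ≫ k W b m h = k V (w ≫ b) (w ≫ m) (by simp only [Category.assoc, h]))
    {W : E} (b : W ⟶ P.base) (m : W ⟶ Q.tot) (h : b ≫ g = m ≫ Q.p) :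
    (ofAct (P := P) (Q := Q) g hg k kp ks).act b m h = k W b m h := by
  change lift b m h ≫ k _ _ _ _ = _
  rw [nat]
  congr 1
  · exact lift_fst _ _ _
  · exact lift_snd _ _ _

lemma ofAct_ap (g : P.base ⟶ Q.base) (hg : g ≫ Q.t = P.t)
    (k : ∀ (W : E) (b : W ⟶ P.base) (m : W ⟶ Q.tot), b ≫ g = m ≫ Q.p → (W ⟶ P.tot))
    (kp) (ks) {W : E} (b : W ⟶ P.base) :
    (ofAct (P := P) (Q := Q) g hg k kp ks).ap b = b ≫ g := rfl

/-- The identity 2-cell. -/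
def id (P : PolyMor I J) : Hom P P :=
  ofAct (𝟙 _) (Category.id_comp _) (fun _ _ m _ => m)
    (fun _ b m h => by simpa using h.symm) (fun _ _ _ _ => rfl)

@[simp] lemma id_ap (P : PolyMor I J) {W : E} (b : W ⟶ P.base) : (Hom.id P).ap b = b :=
  Category.comp_id _

@[simp] lemma id_act (P : PolyMor I J) {W : E} (b : W ⟶ P.base) (m : W ⟶ P.tot)
    (h : (Hom.id P).ap b = m ≫ P.p) : (Hom.id P).act b m h = m :=
  ofAct_act _ _ _ _ _ (fun _ _ _ _ _ _ => rfl) _ _ _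

lemma comp_h (φ : Hom P Q) (ψ : Hom Q R) {W : E} {b : W ⟶ P.base} {m : W ⟶ R.tot}
    (h : b ≫ φ.g ≫ ψ.g = m ≫ R.p) : ψ.ap (φ.ap b) = m ≫ R.p :=
  (Category.assoc _ _ _).trans h

/-- Vertical composition of 2-cells. -/
def comp (φ : Hom P Q) (ψ : Hom Q R) : Hom P R :=
  ofAct (φ.g ≫ ψ.g) (by simp [φ.g_t, ψ.g_t])
    (fun _ b m h => φ.act b (ψ.act (φ.ap b) m (comp_h φ ψ h)) (act_p _ _ _ _).symm)
    (fun _ b m h => by simp) (fun _ b m h => by simp)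

@[simp] lemma comp_ap (φ : Hom P Q) (ψ : Hom Q R) {W : E} (b : W ⟶ P.base) :
    (φ.comp ψ).ap b = ψ.ap (φ.ap b) :=
  (Category.assoc _ _ _).symm

@[simp] lemma comp_act (φ : Hom P Q) (ψ : Hom Q R) {W : E} (b : W ⟶ P.base) (m : W ⟶ R.tot)
    (h : (φ.comp ψ).ap b = m ≫ R.p) :
    (φ.comp ψ).act b m h = φ.act b (ψ.act (φ.ap b) m (comp_h φ ψ h)) (act_p _ _ _ _).symm :=
  ofAct_act _ _ _ _ _ (by intros; simp) _ _ _

end Hom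

instance : Category (PolyMor I J) where
  Hom := Hom
  id := Hom.id
  comp := Hom.comp
  id_comp φ := Hom.ext_act (by simp) (fun b m h h' => by simp)
  comp_id φ := Hom.ext_act (by simp) (fun b m h h' => by simp)
  assoc φ ψ χ := Hom.ext_act (by simp) (fun b m h h' => by simp)

section

variable {P Q R : PolyMor I J}

lemma hom_ext {φ ψ : P ⟶ Q} (hg : ∀ {W : E} (b : W ⟶ P.base), φ.ap b = ψ.ap b)
    (h : ∀ {W : E} (b : W ⟶ P.base) (m : W ⟶ Q.tot) (h₁ : φ.ap b = m ≫ Q.p)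
      (h₂ : ψ.ap b = m ≫ Q.p), φ.act b m h₁ = ψ.act b m h₂) : φ = ψ :=
  Hom.ext_act hg h

@[simp] lemma id_ap {W : E} (b : W ⟶ P.base) : Hom.ap (𝟙 P) b = b := Hom.id_ap P b

@[simp] lemma id_act {W : E} (b : W ⟶ P.base) (m : W ⟶ P.tot)
    (h : Hom.ap (𝟙 P) b = m ≫ P.p) :
    Hom.act (𝟙 P) b m h = m := Hom.id_act P b m h

@[simp] lemma comp_ap (φ : P ⟶ Q) (ψ : Q ⟶ R) {W : E} (b : W ⟶ P.base) :
    Hom.ap (φ ≫ ψ) b = ψ.ap (φ.ap b) := Hom.comp_ap φ ψ b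

@[simp] lemma comp_act (φ : P ⟶ Q) (ψ : Q ⟶ R) {W : E} (b : W ⟶ P.base) (m : W ⟶ R.tot)
    (h : Hom.ap (φ ≫ ψ) b = m ≫ R.p) :
    Hom.act (φ ≫ ψ) b m h =
      φ.act b (ψ.act (φ.ap b) m (Hom.comp_h φ ψ h)) (Hom.act_p ψ _ _ _).symm :=
  Hom.comp_act φ ψ b m h

end

variable [ChosenDistributivityPullbacks E]

/-- The distributivity pullback used to compose `P` and `Q`. -/
def compDPB (P : PolyMor I J) (Q : PolyMor J K) : PullbackAround Q.p (snd P.t Q.s) :=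
  dpb Q.p (snd P.t Q.s)

/-- Composition of polynomials: form the pullback of `P.t` and `Q.s`, then the distributivity
pullback around `Q.p` and the projection to `Q.tot`, and then the pullback along `P.p`. -/
def comp (P : PolyMor I J) (Q : PolyMor J K) : PolyMor I K where
  tot := pullbackObj P.p ((compDPB P Q).p ≫ fst P.t Q.s)
  base := (compDPB P Q).Y
  s := fst P.p ((compDPB P Q).p ≫ fst P.t Q.s) ≫ P.s
  p := snd P.p ((compDPB P Q).p ≫ fst P.t Q.s) ≫ (compDPB P Q).q
  t := (compDPB P Q).r ≫ Q.t

section CompAPI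

variable (P : PolyMor I J) (Q : PolyMor J K)

/-- The projection of the composite to the base of the second factor. -/
def cr : (comp P Q).base ⟶ Q.base := (compDPB P Q).r

@[simp] lemma comp_t : (comp P Q).t = cr P Q ≫ Q.t := rfl

variable {P Q}

/-- The element of `P.base` which an element `x` of `(comp P Q).base` assigns to a point `m` of the
fibre of `Q.p` at `x`. -/
noncomputable def pos {W : E} (x : W ⟶ (comp P Q).base) (m : W ⟶ Q.tot)
    (h : x ≫ cr P Q = m ≫ Q.p) : W ⟶ P.base :=
  ((compDPB P Q).lft x m h ≫ (compDPB P Q).p) ≫ fst P.t Q.s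

@[simp] lemma pos_t {W : E} (x : W ⟶ (comp P Q).base) (m : W ⟶ Q.tot)
    (h : x ≫ cr P Q = m ≫ Q.p) : pos x m h ≫ P.t = m ≫ Q.s := by
  rw [pos, Category.assoc, condition, ← Category.assoc]
  congr 1
  exact (Category.assoc _ _ _).trans ((compDPB P Q).lft_p_u x m h)

@[simp] lemma pos_t_assoc {W Z : E} (x : W ⟶ (comp P Q).base) (m : W ⟶ Q.tot)
    (h : x ≫ cr P Q = m ≫ Q.p) (k : J ⟶ Z) : pos x m h ≫ P.t ≫ k = m ≫ Q.s ≫ k := by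
  rw [← Category.assoc, pos_t, Category.assoc]

@[simp] lemma precomp_pos {V W : E} (z : V ⟶ W) (x : W ⟶ (comp P Q).base) (m : W ⟶ Q.tot)
    (h : x ≫ cr P Q = m ≫ Q.p) :
    z ≫ pos x m h = pos (z ≫ x) (z ≫ m) (by simp only [Category.assoc, h]) := by
  refine (Category.assoc _ _ _).symm.trans (congrArg (· ≫ fst P.t Q.s) ?_)
  refine (Category.assoc _ _ _).symm.trans (congrArg (· ≫ (compDPB P Q).p) ?_)
  exact (compDPB P Q).precomp_lft z x m h

@[simp] lemma precomp_pos_assoc {V W Z : E} (z : V ⟶ W) (x : W ⟶ (comp P Q).base)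
    (m : W ⟶ Q.tot) (h : x ≫ cr P Q = m ≫ Q.p) (k : P.base ⟶ Z) :
    z ≫ pos x m h ≫ k = pos (z ≫ x) (z ≫ m) (by simp only [Category.assoc, h]) ≫ k := by
  rw [← Category.assoc, precomp_pos]

/-- The element of `(comp P Q).base` given by an element `n` of `Q.base` together with a natural
family of elements of `P.base` indexed by the fibre of `Q.p` at `n`. -/
def mkBase {W : E} (n : W ⟶ Q.base)
    (k : ∀ (V : E) (z : V ⟶ W) (m : V ⟶ Q.tot), z ≫ n = m ≫ Q.p → (V ⟶ P.base))
    (kt : ∀ (V : E) (z : V ⟶ W) (m : V ⟶ Q.tot) (h : z ≫ n = m ≫ Q.p),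
      k V z m h ≫ P.t = m ≫ Q.s) : W ⟶ (comp P Q).base :=
  PullbackAround.mkY (isTerminal Q.p (snd P.t Q.s)) n
    (fun V z m h => lift (k V z m h) m (kt V z m h)) (fun _ _ _ _ => lift_snd _ _ _)

@[simp] lemma mkBase_cr {W : E} (n : W ⟶ Q.base)
    (k : ∀ (V : E) (z : V ⟶ W) (m : V ⟶ Q.tot), z ≫ n = m ≫ Q.p → (V ⟶ P.base))
    (kt : ∀ (V : E) (z : V ⟶ W) (m : V ⟶ Q.tot) (h : z ≫ n = m ≫ Q.p),
      k V z m h ≫ P.t = m ≫ Q.s) : mkBase n k kt ≫ cr P Q = n :=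
  PullbackAround.mkY_r (isTerminal Q.p (snd P.t Q.s)) n _ _

@[simp] lemma mkBase_cr_assoc {W Z : E} (n : W ⟶ Q.base)
    (k : ∀ (V : E) (z : V ⟶ W) (m : V ⟶ Q.tot), z ≫ n = m ≫ Q.p → (V ⟶ P.base))
    (kt : ∀ (V : E) (z : V ⟶ W) (m : V ⟶ Q.tot) (h : z ≫ n = m ≫ Q.p),
      k V z m h ≫ P.t = m ≫ Q.s) (l : Q.base ⟶ Z) :
    mkBase n k kt ≫ cr P Q ≫ l = n ≫ l := by
  rw [← Category.assoc, mkBase_cr]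

lemma pos_precomp_mkBase {W : E} (n : W ⟶ Q.base)
    (k : ∀ (V : E) (z : V ⟶ W) (m : V ⟶ Q.tot), z ≫ n = m ≫ Q.p → (V ⟶ P.base))
    (kt : ∀ (V : E) (z : V ⟶ W) (m : V ⟶ Q.tot) (h : z ≫ n = m ≫ Q.p),
      k V z m h ≫ P.t = m ≫ Q.s)
    (nat : ∀ (U V : E) (w : U ⟶ V) (z : V ⟶ W) (m : V ⟶ Q.tot) (h : z ≫ n = m ≫ Q.p),
      w ≫ k V z m h = k U (w ≫ z) (w ≫ m) (by simp only [Category.assoc, h]))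
    {V : E} (z : V ⟶ W) (m : V ⟶ Q.tot) (h : z ≫ n = m ≫ Q.p) :
    pos (z ≫ mkBase n k kt) m (by simp [h]) = k V z m h := by
  have := PullbackAround.lft_mkY (isTerminal Q.p (snd P.t Q.s)) n
    (fun V z m h => lift (k V z m h) m (kt V z m h)) (fun _ _ _ _ => lift_snd _ _ _)
    (fun U V w z m h => by
      apply ChosenPullbacksAlong.hom_ext
      · rw [Category.assoc, lift_fst _ _ (kt _ _ _ _), lift_fst _ _ (kt _ _ _ _), nat]
      · rw [Category.assoc, lift_snd _ _ (kt _ _ _ _), lift_snd _ _ (kt _ _ _ _)]) z m h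
    (by rw [Category.assoc, PullbackAround.mkY_r, h])
  exact (congrArg (· ≫ fst P.t Q.s) this).trans (lift_fst _ _ _)

lemma base_ext {W : E} {x y : W ⟶ (comp P Q).base} (h : x ≫ cr P Q = y ≫ cr P Q)
    (hp : ∀ {V : E} (z : V ⟶ W) (m : V ⟶ Q.tot) (h₁ : (z ≫ x) ≫ cr P Q = m ≫ Q.p)
      (h₂ : (z ≫ y) ≫ cr P Q = m ≫ Q.p), pos (z ≫ x) m h₁ = pos (z ≫ y) m h₂) : x = y := by
  refine PullbackAround.Y_ext (isTerminal Q.p (snd P.t Q.s)) h (fun z m h₁ h₂ => ?_)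
  apply ChosenPullbacksAlong.hom_ext
  · exact hp z m h₁ h₂
  · rw [Category.assoc, Category.assoc, PullbackAround.lft_p_u, PullbackAround.lft_p_u]

variable (P Q)

/-- The projection of the composite to the total object of the second factor. -/
def ctm : (comp P Q).tot ⟶ Q.tot :=
  snd P.p ((compDPB P Q).p ≫ fst P.t Q.s) ≫ (compDPB P Q).p ≫ snd P.t Q.s

def ctx : (comp P Q).tot ⟶ P.tot := fst P.p ((compDPB P Q).p ≫ fst P.t Q.s)

@[simp] lemma comp_s : (comp P Q).s = ctx P Q ≫ P.s := rfl

lemma comp_p_cr : (comp P Q).p ≫ cr P Q = ctm P Q ≫ Q.p := by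
  have := (compDPB P Q).isPullback.w
  change (snd _ _ ≫ (compDPB P Q).q) ≫ (compDPB P Q).r = (snd _ _ ≫ _) ≫ Q.p
  rw [Category.assoc, ← this]
  simp only [Category.assoc]

@[simp] lemma ctm_p : ctm P Q ≫ Q.p = (comp P Q).p ≫ cr P Q := (comp_p_cr P Q).symm

@[simp] lemma ctm_p_assoc {Z : E} (k : Q.base ⟶ Z) :
    ctm P Q ≫ Q.p ≫ k = (comp P Q).p ≫ cr P Q ≫ k := by
  rw [← Category.assoc, ctm_p, Category.assoc]

@[simp] lemma ctx_p : ctx P Q ≫ P.p = pos (comp P Q).p (ctm P Q) (comp_p_cr P Q) := by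
  have : (compDPB P Q).lft (comp P Q).p (ctm P Q) (comp_p_cr P Q) =
      snd P.p ((compDPB P Q).p ≫ fst P.t Q.s) := by
    apply (compDPB P Q).T_ext
    · exact (compDPB P Q).lft_q _ _ _
    · exact (compDPB P Q).lft_p_u _ _ _
  rw [pos, this]
  exact condition.trans (Category.assoc _ _ _).symm

@[simp] lemma ctx_p_assoc {Z : E} (k : P.base ⟶ Z) :
    ctx P Q ≫ P.p ≫ k = pos (comp P Q).p (ctm P Q) (comp_p_cr P Q) ≫ k := by
  rw [← Category.assoc, ctx_p]

variable {P Q}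

noncomputable def mkTot {W : E} (x : W ⟶ (comp P Q).base) (m : W ⟶ Q.tot) (w : W ⟶ P.tot)
    (h : x ≫ cr P Q = m ≫ Q.p) (hw : w ≫ P.p = pos x m h) : W ⟶ (comp P Q).tot :=
  lift w ((compDPB P Q).lft x m h) (hw.trans (Category.assoc _ _ _))

section

variable {W : E} (x : W ⟶ (comp P Q).base) (m : W ⟶ Q.tot) (w : W ⟶ P.tot)
  (h : x ≫ cr P Q = m ≫ Q.p) (hw : w ≫ P.p = pos x m h)

@[simp] lemma mkTot_p : mkTot x m w h hw ≫ (comp P Q).p = x := by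
  refine (Category.assoc _ _ _).symm.trans ?_
  refine (congrArg (· ≫ (compDPB P Q).q) (lift_snd _ _ _)).trans ?_
  exact (compDPB P Q).lft_q x m h

@[simp] lemma mkTot_ctm : mkTot x m w h hw ≫ ctm P Q = m := by
  refine (Category.assoc _ _ _).symm.trans ?_
  refine (congrArg (· ≫ (compDPB P Q).p ≫ snd P.t Q.s) (lift_snd _ _ _)).trans ?_
  exact (compDPB P Q).lft_p_u x m h

@[simp] lemma mkTot_ctx : mkTot x m w h hw ≫ ctx P Q = w :=
  lift_fst _ _ (hw.trans (Category.assoc _ _ _))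

@[simp] lemma mkTot_p_assoc {Z : E} (k : (comp P Q).base ⟶ Z) :
    mkTot x m w h hw ≫ (comp P Q).p ≫ k = x ≫ k := by
  rw [← Category.assoc, mkTot_p]

@[simp] lemma mkTot_ctm_assoc {Z : E} (k : Q.tot ⟶ Z) :
    mkTot x m w h hw ≫ ctm P Q ≫ k = m ≫ k := by
  rw [← Category.assoc, mkTot_ctm]

@[simp] lemma mkTot_ctx_assoc {Z : E} (k : P.tot ⟶ Z) :
    mkTot x m w h hw ≫ ctx P Q ≫ k = w ≫ k := by
  rw [← Category.assoc, mkTot_ctx]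

end

lemma tot_ext {W : E} {y y' : W ⟶ (comp P Q).tot} (hp : y ≫ (comp P Q).p = y' ≫ (comp P Q).p)
    (hm : y ≫ ctm P Q = y' ≫ ctm P Q) (hx : y ≫ ctx P Q = y' ≫ ctx P Q) : y = y' := by
  apply ChosenPullbacksAlong.hom_ext
  · exact hx
  · apply (compDPB P Q).T_ext
    · exact (Category.assoc _ _ _).trans (hp.trans (Category.assoc _ _ _).symm)
    · exact (Category.assoc _ _ _).trans (hm.trans (Category.assoc _ _ _).symm)

@[simp] lemma precomp_mkTot {V W : E} (z : V ⟶ W) (x : W ⟶ (comp P Q).base) (m : W ⟶ Q.tot)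
    (w : W ⟶ P.tot) (h : x ≫ cr P Q = m ≫ Q.p) (hw : w ≫ P.p = pos x m h) :
    z ≫ mkTot x m w h hw = mkTot (z ≫ x) (z ≫ m) (z ≫ w) (by simp only [Category.assoc, h])
      (by simp only [Category.assoc, hw, precomp_pos]) := by
  apply tot_ext <;> simp

lemma cr_of_eq {W : E} {x : W ⟶ (comp P Q).base} {y : W ⟶ (comp P Q).tot}
    (h : x = y ≫ (comp P Q).p) : x ≫ cr P Q = (y ≫ ctm P Q) ≫ Q.p := by
  simp [h]

lemma pos_of_eq {W : E} {x : W ⟶ (comp P Q).base} {y : W ⟶ (comp P Q).tot}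
    (h : x = y ≫ (comp P Q).p) :
    pos x (y ≫ ctm P Q) (cr_of_eq h) = (y ≫ ctx P Q) ≫ P.p := by
  simp [h]

end CompAPI

end PolyMor

end Polynomials

section Polynomials

variable {E : Type u} [Category.{v} E] [ChosenPullbacks E]

namespace PolyMor

variable {I J K L : E} [ChosenDistributivityPullbacks E]

section Whisker

/-- The action of right whiskering on bases. -/
noncomputable def wrBase {P P' : PolyMor I J} (φ : P ⟶ P') (Q : PolyMor J K) :
    (comp P Q).base ⟶ (comp P' Q).base :=
  mkBase (cr P Q) (fun _ z m h => φ.ap (pos z m h)) (by simp)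

section

variable {P P' : PolyMor I J} (φ : P ⟶ P') {Q : PolyMor J K}

lemma wrBase_cr : wrBase φ Q ≫ cr P' Q = cr P Q := mkBase_cr _ _ _

lemma wr_h {W : E} {x : W ⟶ (comp P Q).base} {n : W ⟶ Q.base}
    (h : (x ≫ wrBase φ Q) ≫ cr P' Q = n) : x ≫ cr P Q = n := by
  rwa [Category.assoc, wrBase_cr] at h

lemma pos_wrBase {W : E} (x : W ⟶ (comp P Q).base) (m : W ⟶ Q.tot)
    (h : (x ≫ wrBase φ Q) ≫ cr P' Q = m ≫ Q.p) :
    pos (x ≫ wrBase φ Q) m h = φ.ap (pos x m (wr_h φ h)) :=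
  pos_precomp_mkBase _ _ _ (by simp) _ _ _

lemma wr_h' {W : E} {x : W ⟶ (comp P Q).base} {y : W ⟶ (comp P' Q).tot}
    (h : x ≫ wrBase φ Q = y ≫ (comp P' Q).p) :
    φ.ap (pos x (y ≫ ctm P' Q) (wr_h φ (cr_of_eq h))) = (y ≫ ctx P' Q) ≫ P'.p := by
  rw [← pos_of_eq h, pos_wrBase]

end

/-- Whiskering on the right. -/
noncomputable def whiskerRight {P P' : PolyMor I J} (φ : P ⟶ P') (Q : PolyMor J K) :
    comp P Q ⟶ comp P' Q :=
  Hom.ofAct (wrBase φ Q) (by simp [← wrBase_cr φ])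
    (fun _ x y h => mkTot x (y ≫ ctm P' Q)
      (φ.act (pos x (y ≫ ctm P' Q) (wr_h φ (cr_of_eq h))) (y ≫ ctx P' Q) (wr_h' φ h))
      (wr_h φ (cr_of_eq h)) (Hom.act_p φ _ _ _))
    (by simp) (by simp)

section

variable {P P' : PolyMor I J} (φ : P ⟶ P') {Q : PolyMor J K}

@[simp] lemma whiskerRight_ap_cr {W : E} (x : W ⟶ (comp P Q).base) :
    (whiskerRight φ Q).ap x ≫ cr P' Q = x ≫ cr P Q :=
  (Category.assoc _ _ _).trans (congrArg (x ≫ ·) (wrBase_cr φ))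

@[simp] lemma whiskerRight_ap_cr_assoc {W Z : E} (x : W ⟶ (comp P Q).base) (k : Q.base ⟶ Z) :
    (whiskerRight φ Q).ap x ≫ cr P' Q ≫ k = x ≫ cr P Q ≫ k := by
  rw [← Category.assoc, whiskerRight_ap_cr, Category.assoc]

@[simp] lemma pos_whiskerRight_ap {W : E} (x : W ⟶ (comp P Q).base) (m : W ⟶ Q.tot)
    (h : (whiskerRight φ Q).ap x ≫ cr P' Q = m ≫ Q.p) :
    pos ((whiskerRight φ Q).ap x) m h = φ.ap (pos x m (wr_h φ h)) :=
  pos_wrBase φ x m h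

@[simp] lemma whiskerRight_act {W : E} (x : W ⟶ (comp P Q).base) (y : W ⟶ (comp P' Q).tot)
    (h : (whiskerRight φ Q).ap x = y ≫ (comp P' Q).p) :
    (whiskerRight φ Q).act x y h = mkTot x (y ≫ ctm P' Q)
      (φ.act (pos x (y ≫ ctm P' Q) (wr_h φ (cr_of_eq h))) (y ≫ ctx P' Q) (wr_h' φ h))
      (wr_h φ (cr_of_eq h)) (Hom.act_p φ _ _ _) :=
  Hom.ofAct_act _ _ _ _ _ (by intros; simp) _ _ _

end

section

variable (P : PolyMor I J) {Q Q' : PolyMor J K} (φ : Q ⟶ Q')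

variable {P} in
lemma wl_h₀ {W : E} {x : W ⟶ (comp P Q).base} {n : W ⟶ Q'.base}
    (h : x ≫ cr P Q ≫ φ.g = n) : φ.ap (x ≫ cr P Q) = n :=
  (Category.assoc _ _ _).trans h

/-- The action of left whiskering on bases. -/
noncomputable def wlBase : (comp P Q).base ⟶ (comp P Q').base :=
  mkBase (cr P Q ≫ φ.g)
    (fun _ z m h => pos z (φ.act (z ≫ cr P Q) m (wl_h₀ φ h))
      (Hom.act_p φ _ _ _).symm) (by simp)

lemma wlBase_cr {W : E} (x : W ⟶ (comp P Q).base) :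
    (x ≫ wlBase P φ) ≫ cr P Q' = φ.ap (x ≫ cr P Q) := by
  rw [Category.assoc, Hom.ap, Category.assoc]
  exact congrArg (x ≫ ·) (mkBase_cr _ _ _)

variable {P}

lemma wl_h {W : E} {x : W ⟶ (comp P Q).base} {n : W ⟶ Q'.base}
    (h : (x ≫ wlBase P φ) ≫ cr P Q' = n) : φ.ap (x ≫ cr P Q) = n := by
  rwa [wlBase_cr] at h

lemma pos_wlBase {W : E} (x : W ⟶ (comp P Q).base) (m : W ⟶ Q'.tot)
    (h : (x ≫ wlBase P φ) ≫ cr P Q' = m ≫ Q'.p) :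
    pos (x ≫ wlBase P φ) m h =
      pos x (φ.act (x ≫ cr P Q) m (wl_h φ h)) (Hom.act_p φ _ _ _).symm :=
  pos_precomp_mkBase _ _ _ (by simp) _ _ ((Category.assoc _ _ _).symm.trans (wl_h φ h))

lemma wl_h' {W : E} {x : W ⟶ (comp P Q).base} {y : W ⟶ (comp P Q').tot}
    (h : x ≫ wlBase P φ = y ≫ (comp P Q').p) :
    (y ≫ ctx P Q') ≫ P.p =
      pos x (φ.act (x ≫ cr P Q) (y ≫ ctm P Q') (wl_h φ (cr_of_eq h)))
        (Hom.act_p φ _ _ _).symm := by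
  rw [← pos_of_eq h, pos_wlBase]

variable (P)

/-- Whiskering on the left. -/
noncomputable def whiskerLeft : comp P Q ⟶ comp P Q' :=
  Hom.ofAct (wlBase P φ)
    (by
      have := congrArg (· ≫ Q'.t) (wlBase_cr P φ (𝟙 _))
      simpa using this)
    (fun _ x y h => mkTot x (φ.act (x ≫ cr P Q) (y ≫ ctm P Q') (wl_h φ (cr_of_eq h)))
      (y ≫ ctx P Q') (Hom.act_p φ _ _ _).symm (wl_h' φ h))
    (by simp) (by simp)

@[simp] lemma whiskerLeft_ap_cr {W : E} (x : W ⟶ (comp P Q).base) :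
    (whiskerLeft P φ).ap x ≫ cr P Q' = φ.ap (x ≫ cr P Q) :=
  wlBase_cr P φ x

@[simp] lemma whiskerLeft_ap_cr_assoc {W Z : E} (x : W ⟶ (comp P Q).base) (k : Q'.base ⟶ Z) :
    (whiskerLeft P φ).ap x ≫ cr P Q' ≫ k = φ.ap (x ≫ cr P Q) ≫ k := by
  rw [← Category.assoc, whiskerLeft_ap_cr]

@[simp] lemma pos_whiskerLeft_ap {W : E} (x : W ⟶ (comp P Q).base) (m : W ⟶ Q'.tot)
    (h : (whiskerLeft P φ).ap x ≫ cr P Q' = m ≫ Q'.p) :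
    pos ((whiskerLeft P φ).ap x) m h =
      pos x (φ.act (x ≫ cr P Q) m (wl_h φ h)) (Hom.act_p φ _ _ _).symm :=
  pos_wlBase φ x m h

@[simp] lemma whiskerLeft_act {W : E} (x : W ⟶ (comp P Q).base) (y : W ⟶ (comp P Q').tot)
    (h : (whiskerLeft P φ).ap x = y ≫ (comp P Q').p) :
    (whiskerLeft P φ).act x y h =
      mkTot x (φ.act (x ≫ cr P Q) (y ≫ ctm P Q') (wl_h φ (cr_of_eq h)))
        (y ≫ ctx P Q') (Hom.act_p φ _ _ _).symm (wl_h' φ h) :=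
  Hom.ofAct_act _ _ _ _ _ (by intros; simp) _ _ _

end

end Whisker

section Constraints

section

variable (P : PolyMor I J) (Q : PolyMor J K) (R : PolyMor K L)

@[simp] lemma pos_cr_t {P : PolyMor I J} {Q : PolyMor J K} {R : PolyMor K L} {W : E}
    (x : W ⟶ (comp (comp P Q) R).base) (m : W ⟶ R.tot)
    (h : x ≫ cr (comp P Q) R = m ≫ R.p) : pos x m h ≫ cr P Q ≫ Q.t = m ≫ R.s :=
  pos_t x m h

/-- The element of `(comp Q R).base` underlying an element of `(comp (comp P Q) R).base`. -/
noncomputable def ahInner : (comp (comp P Q) R).base ⟶ (comp Q R).base :=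
  mkBase (cr (comp P Q) R) (fun _ z m h => pos z m h ≫ cr P Q) (by simp)

lemma ahInner_cr {W : E} (x : W ⟶ (comp (comp P Q) R).base) :
    (x ≫ ahInner P Q R) ≫ cr Q R = x ≫ cr (comp P Q) R :=
  (Category.assoc _ _ _).trans (congrArg (x ≫ ·) (mkBase_cr _ _ _))

variable {P Q R}

lemma ah_h {W : E} {x : W ⟶ (comp (comp P Q) R).base} {n : W ⟶ R.base}
    (h : (x ≫ ahInner P Q R) ≫ cr Q R = n) : x ≫ cr (comp P Q) R = n :=
  (ahInner_cr P Q R x).symm.trans h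

lemma pos_ahInner {W : E} (x : W ⟶ (comp (comp P Q) R).base) (m : W ⟶ R.tot)
    (h : (x ≫ ahInner P Q R) ≫ cr Q R = m ≫ R.p) :
    pos (x ≫ ahInner P Q R) m h = pos x m (ah_h h) ≫ cr P Q :=
  pos_precomp_mkBase _ _ _ (by simp) _ _ (ah_h h)

lemma ah_h' {W : E} {x : W ⟶ (comp (comp P Q) R).base} {y : W ⟶ (comp Q R).tot}
    (h : x ≫ ahInner P Q R = y ≫ (comp Q R).p) :
    pos x (y ≫ ctm Q R) (ah_h (cr_of_eq h)) ≫ cr P Q = (y ≫ ctx Q R) ≫ Q.p := by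
  rw [← pos_of_eq h, pos_ahInner]

variable (P Q R)

/-- The action of the associator on bases. -/
noncomputable def ahBase : (comp (comp P Q) R).base ⟶ (comp P (comp Q R)).base :=
  mkBase (ahInner P Q R)
    (fun _ z m h => pos (P := P) (Q := Q) (pos z (m ≫ ctm Q R) (ah_h (cr_of_eq h)))
      (m ≫ ctx Q R) (ah_h' h)) (by simp)

lemma ahBase_cr {W : E} (x : W ⟶ (comp (comp P Q) R).base) :
    (x ≫ ahBase P Q R) ≫ cr P (comp Q R) = x ≫ ahInner P Q R :=
  (Category.assoc _ _ _).trans (congrArg (x ≫ ·) (mkBase_cr _ _ _))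

variable {P Q R}

lemma ah_k {W : E} {x : W ⟶ (comp (comp P Q) R).base} {n : W ⟶ (comp Q R).base}
    (h : (x ≫ ahBase P Q R) ≫ cr P (comp Q R) = n) : x ≫ ahInner P Q R = n :=
  (ahBase_cr P Q R x).symm.trans h

lemma pos_ahBase {W : E} (x : W ⟶ (comp (comp P Q) R).base) (m : W ⟶ (comp Q R).tot)
    (h : (x ≫ ahBase P Q R) ≫ cr P (comp Q R) = m ≫ (comp Q R).p) :
    pos (x ≫ ahBase P Q R) m h = pos (P := P) (Q := Q)
      (pos x (m ≫ ctm Q R) (ah_h (cr_of_eq (ah_k h)))) (m ≫ ctx Q R) (ah_h' (ah_k h)) :=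
  pos_precomp_mkBase _ _ _ (by simp) _ _ (ah_k h)

lemma ah_k' {W : E} {x : W ⟶ (comp (comp P Q) R).base} {y : W ⟶ (comp P (comp Q R)).tot}
    (h : x ≫ ahBase P Q R = y ≫ (comp P (comp Q R)).p) :
    (y ≫ ctx P (comp Q R)) ≫ P.p = pos (P := P) (Q := Q)
      (pos x ((y ≫ ctm P (comp Q R)) ≫ ctm Q R) (ah_h (cr_of_eq (ah_k (cr_of_eq h)))))
      ((y ≫ ctm P (comp Q R)) ≫ ctx Q R) (ah_h' (ah_k (cr_of_eq h))) := by
  rw [← pos_of_eq h, pos_ahBase]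

variable (P Q R)

/-- The associator. -/
noncomputable def assocHom : comp (comp P Q) R ⟶ comp P (comp Q R) :=
  Hom.ofAct (ahBase P Q R)
    (by
      have h₁ := congrArg (· ≫ cr Q R ≫ R.t) (ahBase_cr P Q R (𝟙 _))
      have h₂ := congrArg (· ≫ R.t) (ahInner_cr P Q R (𝟙 _))
      simp only [Category.id_comp, Category.assoc, comp_t] at h₁ h₂ ⊢
      rw [h₁, h₂])
    (fun _ x y h => mkTot x ((y ≫ ctm P (comp Q R)) ≫ ctm Q R)
      (mkTot (pos x ((y ≫ ctm P (comp Q R)) ≫ ctm Q R) (ah_h (cr_of_eq (ah_k (cr_of_eq h)))))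
        ((y ≫ ctm P (comp Q R)) ≫ ctx Q R) (y ≫ ctx P (comp Q R))
        (ah_h' (ah_k (cr_of_eq h))) (ah_k' h))
      (ah_h (cr_of_eq (ah_k (cr_of_eq h)))) (mkTot_p _ _ _ _ _))
    (by simp) (by simp)

variable {P Q R}

@[simp] lemma assocHom_ap_cr_cr {W : E} (x : W ⟶ (comp (comp P Q) R).base) :
    (assocHom P Q R).ap x ≫ cr P (comp Q R) ≫ cr Q R = x ≫ cr (comp P Q) R := by
  rw [← Category.assoc]
  exact (congrArg (· ≫ cr Q R) (ahBase_cr P Q R x)).trans (ahInner_cr P Q R x)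

@[simp] lemma assocHom_ap_cr_cr_assoc {W Z : E} (x : W ⟶ (comp (comp P Q) R).base)
    (k : R.base ⟶ Z) :
    (assocHom P Q R).ap x ≫ cr P (comp Q R) ≫ cr Q R ≫ k = x ≫ cr (comp P Q) R ≫ k := by
  have := congrArg (· ≫ k) (assocHom_ap_cr_cr x)
  simpa only [Category.assoc] using this

lemma ah_l {W : E} {x : W ⟶ (comp (comp P Q) R).base} {n : W ⟶ R.base}
    (h : ((assocHom P Q R).ap x ≫ cr P (comp Q R)) ≫ cr Q R = n) : x ≫ cr (comp P Q) R = n := by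
  rwa [Category.assoc, assocHom_ap_cr_cr] at h

@[simp] lemma pos_assocHom_ap_cr {W : E} (x : W ⟶ (comp (comp P Q) R).base) (m : W ⟶ R.tot)
    (h : ((assocHom P Q R).ap x ≫ cr P (comp Q R)) ≫ cr Q R = m ≫ R.p) :
    pos ((assocHom P Q R).ap x ≫ cr P (comp Q R)) m h = pos x m (ah_l h) ≫ cr P Q := by
  have e : (assocHom P Q R).ap x ≫ cr P (comp Q R) = x ≫ ahInner P Q R := ahBase_cr P Q R x
  simp only [e]
  exact pos_ahInner x m _

@[simp] lemma pos_assocHom_ap {W : E} (x : W ⟶ (comp (comp P Q) R).base)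
    (m : W ⟶ (comp Q R).tot)
    (h : (assocHom P Q R).ap x ≫ cr P (comp Q R) = m ≫ (comp Q R).p) :
    pos ((assocHom P Q R).ap x) m h = pos (P := P) (Q := Q)
      (pos x (m ≫ ctm Q R) (ah_h (cr_of_eq (ah_k h)))) (m ≫ ctx Q R) (ah_h' (ah_k h)) :=
  pos_ahBase x m h

@[simp] lemma assocHom_act {W : E} (x : W ⟶ (comp (comp P Q) R).base)
    (y : W ⟶ (comp P (comp Q R)).tot) (h : (assocHom P Q R).ap x = y ≫ (comp P (comp Q R)).p) :
    (assocHom P Q R).act x y h = mkTot x ((y ≫ ctm P (comp Q R)) ≫ ctm Q R)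
      (mkTot (pos x ((y ≫ ctm P (comp Q R)) ≫ ctm Q R) (ah_h (cr_of_eq (ah_k (cr_of_eq h)))))
        ((y ≫ ctm P (comp Q R)) ≫ ctx Q R) (y ≫ ctx P (comp Q R))
        (ah_h' (ah_k (cr_of_eq h))) (ah_k' h))
      (ah_h (cr_of_eq (ah_k (cr_of_eq h)))) (mkTot_p _ _ _ _ _) :=
  Hom.ofAct_act _ _ _ _ _ (by intros; simp) _ _ _

end

section

variable {P : PolyMor I J} {Q : PolyMor J K} {R : PolyMor K L}

lemma ai_h {V : E} {z : V ⟶ (comp P (comp Q R)).base} {m : V ⟶ R.tot}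
    (h : z ≫ cr P (comp Q R) ≫ cr Q R = m ≫ R.p) :
    (z ≫ cr P (comp Q R)) ≫ cr Q R = m ≫ R.p := (Category.assoc _ _ _).trans h

lemma ai_h₂ {V U : E} {z : V ⟶ (comp P (comp Q R)).base} {m : V ⟶ R.tot}
    (h : z ≫ cr P (comp Q R) ≫ cr Q R = m ≫ R.p) (w : U ⟶ V) :
    ((w ≫ z) ≫ cr P (comp Q R)) ≫ cr Q R = (w ≫ m) ≫ R.p := by
  simp only [Category.assoc, h]

lemma ai_h₃ {V U : E} {z : V ⟶ (comp P (comp Q R)).base} {m : V ⟶ R.tot}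
    (h : z ≫ cr P (comp Q R) ≫ cr Q R = m ≫ R.p) {w : U ⟶ V} {m' : U ⟶ Q.tot}
    (h' : w ≫ pos (z ≫ cr P (comp Q R)) m (ai_h h) = m' ≫ Q.p) :
    m' ≫ Q.p = pos ((w ≫ z) ≫ cr P (comp Q R)) (w ≫ m) (ai_h₂ h w) := by
  rw [← h', precomp_pos]
  simp only [Category.assoc]

/-- An element of `(comp P (comp Q R)).base` assigns to a point of the fibre of `R.p` an element
of `(comp P Q).base`. -/
noncomputable def assocAux {V : E} (z : V ⟶ (comp P (comp Q R)).base) (m : V ⟶ R.tot)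
    (h : z ≫ cr P (comp Q R) ≫ cr Q R = m ≫ R.p) : V ⟶ (comp P Q).base :=
  mkBase (pos (z ≫ cr P (comp Q R)) m (ai_h h))
    (fun _ w m' h' => pos (w ≫ z)
      (mkTot ((w ≫ z) ≫ cr P (comp Q R)) (w ≫ m) m' (ai_h₂ h w) (ai_h₃ h h'))
      (mkTot_p _ _ _ _ _).symm) (by simp)

section

variable {V : E} (z : V ⟶ (comp P (comp Q R)).base) (m : V ⟶ R.tot)
    (h : z ≫ cr P (comp Q R) ≫ cr Q R = m ≫ R.p)

@[simp] lemma assocAux_cr : assocAux z m h ≫ cr P Q = pos (z ≫ cr P (comp Q R)) m (ai_h h) :=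
  mkBase_cr _ _ _

@[simp] lemma assocAux_cr_assoc {Z : E} (k : Q.base ⟶ Z) :
    assocAux z m h ≫ cr P Q ≫ k = pos (z ≫ cr P (comp Q R)) m (ai_h h) ≫ k := by
  rw [← Category.assoc, assocAux_cr]

variable {z m} in
lemma ai_k {U : E} {w : U ⟶ V} {n : U ⟶ Q.base}
    (h' : (w ≫ assocAux z m h) ≫ cr P Q = n) :
    w ≫ pos (z ≫ cr P (comp Q R)) m (ai_h h) = n := by
  rwa [Category.assoc, assocAux_cr] at h'

lemma pos_precomp_assocAux {U : E} (w : U ⟶ V) (m' : U ⟶ Q.tot)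
    (h' : (w ≫ assocAux z m h) ≫ cr P Q = m' ≫ Q.p) :
    pos (w ≫ assocAux z m h) m' h' =
      pos (w ≫ z) (mkTot ((w ≫ z) ≫ cr P (comp Q R)) (w ≫ m) m' (ai_h₂ h w)
        (ai_h₃ h (ai_k h h'))) (mkTot_p _ _ _ _ _).symm :=
  pos_precomp_mkBase (P := P) (Q := Q) _ _ _ (by intros; simp) w m' (ai_k h h')

variable {z m} in
lemma ai_k' {m' : V ⟶ Q.tot} (h' : assocAux z m h ≫ cr P Q = m' ≫ Q.p) :
    m' ≫ Q.p = pos (z ≫ cr P (comp Q R)) m (ai_h h) := by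
  rw [← h', assocAux_cr]

@[simp] lemma pos_assocAux (m' : V ⟶ Q.tot) (h' : assocAux z m h ≫ cr P Q = m' ≫ Q.p) :
    pos (assocAux z m h) m' h' =
      pos z (mkTot (z ≫ cr P (comp Q R)) m m' (ai_h h) (ai_k' h h'))
        (mkTot_p _ _ _ _ _).symm := by
  have := pos_precomp_assocAux z m h (𝟙 V) m' (by simpa only [Category.id_comp] using h')
  simpa only [Category.id_comp] using this

lemma ai_l {z : V ⟶ (comp P (comp Q R)).base} {m : V ⟶ R.tot}
    (h : z ≫ cr P (comp Q R) ≫ cr Q R = m ≫ R.p) {U : E} (w : U ⟶ V) :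
    (w ≫ z) ≫ cr P (comp Q R) ≫ cr Q R = (w ≫ m) ≫ R.p := by
  simp only [Category.assoc, h]

@[simp] lemma precomp_assocAux {U : E} (w : U ⟶ V) :
    w ≫ assocAux z m h = assocAux (w ≫ z) (w ≫ m) (ai_l h w) := by
  refine base_ext (by simp) (fun z' m' h₁ h₂ => ?_)
  have e₁ := pos_precomp_assocAux z m h (z' ≫ w) m' (by simpa only [Category.assoc] using h₁)
  have e₂ := pos_precomp_assocAux (w ≫ z) (w ≫ m) (ai_l h w) z' m' h₂
  simp only [Category.assoc] at e₁ e₂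
  exact e₁.trans e₂.symm

@[simp] lemma precomp_assocAux_assoc {U Z : E} (w : U ⟶ V) (k : (comp P Q).base ⟶ Z) :
    w ≫ assocAux z m h ≫ k = assocAux (w ≫ z) (w ≫ m) (ai_l h w) ≫ k := by
  rw [← Category.assoc, precomp_assocAux]

end

variable (P Q R)

/-- The action of the inverse associator on bases. -/
noncomputable def aiBase : (comp P (comp Q R)).base ⟶ (comp (comp P Q) R).base :=
  mkBase (cr P (comp Q R) ≫ cr Q R) (fun _ z m h => assocAux z m h) (by simp)

lemma aiBase_cr {W : E} (x : W ⟶ (comp P (comp Q R)).base) :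
    (x ≫ aiBase P Q R) ≫ cr (comp P Q) R = x ≫ cr P (comp Q R) ≫ cr Q R :=
  (Category.assoc _ _ _).trans (congrArg (x ≫ ·) (mkBase_cr _ _ _))

variable {P Q R}

lemma ai_m {W : E} {x : W ⟶ (comp P (comp Q R)).base} {n : W ⟶ R.base}
    (h : (x ≫ aiBase P Q R) ≫ cr (comp P Q) R = n) : x ≫ cr P (comp Q R) ≫ cr Q R = n :=
  (aiBase_cr P Q R x).symm.trans h

lemma pos_aiBase {W : E} (x : W ⟶ (comp P (comp Q R)).base) (m : W ⟶ R.tot)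
    (h : (x ≫ aiBase P Q R) ≫ cr (comp P Q) R = m ≫ R.p) :
    pos (x ≫ aiBase P Q R) m h = assocAux x m (ai_m h) :=
  pos_precomp_mkBase _ _ _ (by intros; simp) _ _ (ai_m h)

lemma ai_m' {W : E} {x : W ⟶ (comp P (comp Q R)).base} {y : W ⟶ (comp (comp P Q) R).tot}
    (h : x ≫ aiBase P Q R = y ≫ (comp (comp P Q) R).p) :
    assocAux x (y ≫ ctm (comp P Q) R) (ai_m (cr_of_eq h)) =
      (y ≫ ctx (comp P Q) R) ≫ (comp P Q).p := by
  rw [← pos_of_eq h, pos_aiBase]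

lemma ai_n {W : E} {x : W ⟶ (comp P (comp Q R)).base} {y : W ⟶ (comp (comp P Q) R).tot}
    (h : x ≫ aiBase P Q R = y ≫ (comp (comp P Q) R).p) :
    ((y ≫ ctx (comp P Q) R) ≫ ctm P Q) ≫ Q.p =
      pos (x ≫ cr P (comp Q R)) (y ≫ ctm (comp P Q) R) (ai_h (ai_m (cr_of_eq h))) := by
  rw [← cr_of_eq (ai_m' h), assocAux_cr]

lemma ai_n' {W : E} {x : W ⟶ (comp P (comp Q R)).base} {y : W ⟶ (comp (comp P Q) R).tot}
    (h : x ≫ aiBase P Q R = y ≫ (comp (comp P Q) R).p) :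
    ((y ≫ ctx (comp P Q) R) ≫ ctx P Q) ≫ P.p =
      pos x (mkTot (x ≫ cr P (comp Q R)) (y ≫ ctm (comp P Q) R)
        ((y ≫ ctx (comp P Q) R) ≫ ctm P Q) (ai_h (ai_m (cr_of_eq h))) (ai_n h))
        (mkTot_p _ _ _ _ _).symm := by
  rw [← pos_of_eq (ai_m' h), pos_assocAux]

variable (P Q R)

/-- The inverse associator. -/
noncomputable def assocInv : comp P (comp Q R) ⟶ comp (comp P Q) R :=
  Hom.ofAct (aiBase P Q R)
    (by
      have h₁ := congrArg (· ≫ R.t) (aiBase_cr P Q R (𝟙 _))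
      simpa only [Category.id_comp, Category.assoc, comp_t] using h₁)
    (fun _ x y h => mkTot x (mkTot (x ≫ cr P (comp Q R)) (y ≫ ctm (comp P Q) R)
        ((y ≫ ctx (comp P Q) R) ≫ ctm P Q) (ai_h (ai_m (cr_of_eq h))) (ai_n h))
        ((y ≫ ctx (comp P Q) R) ≫ ctx P Q) (mkTot_p _ _ _ _ _).symm (ai_n' h))
    (by simp) (by simp)

variable {P Q R}

@[simp] lemma assocInv_ap_cr {W : E} (x : W ⟶ (comp P (comp Q R)).base) :
    (assocInv P Q R).ap x ≫ cr (comp P Q) R = x ≫ cr P (comp Q R) ≫ cr Q R :=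
  aiBase_cr P Q R x

@[simp] lemma assocInv_ap_cr_assoc {W Z : E} (x : W ⟶ (comp P (comp Q R)).base)
    (k : R.base ⟶ Z) :
    (assocInv P Q R).ap x ≫ cr (comp P Q) R ≫ k = x ≫ cr P (comp Q R) ≫ cr Q R ≫ k := by
  rw [← Category.assoc, assocInv_ap_cr]
  simp only [Category.assoc]

@[simp] lemma pos_assocInv_ap {W : E} (x : W ⟶ (comp P (comp Q R)).base) (m : W ⟶ R.tot)
    (h : (assocInv P Q R).ap x ≫ cr (comp P Q) R = m ≫ R.p) :
    pos ((assocInv P Q R).ap x) m h = assocAux x m (ai_m h) :=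
  pos_aiBase x m h

@[simp] lemma assocInv_act {W : E} (x : W ⟶ (comp P (comp Q R)).base)
    (y : W ⟶ (comp (comp P Q) R).tot) (h : (assocInv P Q R).ap x = y ≫ (comp (comp P Q) R).p) :
    (assocInv P Q R).act x y h =
      mkTot x (mkTot (x ≫ cr P (comp Q R)) (y ≫ ctm (comp P Q) R)
        ((y ≫ ctx (comp P Q) R) ≫ ctm P Q) (ai_h (ai_m (cr_of_eq h))) (ai_n h))
        ((y ≫ ctx (comp P Q) R) ≫ ctx P Q) (mkTot_p _ _ _ _ _).symm (ai_n' h) :=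
  Hom.ofAct_act _ _ _ _ _ (by intros; simp) _ _ _

end

end Constraints

section Unitors

/-- The identity polynomial. -/
@[reducible] def idP (X : E) : PolyMor X X where
  tot := X
  base := X
  s := 𝟙 X
  p := 𝟙 X
  t := 𝟙 X

section

variable (P : PolyMor I J)

@[simp] lemma pos_idLeft {P : PolyMor I J} {W : E} (x : W ⟶ (comp (idP I) P).base)
    (m : W ⟶ P.tot) (h : x ≫ cr (idP I) P = m ≫ P.p) : pos x m h = m ≫ P.s :=
  (Category.comp_id _).symm.trans (pos_t x m h)

lemma lu_h {P : PolyMor I J} {W : E} {x : W ⟶ (comp (idP I) P).base}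
    {m : W ⟶ P.tot} (h : x ≫ cr (idP I) P = m ≫ P.p) :
    (m ≫ P.s) ≫ (idP I).p = pos x m h :=
  (Category.comp_id _).trans (pos_idLeft x m h).symm

/-- The element of `(comp (idP I) P).tot` over `x` determined by `m`. -/
noncomputable def luTot {P : PolyMor I J} {W : E} (x : W ⟶ (comp (idP I) P).base)
    (m : W ⟶ P.tot) (h : x ≫ cr (idP I) P = m ≫ P.p) : W ⟶ (comp (idP I) P).tot :=
  mkTot x m (m ≫ P.s) h (lu_h h)

section

variable {P : PolyMor I J} {W : E} (x : W ⟶ (comp (idP I) P).base)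
    (m : W ⟶ P.tot) (h : x ≫ cr (idP I) P = m ≫ P.p)

@[simp] lemma luTot_p : luTot x m h ≫ (comp (idP I) P).p = x := mkTot_p _ _ _ _ _

@[simp] lemma luTot_ctm : luTot x m h ≫ ctm (idP I) P = m := mkTot_ctm _ _ _ _ _

@[simp] lemma luTot_ctx : luTot x m h ≫ ctx (idP I) P = m ≫ P.s := mkTot_ctx _ _ _ _ _

@[simp] lemma luTot_ctm_assoc {Z : E} (k : P.tot ⟶ Z) :
    luTot x m h ≫ ctm (idP I) P ≫ k = m ≫ k := by
  rw [← Category.assoc, luTot_ctm]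

@[simp] lemma precomp_luTot {V : E} (w : V ⟶ W) :
    w ≫ luTot x m h = luTot (w ≫ x) (w ≫ m) (by simp only [Category.assoc, h]) := by
  apply tot_ext
  · rw [Category.assoc, luTot_p, luTot_p]
  · rw [Category.assoc, luTot_ctm, luTot_ctm]
  · rw [Category.assoc, luTot_ctx, luTot_ctx, Category.assoc]

end

/-- The left unitor. -/
noncomputable def luHom : comp (idP I) P ⟶ P :=
  Hom.ofAct (cr (idP I) P) rfl (fun _ x m h => luTot x m h)
    (by simp) (fun _ x m h =>
      (congrArg (luTot x m h ≫ ·) (Category.comp_id _)).trans (luTot_ctx x m h))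

/-- The action of the inverse left unitor on bases. -/
def luiBase : P.base ⟶ (comp (idP I) P).base :=
  mkBase (𝟙 _) (fun _ _ m _ => m ≫ P.s) (by simp)

lemma luiBase_cr {W : E} (x : W ⟶ P.base) : (x ≫ luiBase P) ≫ cr (idP I) P = x :=
  (Category.assoc _ _ _).trans ((congrArg (x ≫ ·) (mkBase_cr _ _ _)).trans (Category.comp_id _))

variable {P} in
lemma lui_h {W : E} {x : W ⟶ P.base} {y : W ⟶ (comp (idP I) P).tot}
    (h : x ≫ luiBase P = y ≫ (comp (idP I) P).p) : (y ≫ ctm (idP I) P) ≫ P.p = x := by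
  rw [← cr_of_eq h, luiBase_cr]

variable {P} in
lemma lui_h' {W : E} (y : W ⟶ (comp (idP I) P).tot) :
    y ≫ ctx (idP I) P = (y ≫ ctm (idP I) P) ≫ P.s :=
  (Category.comp_id _).symm.trans ((pos_of_eq rfl).symm.trans (pos_idLeft _ _ _))

/-- The inverse left unitor. -/
def luInv : P ⟶ comp (idP I) P :=
  Hom.ofAct (luiBase P)
    (by
      have h := congrArg (· ≫ P.t) (luiBase_cr P (𝟙 _))
      simpa only [Category.id_comp, Category.assoc, comp_t] using h)
    (fun _ x y _ => y ≫ ctm (idP I) P)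
    (fun _ _ _ h => lui_h h)
    (fun _ x y h => by
      have := lui_h' y
      simpa using this.symm)

variable {P}

@[simp] lemma ctx_idLeft : ctx (idP I) P = ctm (idP I) P ≫ P.s := by
  simpa using lui_h' (P := P) (𝟙 _)

@[simp] lemma luHom_ap {W : E} (x : W ⟶ (comp (idP I) P).base) :
    (luHom P).ap x = x ≫ cr (idP I) P := rfl

lemma luHom_h {W : E} {x : W ⟶ (comp (idP I) P).base} {n : W ⟶ P.base}
    (h : (luHom P).ap x = n) : x ≫ cr (idP I) P = n := h

@[simp] lemma luHom_act {W : E} (x : W ⟶ (comp (idP I) P).base) (m : W ⟶ P.tot)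
    (h : (luHom P).ap x = m ≫ P.p) :
    (luHom P).act x m h = luTot x m (luHom_h h) :=
  Hom.ofAct_act _ _ _ _ _ (by intros; simp) _ _ _

@[simp] lemma luInv_ap_cr {W : E} (x : W ⟶ P.base) : (luInv P).ap x ≫ cr (idP I) P = x :=
  luiBase_cr P x

@[simp] lemma luInv_ap_cr_assoc {W Z : E} (x : W ⟶ P.base) (k : P.base ⟶ Z) :
    (luInv P).ap x ≫ cr (idP I) P ≫ k = x ≫ k := by
  rw [← Category.assoc, luInv_ap_cr]

@[simp] lemma luInv_act {W : E} (x : W ⟶ P.base) (y : W ⟶ (comp (idP I) P).tot)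
    (h : (luInv P).ap x = y ≫ (comp (idP I) P).p) :
    (luInv P).act x y h = y ≫ ctm (idP I) P :=
  Hom.ofAct_act _ _ _ _ _ (by intros; simp) _ _ _

end

section

variable (P : PolyMor I J)

lemma ru_h {P : PolyMor I J} {W : E} (x : W ⟶ (comp P (idP J)).base) :
    x ≫ cr P (idP J) = (x ≫ cr P (idP J)) ≫ (idP J).p := (Category.comp_id _).symm

lemma ru_p {P : PolyMor I J} {W : E} {x : W ⟶ (comp P (idP J)).base}
    {m : W ⟶ P.tot} (h : x ≫ pos (𝟙 _) (𝟙 _ ≫ cr P (idP J)) (ru_h _) = m ≫ P.p) :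
    m ≫ P.p = pos x (x ≫ cr P (idP J)) (ru_h x) := by
  rw [← h, precomp_pos]
  simp only [Category.comp_id, Category.id_comp]

/-- The right unitor. -/
noncomputable def ruHom : comp P (idP J) ⟶ P :=
  Hom.ofAct (pos (𝟙 _) (𝟙 _ ≫ cr P (idP J)) (ru_h _)) (by simp)
    (fun _ x m h => mkTot x (x ≫ cr P (idP J)) m (ru_h x) (ru_p h))
    (by simp) (by simp)

lemma ruHom_ap {P : PolyMor I J} {W : E} (x : W ⟶ (comp P (idP J)).base) :
    (ruHom P).ap x = pos x (x ≫ cr P (idP J)) (ru_h x) := by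
  refine (precomp_pos _ _ _ _).trans ?_
  simp only [Category.comp_id, Category.id_comp]

@[simp] lemma pos_idRight {P : PolyMor I J} {W : E} (x : W ⟶ (comp P (idP J)).base) (m : W ⟶ J)
    (h : x ≫ cr P (idP J) = m ≫ (idP J).p) : pos x m h = (ruHom P).ap x := by
  obtain rfl : x ≫ cr P (idP J) = m := h.trans (Category.comp_id _)
  exact (ruHom_ap x).symm

lemma ru_h' {P : PolyMor I J} {W : E} {x : W ⟶ (comp P (idP J)).base} {m : W ⟶ P.tot}
    (h : (ruHom P).ap x = m ≫ P.p) : m ≫ P.p = pos x (x ≫ cr P (idP J)) (ru_h x) :=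
  h.symm.trans (ruHom_ap x)

@[simp] lemma ruHom_act {P : PolyMor I J} {W : E} (x : W ⟶ (comp P (idP J)).base) (m : W ⟶ P.tot)
    (h : (ruHom P).ap x = m ≫ P.p) :
    (ruHom P).act x m h = mkTot x (x ≫ cr P (idP J)) m (ru_h x) (ru_h' h) :=
  Hom.ofAct_act _ _ _ _ _ (by intros; simp) _ _ _

lemma cr_idRight {P : PolyMor I J} {W : E} (x : W ⟶ (comp P (idP J)).base) :
    x ≫ cr P (idP J) = (ruHom P).ap x ≫ P.t := by
  rw [ruHom_ap, pos_t]
  exact (Category.comp_id _).symm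

lemma ctm_idRight {P : PolyMor I J} :
    ctm P (idP J) = (comp P (idP J)).p ≫ cr P (idP J) :=
  (Category.comp_id _).symm.trans (ctm_p P (idP J))

@[simp] lemma ruHom_whiskerRight_ap {P Q : PolyMor I J} (φ : P ⟶ Q) {W : E}
    (x : W ⟶ (comp P (idP J)).base) :
    (ruHom Q).ap ((whiskerRight φ (idP J)).ap x) = φ.ap ((ruHom P).ap x) := by
  rw [ruHom_ap, pos_whiskerRight_ap, pos_idRight]

/-- The action of the inverse right unitor on bases. -/
def ruiBase : P.base ⟶ (comp P (idP J)).base :=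
  mkBase (P.t : _ ⟶ (idP J).base) (fun _ z _ _ => z) (fun _ _ _ h => h)

lemma ruiBase_cr : ruiBase P ≫ cr P (idP J) = P.t := mkBase_cr _ _ _

variable {P}

lemma ruHom_ruiBase {W : E} (x : W ⟶ P.base) : (ruHom P).ap (x ≫ ruiBase P) = x := by
  rw [ruHom_ap]
  refine pos_precomp_mkBase _ _ _ (by simp) _ _ ?_
  exact ((Category.comp_id _).trans ((Category.assoc _ _ _).trans
    (congrArg (x ≫ ·) (ruiBase_cr P)))).symm

lemma rui_h {W : E} {x : W ⟶ P.base} {y : W ⟶ (comp P (idP J)).tot}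
    (h : x ≫ ruiBase P = y ≫ (comp P (idP J)).p) : (y ≫ ctx P (idP J)) ≫ P.p = x := by
  rw [← pos_of_eq h, pos_idRight, ruHom_ruiBase]

variable (P)

/-- The inverse right unitor. -/
noncomputable def ruInv : P ⟶ comp P (idP J) :=
  Hom.ofAct (ruiBase P)
    ((Category.assoc _ _ _).symm.trans ((Category.comp_id _).trans (ruiBase_cr P)))
    (fun _ x y _ => y ≫ ctx P (idP J))
    (fun _ _ _ h => rui_h h)
    (by simp)

variable {P}

@[simp] lemma ruHom_ruInv_ap {W : E} (x : W ⟶ P.base) : (ruHom P).ap ((ruInv P).ap x) = x :=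
  ruHom_ruiBase x

@[simp] lemma ruInv_ap_cr {W : E} (x : W ⟶ P.base) :
    (ruInv P).ap x ≫ cr P (idP J) = x ≫ P.t := by
  rw [cr_idRight, ruHom_ruInv_ap]

@[simp] lemma ruInv_act {W : E} (x : W ⟶ P.base) (y : W ⟶ (comp P (idP J)).tot)
    (h : (ruInv P).ap x = y ≫ (comp P (idP J)).p) :
    (ruInv P).act x y h = y ≫ ctx P (idP J) :=
  Hom.ofAct_act _ _ _ _ _ (by intros; simp) _ _ _

end

end Unitors

section Axioms

variable {M : E}

lemma assocHom_assocInv (P : PolyMor I J) (Q : PolyMor J K) (R : PolyMor K L) :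
    assocHom P Q R ≫ assocInv P Q R = 𝟙 _ := by
  refine hom_ext (fun x => ?_) (fun x y h h' => ?_)
  · refine base_ext (by simp) (fun z m h₁ h₂ => ?_)
    refine base_ext (by simp) (fun z' m' h₁ h₂ => ?_)
    simp
  · obtain rfl : x = y ≫ _ := by simpa using h'
    refine tot_ext (by simp) (by simp) ?_
    exact tot_ext (by simp) (by simp) (by simp)

lemma assocInv_assocHom (P : PolyMor I J) (Q : PolyMor J K) (R : PolyMor K L) :
    assocInv P Q R ≫ assocHom P Q R = 𝟙 _ := by
  refine hom_ext (fun x => ?_) (fun x y h h' => ?_)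
  · refine base_ext ?_ (fun z m h₁ h₂ => ?_)
    · refine base_ext (by simp) (fun z m h₁ h₂ => ?_)
      simp
    · simp only [comp_ap, id_ap, Hom.precomp_ap, pos_assocHom_ap, pos_assocInv_ap, pos_assocAux] at h₂ ⊢
      congr 1
      exact tot_ext (by simpa using h₂) (by simp) (by simp)
  · obtain rfl : x = y ≫ _ := by simpa using h'
    refine tot_ext (by simp) ?_ ?_
    · refine tot_ext (by simp) (by simp) (by simp)
    · simp

lemma luHom_luInv (P : PolyMor I J) : luHom P ≫ luInv P = 𝟙 _ := by
  refine hom_ext (fun x => ?_) (fun x y h h' => ?_)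
  · exact base_ext (by simp) (fun z m h₁ h₂ => by simp)
  · obtain rfl : x = y ≫ _ := by simpa using h'
    exact tot_ext (by simp) (by simp) (by simp)

lemma luInv_luHom (P : PolyMor I J) : luInv P ≫ luHom P = 𝟙 _ :=
  hom_ext (fun x => by simp) (fun x y h h' => by simp)

lemma ruHom_ruInv (P : PolyMor I J) : ruHom P ≫ ruInv P = 𝟙 _ := by
  refine hom_ext (fun x => ?_) (fun x y h h' => ?_)
  · exact base_ext (by simp) (fun z m h₁ h₂ => by simp)
  · obtain rfl : x = y ≫ _ := by simpa using h'
    exact tot_ext (by simp) (by simp [ctm_idRight]) (by simp)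

lemma ruInv_ruHom (P : PolyMor I J) : ruInv P ≫ ruHom P = 𝟙 _ :=
  hom_ext (fun x => by simp) (fun x y h h' => by simp)

lemma whiskerLeft_id' (P : PolyMor I J) (Q : PolyMor J K) : whiskerLeft P (𝟙 Q) = 𝟙 _ := by
  refine hom_ext (fun x => ?_) (fun x y h h' => ?_)
  · exact base_ext (by simp) (fun z m h₁ h₂ => by simp)
  · obtain rfl : x = y ≫ _ := by simpa using h'
    exact tot_ext (by simp) (by simp) (by simp)

lemma whiskerLeft_comp' (P : PolyMor I J) {Q Q' Q'' : PolyMor J K} (φ : Q ⟶ Q')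
    (ψ : Q' ⟶ Q'') : whiskerLeft P (φ ≫ ψ) = whiskerLeft P φ ≫ whiskerLeft P ψ := by
  refine hom_ext (fun x => ?_) (fun x y h h' => ?_)
  · exact base_ext (by simp) (fun z m h₁ h₂ => by simp)
  · exact tot_ext (by simp) (by simp) (by simp)

lemma id_whiskerRight' (P : PolyMor I J) (Q : PolyMor J K) : whiskerRight (𝟙 P) Q = 𝟙 _ := by
  refine hom_ext (fun x => ?_) (fun x y h h' => ?_)
  · exact base_ext (by simp) (fun z m h₁ h₂ => by simp)
  · obtain rfl : x = y ≫ _ := by simpa using h'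
    exact tot_ext (by simp) (by simp) (by simp)

lemma comp_whiskerRight' {P P' P'' : PolyMor I J} (φ : P ⟶ P') (ψ : P' ⟶ P'')
    (Q : PolyMor J K) : whiskerRight (φ ≫ ψ) Q = whiskerRight φ Q ≫ whiskerRight ψ Q := by
  refine hom_ext (fun x => ?_) (fun x y h h' => ?_)
  · exact base_ext (by simp) (fun z m h₁ h₂ => by simp)
  · exact tot_ext (by simp) (by simp) (by simp)

lemma id_whiskerLeft' {P Q : PolyMor I J} (φ : P ⟶ Q) :
    whiskerLeft (idP I) φ = luHom P ≫ φ ≫ luInv Q := by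
  refine hom_ext (fun x => ?_) (fun x y h h' => ?_)
  · exact base_ext (by simp) (fun z m h₁ h₂ => by simp)
  · exact tot_ext (by simp) (by simp) (by simp)

lemma whiskerRight_id' {P Q : PolyMor I J} (φ : P ⟶ Q) :
    whiskerRight φ (idP J) = ruHom P ≫ φ ≫ ruInv Q := by
  refine hom_ext (fun x => ?_) (fun x y h h' => ?_)
  · exact base_ext (by simp) (fun z m h₁ h₂ => by simp)
  · refine tot_ext (by simp) ?_ (by simp)
    have e := cr_of_eq h
    rw [whiskerRight_ap_cr] at e
    have e' : x ≫ cr P (idP J) = y ≫ ctm Q (idP J) := e.trans (Category.comp_id _)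
    simp [e']

lemma whisker_exchange' {P P' : PolyMor I J} {Q Q' : PolyMor J K} (φ : P ⟶ P') (ψ : Q ⟶ Q') :
    whiskerLeft P ψ ≫ whiskerRight φ Q' = whiskerRight φ Q ≫ whiskerLeft P' ψ := by
  refine hom_ext (fun x => ?_) (fun x y h h' => ?_)
  · exact base_ext (by simp) (fun z m h₁ h₂ => by simp)
  · exact tot_ext (by simp) (by simp) (by simp)

lemma comp_whiskerLeft' (P : PolyMor I J) (Q : PolyMor J K) {R R' : PolyMor K L} (φ : R ⟶ R') :
    whiskerLeft (comp P Q) φ ≫ assocHom P Q R' =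
      assocHom P Q R ≫ whiskerLeft P (whiskerLeft Q φ) := by
  refine hom_ext (fun x => ?_) (fun x y h h' => ?_)
  · refine base_ext ?_ (fun z m h₁ h₂ => by simp)
    exact base_ext (by simp) (fun z m h₁ h₂ => by simp)
  · refine tot_ext (by simp) (by simp) ?_
    exact tot_ext (by simp) (by simp) (by simp)

lemma whiskerRight_comp' {P P' : PolyMor I J} (φ : P ⟶ P') (Q : PolyMor J K) (R : PolyMor K L) :
    whiskerRight (whiskerRight φ Q) R ≫ assocHom P' Q R =
      assocHom P Q R ≫ whiskerRight φ (comp Q R) := by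
  refine hom_ext (fun x => ?_) (fun x y h h' => ?_)
  · refine base_ext ?_ (fun z m h₁ h₂ => by simp)
    exact base_ext (by simp) (fun z m h₁ h₂ => by simp)
  · refine tot_ext (by simp) (by simp) ?_
    exact tot_ext (by simp) (by simp) (by simp)

lemma whisker_assoc' (P : PolyMor I J) {Q Q' : PolyMor J K} (φ : Q ⟶ Q') (R : PolyMor K L) :
    whiskerRight (whiskerLeft P φ) R ≫ assocHom P Q' R =
      assocHom P Q R ≫ whiskerLeft P (whiskerRight φ R) := by
  refine hom_ext (fun x => ?_) (fun x y h h' => ?_)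
  · refine base_ext ?_ (fun z m h₁ h₂ => by simp)
    exact base_ext (by simp) (fun z m h₁ h₂ => by simp)
  · refine tot_ext (by simp) (by simp) ?_
    exact tot_ext (by simp) (by simp) (by simp)

@[simp] lemma pos_cr_idRight {P : PolyMor I J} {Q : PolyMor J K} {W : E}
    (x : W ⟶ (comp (comp P (idP J)) Q).base) (m : W ⟶ Q.tot)
    (h : x ≫ cr (comp P (idP J)) Q = m ≫ Q.p) : pos x m h ≫ cr P (idP J) = m ≫ Q.s :=
  (congrArg (pos x m h ≫ ·) (Category.comp_id _).symm).trans (pos_cr_t x m h)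

lemma triangle' (P : PolyMor I J) (Q : PolyMor J K) :
    assocHom P (idP J) Q ≫ whiskerLeft P (luHom Q) = whiskerRight (ruHom P) Q := by
  refine hom_ext (fun x => ?_) (fun x y h h' => ?_)
  · exact base_ext (by simp) (fun z m h₁ h₂ => by simp)
  · refine tot_ext (by simp) (by simp) ?_
    exact tot_ext (by simp) (by simp) (by simp)

lemma pentagon' (P : PolyMor I J) (Q : PolyMor J K) (R : PolyMor K L) (S : PolyMor L M) :
    whiskerRight (assocHom P Q R) S ≫ assocHom P (comp Q R) S ≫ whiskerLeft P (assocHom Q R S) =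
      assocHom (comp P Q) R S ≫ assocHom P Q (comp R S) := by
  refine hom_ext (fun x => ?_) (fun x y h h' => ?_)
  · refine base_ext ?_ (fun z m h₁ h₂ => by simp)
    refine base_ext ?_ (fun z m h₁ h₂ => by simp)
    exact base_ext (by simp) (fun z m h₁ h₂ => by simp)
  · refine tot_ext (by simp) (by simp) ?_
    refine tot_ext (by simp) (by simp) ?_
    exact tot_ext (by simp) (by simp) (by simp)

end Axioms

end PolyMor

end Polynomials

section Polynomials

variable {E : Type u} [Category.{v} E] [ChosenPullbacks E]

/-- The bicategory of polynomials: its objects are those of `E`. -/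
structure PolyBicat (E : Type u) where
  as : E

variable [ChosenDistributivityPullbacks E]

noncomputable instance : Bicategory (PolyBicat E) where
  Hom I J := PolyMor I.as J.as
  id I := PolyMor.idP I.as
  comp P Q := PolyMor.comp P Q
  homCategory I J := inferInstanceAs (Category (PolyMor I.as J.as))
  whiskerLeft P _ _ φ := PolyMor.whiskerLeft P φ
  whiskerRight φ Q := PolyMor.whiskerRight φ Q
  associator P Q R :=
    ⟨PolyMor.assocHom P Q R, PolyMor.assocInv P Q R, PolyMor.assocHom_assocInv P Q R,
      PolyMor.assocInv_assocHom P Q R⟩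
  leftUnitor P := ⟨PolyMor.luHom P, PolyMor.luInv P, PolyMor.luHom_luInv P, PolyMor.luInv_luHom P⟩
  rightUnitor P :=
    ⟨PolyMor.ruHom P, PolyMor.ruInv P, PolyMor.ruHom_ruInv P, PolyMor.ruInv_ruHom P⟩
  whiskerLeft_id P Q := PolyMor.whiskerLeft_id' P Q
  whiskerLeft_comp P _ _ _ φ ψ := PolyMor.whiskerLeft_comp' P φ ψ
  id_whiskerLeft φ := PolyMor.id_whiskerLeft' φ
  comp_whiskerLeft P Q _ _ φ := by
    have := PolyMor.comp_whiskerLeft' P Q φ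
    exact ((Category.comp_id _).symm.trans (congrArg _ (PolyMor.assocHom_assocInv _ _ _).symm)).trans
      ((Category.assoc _ _ _).symm.trans ((congrArg (· ≫ _) this).trans (Category.assoc _ _ _)))
  id_whiskerRight P Q := PolyMor.id_whiskerRight' P Q
  comp_whiskerRight φ ψ Q := PolyMor.comp_whiskerRight' φ ψ Q
  whiskerRight_id φ := PolyMor.whiskerRight_id' φ
  whiskerRight_comp φ Q R := by
    have := PolyMor.whiskerRight_comp' φ Q R
    exact ((Category.id_comp _).symm.trans (congrArg (· ≫ _)
      (PolyMor.assocInv_assocHom _ _ _).symm)).trans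
      ((Category.assoc _ _ _).trans (congrArg _ this.symm))
  whisker_assoc P _ _ φ R := by
    have := PolyMor.whisker_assoc' P φ R
    exact ((Category.comp_id _).symm.trans (congrArg _ (PolyMor.assocHom_assocInv _ _ _).symm)).trans
      ((Category.assoc _ _ _).symm.trans ((congrArg (· ≫ _) this).trans (Category.assoc _ _ _)))
  whisker_exchange φ ψ := PolyMor.whisker_exchange' φ ψ
  pentagon P Q R S := PolyMor.pentagon' P Q R S
  triangle P Q := PolyMor.triangle' P Q

end Polynomials

section Polynomials

variable {E : Type u} [Category.{v} E] [ChosenPullbacks E]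

namespace PolyMor

variable {I J K L : E} [ChosenDistributivityPullbacks E]

section Sigma

set_option linter.unusedSectionVars false

/-- The polynomial `X <--1-- X --1--> X --f--> Y` associated with a morphism `f : X ⟶ Y`. -/
@[reducible] def sig {X Y : E} (f : X ⟶ Y) : PolyMor X Y where
  tot := X
  base := X
  s := 𝟙 X
  p := 𝟙 X
  t := f

/-- Postcomposition of a polynomial with a morphism. -/
@[reducible] def post (P : PolyMor I J) (f : J ⟶ K) : PolyMor I K where
  tot := P.tot
  base := P.base
  s := P.s
  p := P.p
  t := P.t ≫ f

lemma act_sig {X Y : E} {f : X ⟶ Y} {Q : PolyMor X Y} (φ : sig f ⟶ Q) {W : E} (b : W ⟶ X)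
    (m : W ⟶ Q.tot) (h : φ.ap b = m ≫ Q.p) : φ.act b m h = b :=
  (Category.comp_id _).symm.trans (Hom.act_p φ b m h)

lemma eqToHom_ap {X Y : E} {f f' : X ⟶ Y} (e : f = f') {W : E} (b : W ⟶ X) :
    Hom.ap (eqToHom (congrArg sig e)) b = b := by
  subst e
  exact id_ap (P := sig f) b

section

variable (P : PolyMor I J) (f : J ⟶ K)

lemma po_h {P : PolyMor I J} {f : J ⟶ K} {W : E} (x : W ⟶ (comp P (sig f)).base) :
    x ≫ cr P (sig f) = (x ≫ cr P (sig f)) ≫ (sig f).p := (Category.comp_id _).symm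

/-- The action of `postHom` on bases. -/
noncomputable def poBase : (comp P (sig f)).base ⟶ P.base :=
  pos (𝟙 _) (𝟙 _ ≫ cr P (sig f)) (po_h _)

variable {P f}

lemma poBase_eq {W : E} (x : W ⟶ (comp P (sig f)).base) :
    x ≫ poBase P f = pos x (x ≫ cr P (sig f)) (po_h x) := by
  refine (precomp_pos _ _ _ _).trans ?_
  simp only [Category.comp_id, Category.id_comp]

lemma po_p {W : E} {x : W ⟶ (comp P (sig f)).base} {m : W ⟶ P.tot}
    (h : x ≫ poBase P f = m ≫ P.p) : m ≫ P.p = pos x (x ≫ cr P (sig f)) (po_h x) :=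
  h.symm.trans (poBase_eq x)

lemma poBase_t : poBase P f ≫ P.t = cr P (sig f) := by
  rw [poBase, pos_t]
  exact (Category.comp_id _).trans (Category.id_comp _)

variable (P f)

/-- The comparison from the composite of `P` with `f_Σ` to the postcomposite of `P` with `f`. -/
noncomputable def postHom : comp P (sig f) ⟶ post P f :=
  Hom.ofAct (poBase P f)
    ((Category.assoc _ _ _).symm.trans (congrArg (· ≫ f) poBase_t))
    (fun _ x m h => mkTot x (x ≫ cr P (sig f)) m (po_h x) (po_p h))
    (by simp) (by simp)

/-- The action of `postInv` on bases. -/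
def poiBase : P.base ⟶ (comp P (sig f)).base :=
  mkBase (P.t : _ ⟶ (sig f).base) (fun _ z _ _ => z) (fun _ _ _ h => h)

lemma poiBase_cr : poiBase P f ≫ cr P (sig f) = P.t := mkBase_cr _ _ _

variable {P f}

lemma pos_poiBase {W : E} (x : W ⟶ P.base) (m : W ⟶ J)
    (h : (x ≫ poiBase P f) ≫ cr P (sig f) = m ≫ (sig f).p) :
    pos (x ≫ poiBase P f) m h = x := by
  refine pos_precomp_mkBase _ _ _ (by simp) _ _ ?_
  exact ((Category.assoc _ _ _).trans
    (congrArg (x ≫ ·) (poiBase_cr P f))).symm.trans h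

lemma poi_h {W : E} {x : W ⟶ P.base} {y : W ⟶ (comp P (sig f)).tot}
    (h : x ≫ poiBase P f = y ≫ (comp P (sig f)).p) : (y ≫ ctx P (sig f)) ≫ P.p = x := by
  rw [← pos_of_eq h, pos_poiBase]

variable (P f)

/-- The inverse of `postHom`. -/
noncomputable def postInv : post P f ⟶ comp P (sig f) :=
  Hom.ofAct (poiBase P f)
    ((Category.assoc _ _ _).symm.trans (congrArg (· ≫ f) (poiBase_cr P f)))
    (fun _ x y _ => y ≫ ctx P (sig f))
    (fun _ _ _ h => poi_h h)
    (by simp)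

variable {P f}

@[simp] lemma postHom_ap {W : E} (x : W ⟶ (comp P (sig f)).base) :
    (postHom P f).ap x = pos x (x ≫ cr P (sig f)) (po_h x) := poBase_eq x

lemma po_h' {W : E} {x : W ⟶ (comp P (sig f)).base} {m : W ⟶ P.tot}
    (h : (postHom P f).ap x = m ≫ (post P f).p) :
    m ≫ P.p = pos x (x ≫ cr P (sig f)) (po_h x) := po_p h

@[simp] lemma postHom_act {W : E} (x : W ⟶ (comp P (sig f)).base) (m : W ⟶ P.tot)
    (h : (postHom P f).ap x = m ≫ (post P f).p) :
    (postHom P f).act x m h = mkTot x (x ≫ cr P (sig f)) m (po_h x) (po_h' h) :=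
  Hom.ofAct_act _ _ _ _ _ (by intros; simp) _ _ _

@[simp] lemma pos_postInv_ap {W : E} (x : W ⟶ P.base) (m : W ⟶ J)
    (h : (postInv P f).ap x ≫ cr P (sig f) = m ≫ (sig f).p) :
    pos ((postInv P f).ap x) m h = x := pos_poiBase x m h

@[simp] lemma postInv_ap_cr {W : E} (x : W ⟶ P.base) :
    (postInv P f).ap x ≫ cr P (sig f) = x ≫ P.t :=
  (Category.assoc _ _ _).trans (congrArg (x ≫ ·) (poiBase_cr P f))

@[simp] lemma postInv_act {W : E} (x : W ⟶ P.base) (y : W ⟶ (comp P (sig f)).tot)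
    (h : (postInv P f).ap x = y ≫ (comp P (sig f)).p) :
    (postInv P f).act x y h = y ≫ ctx P (sig f) :=
  Hom.ofAct_act _ _ _ _ _ (by intros; simp) _ _ _

lemma pos_sig {W : E} (x : W ⟶ (comp P (sig f)).base) (m : W ⟶ J)
    (h : x ≫ cr P (sig f) = m ≫ (sig f).p) :
    pos x m h = pos x (x ≫ cr P (sig f)) (po_h x) := by
  obtain rfl : x ≫ cr P (sig f) = m := h.trans (Category.comp_id _)
  rfl

lemma ctm_sig : ctm P (sig f) = (comp P (sig f)).p ≫ cr P (sig f) :=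
  (Category.comp_id _).symm.trans (ctm_p P (sig f))

lemma pos_sig_t {W : E} (x : W ⟶ (comp P (sig f)).base) :
    pos x (x ≫ cr P (sig f)) (po_h x) ≫ P.t = x ≫ cr P (sig f) :=
  (pos_t _ _ _).trans (Category.comp_id _)

variable (P f)

lemma postInv_postHom : postInv P f ≫ postHom P f = 𝟙 _ :=
  hom_ext (fun x => by simp) (fun x y h h' => by simp)

lemma postHom_postInv : postHom P f ≫ postInv P f = 𝟙 _ := by
  refine hom_ext (fun x => ?_) (fun x y h h' => ?_)
  · refine base_ext ?_ (fun z m h₁ h₂ => ?_)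
    · rw [comp_ap, postInv_ap_cr, postHom_ap, pos_sig_t, id_ap]
    · have e := (pos_sig (z ≫ x) m (by simpa using h₂)).symm
      simpa using e
  · obtain rfl : x = y ≫ _ := by simpa using h'
    exact tot_ext (by simp) (by simp [ctm_sig]) (by simp)

end

section

variable {X Y Z T : E} (f : X ⟶ Y) (g : Y ⟶ Z) (h : Z ⟶ T)

lemma sigma_assoc :
    (postInv (sig (f ≫ g)) h ≫ whiskerRight (postInv (sig f) g) (sig h) ≫
      assocHom (sig f) (sig g) (sig h) ≫ whiskerLeft (sig f) (postHom (sig g) h) ≫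
      postHom (sig f) (g ≫ h) : sig ((f ≫ g) ≫ h) ⟶ sig (f ≫ g ≫ h)) =
    eqToHom (congrArg sig (Category.assoc f g h)) := by
  refine hom_ext (fun x => ?_) (fun x y h h' => (act_sig _ x y h).trans (act_sig _ x y h').symm)
  rw [eqToHom_ap (Category.assoc f g h)]
  simp

lemma sigma_id_left :
    (postInv (sig (𝟙 X)) f ≫ whiskerRight (𝟙 (sig (𝟙 X))) (sig f) ≫ luHom (sig f) :
      sig (𝟙 X ≫ f) ⟶ sig f) = eqToHom (congrArg sig (Category.id_comp f)) := by
  refine hom_ext (fun x => ?_) (fun x y h h' => (act_sig _ x y h).trans (act_sig _ x y h').symm)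
  rw [eqToHom_ap (Category.id_comp f)]
  simp

lemma sigma_id_right :
    (postInv (sig f) (𝟙 Y) ≫ whiskerLeft (sig f) (𝟙 (sig (𝟙 Y))) ≫ ruHom (sig f) :
      sig (f ≫ 𝟙 Y) ⟶ sig f) = eqToHom (congrArg sig (Category.comp_id f)) := by
  refine hom_ext (fun x => ?_) (fun x y h h' => (act_sig _ x y h).trans (act_sig _ x y h').symm)
  rw [eqToHom_ap (Category.comp_id f)]
  simp only [comp_ap]
  rw [ruHom_ap, pos_whiskerLeft_ap, pos_postInv_ap]

end

end Sigma

end PolyMor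

end Polynomials

section Polynomials

variable {E : Type u} [Category.{v} E] [ChosenPullbacks E]

open Bicategory PolyMor

variable [ChosenDistributivityPullbacks E]

variable (E) in
/-- The canonical embedding of `E` into polynomials, sending `f : X ⟶ Y` to
`X <--1-- X --1--> X --f--> Y`. -/
noncomputable def sigmaEmb : LocallyDiscrete E ⥤ᵖ PolyBicat E :=
  pseudofunctorOfIsLocallyDiscrete (fun X => ⟨X.as⟩) (fun f => sig f.as)
    (fun _ => Iso.refl _)
    (fun f g => ⟨postInv (sig f.as) g.as, postHom (sig f.as) g.as,
      postInv_postHom (sig f.as) g.as, postHom_postInv (sig f.as) g.as⟩)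
    (fun f g h => sigma_assoc f.as g.as h.as)
    (fun f => sigma_id_left f.as)
    (fun f => sigma_id_right f.as)

end Polynomials

open Bicategory

section Diagrams

open ChosenPullbacksAlong

variable {E : Type u} [Category.{v} E] {I J : E}

/-- A diagram defining a 2-cell between polynomials: a pullback `S` of `g` and `Q.p` together with
`e : S ⟶ P.tot` such that the projection from `S` to `P.base` is `e ≫ P.p`. -/
structure PolyMor.Diagram (P Q : PolyMor I J) where
  S : E
  e : S ⟶ P.tot
  f : S ⟶ Q.tot
  g : P.base ⟶ Q.base
  isPullback : IsPullback (e ≫ P.p) f g Q.p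
  e_s : e ≫ P.s = f ≫ Q.s
  g_t : g ≫ Q.t = P.t

/-- Two diagrams are equivalent if they have the same `g` and their pullbacks are isomorphic
compatibly with `e` and `f`. -/
def PolyMor.Diagram.Equivalent {P Q : PolyMor I J} (d d' : PolyMor.Diagram P Q) : Prop :=
  d.g = d'.g ∧ ∃ ν : d.S ≅ d'.S, ν.hom ≫ d'.e = d.e ∧ ν.hom ≫ d'.f = d.f

variable [ChosenPullbacks E] {P Q : PolyMor I J}

/-- The 2-cell represented by a diagram. -/
noncomputable def PolyMor.Diagram.toHom (d : PolyMor.Diagram P Q) : PolyMor.Hom P Q where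
  g := d.g
  e := d.isPullback.lift (fst d.g Q.p) (snd d.g Q.p) condition ≫ d.e
  g_t := d.g_t
  e_p := (Category.assoc _ _ _).trans (d.isPullback.lift_fst _ _ _)
  e_s := (Category.assoc _ _ _).trans ((congrArg _ d.e_s).trans ((Category.assoc _ _ _).symm.trans
    (congrArg (· ≫ Q.s) (d.isPullback.lift_snd _ _ _))))

lemma PolyMor.Diagram.toHom_eq (d : PolyMor.Diagram P Q) {φ : PolyMor.Hom P Q} (hg : d.g = φ.g)
    (m : pullbackObj φ.g Q.p ⟶ d.S) (h₁ : m ≫ d.e = φ.e) (h₂ : m ≫ d.f = snd φ.g Q.p) :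
    d.toHom = φ := by
  obtain ⟨S, e, f, g, hp, hs, ht⟩ := d
  obtain ⟨g', e', h1, h2, h3⟩ := φ
  obtain rfl : g = g' := hg
  have h : hp.lift (fst g Q.p) (snd g Q.p) condition = m := by
    apply hp.hom_ext
    · rw [hp.lift_fst, reassoc_of% h₁, h2]
    · rw [hp.lift_snd, h₂]
  have : hp.lift (fst g Q.p) (snd g Q.p) condition ≫ e = e' := by rw [h, h₁]
  subst this
  rfl

/-- Every 2-cell is represented by a diagram. -/
lemma PolyMor.Diagram.toHom_surjective :
    Function.Surjective (PolyMor.Diagram.toHom (P := P) (Q := Q)) := fun φ =>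
  ⟨⟨pullbackObj φ.g Q.p, φ.e, snd φ.g Q.p, φ.g,
    φ.e_p ▸ ChosenPullbacksAlong.isPullback _ _, φ.e_s, φ.g_t⟩,
    toHom_eq _ rfl (𝟙 _) (Category.id_comp _) (Category.id_comp _)⟩

/-- Two diagrams represent the same 2-cell if and only if they are equivalent. -/
lemma PolyMor.Diagram.toHom_eq_iff (d d' : PolyMor.Diagram P Q) :
    d.toHom = d'.toHom ↔ d.Equivalent d' := by
  constructor
  · intro h
    have hg : d.g = d'.g := congrArg PolyMor.Hom.g h
    obtain ⟨S, e, f, g, hp, hs, ht⟩ := d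
    obtain ⟨S', e', f', g', hp', hs', ht'⟩ := d'
    obtain rfl : g = g' := hg
    have he : hp.lift (fst g Q.p) (snd g Q.p) condition ≫ e =
        hp'.lift (fst g Q.p) (snd g Q.p) condition ≫ e' := by
      simpa [toHom] using h
    have hl : (ChosenPullbacksAlong.isPullback g Q.p).lift (e ≫ P.p) f hp.w ≫
        hp.lift (fst g Q.p) (snd g Q.p) condition = 𝟙 _ := by
      apply hp.hom_ext <;> simp
    have hl' : (ChosenPullbacksAlong.isPullback g Q.p).lift (e ≫ P.p) f hp.w ≫
        hp'.lift (fst g Q.p) (snd g Q.p) condition = (hp.isoIsPullback _ _ hp').hom := by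
      apply hp'.hom_ext <;> simp
    refine ⟨rfl, hp.isoIsPullback _ _ hp', ?_, hp.isoIsPullback_hom_snd _ _ hp'⟩
    rw [← hl']
    change (_ ≫ _) ≫ e' = e
    rw [Category.assoc, ← he, reassoc_of% hl]
  · rintro ⟨hg, ν, h₁, h₂⟩
    refine toHom_eq d hg (d'.isPullback.lift (fst d'.g Q.p) (snd d'.g Q.p) condition ≫ ν.inv) ?_ ?_
    · rw [Category.assoc, ← h₁, ν.inv_hom_id_assoc]
      rfl
    · rw [Category.assoc, ← h₂, ν.inv_hom_id_assoc]
      exact d'.isPullback.lift_snd _ _ _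

end Diagrams

section Icons

section Cast

variable {C : Type u₂} [Bicategory.{w₂, v₂} C]

/-- The identification of hom-categories along equalities of objects. -/
def castFunctor {a a' b b' : C} (ha : a = a') (hb : b = b') : (a' ⟶ b') ⥤ (a ⟶ b) :=
  match ha, hb with
  | rfl, rfl => 𝟭 _

lemma castFunctor_rfl {a b : C} (ha : a = a) (hb : b = b) : castFunctor ha hb = 𝟭 (a ⟶ b) := rfl

lemma castFunctor_comp {a a' b b' c c' : C} (ha : a = a') (hb : b = b') (hc : c = c')
    (f : a' ⟶ b') (g : b' ⟶ c') :
    (castFunctor ha hc).obj (f ≫ g) = (castFunctor ha hb).obj f ≫ (castFunctor hb hc).obj g := by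
  subst ha hb hc
  rfl

lemma castFunctor_id {a a' : C} (ha : a = a') : (castFunctor ha ha).obj (𝟙 a') = 𝟙 a := by
  subst ha
  rfl

lemma castFunctor_trans {a a' a'' b b' b'' : C} (ha : a = a') (ha' : a' = a'') (hb : b = b')
    (hb' : b' = b'') (f : a'' ⟶ b'') :
    (castFunctor ha hb).obj ((castFunctor ha' hb').obj f) =
      (castFunctor (ha.trans ha') (hb.trans hb')).obj f := by
  subst ha ha' hb hb'
  rfl

section Aux

lemma icon_aux_naturality {D : Type u₁} [Category.{v₁} D] {x x' y y' z z' : D} (F₂ : x ⟶ x')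
    (G₂ : y ⟶ y') (H₂ : z ⟶ z') (α : x ⟶ y) (α' : x' ⟶ y') (β : y ⟶ z) (β' : y' ⟶ z')
    (e₁ : F₂ ≫ α' = α ≫ G₂) (e₂ : G₂ ≫ β' = β ≫ H₂) :
    F₂ ≫ α' ≫ β' ≫ 𝟙 z' = (α ≫ β ≫ 𝟙 z) ≫ H₂ := by
  rw [Category.comp_id, Category.comp_id, Category.assoc, ← e₂, reassoc_of% e₁]

lemma icon_aux_id {D : Type u₁} [Category.{v₁} D] {x y z i : D} (F : x ⟶ i)
    (G : y ⟶ i) (H : z ⟶ i) (α : x ⟶ y) (β : y ⟶ z)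
    (e₁ : α ≫ G ≫ 𝟙 i = F) (e₂ : β ≫ H ≫ 𝟙 i = G) :
    (α ≫ β ≫ 𝟙 z) ≫ H ≫ 𝟙 i = F := by
  simp only [Category.comp_id, Category.assoc] at *
  rw [e₂, e₁]

lemma icon_aux_assoc {D : Type u₁} [Category.{v₁} D] {x y z w : D} (α : x ⟶ y) (β : y ⟶ z)
    (γ : z ⟶ w) :
    (α ≫ β ≫ 𝟙 z) ≫ γ ≫ 𝟙 w = α ≫ (β ≫ γ ≫ 𝟙 w) ≫ 𝟙 w := by
  simp only [Category.comp_id, Category.assoc]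

lemma icon_aux_comp {a b c : C} {Ff Gf Hf : a ⟶ b} {Fg Gg Hg : b ⟶ c} {F G H : a ⟶ c}
    (Fc : F ⟶ Ff ≫ Fg) (Gc : G ⟶ Gf ≫ Gg) (Hc : H ⟶ Hf ≫ Hg) (α : F ⟶ G) (β : G ⟶ H)
    (αf : Ff ⟶ Gf) (βf : Gf ⟶ Hf) (αg : Fg ⟶ Gg) (βg : Gg ⟶ Hg)
    (e₁ : α ≫ Gc ≫ 𝟙 (Gf ≫ Gg) = Fc ≫ αf ▷ Fg ≫ Gf ◁ αg)
    (e₂ : β ≫ Hc ≫ 𝟙 (Hf ≫ Hg) = Gc ≫ βf ▷ Gg ≫ Hf ◁ βg) :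
    (α ≫ β ≫ 𝟙 H) ≫ Hc ≫ 𝟙 (Hf ≫ Hg) =
      Fc ≫ (αf ≫ βf ≫ 𝟙 Hf) ▷ Fg ≫ Hf ◁ (αg ≫ βg ≫ 𝟙 Hg) := by
  simp only [Category.comp_id, Category.assoc, comp_whiskerRight,
      Bicategory.whiskerLeft_comp] at *
  rw [e₂, reassoc_of% e₁, whisker_exchange_assoc]

end Aux

end Cast

variable {B : Type u₁} [Bicategory.{w₁, v₁} B] {C : Type u₂} [Bicategory.{w₂, v₂} C]

/-- An icon between oplax functors `F` and `G` which agree on objects: natural families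
`F.map f ⟶ G.map f` compatible with the constraint cells. Since `F` and `G` agree on objects only
propositionally, `G.map f` is transported along these equalities. -/
structure Icon (F G : B ⥤ᵒᵖᴸ C) where
  obj_eq (a : B) : F.obj a = G.obj a
  app {a b : B} (f : a ⟶ b) : F.map f ⟶ (castFunctor (obj_eq a) (obj_eq b)).obj (G.map f)
  naturality {a b : B} {f g : a ⟶ b} (η : f ⟶ g) :
    F.map₂ η ≫ app g = app f ≫ (castFunctor (obj_eq a) (obj_eq b)).map (G.map₂ η)
  map_comp {a b c : B} (f : a ⟶ b) (g : b ⟶ c) :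
    app (f ≫ g) ≫ (castFunctor (obj_eq a) (obj_eq c)).map (G.mapComp f g) ≫
        eqToHom (castFunctor_comp (obj_eq a) (obj_eq b) (obj_eq c) (G.map f) (G.map g)) =
      F.mapComp f g ≫ app f ▷ F.map g ≫
        (castFunctor (obj_eq a) (obj_eq b)).obj (G.map f) ◁ app g
  map_id (a : B) :
    app (𝟙 a) ≫ (castFunctor (obj_eq a) (obj_eq a)).map (G.mapId a) ≫
        eqToHom (castFunctor_id (obj_eq a)) = F.mapId a

namespace Icon

lemma ext_app {F G : B ⥤ᵒᵖᴸ C} {α β : Icon F G}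
    (h : ∀ {a b : B} (f : a ⟶ b), α.app f = β.app f) : α = β := by
  obtain ⟨_, α, _, _, _⟩ := α
  obtain ⟨_, β, _, _, _⟩ := β
  obtain rfl : @α = @β := by
    funext a b f
    exact h f
  rfl

/-- The identity icon. -/
def id (F : B ⥤ᵒᵖᴸ C) : Icon F F where
  obj_eq _ := rfl
  app f := 𝟙 (F.map f)
  naturality η := by simp [castFunctor_rfl]
  map_comp f g := by simp [castFunctor_rfl]
  map_id a := (Category.id_comp _).trans (Category.comp_id _)

/-- Composition of icons. -/
def comp {F G H : B ⥤ᵒᵖᴸ C} (α : Icon F G) (β : Icon G H) : Icon F H where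
  obj_eq a := (α.obj_eq a).trans (β.obj_eq a)
  app {a b} f := α.app f ≫ (castFunctor (α.obj_eq a) (α.obj_eq b)).map (β.app f) ≫
    eqToHom (castFunctor_trans _ _ _ _ _)
  naturality {a b f g} η := by
    obtain ⟨hα, α, αn, αc, αi⟩ := α
    obtain ⟨hβ, β, βn, βc, βi⟩ := β
    obtain ⟨⟨⟨⟨Gobj, Gmap⟩, Gmap₂⟩, h1, h2⟩, h3, h4, h5, h6, h7, h8, h9⟩ := G
    obtain rfl : F.obj = Gobj := funext hα
    obtain ⟨⟨⟨⟨Hobj, Hmap⟩, Hmap₂⟩, k1, k2⟩, k3, k4, k5, k6, k7, k8, k9⟩ := H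
    obtain rfl : F.obj = Hobj := funext hβ
    exact icon_aux_naturality (F.map₂ η) (Gmap₂ η) (Hmap₂ η) (α f) (α g) (β f) (β g) (αn η) (βn η)
  map_comp {a b c} f g := by
    obtain ⟨hα, α, αn, αc, αi⟩ := α
    obtain ⟨hβ, β, βn, βc, βi⟩ := β
    obtain ⟨⟨⟨⟨Gobj, Gmap⟩, Gmap₂⟩, h1, h2⟩, Gi, Gc, h5, h6, h7, h8, h9⟩ := G
    obtain rfl : F.obj = Gobj := funext hα
    obtain ⟨⟨⟨⟨Hobj, Hmap⟩, Hmap₂⟩, k1, k2⟩, Hi, Hc, k5, k6, k7, k8, k9⟩ := H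
    obtain rfl : F.obj = Hobj := funext hβ
    exact icon_aux_comp (F.mapComp f g) (Gc f g) (Hc f g) (α (f ≫ g)) (β (f ≫ g)) (α f) (β f) (α g)
      (β g) (αc f g) (βc f g)
  map_id a := by
    obtain ⟨hα, α, αn, αc, αi⟩ := α
    obtain ⟨hβ, β, βn, βc, βi⟩ := β
    obtain ⟨⟨⟨⟨Gobj, Gmap⟩, Gmap₂⟩, h1, h2⟩, Gi, Gc, h5, h6, h7, h8, h9⟩ := G
    obtain rfl : F.obj = Gobj := funext hα
    obtain ⟨⟨⟨⟨Hobj, Hmap⟩, Hmap₂⟩, k1, k2⟩, Hi, Hc, k5, k6, k7, k8, k9⟩ := H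
    obtain rfl : F.obj = Hobj := funext hβ
    exact icon_aux_id (F.mapId a) (Gi a) (Hi a) (α (𝟙 a)) (β (𝟙 a)) (αi a) (βi a)

lemma id_comp {F G : B ⥤ᵒᵖᴸ C} (α : Icon F G) : comp (id F) α = α :=
  ext_app fun _ => (Category.id_comp _).trans (Category.comp_id _)

lemma comp_id {F G : B ⥤ᵒᵖᴸ C} (α : Icon F G) : comp α (id G) = α :=
  ext_app fun f => by
    obtain ⟨hα, α, αn, αc, αi⟩ := α
    obtain ⟨⟨⟨⟨Gobj, Gmap⟩, Gmap₂⟩, h1, h2⟩, Gi, Gc, h5, h6, h7, h8, h9⟩ := G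
    obtain rfl : F.obj = Gobj := funext hα
    exact (congrArg (α f ≫ ·) (Category.id_comp _)).trans (Category.comp_id _)

lemma assoc {F G H K : B ⥤ᵒᵖᴸ C} (α : Icon F G) (β : Icon G H) (γ : Icon H K) :
    comp (comp α β) γ = comp α (comp β γ) :=
  ext_app fun f => by
    obtain ⟨hα, α, αn, αc, αi⟩ := α
    obtain ⟨hβ, β, βn, βc, βi⟩ := β
    obtain ⟨hγ, γ, γn, γc, γi⟩ := γ
    obtain ⟨⟨⟨⟨Gobj, Gmap⟩, Gmap₂⟩, h1, h2⟩, Gi, Gc, h5, h6, h7, h8, h9⟩ := G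
    obtain rfl : F.obj = Gobj := funext hα
    obtain ⟨⟨⟨⟨Hobj, Hmap⟩, Hmap₂⟩, k1, k2⟩, Hi, Hc, k5, k6, k7, k8, k9⟩ := H
    obtain rfl : F.obj = Hobj := funext hβ
    obtain ⟨⟨⟨⟨Kobj, Kmap⟩, Kmap₂⟩, l1, l2⟩, Ki, Kc, l5, l6, l7, l8, l9⟩ := K
    obtain rfl : F.obj = Kobj := funext hγ
    exact icon_aux_assoc (α f) (β f) (γ f)

end Icon

variable (B C) in
/-- The category of oplax functors and icons. -/
structure OplaxIcon where
  functor : B ⥤ᵒᵖᴸ C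

instance : Category (OplaxIcon B C) where
  Hom F G := Icon F.functor G.functor
  id F := Icon.id F.functor
  comp α β := Icon.comp α β
  id_comp := Icon.id_comp
  comp_id := Icon.comp_id
  assoc := Icon.assoc

variable (B C) in
/-- The category of pseudofunctors and icons. -/
structure PseudoIcon where
  functor : B ⥤ᵖ C

instance : Category (PseudoIcon B C) where
  Hom F G := Icon F.functor.toOplax G.functor.toOplax
  id F := Icon.id F.functor.toOplax
  comp α β := Icon.comp α β
  id_comp := Icon.id_comp
  comp_id := Icon.comp_id
  assoc := Icon.assoc

variable (B C) in
/-- The inclusion of pseudofunctors into oplax functors. -/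
def pseudoToOplax : PseudoIcon B C ⥤ OplaxIcon B C where
  obj F := ⟨F.functor.toOplax⟩
  map α := α

/-- An oplax functor is gregarious if it is normal and the constraint cell of a composite `f ≫ g`
is invertible whenever `g` has a right adjoint. -/
structure IsGregarious (F : B ⥤ᵒᵖᴸ C) : Prop where
  isIso_mapId (a : B) : IsIso (F.mapId a)
  isIso_mapComp {a b c : B} (f : a ⟶ b) (g : b ⟶ c) (hg : ∃ r : c ⟶ b, Nonempty (g ⊣ r)) :
    IsIso (F.mapComp f g)

lemma isGregarious_of_pseudofunctor (F : B ⥤ᵖ C) : IsGregarious F.toOplax where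
  isIso_mapId a := inferInstanceAs (IsIso (F.mapId a).hom)
  isIso_mapComp f g _ := inferInstanceAs (IsIso (F.mapComp f g).hom)

variable (B C) in
/-- The category of gregarious functors and icons. -/
abbrev Greg := ObjectProperty.FullSubcategory fun F : OplaxIcon B C => IsGregarious F.functor

variable (B C) in
/-- The inclusion of gregarious functors into oplax functors. -/
abbrev gregToOplax : Greg B C ⥤ OplaxIcon B C := ObjectProperty.ι _

variable (B C) in
/-- The inclusion of pseudofunctors into gregarious functors. -/
def pseudoToGreg : PseudoIcon B C ⥤ Greg B C :=
  ObjectProperty.lift _ (pseudoToOplax B C) fun F => isGregarious_of_pseudofunctor F.functor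

end Icons

section Restriction

variable {A : Type u₁} [Bicategory.{w₁, v₁} A] {B : Type u₂} [Bicategory.{w₂, v₂} B]
  {C : Type u₃} [Bicategory.{w₃, v₃} C]

lemma icon_aux_restrict_id {D : Type u₁} [Category.{v₁} D] {x x' y y' z : D} (f : x ⟶ y)
    (p : x ⟶ x') (f' : x' ⟶ y') (q : y ⟶ y') (m : y' ⟶ z) (n : x' ⟶ z)
    (e₁ : p ≫ f' = f ≫ q) (e₂ : f' ≫ m ≫ 𝟙 z = n) :
    f ≫ (q ≫ m) ≫ 𝟙 z = p ≫ n := by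
  simp only [Category.comp_id] at *
  rw [← reassoc_of% e₁, e₂]

/-- Restriction of an icon along a pseudofunctor. -/
def Icon.precomp (P : A ⥤ᵖ B) {F G : B ⥤ᵒᵖᴸ C} (α : Icon F G) :
    Icon (P.toOplax.comp F) (P.toOplax.comp G) where
  obj_eq a := α.obj_eq (P.obj a)
  app f := α.app (P.map f)
  naturality η := α.naturality (P.map₂ η)
  map_comp {a b c} f g := by
    obtain ⟨hα, α, αn, αc, αi⟩ := α
    obtain ⟨⟨⟨⟨Gobj, Gmap⟩, Gmap₂⟩, h1, h2⟩, Gi, Gc, h5, h6, h7, h8, h9⟩ := G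
    obtain rfl : F.obj = Gobj := funext hα
    exact (icon_aux_restrict_id (α (P.map (f ≫ g))) (F.map₂ (P.mapComp f g).hom)
      (α (P.map f ≫ P.map g)) (Gmap₂ (P.mapComp f g).hom) (Gc (P.map f) (P.map g)) _
      (αn (P.mapComp f g).hom) (αc (P.map f) (P.map g))).trans (Category.assoc _ _ _).symm
  map_id a := by
    obtain ⟨hα, α, αn, αc, αi⟩ := α
    obtain ⟨⟨⟨⟨Gobj, Gmap⟩, Gmap₂⟩, h1, h2⟩, Gi, Gc, h5, h6, h7, h8, h9⟩ := G
    obtain rfl : F.obj = Gobj := funext hα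
    exact icon_aux_restrict_id (α (P.map (𝟙 a))) (F.map₂ (P.mapId a).hom)
      (α (𝟙 (P.obj a))) (Gmap₂ (P.mapId a).hom) (Gi (P.obj a)) (F.mapId (P.obj a))
      (αn (P.mapId a).hom) (αi (P.obj a))

variable (C) in
/-- Composition with a pseudofunctor `P`, as a functor between categories of oplax functors
and icons. -/
def precompose (P : A ⥤ᵖ B) : OplaxIcon B C ⥤ OplaxIcon A C where
  obj F := ⟨P.toOplax.comp F.functor⟩
  map α := Icon.precomp P α
  map_id _ := rfl
  map_comp _ _ := rfl

end Restriction

section TwoBeck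

variable {E : Type u} [Category.{v} E] {C : Type u₂} [Bicategory.{w₂, v₂} C]

/-- The 1-cell underlying the value of a pseudofunctor on a morphism of `E`. -/
abbrev mapHom (F : LocallyDiscrete E ⥤ᵖ C) {X Y : E} (f : X ⟶ Y) :
    F.obj ⟨X⟩ ⟶ F.obj ⟨Y⟩ := F.map f.toLoc

lemma commSq_toLoc {X Y Z W : E} {f' : X ⟶ Y} {g' : X ⟶ Z} {g : Y ⟶ W} {f : Z ⟶ W}
    (h : CommSq f' g' g f) : CommSq f'.toLoc g'.toLoc g.toLoc f.toLoc :=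
  ⟨congrArg Quiver.Hom.toLoc h.w⟩

/-- The Beck 2-cell of a commutative square with top `f'`, left `g'`, right `g` and bottom `f`,
for given adjunctions `F g' ⊣ u'` and `F g ⊣ u`: the mate of `F f' ≫ F g ≅ F g' ≫ F f`. -/
def beckCell (F : LocallyDiscrete E ⥤ᵖ C) {X Y Z W : E} {f' : X ⟶ Y} {g' : X ⟶ Z} {g : Y ⟶ W}
    {f : Z ⟶ W} (h : CommSq f' g' g f)
    {u' : F.obj ⟨Z⟩ ⟶ F.obj ⟨X⟩} {u : F.obj ⟨W⟩ ⟶ F.obj ⟨Y⟩}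
    (adj' : mapHom F g' ⊣ u') (adj : mapHom F g ⊣ u) :
    u' ≫ mapHom F f' ⟶ mapHom F f ≫ u :=
  mateEquiv adj' adj (F.isoMapOfCommSq (commSq_toLoc h)).hom

/-- A pseudofunctor `E ⥤ᵖ C` is 2-Beck if every `F f` has two successive right adjoints and
the Beck 2-cells of all pullback squares are invertible. -/
structure IsTwoBeck (F : LocallyDiscrete E ⥤ᵖ C) : Prop where
  exists_adj {X Y : E} (f : X ⟶ Y) :
    ∃ (r : F.obj ⟨Y⟩ ⟶ F.obj ⟨X⟩) (r' : F.obj ⟨X⟩ ⟶ F.obj ⟨Y⟩),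
      Nonempty (mapHom F f ⊣ r) ∧ Nonempty (r ⊣ r')
  beck {X Y Z W : E} {f' : X ⟶ Y} {g' : X ⟶ Z} {g : Y ⟶ W} {f : Z ⟶ W}
    (h : IsPullback f' g' g f) {u' : F.obj ⟨Z⟩ ⟶ F.obj ⟨X⟩} {u : F.obj ⟨W⟩ ⟶ F.obj ⟨Y⟩}
    (adj' : mapHom F g' ⊣ u') (adj : mapHom F g ⊣ u) :
    IsIso (beckCell F h.toCommSq adj' adj)

/-- A choice of successive right adjoints `F f ⊣ pull ⊣ push` of the value of `F` at `f`. -/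
structure AdjTriple (F : LocallyDiscrete E ⥤ᵖ C) {X Y : E} (f : X ⟶ Y) where
  pull : F.obj ⟨Y⟩ ⟶ F.obj ⟨X⟩
  push : F.obj ⟨X⟩ ⟶ F.obj ⟨Y⟩
  adj : mapHom F f ⊣ pull
  adj' : pull ⊣ push

section Distributivity

variable {F : LocallyDiscrete E ⥤ᵖ C} (hF : IsTwoBeck F)
  {X A B : E} {f : A ⟶ B} {u : X ⟶ A} (D : PullbackAround f u)
  (tf : AdjTriple F f) (tu : AdjTriple F u) (tp : AdjTriple F D.p) (tq : AdjTriple F D.q)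
  (tr : AdjTriple F D.r)

/-- The 2-cell `uΔ ≫ pΔ ≫ qΠ ⟶ fΠ ≫ rΔ` for a pullback around `(f, u)`. It is the mate,
under `qΔ ≫ F p ≫ F u ⊣ (uΔ ≫ pΔ) ≫ qΠ` and `F r ≫ fΔ ⊣ fΠ ≫ rΔ`, of the inverse of the
Beck 2-cell `qΔ ≫ F (p ≫ u) ⟶ F r ≫ fΔ`. -/
noncomputable def beckMate : (tu.pull ≫ tp.pull) ≫ tq.push ⟶ tf.push ≫ tr.pull :=
  haveI := hF.beck D.isPullback tq.adj tf.adj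
  conjugateEquiv (tq.adj'.comp (tp.adj.comp tu.adj)) (tr.adj.comp tf.adj')
    (inv (beckCell F D.isPullback.toCommSq tq.adj tf.adj) ≫
      tq.pull ◁ (F.mapComp D.p.toLoc u.toLoc).hom)

/-- The distributivity morphism `pΔ ≫ qΠ ≫ F r ⟶ F u ≫ fΠ`: the pasting of the unit of
`F u ⊣ uΔ`, the 2-cell `beckMate` and the counit of `F r ⊣ rΔ`. -/
noncomputable def distributivityMor :
    tp.pull ≫ tq.push ≫ mapHom F D.r ⟶ mapHom F u ≫ tf.push :=
  𝟙 _ ⊗≫ tu.adj.unit ▷ (tp.pull ≫ tq.push ≫ mapHom F D.r) ⊗≫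
    mapHom F u ◁ beckMate hF D tf tu tp tq tr ▷ mapHom F D.r ⊗≫
    (mapHom F u ≫ tf.push) ◁ tr.adj.counit ⊗≫ 𝟙 _

end Distributivity

/-- A pseudofunctor `E ⥤ᵖ C` is DistBeck if it is 2-Beck and the distributivity morphisms of all
distributivity pullbacks are invertible. -/
structure IsDistBeck (F : LocallyDiscrete E ⥤ᵖ C) : Prop where
  isTwoBeck : IsTwoBeck F
  isIso_distributivityMor {X A B : E} {f : A ⟶ B} {u : X ⟶ A} (D : PullbackAround f u)
    (hD : D.IsDistributivityPullback) (tf : AdjTriple F f) (tu : AdjTriple F u)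
    (tp : AdjTriple F D.p) (tq : AdjTriple F D.q) (tr : AdjTriple F D.r) :
    IsIso (distributivityMor isTwoBeck D tf tu tp tq tr)

variable (E C)

/-- The category of 2-Beck pseudofunctors and invertible icons. -/
abbrev TwoBeck := Core (ObjectProperty.FullSubcategory
  fun F : PseudoIcon (LocallyDiscrete E) C => IsTwoBeck F.functor)

/-- The category of DistBeck pseudofunctors and invertible icons. -/
abbrev DistBeck := Core (ObjectProperty.FullSubcategory
  fun F : PseudoIcon (LocallyDiscrete E) C => IsDistBeck F.functor)

/-- The inclusion of 2-Beck pseudofunctors into oplax functors and icons. -/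
def twoBeckToOplax : TwoBeck E C ⥤ OplaxIcon (LocallyDiscrete E) C :=
  Core.inclusion _ ⋙ ObjectProperty.ι _ ⋙ pseudoToOplax _ _

/-- The inclusion of DistBeck pseudofunctors into 2-Beck pseudofunctors. -/
def distBeckToTwoBeck : DistBeck E C ⥤ TwoBeck E C :=
  (ObjectProperty.ιOfLE fun _ hF => hF.isTwoBeck).core

end TwoBeck

section Restrict

variable (E : Type u) [Category.{v} E] [ChosenPullbacks E] [ChosenDistributivityPullbacks E]
  (C : Type u₂) [Bicategory.{w₂, v₂} C]

/-- Composition with the canonical embedding of `E` into polynomials. -/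
noncomputable abbrev restrictSigma :
    OplaxIcon (PolyBicat E) C ⥤ OplaxIcon (LocallyDiscrete E) C :=
  precompose C (sigmaEmb E)

end Restrict

end PolyUniv

open PolyUniv

-- The embedding of $\mathcal E$ into polynomials factors through spans, and both stages are left
-- Kan extension problems of the same formal kind. A span with legs $l$, $r$ is the left Kan
-- extension of the embedded $r$ along the embedded $l$, and a polynomial $(s,p,t)$ is the left Kan
-- extension of the embedded $t$ along the span with legs $p$, $s$. This dictates the extension of a
-- 2-Beck $F$: a span goes to $F_\Delta l$ followed by $Fr$, and a polynomial goes to $F_\Delta s$,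
-- then $F_\Pi p$, then $Ft$. The adjunctions in $\mathscr C$ say precisely that these composites
-- are the required Kan extensions (`isUniv_unit`).
--
-- The common formalism is `Shape`: 1-cells $P$ of one bicategory are presented by pairs `src P`,
-- `tgt P` of 1-cells of another. An element (`El`) is a 2-cell $Tj\to Ts\cdot X$, with $Tj$ as its
-- source, and it is universal (`IsUniv`) if it exhibits $X$ as a left Kan extension. A choice of
-- universal elements produces an oplax functor (`Shape.kanOplax`). Its axioms can be tested on
-- universal elements, where they become identities for restriction and product of elements, proved
-- by sliding 2-cells along dinaturality relations. What is special to $\mathcal E$ is confined to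
-- `spanShape` and `polyShape`, whose axioms are checked on generalised elements.
--
-- Invertibility of a constraint cell at a composite is universality of a product of universal
-- elements (`Shape.IsKan.isIso_mapComp_iff`). For spans it follows from the Beck condition
-- (`OplaxOn.IsBeck.isPseudo_of_isKan`). For polynomials with linear second factor it is automatic
-- (`isGood_lin`), and every left adjoint between polynomials is linear up to isomorphism
-- (`isIso_p_of_adjunction`), so the extension is gregarious. When the second factor pushes forward
-- along $f$, it amounts to the distributivity condition for a distributivity pullback around $f$
-- and the last leg of the first factor (`isUniv_zel_pi_iff`, `isDistributivityPullback_piAround`).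
-- Every polynomial is a linear one, followed by such a pushforward, followed by a linear one. Hence
-- distributivity makes the extension a pseudofunctor (`isPseudo_of_isDist`), and conversely
-- (`isDist_embOn_comp`).
--
-- In the other direction, gregarious functors preserve adjunctions (`OplaxOn.mapAdj`) and the
-- universal elements whose two indices are left adjoints (`OplaxOn.isUniv_map₂`). The identity
-- functors of spans and of polynomials are Kan extensions of the embeddings
-- (`SpanBicat.isKan_idOn_embOn`, `isKan_idOn_linOn`), so a gregarious functor is recovered from its
-- restriction to $\mathcal E$ by Kan extension, and that restriction is 2-Beck
-- (`isBeck_embOn_comp`). An icon between gregarious functors is therefore determined by its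
-- restriction, and every invertible icon between restrictions extends. Restricted icons are always
-- invertible, because an icon is invertible at left adjoints (`IconOn.isIso_app_of_adjunction`).
-- This gives fullness and faithfulness; the extension (`exists_extension`) gives essential
-- surjectivity.

universe w₄ v₄ u₄

namespace PolyUniv

open Bicategory

/-! ### Oplax functors with a fixed action on objects -/

section OplaxOn

variable {S : Type u₁} [Bicategory.{w₁, v₁} S] {C : Type u₂} [Bicategory.{w₂, v₂} C]

/-- An oplax functor with prescribed action `o` on objects. -/
structure OplaxOn (o : S → C) where
  map {a b : S} (f : a ⟶ b) : o a ⟶ o b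
  map₂ {a b : S} {f g : a ⟶ b} (η : f ⟶ g) : map f ⟶ map g
  mapId (a : S) : map (𝟙 a) ⟶ 𝟙 (o a)
  mapComp {a b c : S} (f : a ⟶ b) (g : b ⟶ c) : map (f ≫ g) ⟶ map f ≫ map g
  map₂_id {a b : S} (f : a ⟶ b) : map₂ (𝟙 f) = 𝟙 (map f)
  map₂_comp {a b : S} {f g h : a ⟶ b} (η : f ⟶ g) (θ : g ⟶ h) : map₂ (η ≫ θ) = map₂ η ≫ map₂ θ
  naturality_left {a b c : S} {f f' : a ⟶ b} (η : f ⟶ f') (g : b ⟶ c) :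
    map₂ (η ▷ g) ≫ mapComp f' g = mapComp f g ≫ map₂ η ▷ map g
  naturality_right {a b c : S} (f : a ⟶ b) {g g' : b ⟶ c} (η : g ⟶ g') :
    map₂ (f ◁ η) ≫ mapComp f g' = mapComp f g ≫ map f ◁ map₂ η
  associator {a b c d : S} (f : a ⟶ b) (g : b ⟶ c) (h : c ⟶ d) :
    map₂ (α_ f g h).hom ≫ mapComp f (g ≫ h) ≫ map f ◁ mapComp g h =
      mapComp (f ≫ g) h ≫ mapComp f g ▷ map h ≫ (α_ (map f) (map g) (map h)).hom
  leftUnitor {a b : S} (f : a ⟶ b) :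
    map₂ (λ_ f).hom = mapComp (𝟙 a) f ≫ mapId a ▷ map f ≫ (λ_ (map f)).hom
  rightUnitor {a b : S} (f : a ⟶ b) :
    map₂ (ρ_ f).hom = mapComp f (𝟙 b) ≫ map f ◁ mapId b ≫ (ρ_ (map f)).hom

namespace OplaxOn

variable {o : S → C}

/-- The oplax functor underlying an `OplaxOn`. -/
def toOplax (T : OplaxOn o) : S ⥤ᵒᵖᴸ C where
  obj := o
  map := T.map
  map₂ := T.map₂
  map₂_id := T.map₂_id
  map₂_comp := T.map₂_comp
  mapId := T.mapId
  mapComp := T.mapComp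
  mapComp_naturality_left := T.naturality_left
  mapComp_naturality_right := T.naturality_right
  map₂_associator := T.associator
  map₂_leftUnitor := T.leftUnitor
  map₂_rightUnitor := T.rightUnitor

/-- An oplax functor, as an `OplaxOn` its action on objects. -/
def ofOplax (F : S ⥤ᵒᵖᴸ C) : OplaxOn F.obj where
  map := F.map
  map₂ := F.map₂
  map₂_id := F.map₂_id
  map₂_comp := F.map₂_comp
  mapId := F.mapId
  mapComp := F.mapComp
  naturality_left := F.mapComp_naturality_left
  naturality_right := F.mapComp_naturality_right
  associator := F.map₂_associator
  leftUnitor := F.map₂_leftUnitor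
  rightUnitor := F.map₂_rightUnitor

/-- The constraint cells are invertible. -/
class IsPseudo (T : OplaxOn o) : Prop where
  isIso_mapId (a : S) : IsIso (T.mapId a) := by infer_instance
  isIso_mapComp {a b c : S} (f : a ⟶ b) (g : b ⟶ c) : IsIso (T.mapComp f g) := by infer_instance

attribute [instance] IsPseudo.isIso_mapId IsPseudo.isIso_mapComp

variable (T : OplaxOn o)

@[simp] lemma map₂_id' {a b : S} (f : a ⟶ b) : T.map₂ (𝟙 f) = 𝟙 (T.map f) := T.map₂_id f

@[simp]
lemma map₂_hom_inv {a b : S} {f g : a ⟶ b} (e : f ≅ g) :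
    T.map₂ e.hom ≫ T.map₂ e.inv = 𝟙 _ := by
  rw [← T.map₂_comp, e.hom_inv_id, T.map₂_id]

@[simp]
lemma map₂_hom_inv_assoc {a b : S} {f g : a ⟶ b} (e : f ≅ g) {h : o a ⟶ o b} (k : T.map f ⟶ h) :
    T.map₂ e.hom ≫ T.map₂ e.inv ≫ k = k := by
  rw [← Category.assoc, map₂_hom_inv, Category.id_comp]

@[simp]
lemma map₂_inv_hom {a b : S} {f g : a ⟶ b} (e : f ≅ g) :
    T.map₂ e.inv ≫ T.map₂ e.hom = 𝟙 _ := by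
  rw [← T.map₂_comp, e.inv_hom_id, T.map₂_id]

@[simp]
lemma map₂_inv_hom_assoc {a b : S} {f g : a ⟶ b} (e : f ≅ g) {h : o a ⟶ o b} (k : T.map g ⟶ h) :
    T.map₂ e.inv ≫ T.map₂ e.hom ≫ k = k := by
  rw [← Category.assoc, map₂_inv_hom, Category.id_comp]

instance {a b : S} {f g : a ⟶ b} (η : f ⟶ g) [IsIso η] : IsIso (T.map₂ η) :=
  ⟨T.map₂ (inv η), by rw [← T.map₂_comp, IsIso.hom_inv_id, T.map₂_id],
    by rw [← T.map₂_comp, IsIso.inv_hom_id, T.map₂_id]⟩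

lemma naturality_left_assoc {a b c : S} {f f' : a ⟶ b} (η : f ⟶ f') (g : b ⟶ c) {h : o a ⟶ o c}
    (k : T.map f' ≫ T.map g ⟶ h) :
    T.map₂ (η ▷ g) ≫ T.mapComp f' g ≫ k = T.mapComp f g ≫ T.map₂ η ▷ T.map g ≫ k := by
  rw [reassoc_of% T.naturality_left η g]

lemma naturality_right_assoc {a b c : S} (f : a ⟶ b) {g g' : b ⟶ c} (η : g ⟶ g') {h : o a ⟶ o c}
    (k : T.map f ≫ T.map g' ⟶ h) :
    T.map₂ (f ◁ η) ≫ T.mapComp f g' ≫ k = T.mapComp f g ≫ T.map f ◁ T.map₂ η ≫ k := by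
  rw [reassoc_of% T.naturality_right f η]

lemma associator_assoc {a b c d : S} (f : a ⟶ b) (g : b ⟶ c) (h : c ⟶ d) {m : o a ⟶ o d}
    (k : T.map f ≫ T.map g ≫ T.map h ⟶ m) :
    T.map₂ (α_ f g h).hom ≫ T.mapComp f (g ≫ h) ≫ T.map f ◁ T.mapComp g h ≫ k =
      T.mapComp (f ≫ g) h ≫ T.mapComp f g ▷ T.map h ≫
        (α_ (T.map f) (T.map g) (T.map h)).hom ≫ k := by
  rw [reassoc_of% T.associator f g h]

variable [T.IsPseudo]

lemma inv_naturality_left {a b c : S} {f f' : a ⟶ b} (η : f ⟶ f') (g : b ⟶ c) :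
    inv (T.mapComp f g) ≫ T.map₂ (η ▷ g) = T.map₂ η ▷ T.map g ≫ inv (T.mapComp f' g) := by
  rw [IsIso.inv_comp_eq, ← Category.assoc, IsIso.eq_comp_inv, T.naturality_left]

lemma inv_naturality_right {a b c : S} (f : a ⟶ b) {g g' : b ⟶ c} (η : g ⟶ g') :
    inv (T.mapComp f g) ≫ T.map₂ (f ◁ η) = T.map f ◁ T.map₂ η ≫ inv (T.mapComp f g') := by
  rw [IsIso.inv_comp_eq, ← Category.assoc, IsIso.eq_comp_inv, T.naturality_right]

lemma inv_associator {a b c d : S} (f : a ⟶ b) (g : b ⟶ c) (h : c ⟶ d) :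
    inv (T.mapComp f g) ▷ T.map h ≫ inv (T.mapComp (f ≫ g) h) ≫ T.map₂ (α_ f g h).hom =
      (α_ _ _ _).hom ≫ T.map f ◁ inv (T.mapComp g h) ≫ inv (T.mapComp f (g ≫ h)) := by
  rw [← inv_whiskerRight, ← inv_whiskerLeft, IsIso.inv_comp_eq, IsIso.inv_comp_eq,
    ← cancel_mono (T.mapComp f (g ≫ h) ≫ T.map f ◁ T.mapComp g h), T.associator]
  simp

lemma inv_associator_symm {a b c d : S} (f : a ⟶ b) (g : b ⟶ c) (h : c ⟶ d) :
    T.map f ◁ inv (T.mapComp g h) ≫ inv (T.mapComp f (g ≫ h)) ≫ T.map₂ (α_ f g h).inv =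
      (α_ _ _ _).inv ≫ inv (T.mapComp f g) ▷ T.map h ≫ inv (T.mapComp (f ≫ g) h) := by
  rw [Iso.eq_inv_comp, ← reassoc_of% T.inv_associator f g h, T.map₂_hom_inv, Category.comp_id]

end OplaxOn

end OplaxOn

/-! ### The calculus of elements $Tj\to Ts\cdot X$ -/

section Elements

section

variable {C : Type u₂} [Bicategory.{w₂, v₂} C] {a b c : C}

@[simp]
lemma isIso_hom_inv_whiskerRight {f g : a ⟶ b} (e : f ⟶ g) [IsIso e] (h : b ⟶ c) :
    e ▷ h ≫ inv e ▷ h = 𝟙 _ := by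
  rw [← comp_whiskerRight, IsIso.hom_inv_id, id_whiskerRight]

@[simp]
lemma isIso_hom_inv_whiskerRight_assoc {f g : a ⟶ b} (e : f ⟶ g) [IsIso e] (h : b ⟶ c)
    {m : a ⟶ c} (k : f ≫ h ⟶ m) : e ▷ h ≫ inv e ▷ h ≫ k = k := by
  rw [← Category.assoc, isIso_hom_inv_whiskerRight, Category.id_comp]

@[simp]
lemma isIso_inv_hom_whiskerRight {f g : a ⟶ b} (e : f ⟶ g) [IsIso e] (h : b ⟶ c) :
    inv e ▷ h ≫ e ▷ h = 𝟙 _ := by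
  rw [← comp_whiskerRight, IsIso.inv_hom_id, id_whiskerRight]

@[simp]
lemma isIso_inv_hom_whiskerRight_assoc {f g : a ⟶ b} (e : f ⟶ g) [IsIso e] (h : b ⟶ c)
    {m : a ⟶ c} (k : g ≫ h ⟶ m) : inv e ▷ h ≫ e ▷ h ≫ k = k := by
  rw [← Category.assoc, isIso_inv_hom_whiskerRight, Category.id_comp]

@[simp]
lemma whiskerLeft_isIso_hom_inv (h : a ⟶ b) {f g : b ⟶ c} (e : f ⟶ g) [IsIso e] :
    h ◁ e ≫ h ◁ inv e = 𝟙 _ := by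
  rw [← whiskerLeft_comp, IsIso.hom_inv_id, whiskerLeft_id]

@[simp]
lemma whiskerLeft_isIso_hom_inv_assoc (h : a ⟶ b) {f g : b ⟶ c} (e : f ⟶ g) [IsIso e]
    {m : a ⟶ c} (k : h ≫ f ⟶ m) : h ◁ e ≫ h ◁ inv e ≫ k = k := by
  rw [← Category.assoc, whiskerLeft_isIso_hom_inv, Category.id_comp]

@[simp]
lemma whiskerLeft_isIso_inv_hom (h : a ⟶ b) {f g : b ⟶ c} (e : f ⟶ g) [IsIso e] :
    h ◁ inv e ≫ h ◁ e = 𝟙 _ := by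
  rw [← whiskerLeft_comp, IsIso.inv_hom_id, whiskerLeft_id]

end

/-- Interchange and cancellation. It replaces whiskering by the value at a composite, or at an
identity, by whiskering by the composite of values, or by the identity, through the invertible
constraint cell. -/
lemma whiskerLeft_eq_conj {C : Type u₂} [Bicategory.{w₂, v₂} C] {a b c : C} {f g : a ⟶ b}
    {h k : b ⟶ c} (e : f ⟶ g) [IsIso e] (x : h ⟶ k) :
    f ◁ x = e ▷ h ≫ g ◁ x ≫ inv e ▷ k := by
  rw [← whisker_exchange_assoc]
  simp

variable {S : Type u₁} [Bicategory.{w₁, v₁} S] {C : Type u₂} [Bicategory.{w₂, v₂} C]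
variable {o : S → C} (T : OplaxOn o)

/-- The elements of `X` at the pair of 1-cells `s : b ⟶ i` and `j : b ⟶ k`. -/
abbrev El {b i k : S} (s : b ⟶ i) (j : b ⟶ k) (X : o i ⟶ o k) := T.map j ⟶ T.map s ≫ X

namespace El

variable {T}

section

variable {b i k : S} {s s' s'' : b ⟶ i} {j j' j'' : b ⟶ k} {X Y Z : o i ⟶ o k}

/-- Postcomposition of an element with a 2-cell. -/
def push (x : El T s j X) (f : X ⟶ Y) : El T s j Y := x ≫ T.map s ◁ f

/-- Transport of an element along a 2-cell out of its first index. -/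
def cov (σ : s ⟶ s') (x : El T s j X) : El T s' j X := x ≫ T.map₂ σ ▷ X

/-- Transport of an element along a 2-cell into its second index. -/
def con (τ : j' ⟶ j) (x : El T s j X) : El T s j' X := T.map₂ τ ≫ x

@[simp] lemma push_id (x : El T s j X) : x.push (𝟙 X) = x := by simp [push]

lemma push_push (x : El T s j X) (f : X ⟶ Y) (g : Y ⟶ Z) :
    (x.push f).push g = x.push (f ≫ g) := by simp [push]

@[simp] lemma cov_id (x : El T s j X) : cov (𝟙 s) x = x := by simp [cov]

lemma cov_cov (σ : s ⟶ s') (σ' : s' ⟶ s'') (x : El T s j X) :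
    cov σ' (cov σ x) = cov (σ ≫ σ') x := by simp [cov, T.map₂_comp]

@[simp] lemma con_id (x : El T s j X) : con (𝟙 j) x = x := by simp [con]

lemma con_con (τ : j' ⟶ j) (τ' : j'' ⟶ j') (x : El T s j X) :
    con τ' (con τ x) = con (τ' ≫ τ) x := by simp [con, T.map₂_comp]

lemma cov_con (σ : s ⟶ s') (τ : j' ⟶ j) (x : El T s j X) :
    cov σ (con τ x) = con τ (cov σ x) := by simp [con, cov]

lemma push_cov (σ : s ⟶ s') (x : El T s j X) (f : X ⟶ Y) :
    (cov σ x).push f = cov σ (x.push f) := by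
  simp [cov, push, whisker_exchange]

lemma push_con (τ : j' ⟶ j) (x : El T s j X) (f : X ⟶ Y) :
    (con τ x).push f = con τ (x.push f) := by
  simp [con, push]

/-- The unit element. -/
def unit (s : b ⟶ i) : El T s s (𝟙 (o i)) := (ρ_ (T.map s)).inv

end

variable [T.IsPseudo]

section

variable {a b i k : S} {s s' : b ⟶ i} {j j' : b ⟶ k} {X Y : o i ⟶ o k}

/-- Restriction of an element along a 1-cell. -/
noncomputable def pull (w : a ⟶ b) (x : El T s j X) : El T (w ≫ s) (w ≫ j) X :=
  T.mapComp w j ≫ T.map w ◁ x ≫ (α_ _ _ _).inv ≫ inv (T.mapComp w s) ▷ X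

lemma push_pull (w : a ⟶ b) (x : El T s j X) (f : X ⟶ Y) :
    (pull w x).push f = pull w (x.push f) := by
  simp only [pull, push, Category.assoc, whiskerLeft_comp, ← whisker_exchange]
  simp

lemma pull_con (w : a ⟶ b) (τ : j' ⟶ j) (x : El T s j X) :
    pull w (con τ x) = con (w ◁ τ) (pull w x) := by
  simp only [pull, con, whiskerLeft_comp, Category.assoc, T.naturality_right_assoc]

lemma pull_cov (w : a ⟶ b) (σ : s ⟶ s') (x : El T s j X) :
    pull w (cov σ x) = cov (w ◁ σ) (pull w x) := by
  simp only [pull, cov, whiskerLeft_comp, Category.assoc, ← comp_whiskerRight,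
    T.inv_naturality_right]
  simp

/-- Naturality of the constraint in its first variable, followed by interchange. This relation, with
`prod_dinatural`, is what lets two presentations of the same element be identified through a 2-cell
that need not be invertible. -/
lemma pull_dinatural {w w' : a ⟶ b} (ζ : w ⟶ w') (x : El T s j X) :
    cov (ζ ▷ s) (pull w x) = con (ζ ▷ j) (pull w' x) := by
  simp only [pull, cov, con, Category.assoc, ← comp_whiskerRight, T.inv_naturality_left,
    T.naturality_left_assoc]
  rw [← whisker_exchange_assoc]
  simp

lemma pull_comp {a' : S} (w' : a' ⟶ a) (w : a ⟶ b) (x : El T s j X) :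
    pull (w' ≫ w) x = con (α_ _ _ _).hom (cov (α_ _ _ _).inv (pull w' (pull w x))) := by
  simp only [pull, con, cov, whiskerLeft_comp, Category.assoc, T.associator_assoc]
  have h := congrArg (· ▷ X) (T.inv_associator_symm w' w s)
  simp only [comp_whiskerRight] at h
  rw [associator_inv_naturality_middle_assoc, h]
  rw [whiskerLeft_eq_conj (T.mapComp w' w) x]
  simp

lemma pull_id (x : El T s j X) :
    pull (𝟙 b) x = con (λ_ _).hom (cov (λ_ _).inv x) := by
  have h : T.map₂ (λ_ s).inv = (λ_ _).inv ≫ inv (T.mapId b) ▷ T.map s ≫ inv (T.mapComp (𝟙 b) s) := by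
    rw [← cancel_epi (T.map₂ (λ_ s).hom), T.map₂_hom_inv, T.leftUnitor]
    simp
  simp only [pull, con, cov, h, T.leftUnitor, Category.assoc, comp_whiskerRight]
  rw [whiskerLeft_eq_conj (T.mapId b) x]
  simp

end

section

variable {a b i k l : S} {s s' : b ⟶ i} {j j' : b ⟶ k} {m m' : a ⟶ l}
  {X X' : o i ⟶ o k} {Y Y' : o k ⟶ o l}

/-- The product of an element `x` at `(s, j)` and an element `y` at `(r ≫ j, m)`. -/
noncomputable def prod (r : a ⟶ b) (x : El T s j X) (y : El T (r ≫ j) m Y) :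
    El T (r ≫ s) m (X ≫ Y) :=
  y ≫ T.mapComp r j ▷ Y ≫ (α_ _ _ _).hom ≫ T.map r ◁ (x ▷ Y ≫ (α_ _ _ _).hom) ≫
    (α_ _ _ _).inv ≫ inv (T.mapComp r s) ▷ (X ≫ Y)

lemma prod_cov_left (r : a ⟶ b) (σ : s ⟶ s') (x : El T s j X) (y : El T (r ≫ j) m Y) :
    prod r (cov σ x) y = cov (r ◁ σ) (prod r x y) := by
  simp only [prod, cov, whiskerLeft_comp, Category.assoc, ← comp_whiskerRight,
    T.inv_naturality_right]
  simp

lemma prod_con_left (r : a ⟶ b) (τ : j' ⟶ j) (x : El T s j X) (y : El T (r ≫ j') m Y) :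
    prod r (con τ x) y = prod r x (cov (r ◁ τ) y) := by
  simp only [prod, cov, con, whiskerLeft_comp, Category.assoc, ← comp_whiskerRight_assoc,
    T.naturality_right]
  simp

lemma prod_con_right (r : a ⟶ b) (τ : m' ⟶ m) (x : El T s j X) (y : El T (r ≫ j) m Y) :
    prod r x (con τ y) = con τ (prod r x y) := by
  simp only [prod, con, Category.assoc]

lemma prod_dinatural {r r' : a ⟶ b} (ζ : r ⟶ r') (x : El T s j X) (y : El T (r ≫ j) m Y) :
    prod r' x (cov (ζ ▷ j) y) = cov (ζ ▷ s) (prod r x y) := by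
  simp only [prod, cov, Category.assoc, ← comp_whiskerRight, T.inv_naturality_left]
  simp only [← comp_whiskerRight_assoc, T.naturality_left]
  simp only [comp_whiskerRight, Category.assoc]
  rw [associator_naturality_left_assoc, ← whisker_exchange_assoc]
  simp

lemma prod_push (r : a ⟶ b) (x : El T s j X) (y : El T (r ≫ j) m Y) (f : X ⟶ X')
    (g : Y ⟶ Y') :
    prod r (x.push f) (y.push g) = (prod r x y).push (f ▷ Y ≫ X' ◁ g) := by
  simp only [prod, push, Category.assoc]
  rw [← whisker_exchange, whisker_exchange_assoc, associator_naturality_right_assoc,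
    ← whiskerLeft_comp_assoc, whisker_exchange_assoc]
  simp

/-- Associativity coherence of the constraints is used twice: once at the index where the two
elements are glued, and once, inverted, at the outer index. -/
lemma pull_prod {a' : S} (w : a' ⟶ a) (r : a ⟶ b) (x : El T s j X) (y : El T (r ≫ j) m Y) :
    pull w (prod r x y) =
      cov (α_ _ _ _).hom (prod (w ≫ r) x (cov (α_ _ _ _).inv (pull w y))) := by
  have h := congrArg (· ▷ (X ≫ Y)) (T.inv_associator w r s)
  have h'' : T.map₂ (α_ w r j).inv ≫ T.mapComp (w ≫ r) j ≫ T.mapComp w r ▷ T.map j =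
    T.mapComp w (r ≫ j) ≫ T.map w ◁ T.mapComp r j ≫ (α_ _ _ _).inv := by
    rw [← cancel_mono (α_ _ _ _).hom]
    simp [← T.associator]
  have h3 := congrArg (· ▷ Y) h''
  simp only [comp_whiskerRight] at h h3
  simp only [prod, pull, cov, Category.assoc]
  rw [whiskerLeft_eq_conj (T.mapComp w r)]
  simp only [Category.assoc, ← associator_naturality_left_assoc]
  rw [reassoc_of% h3]
  simp only [associator_inv_naturality_left_assoc, h]
  simp only [isIso_inv_hom_whiskerRight_assoc]
  bicategory

lemma prod_pull {c : S} {s : c ⟶ i} {j : c ⟶ k} (r : a ⟶ b) (w : b ⟶ c) (x : El T s j X)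
    (y : El T (r ≫ w ≫ j) m Y) :
    prod r (pull w x) y = cov (α_ _ _ _).hom (prod (r ≫ w) x (cov (α_ _ _ _).inv y)) := by
  have h := congrArg (· ▷ (X ≫ Y)) (T.inv_associator r w s)
  have h'' : T.map₂ (α_ r w j).inv ≫ T.mapComp (r ≫ w) j ≫ T.mapComp r w ▷ T.map j =
    T.mapComp r (w ≫ j) ≫ T.map r ◁ T.mapComp w j ≫ (α_ _ _ _).inv := by
    rw [← cancel_mono (α_ _ _ _).hom]
    simp [← T.associator]
  have h3 := congrArg (· ▷ Y) h''
  simp only [comp_whiskerRight] at h h3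
  simp only [prod, pull, cov, Category.assoc]
  rw [whiskerLeft_eq_conj (T.mapComp r w)]
  simp only [Category.assoc, ← associator_naturality_left_assoc]
  rw [reassoc_of% h3]
  simp only [associator_inv_naturality_left_assoc, h]
  bicategory

lemma prod_unit_left (r : a ⟶ b) (s : b ⟶ k) (y : El T (r ≫ s) m Y) :
    (prod r (unit s) y).push (λ_ Y).hom = y := by
  simp only [prod, push, unit, Category.assoc]
  rw [← whisker_exchange]
  simp

lemma prod_unit_right (r : a ⟶ b) (x : El T s j X) :
    (prod r x (unit (r ≫ j))).push (ρ_ X).hom = pull r x := by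
  simp only [prod, push, unit, pull, Category.assoc]
  rw [← whisker_exchange]
  simp

end

/-- The associators that remain after the coherence law for the triples `(q, r, j)` and `(q, r, s)`
cancel by coherence in the target bicategory alone. -/
lemma prod_assoc {a b c i k l n : S} {s : b ⟶ i} {j : b ⟶ k} {m : a ⟶ l} {p : c ⟶ n}
    {X : o i ⟶ o k} {Y : o k ⟶ o l} {Z : o l ⟶ o n} (r : a ⟶ b) (q : c ⟶ a)
    (x : El T s j X) (y : El T (r ≫ j) m Y) (z : El T (q ≫ m) p Z) :
    (prod q (prod r x y) z).push (α_ X Y Z).hom =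
      cov (α_ _ _ _).hom (prod (q ≫ r) x (cov (α_ _ _ _).inv (prod q y z))) := by
  have h := congrArg (· ▷ (X ≫ Y ≫ Z)) (T.inv_associator q r s)
  have h'' : T.map₂ (α_ q r j).inv ≫ T.mapComp (q ≫ r) j ≫ T.mapComp q r ▷ T.map j =
    T.mapComp q (r ≫ j) ≫ T.map q ◁ T.mapComp r j ≫ (α_ _ _ _).inv := by
    rw [← cancel_mono (α_ _ _ _).hom]
    simp [← T.associator]
  have h3 := congrArg (· ▷ (Y ≫ Z)) h''
  simp only [comp_whiskerRight] at h h3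
  simp only [prod, push, cov, Category.assoc]
  rw [whiskerLeft_eq_conj (T.mapComp q r)]
  simp only [Category.assoc, ← associator_naturality_left_assoc]
  rw [reassoc_of% h3]
  simp only [associator_inv_naturality_left_assoc, h]
  rw [← whisker_exchange, isIso_inv_hom_whiskerRight_assoc]
  bicategory

end El

end Elements

end PolyUniv

namespace PolyUniv

open Bicategory

/-! ### Universal elements, that is, left Kan extensions -/

section Universal

variable {C : Type u₂} [Bicategory.{w₂, v₂} C] {a b c : C}

/-- A 2-cell `x : j ⟶ s ≫ X` exhibits `X` as a left Kan extension of `j` along `s`. -/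
def IsUniv {s : a ⟶ b} {j : a ⟶ c} {X : b ⟶ c} (x : j ⟶ s ≫ X) : Prop :=
  ∀ Z : b ⟶ c, Function.Bijective fun f : X ⟶ Z => x ≫ s ◁ f

namespace IsUniv

variable {s : a ⟶ b} {j : a ⟶ c} {X : b ⟶ c} {x : j ⟶ s ≫ X} (hx : IsUniv x)

/-- The 2-cell out of a left Kan extension induced by an element. -/
noncomputable def desc {Z : b ⟶ c} (z : j ⟶ s ≫ Z) : X ⟶ Z := ((hx Z).2 z).choose

lemma fac {Z : b ⟶ c} (z : j ⟶ s ≫ Z) : x ≫ s ◁ hx.desc z = z := ((hx Z).2 z).choose_spec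

lemma hom_ext (hx : IsUniv x) {Z : b ⟶ c} {f g : X ⟶ Z} (h : x ≫ s ◁ f = x ≫ s ◁ g) : f = g :=
  (hx Z).1 h

end IsUniv

end Universal

section ElUnit

variable {S : Type u₁} [Bicategory.{w₁, v₁} S] {C : Type u₂} [Bicategory.{w₂, v₂} C]
variable {o : S → C} {T : OplaxOn o}

namespace El

lemma push_injective {b i k : S} {s : b ⟶ i} {j : b ⟶ k} {X Y : o i ⟶ o k} {x : El T s j X}
    (hx : IsUniv x) {f g : X ⟶ Y} (h : x.push f = x.push g) : f = g := hx.hom_ext h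

lemma push_desc {b i k : S} {s : b ⟶ i} {j : b ⟶ k} {X Y : o i ⟶ o k} {x : El T s j X}
    (hx : IsUniv x) (y : El T s j Y) : x.push (hx.desc y) = y := hx.fac y

lemma cov_unit {b i : S} {s s' : b ⟶ i} (σ : s ⟶ s') :
    cov σ (unit (T := T) s) = con σ (unit s') := by
  simp [cov, con, unit]

variable [T.IsPseudo]

lemma pull_unit {a b i : S} (w : a ⟶ b) (s : b ⟶ i) :
    pull w (unit (T := T) s) = unit (w ≫ s) := by
  simp [pull, unit]

lemma pull_pull {a' a b i k : S} {s : b ⟶ i} {j : b ⟶ k} {X : o i ⟶ o k} (w' : a' ⟶ a)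
    (w : a ⟶ b) (x : El T s j X) :
    pull w' (pull w x) = con (α_ _ _ _).inv (cov (α_ _ _ _).hom (pull (w' ≫ w) x)) := by
  rw [pull_comp, cov_con, con_con, cov_cov]
  simp

/-- An expression on either side depends on its auxiliary 1-cells only up to the relation generated
by dinaturality. The 2-cells `ζ₁`, `ζ₂` witness that the two presentations are related, and every
binary coherence law is reduced to exhibiting such witnesses. -/
lemma cov_prod_pull_congr {a b c i k l : S} {s : b ⟶ i} {j : b ⟶ k} {s' : c ⟶ k} {j' : c ⟶ l}
    {X : o i ⟶ o k} {Y : o k ⟶ o l} {s₀ : a ⟶ i} {t₀ : a ⟶ l} {w w' : a ⟶ c} {r r' : a ⟶ b}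
    (ζ₁ : w ⟶ w') (ζ₂ : r ⟶ r') {τ : t₀ ⟶ w ≫ j'} {τ' : t₀ ⟶ w' ≫ j'} {m : w ≫ s' ⟶ r ≫ j}
    {m' : w' ≫ s' ⟶ r' ≫ j} {c : r ≫ s ⟶ s₀} {c' : r' ≫ s ⟶ s₀} (x : El T s j X) (y : El T s' j' Y)
    (h₁ : τ ≫ ζ₁ ▷ j' = τ') (h₂ : m ≫ ζ₂ ▷ j = ζ₁ ▷ s' ≫ m') (h₃ : ζ₂ ▷ s ≫ c' = c) :
    con τ (cov c (prod r x (cov m (pull w y)))) =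
      con τ' (cov c' (prod r' x (cov m' (pull w' y)))) := by
  rw [← h₃, ← cov_cov, ← prod_dinatural, cov_cov, h₂, ← cov_cov, pull_dinatural, cov_con,
    prod_con_right, cov_con, con_con, h₁]

/-- The ternary form of `cov_prod_pull_congr`, needed for associativity: the three comparison
2-cells are slid one after another from the outermost factor inwards. -/
lemma cov_prod_prod_pull_congr {a b c d i k l n : S} {s : b ⟶ i} {j : b ⟶ k} {s' : c ⟶ k}
    {j' : c ⟶ l} {s'' : d ⟶ l} {j'' : d ⟶ n} {X : o i ⟶ o k} {Y : o k ⟶ o l} {Z : o l ⟶ o n}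
    {s₀ : a ⟶ i} {t₀ : a ⟶ n} {w w' : a ⟶ d} {q q' : a ⟶ c} {r r' : a ⟶ b} (ζ₁ : w ⟶ w')
    (ζ₂ : q ⟶ q') (ζ₃ : r ⟶ r') {τ : t₀ ⟶ w ≫ j''} {τ' : t₀ ⟶ w' ≫ j''}
    {m : w ≫ s'' ⟶ q ≫ j'} {m' : w' ≫ s'' ⟶ q' ≫ j'} {e : q ≫ s' ⟶ r ≫ j} {e' : q' ≫ s' ⟶ r' ≫ j}
    {c : r ≫ s ⟶ s₀} {c' : r' ≫ s ⟶ s₀} (x : El T s j X) (y : El T s' j' Y) (z : El T s'' j'' Z)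
    (h₁ : τ ≫ ζ₁ ▷ j'' = τ') (h₂ : m ≫ ζ₂ ▷ j' = ζ₁ ▷ s'' ≫ m') (h₃ : e ≫ ζ₃ ▷ j = ζ₂ ▷ s' ≫ e')
    (h₄ : ζ₃ ▷ s ≫ c' = c) :
    con τ (cov c (prod r x (cov e (prod q y (cov m (pull w z)))))) =
      con τ' (cov c' (prod r' x (cov e' (prod q' y (cov m' (pull w' z)))))) := by
  rw [← h₄, ← cov_cov, ← prod_dinatural, cov_cov, h₃, ← cov_cov, ← prod_dinatural, cov_cov, h₂,
    ← cov_cov, pull_dinatural]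
  simp only [cov_con, prod_con_right, con_con, h₁]

end El

end ElUnit

/-! ### Presentations of one bicategory by another -/

section Shapes

variable (S : Type u₁) [Bicategory.{w₁, v₁} S] (A : Type u₂) [Bicategory.{w₂, v₂} A]

/-- A presentation of the 1-cells and 2-cells of `A`, and of their composition, by 1-cells and
2-cells of `S`: a 1-cell `P : I ⟶ J` is thought of as the left Kan extension of `tgt P` along
`src P`. -/
structure Shape where
  ob : A → S
  base {I J : A} (P : I ⟶ J) : S
  src {I J : A} (P : I ⟶ J) : base P ⟶ ob I
  tgt {I J : A} (P : I ⟶ J) : base P ⟶ ob J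
  g {I J : A} {P Q : I ⟶ J} (φ : P ⟶ Q) : base P ⟶ base Q
  gt {I J : A} {P Q : I ⟶ J} (φ : P ⟶ Q) : tgt P ⟶ g φ ≫ tgt Q
  gs {I J : A} {P Q : I ⟶ J} (φ : P ⟶ Q) : g φ ≫ src Q ⟶ src P
  cr {I J K : A} (P : I ⟶ J) (Q : J ⟶ K) : base (P ≫ Q) ⟶ base Q
  cs {I J K : A} (P : I ⟶ J) (Q : J ⟶ K) : base (P ≫ Q) ⟶ base P
  ct {I J K : A} (P : I ⟶ J) (Q : J ⟶ K) : tgt (P ≫ Q) ⟶ cr P Q ≫ tgt Q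
  cm {I J K : A} (P : I ⟶ J) (Q : J ⟶ K) : cr P Q ≫ src Q ⟶ cs P Q ≫ tgt P
  cc {I J K : A} (P : I ⟶ J) (Q : J ⟶ K) : cs P Q ≫ src P ⟶ src (P ≫ Q)
  un (I : A) : tgt (𝟙 I) ⟶ src (𝟙 I)
  -- The axioms ask for the existence of comparison 2-cells `ζ`, not for isomorphisms or equalities
  -- of 1-cells: this is what the dinaturality relations consume, and for polynomials some of these
  -- 2-cells are not invertible.
  id_eq {I J : A} (P : I ⟶ J) : ∃ ζ : g (𝟙 P) ⟶ 𝟙 _,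
    gs (𝟙 P) = ζ ▷ src P ≫ (λ_ _).hom ∧ gt (𝟙 P) ≫ ζ ▷ tgt P ≫ (λ_ _).hom = 𝟙 _
  comp_eq {I J : A} {P Q R : I ⟶ J} (φ : P ⟶ Q) (ψ : Q ⟶ R) : ∃ ζ : g (φ ≫ ψ) ⟶ g φ ≫ g ψ,
    gs (φ ≫ ψ) = ζ ▷ src R ≫ (α_ _ _ _).hom ≫ g φ ◁ gs ψ ≫ gs φ ∧
    gt (φ ≫ ψ) ≫ ζ ▷ tgt R ≫ (α_ _ _ _).hom = gt φ ≫ g φ ◁ gt ψ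
  whiskerRight_eq {I J K : A} {P P' : I ⟶ J} (φ : P ⟶ P') (Q : J ⟶ K) :
    ∃ (ζ₁ : g (φ ▷ Q) ≫ cr P' Q ⟶ cr P Q) (ζ₂ : g (φ ▷ Q) ≫ cs P' Q ⟶ cs P Q ≫ g φ),
      gt (φ ▷ Q) ≫ g (φ ▷ Q) ◁ ct P' Q ≫ (α_ _ _ _).inv ≫ ζ₁ ▷ tgt Q = ct P Q ∧
      (α_ _ _ _).hom ≫ g (φ ▷ Q) ◁ cm P' Q ≫ (α_ _ _ _).inv ≫ ζ₂ ▷ tgt P' =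
        ζ₁ ▷ src Q ≫ cm P Q ≫ cs P Q ◁ gt φ ≫ (α_ _ _ _).inv ∧
      ζ₂ ▷ src P' ≫ (α_ _ _ _).hom ≫ cs P Q ◁ gs φ ≫ cc P Q =
        (α_ _ _ _).hom ≫ g (φ ▷ Q) ◁ cc P' Q ≫ gs (φ ▷ Q)
  whiskerLeft_eq {I J K : A} (P : I ⟶ J) {Q Q' : J ⟶ K} (ψ : Q ⟶ Q') :
    ∃ (ζ₁ : g (P ◁ ψ) ≫ cr P Q' ⟶ cr P Q ≫ g ψ) (ζ₂ : g (P ◁ ψ) ≫ cs P Q' ⟶ cs P Q),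
      gt (P ◁ ψ) ≫ g (P ◁ ψ) ◁ ct P Q' ≫ (α_ _ _ _).inv ≫ ζ₁ ▷ tgt Q' =
        ct P Q ≫ cr P Q ◁ gt ψ ≫ (α_ _ _ _).inv ∧
      (α_ _ _ _).hom ≫ g (P ◁ ψ) ◁ cm P Q' ≫ (α_ _ _ _).inv ≫ ζ₂ ▷ tgt P =
        ζ₁ ▷ src Q' ≫ (α_ _ _ _).hom ≫ cr P Q ◁ gs ψ ≫ cm P Q ∧
      ζ₂ ▷ src P ≫ cc P Q = (α_ _ _ _).hom ≫ g (P ◁ ψ) ◁ cc P Q' ≫ gs (P ◁ ψ)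
  assoc_eq {I J K L : A} (P : I ⟶ J) (Q : J ⟶ K) (R : K ⟶ L) :
    ∃ (ζ₁ : (g (α_ P Q R).hom ≫ cr P (Q ≫ R)) ≫ cr Q R ⟶ cr (P ≫ Q) R)
      (ζ₂ : (g (α_ P Q R).hom ≫ cr P (Q ≫ R)) ≫ cs Q R ⟶ cs (P ≫ Q) R ≫ cr P Q)
      (ζ₃ : g (α_ P Q R).hom ≫ cs P (Q ≫ R) ⟶ cs (P ≫ Q) R ≫ cs P Q),
      gt (α_ P Q R).hom ≫ g (α_ P Q R).hom ◁ ct P (Q ≫ R) ≫ (α_ _ _ _).inv ≫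
        (g (α_ P Q R).hom ≫ cr P (Q ≫ R)) ◁ ct Q R ≫ (α_ _ _ _).inv ≫ ζ₁ ▷ tgt R =
        ct (P ≫ Q) R ∧
      ζ₁ ▷ src R ≫ cm (P ≫ Q) R ≫ cs (P ≫ Q) R ◁ ct P Q ≫ (α_ _ _ _).inv =
        (α_ _ _ _).hom ≫ (g (α_ P Q R).hom ≫ cr P (Q ≫ R)) ◁ cm Q R ≫ (α_ _ _ _).inv ≫
          ζ₂ ▷ tgt Q ∧
      ζ₂ ▷ src Q ≫ (α_ _ _ _).hom ≫ cs (P ≫ Q) R ◁ cm P Q ≫ (α_ _ _ _).inv =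
        (α_ _ _ _).hom ≫ (g (α_ P Q R).hom ≫ cr P (Q ≫ R)) ◁ cc Q R ≫ (α_ _ _ _).hom ≫
          g (α_ P Q R).hom ◁ cm P (Q ≫ R) ≫ (α_ _ _ _).inv ≫ ζ₃ ▷ tgt P ∧
      ζ₃ ▷ src P ≫ (α_ _ _ _).hom ≫ cs (P ≫ Q) R ◁ cc P Q ≫ cc (P ≫ Q) R =
        (α_ _ _ _).hom ≫ g (α_ P Q R).hom ◁ cc P (Q ≫ R) ≫ gs (α_ P Q R).hom
  leftUnitor_eq {I J : A} (P : I ⟶ J) : ∃ ζ : g (λ_ P).hom ⟶ cr (𝟙 I) P,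
    gs (λ_ P).hom = ζ ▷ src P ≫ cm (𝟙 I) P ≫ cs (𝟙 I) P ◁ un I ≫ cc (𝟙 I) P ∧
    gt (λ_ P).hom ≫ ζ ▷ tgt P = ct (𝟙 I) P
  rightUnitor_eq {I J : A} (P : I ⟶ J) : ∃ ζ : g (ρ_ P).hom ⟶ cs P (𝟙 J),
    gs (ρ_ P).hom = ζ ▷ src P ≫ cc P (𝟙 J) ∧
    gt (ρ_ P).hom ≫ ζ ▷ tgt P = ct P (𝟙 J) ≫ cr P (𝟙 J) ◁ un J ≫ cm P (𝟙 J)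

end Shapes

namespace Shape

variable {S : Type u₁} [Bicategory.{w₁, v₁} S] {A : Type u₂} [Bicategory.{w₂, v₂} A]
  {C : Type u₃} [Bicategory.{w₃, v₃} C]
variable (Sh : Shape S A) {o : S → C} {T : OplaxOn o}

/-- The elements at a 1-cell of `A`. -/
abbrev ElAt (T : OplaxOn o) {I J : A} (P : I ⟶ J) (X : o (Sh.ob I) ⟶ o (Sh.ob J)) :=
  El T (Sh.src P) (Sh.tgt P) X

/-- The unit element at an identity 1-cell. -/
def unitAt (T : OplaxOn o) (I : A) : Sh.ElAt T (𝟙 I) (𝟙 (o (Sh.ob I))) :=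
  El.con (Sh.un I) (El.unit _)

variable [T.IsPseudo]

section

variable {I J K L : A}

/-- Restriction of elements along a 2-cell of `A`. -/
noncomputable def res {P Q : I ⟶ J} (φ : P ⟶ Q) {X : o (Sh.ob I) ⟶ o (Sh.ob J)}
    (x : Sh.ElAt T Q X) : Sh.ElAt T P X :=
  El.con (Sh.gt φ) (El.cov (Sh.gs φ) (El.pull (Sh.g φ) x))

/-- The product of elements at composable 1-cells of `A`. -/
noncomputable def cprod {P : I ⟶ J} {Q : J ⟶ K} {X : o (Sh.ob I) ⟶ o (Sh.ob J)}
    {Y : o (Sh.ob J) ⟶ o (Sh.ob K)} (x : Sh.ElAt T P X) (y : Sh.ElAt T Q Y) :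
    Sh.ElAt T (P ≫ Q) (X ≫ Y) :=
  El.cov (Sh.cc P Q) (El.prod (Sh.cs P Q) x
    (El.con (Sh.ct P Q) (El.cov (Sh.cm P Q) (El.pull (Sh.cr P Q) y))))

variable {X X' : o (Sh.ob I) ⟶ o (Sh.ob J)} {Y Y' : o (Sh.ob J) ⟶ o (Sh.ob K)}
  {Z : o (Sh.ob K) ⟶ o (Sh.ob L)}

lemma push_res {P Q : I ⟶ J} (φ : P ⟶ Q) (x : Sh.ElAt T Q X) (f : X ⟶ X') :
    (Sh.res φ x).push f = Sh.res φ (x.push f) := by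
  simp only [res, El.push_con, El.push_cov, El.push_pull]

lemma cprod_push {P : I ⟶ J} {Q : J ⟶ K} (x : Sh.ElAt T P X) (y : Sh.ElAt T Q Y) (f : X ⟶ X')
    (f' : Y ⟶ Y') :
    Sh.cprod (x.push f) (y.push f') = (Sh.cprod x y).push (f ▷ Y ≫ X' ◁ f') := by
  simp only [cprod, ← El.push_pull, ← El.push_cov, ← El.push_con, El.prod_push]

lemma cprod_push_left {P : I ⟶ J} {Q : J ⟶ K} (x : Sh.ElAt T P X) (y : Sh.ElAt T Q Y)
    (f : X ⟶ X') : Sh.cprod (x.push f) y = (Sh.cprod x y).push (f ▷ Y) := by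
  simpa using Sh.cprod_push x y f (𝟙 Y)

lemma cprod_push_right {P : I ⟶ J} {Q : J ⟶ K} (x : Sh.ElAt T P X) (y : Sh.ElAt T Q Y)
    (f' : Y ⟶ Y') : Sh.cprod x (y.push f') = (Sh.cprod x y).push (X ◁ f') := by
  simpa using Sh.cprod_push x y (𝟙 X) f'

lemma res_id {P : I ⟶ J} (x : Sh.ElAt T P X) : Sh.res (𝟙 P) x = x := by
  obtain ⟨ζ, h₁, h₂⟩ := Sh.id_eq P
  rw [res, h₁, ← El.cov_cov, El.pull_dinatural, El.pull_id]
  simp only [El.cov_con, El.con_con, El.cov_cov, Iso.inv_hom_id, El.cov_id, Category.assoc, h₂,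
    El.con_id]

lemma res_comp {P Q R : I ⟶ J} (φ : P ⟶ Q) (ψ : Q ⟶ R) (x : Sh.ElAt T R X) :
    Sh.res (φ ≫ ψ) x = Sh.res φ (Sh.res ψ x) := by
  obtain ⟨ζ, h₁, h₂⟩ := Sh.comp_eq φ ψ
  simp only [res]
  rw [h₁, ← El.cov_cov, El.pull_dinatural, El.pull_con, El.pull_cov, El.pull_pull]
  simp only [El.cov_con, El.con_con, El.cov_cov, Category.assoc]
  rw [← reassoc_of% h₂]
  simp

lemma cprod_res_left {P P' : I ⟶ J} (φ : P ⟶ P') {Q : J ⟶ K} (x : Sh.ElAt T P' X)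
    (y : Sh.ElAt T Q Y) : Sh.res (φ ▷ Q) (Sh.cprod x y) = Sh.cprod (Sh.res φ x) y := by
  obtain ⟨ζ₁, ζ₂, h₁, h₂, h₃⟩ := Sh.whiskerRight_eq φ Q
  -- Both sides are brought to the normal form of `El.cov_prod_pull_congr`: one restriction and one
  -- product, with all reindexings collected on the outside of each.
  simp only [res, cprod, El.pull_cov, El.pull_prod, El.pull_con, El.prod_con_left,
    El.prod_cov_left, El.prod_pull, El.pull_pull, El.prod_con_right, El.cov_con, El.con_con,
    El.cov_cov, Category.assoc]
  refine El.cov_prod_pull_congr ζ₁ ζ₂ x y ?_ ?_ ?_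
  · simpa using h₁
  · simpa using h₂
  · simpa using h₃

lemma cprod_res_right {P : I ⟶ J} {Q Q' : J ⟶ K} (ψ : Q ⟶ Q') (x : Sh.ElAt T P X)
    (y : Sh.ElAt T Q' Y) : Sh.res (P ◁ ψ) (Sh.cprod x y) = Sh.cprod x (Sh.res ψ y) := by
  obtain ⟨ζ₁, ζ₂, h₁, h₂, h₃⟩ := Sh.whiskerLeft_eq P ψ
  simp only [res, cprod, El.pull_cov, El.pull_prod, El.pull_con, El.prod_con_left,
    El.prod_cov_left, El.prod_pull, El.pull_pull, El.prod_con_right, El.cov_con, El.con_con,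
    El.cov_cov, Category.assoc]
  refine El.cov_prod_pull_congr ζ₁ ζ₂ x y ?_ ?_ ?_
  · simpa using h₁
  · simpa using h₂
  · simpa using h₃

lemma cprod_assoc {P : I ⟶ J} {Q : J ⟶ K} {R : K ⟶ L} (x : Sh.ElAt T P X) (y : Sh.ElAt T Q Y)
    (z : Sh.ElAt T R Z) :
    (Sh.cprod (Sh.cprod x y) z).push (α_ X Y Z).hom =
      Sh.res (α_ P Q R).hom (Sh.cprod x (Sh.cprod y z)) := by
  obtain ⟨ζ₁, ζ₂, ζ₃, h₁, h₂, h₃, h₄⟩ := Sh.assoc_eq P Q R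
  simp only [res, cprod, El.push_cov, El.pull_cov, El.pull_prod, El.pull_con, El.prod_con_left,
    El.prod_cov_left, El.prod_pull, El.pull_pull, El.prod_con_right, El.cov_con, El.con_con,
    El.cov_cov, Category.assoc, El.prod_assoc, El.push_con]
  symm
  refine El.cov_prod_prod_pull_congr ((α_ _ _ _).inv ≫ ζ₁) ((α_ _ _ _).inv ≫ ζ₂) ζ₃ x y z ?_ ?_ ?_ ?_
  · simpa using h₁
  · simp only [comp_whiskerRight, Category.assoc, h₂]
    simp
  · simp only [comp_whiskerRight, Category.assoc, h₃]
    simp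
  · simpa using h₄

lemma cprod_unit_left {P : I ⟶ J} (y : Sh.ElAt T P X) :
    (Sh.cprod (Sh.unitAt T I) y).push (λ_ X).hom = Sh.res (λ_ P).hom y := by
  obtain ⟨ζ, h₁, h₂⟩ := Sh.leftUnitor_eq P
  simp only [res, cprod, unitAt, El.push_cov, El.prod_con_left, El.prod_con_right, El.push_con,
    El.prod_unit_left, El.cov_con, El.cov_cov, Category.assoc, h₁]
  rw [← h₂, ← El.con_con, ← El.cov_cov (Sh.cm _ _), ← El.cov_cov (ζ ▷ _), El.pull_dinatural,
    El.cov_con, El.cov_cov]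

lemma cprod_unit_right {P : I ⟶ J} (x : Sh.ElAt T P X) :
    (Sh.cprod x (Sh.unitAt T J)).push (ρ_ X).hom = Sh.res (ρ_ P).hom x := by
  obtain ⟨ζ, h₁, h₂⟩ := Sh.rightUnitor_eq P
  simp only [res, cprod, unitAt, El.push_cov, El.pull_con, El.pull_unit, El.cov_con, El.cov_unit,
    El.con_con, El.prod_con_right, El.push_con, El.prod_unit_right, h₁]
  rw [← El.cov_cov, El.pull_dinatural, El.cov_con, El.con_con, h₂]

end

/-! ### The oplax functor defined by universal elements -/

section KanOplax

variable (T)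

/-- The oplax functor on `A` given by a choice of universal elements. -/
noncomputable def kanOplax (L : ∀ {I J : A}, (I ⟶ J) → (o (Sh.ob I) ⟶ o (Sh.ob J)))
    (U : ∀ {I J : A} (P : I ⟶ J), Sh.ElAt T P (L P)) (hU : ∀ {I J : A} (P : I ⟶ J), IsUniv (U P)) :
    OplaxOn (S := A) (fun I => o (Sh.ob I)) where
  map P := L P
  map₂ {_ _ P Q} φ := (hU P).desc (Sh.res φ (U Q))
  mapId I := (hU (𝟙 I)).desc (Sh.unitAt T I)
  mapComp P Q := (hU (P ≫ Q)).desc (Sh.cprod (U P) (U Q))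
  -- Each axiom equates 2-cells out of a Kan extension, so it may be tested by pushing the universal
  -- element along them; what remains is a law for `res`, `cprod` or `unitAt`.
  map₂_id P := El.push_injective (hU _) (by simp only [El.push_desc, res_id, El.push_id])
  map₂_comp φ ψ := El.push_injective (hU _) (by
    simp only [El.push_desc, ← El.push_push, res_comp, push_res])
  naturality_left φ Q := El.push_injective (hU _) (by
    simp only [El.push_desc, ← El.push_push, push_res, cprod_res_left, ← cprod_push_left])
  naturality_right P _ _ ψ := El.push_injective (hU _) (by
    simp only [El.push_desc, ← El.push_push, push_res, cprod_res_right, ← cprod_push_right])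
  associator P Q R := El.push_injective (hU _) (by
    simp only [El.push_desc, ← El.push_push, push_res, ← cprod_push_left, ← cprod_push_right,
      cprod_assoc])
  leftUnitor P := El.push_injective (hU _) (by
    simp only [El.push_desc, ← El.push_push, ← cprod_push_left, cprod_unit_left])
  rightUnitor P := El.push_injective (hU _) (by
    simp only [El.push_desc, ← El.push_push, ← cprod_push_right, cprod_unit_right])

/-- The elements `U` of the values of `F` are compatible with 2-cells and with the constraint
cells of `F`. -/
structure IsCompat (F : OplaxOn (S := A) (fun I => o (Sh.ob I)))
    (U : ∀ {I J : A} (P : I ⟶ J), Sh.ElAt T P (F.map P)) : Prop where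
  push_map₂ {I J : A} {P Q : I ⟶ J} (φ : P ⟶ Q) : (U P).push (F.map₂ φ) = Sh.res φ (U Q)
  push_mapComp {I J K : A} (P : I ⟶ J) (Q : J ⟶ K) :
    (U (P ≫ Q)).push (F.mapComp P Q) = Sh.cprod (U P) (U Q)
  push_mapId (I : A) : (U (𝟙 I)).push (F.mapId I) = Sh.unitAt T I

/-- The elements `U` exhibit the values of `F` as left Kan extensions, compatibly with 2-cells
and with the constraint cells of `F`. -/
structure IsKan (F : OplaxOn (S := A) (fun I => o (Sh.ob I)))
    (U : ∀ {I J : A} (P : I ⟶ J), Sh.ElAt T P (F.map P)) : Prop extends Sh.IsCompat T F U where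
  univ {I J : A} (P : I ⟶ J) : IsUniv (U P)

lemma isKan_kanOplax (L : ∀ {I J : A}, (I ⟶ J) → (o (Sh.ob I) ⟶ o (Sh.ob J)))
    (U : ∀ {I J : A} (P : I ⟶ J), Sh.ElAt T P (L P)) (hU : ∀ {I J : A} (P : I ⟶ J), IsUniv (U P)) :
    Sh.IsKan T (Sh.kanOplax T L U hU) U where
  univ := hU
  push_map₂ _ := El.push_desc (hU _) _
  push_mapComp _ _ := El.push_desc (hU _) _
  push_mapId _ := El.push_desc (hU _) _

end KanOplax

end Shape

end PolyUniv

namespace PolyUniv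

open Bicategory

/-! ### Closure properties of universal elements -/

section UniversalLemmas

variable {C : Type u₂} [Bicategory.{w₂, v₂} C] {a b c d : C}

lemma isUniv_push_iff {s : a ⟶ b} {j : a ⟶ c} {X Y : b ⟶ c} (x : j ⟶ s ≫ X) (f : X ⟶ Y)
    [IsIso f] : IsUniv (x ≫ s ◁ f) ↔ IsUniv x := by
  refine forall_congr' fun Z => ?_
  have : (fun g : Y ⟶ Z => (x ≫ s ◁ f) ≫ s ◁ g) = (fun g : X ⟶ Z => x ≫ s ◁ g) ∘ (f ≫ ·) := by
    funext g
    simp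
  rw [this]
  refine Function.Bijective.of_comp_iff _ ⟨fun g h e => ?_, fun g => ⟨inv f ≫ g, by simp⟩⟩
  exact (cancel_epi f).1 e

lemma IsUniv.isIso {s : a ⟶ b} {j : a ⟶ c} {X Y : b ⟶ c} {x : j ⟶ s ≫ X} (hx : IsUniv x)
    {f : X ⟶ Y} (h : IsUniv (x ≫ s ◁ f)) : IsIso f := by
  refine ⟨h.desc x, hx.hom_ext ?_, h.hom_ext ?_⟩
  · rw [whiskerLeft_comp, ← Category.assoc, h.fac]
    simp
  · rw [whiskerLeft_comp, ← Category.assoc, h.fac]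
    simp

/-- Two Kan extensions of the same 2-cell are canonically isomorphic. All invertibility questions
about constraints, icons and the distributivity morphism are turned into universality questions by
this equivalence. -/
lemma IsUniv.isIso_iff {s : a ⟶ b} {j : a ⟶ c} {X Y : b ⟶ c} {x : j ⟶ s ≫ X} (hx : IsUniv x)
    {f : X ⟶ Y} {y : j ⟶ s ≫ Y} (e : x ≫ s ◁ f = y) : IsIso f ↔ IsUniv y := by
  subst e
  exact ⟨fun _ => (isUniv_push_iff _ _).2 hx, hx.isIso⟩

lemma isUniv_iso_comp_iff {s : a ⟶ b} {j j' : a ⟶ c} {X : b ⟶ c} (x : j ⟶ s ≫ X) (e : j' ⟶ j)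
    [IsIso e] : IsUniv (e ≫ x) ↔ IsUniv x := by
  refine forall_congr' fun Z => ?_
  have : (fun g : X ⟶ Z => (e ≫ x) ≫ s ◁ g) = (e ≫ ·) ∘ (fun g : X ⟶ Z => x ≫ s ◁ g) := by
    funext g
    simp
  rw [this]
  refine Function.Bijective.of_comp_iff' ⟨fun g h k => ?_, fun g => ⟨inv e ≫ g, by simp⟩⟩ _
  exact (cancel_epi e).1 k

lemma isUniv_comp_whiskerRight_iff {s s' : a ⟶ b} {j : a ⟶ c} {X : b ⟶ c} (x : j ⟶ s ≫ X)
    (e : s ⟶ s') [IsIso e] : IsUniv (x ≫ e ▷ X) ↔ IsUniv x := by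
  refine forall_congr' fun Z => ?_
  have : (fun g : X ⟶ Z => (x ≫ e ▷ X) ≫ s' ◁ g) =
      (· ≫ e ▷ Z) ∘ (fun g : X ⟶ Z => x ≫ s ◁ g) := by
    funext g
    simp [whisker_exchange]
  rw [this]
  refine Function.Bijective.of_comp_iff' ⟨fun g h k => ?_, fun g => ⟨g ≫ inv e ▷ Z, by simp⟩⟩ _
  exact (cancel_mono (e ▷ Z)).1 k

/-- The bijection required is transposition across the adjunction: along a left adjoint, a Kan
extension is composition with the right adjoint. -/
lemma isUniv_unit {s : a ⟶ b} {r : b ⟶ a} (adj : s ⊣ r) (j : a ⟶ c) :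
    IsUniv ((λ_ j).inv ≫ adj.unit ▷ j ≫ (α_ s r j).hom) := by
  intro Z
  convert (adj.homEquiv₁ (g := j) (h := Z)).symm.bijective using 1
  funext f
  simp [Adjunction.homEquiv₁]

/-- The composite of universal elements. -/
lemma isUniv_comp_iff {s : a ⟶ b} {s' : b ⟶ c} {j : a ⟶ d} {X : b ⟶ d} {Y : c ⟶ d}
    {x : j ⟶ s ≫ X} (hx : IsUniv x) (y : X ⟶ s' ≫ Y) :
    IsUniv (x ≫ s ◁ y ≫ (α_ s s' Y).inv) ↔ IsUniv y := by
  refine forall_congr' fun Z => ?_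
  have : (fun g : Y ⟶ Z => (x ≫ s ◁ y ≫ (α_ s s' Y).inv) ≫ (s ≫ s') ◁ g) =
      ((· ≫ (α_ s s' Z).inv) ∘ (fun k : X ⟶ s' ≫ Z => x ≫ s ◁ k)) ∘
        (fun g : Y ⟶ Z => y ≫ s' ◁ g) := by
    funext g
    simp
  rw [this]
  refine Function.Bijective.of_comp_iff' (Function.Bijective.comp
    ⟨fun g h k => ?_, fun g => ⟨g ≫ (α_ s s' Z).hom, by simp⟩⟩ (hx _)) _
  simpa using k

/-- Left Kan extensions along left adjoints are absolute. -/
lemma IsUniv.whiskerRight {s : a ⟶ b} {r : b ⟶ a} (adj : s ⊣ r) {j : a ⟶ c} {X : b ⟶ c}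
    {x : j ⟶ s ≫ X} (hx : IsUniv x) (Y : c ⟶ d) : IsUniv (x ▷ Y ≫ (α_ _ _ _).hom) := by
  have h := isUniv_unit adj j
  have hf : IsIso (h.desc x) := h.isIso (by rwa [h.fac])
  -- Up to the isomorphism `h.desc x`, the extension is `r ≫ j`; composing with `Y` gives `r ≫ (j ≫
  -- Y)`, which is again an extension along `s` by the same adjunction.
  have e : x ▷ Y ≫ (α_ _ _ _).hom =
      ((λ_ (j ≫ Y)).inv ≫ adj.unit ▷ (j ≫ Y) ≫ (α_ s r (j ≫ Y)).hom) ≫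
        s ◁ ((α_ r j Y).inv ≫ h.desc x ▷ Y) := by
    conv_lhs => rw [← h.fac x]
    simp
  rw [e, isUniv_push_iff]
  exact isUniv_unit adj _

end UniversalLemmas

namespace OplaxOn

section

variable {S : Type u₁} [Bicategory.{w₁, v₁} S]

/-- The identity oplax functor. -/
def idOn (S : Type u₁) [Bicategory.{w₁, v₁} S] : OplaxOn (fun a : S => a) :=
  ofOplax (OplaxFunctor.id S)

end

variable {S : Type u₁} [Bicategory.{w₁, v₁} S] {A : Type u₂} [Bicategory.{w₂, v₂} A]
  {C : Type u₃} [Bicategory.{w₃, v₃} C] {o : S → A} {o' : A → C}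

/-- Composition of oplax functors. -/
@[reducible]
def comp (J : OplaxOn o) (F : OplaxOn o') : OplaxOn (fun a : S => o' (o a)) where
  map f := F.map (J.map f)
  map₂ η := F.map₂ (J.map₂ η)
  mapId a := F.map₂ (J.mapId a) ≫ F.mapId (o a)
  mapComp f g := F.map₂ (J.mapComp f g) ≫ F.mapComp (J.map f) (J.map g)
  map₂_id := (J.toOplax.comp F.toOplax).map₂_id
  map₂_comp := (J.toOplax.comp F.toOplax).map₂_comp
  naturality_left := (J.toOplax.comp F.toOplax).mapComp_naturality_left
  naturality_right := (J.toOplax.comp F.toOplax).mapComp_naturality_right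
  associator := (J.toOplax.comp F.toOplax).map₂_associator
  leftUnitor := (J.toOplax.comp F.toOplax).map₂_leftUnitor
  rightUnitor := (J.toOplax.comp F.toOplax).map₂_rightUnitor

variable (J : OplaxOn o) (F : OplaxOn o')

instance [J.IsPseudo] [F.IsPseudo] : (J.comp F).IsPseudo where
  isIso_mapId a := inferInstanceAs (IsIso (F.map₂ (J.mapId a) ≫ F.mapId (o a)))
  isIso_mapComp f g :=
    inferInstanceAs (IsIso (F.map₂ (J.mapComp f g) ≫ F.mapComp (J.map f) (J.map g)))

instance [J.IsPseudo] [h : (J.comp F).IsPseudo] {a b c : S} (f : a ⟶ b) (g : b ⟶ c) :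
    IsIso (F.mapComp (J.map f) (J.map g)) := by
  have : IsIso (F.map₂ (J.mapComp f g) ≫ F.mapComp (J.map f) (J.map g)) := h.isIso_mapComp f g
  exact IsIso.of_isIso_comp_left (F.map₂ (J.mapComp f g)) _

/-- The two composites share their actions on 1-cells and 2-cells by definition and differ only in
the bracketing of constraints, so a strict equality is available. -/
lemma comp_assoc {D : Type u₄} [Bicategory.{w₄, v₄} D] {o'' : C → D} (G : OplaxOn o'') :
    (J.comp F).comp G = J.comp (F.comp G) := by
  obtain ⟨m, m₂, i, c, h1, h2, _, _, _, _, _⟩ := G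
  simp only [comp]
  congr 1
  · funext a
    exact (congrArg (· ≫ i _) (h2 _ _)).trans (Category.assoc _ _ _)
  · funext a b d f g
    exact (congrArg (· ≫ c _ _) (h2 _ _)).trans (Category.assoc _ _ _)

end OplaxOn

namespace El

/-! ### Universality of products -/

section Curry

variable {S : Type u₁} [Bicategory.{w₁, v₁} S] {C : Type u₂} [Bicategory.{w₂, v₂} C]
variable {o : S → C} {T : OplaxOn o}

/-- An element at a composite 1-cell, as an element at the first factor. -/
def curry {a b i k : S} {r : a ⟶ b} {s : b ⟶ i} {j : a ⟶ k} {X : o i ⟶ o k}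
    (x : El T (r ≫ s) j X) : El T r j (T.map s ≫ X) :=
  x ≫ T.mapComp r s ▷ X ≫ (α_ _ _ _).hom

lemma curry_push {a b i k : S} {r : a ⟶ b} {s : b ⟶ i} {j : a ⟶ k} {X Y : o i ⟶ o k}
    (x : El T (r ≫ s) j X) (f : X ⟶ Y) : (x.push f).curry = x.curry.push (T.map s ◁ f) := by
  simp [push, curry, whisker_exchange_assoc]

variable [T.IsPseudo]

/-- A description of `pull` that does not mention an inverse constraint. It is the form in which
compatibility with an oplax functor or with an icon can be verified. -/
lemma eq_pull_iff {a b i k : S} {s : b ⟶ i} {j : b ⟶ k} {X : o i ⟶ o k} {w : a ⟶ b}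
    {x : El T s j X} {y : El T (w ≫ s) (w ≫ j) X} :
    y = pull w x ↔ y.curry = T.mapComp w j ≫ T.map w ◁ x := by
  rw [← cancel_mono (T.mapComp w s ▷ X ≫ (α_ _ _ _).hom)]
  simp [curry, pull]

lemma eq_prod_iff {a b i k l : S} {s : b ⟶ i} {j : b ⟶ k} {m : a ⟶ l} {X : o i ⟶ o k}
    {Y : o k ⟶ o l} {r : a ⟶ b} {x : El T s j X} {y : El T (r ≫ j) m Y}
    {z : El T (r ≫ s) m (X ≫ Y)} :
    z = prod r x y ↔ z.curry = y.curry ≫ T.map r ◁ (x ▷ Y ≫ (α_ _ _ _).hom) := by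
  rw [← cancel_mono (T.mapComp r s ▷ (X ≫ Y) ≫ (α_ _ _ _).hom)]
  simp [curry, prod]

/-- Extension in two stages: `y.curry` extends along `r`, and `x` composed with `Y` extends along
`s`. The second is universal because extensions along left adjoints are absolute. -/
lemma isUniv_prod {a b i k l : S} {s : b ⟶ i} {j : b ⟶ k} {m : a ⟶ l} {X : o i ⟶ o k}
    {Y : o k ⟶ o l} {r : a ⟶ b} {x : El T s j X} (hx : IsUniv x)
    (hs : ∃ R, Nonempty (T.map s ⊣ R)) {y : El T (r ≫ j) m Y} (hy : IsUniv y.curry) :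
    IsUniv (prod r x y) := by
  obtain ⟨R, ⟨adj⟩⟩ := hs
  have e : prod r x y = (y.curry ≫ T.map r ◁ (x ▷ Y ≫ (α_ _ _ _).hom) ≫ (α_ _ _ _).inv) ≫
      inv (T.mapComp r s) ▷ (X ≫ Y) := by
    simp [curry, prod]
  rw [e, isUniv_comp_whiskerRight_iff, isUniv_comp_iff hy]
  exact hx.whiskerRight adj Y

/-- An element at an identity 1-cell, as a 2-cell. -/
def toHom {b k : S} {j : b ⟶ k} {X : o b ⟶ o k} (x : El T (𝟙 b) j X) : T.map j ⟶ X :=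
  x ≫ T.mapId b ▷ X ≫ (λ_ X).hom

/-- As `T` is normal up to isomorphism, extending along `𝟙 b` is extending along an identity, and
such an extension is an isomorphic copy of the 2-cell's source. -/
lemma isUniv_iff_isIso_toHom {b k : S} {j : b ⟶ k} {X : o b ⟶ o k} (x : El T (𝟙 b) j X) :
    IsUniv x ↔ IsIso x.toHom := by
  have h : IsUniv (λ_ (T.map j)).inv := fun Z =>
    ⟨fun f g e => by simpa using e, fun f => ⟨f ≫ (λ_ Z).hom, by simp⟩⟩
  rw [← isUniv_comp_whiskerRight_iff x (T.mapId b), h.isIso_iff]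
  simp [toHom]

/-- A converse of `isUniv_prod` when the first stage is along an identity: then `x` is essentially
an isomorphism and can be cancelled. It extracts distributivity from invertibility of a constraint
cell. -/
lemma isUniv_curry_of_prod {a b k l : S} {j : b ⟶ k} {m : a ⟶ l} {X : o b ⟶ o k}
    {Y : o k ⟶ o l} {r : a ⟶ b} {x : El T (𝟙 b) j X} (hx : IsUniv x) {y : El T (r ≫ j) m Y}
    (h : IsUniv (prod r x y)) : IsUniv y.curry := by
  rw [isUniv_iff_isIso_toHom] at hx
  have e : prod r x y = (y.curry ≫ T.map r ◁ x.toHom ▷ Y) ≫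
    ((ρ_ _).inv ≫ T.map r ◁ inv (T.mapId b) ≫ inv (T.mapComp r (𝟙 b))) ▷ (X ≫ Y) := by
    have hx' : x = x.toHom ≫ (λ_ X).inv ≫ inv (T.mapId b) ▷ X := by simp [toHom]
    conv_lhs => rw [hx']
    simp only [curry, prod, Category.assoc, comp_whiskerRight, whiskerLeft_comp]
    bicategory
  rwa [e, isUniv_comp_whiskerRight_iff, isUniv_push_iff] at h

end Curry

/-! ### Images of elements under oplax functors -/

section MapEl

variable {S : Type u₁} [Bicategory.{w₁, v₁} S] {A : Type u₂} [Bicategory.{w₂, v₂} A]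
  {C : Type u₃} [Bicategory.{w₃, v₃} C] {o : S → A} {o' : A → C} {J : OplaxOn o} (F : OplaxOn o')

/-- Only the oplax direction of the constraint of `F` is used, so no invertibility is assumed. -/
def mapEl {b i k : S} {s : b ⟶ i} {j : b ⟶ k} {X : o i ⟶ o k} (x : El J s j X) :
    El (J.comp F) s j (F.map X) :=
  F.map₂ x ≫ F.mapComp (J.map s) X

section

variable {b i k : S} {s s' : b ⟶ i} {j j' : b ⟶ k} {X Y : o i ⟶ o k}

lemma mapEl_push (x : El J s j X) (f : X ⟶ Y) :
    mapEl F (x.push f) = (mapEl F x).push (F.map₂ f) := by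
  simp [mapEl, push, F.map₂_comp, F.naturality_right]

lemma mapEl_cov (σ : s ⟶ s') (x : El J s j X) : mapEl F (cov σ x) = cov σ (mapEl F x) := by
  simp [mapEl, cov, F.map₂_comp, F.naturality_left]

lemma mapEl_con (τ : j' ⟶ j) (x : El J s j X) : mapEl F (con τ x) = con τ (mapEl F x) := by
  simp [mapEl, con, F.map₂_comp]

end

lemma mapEl_curry {a b i k : S} {r : a ⟶ b} {s : b ⟶ i} {j : a ⟶ k} {X : o i ⟶ o k}
    (x : El J (r ≫ s) j X) :
    (mapEl F x.curry).push (F.mapComp (J.map s) X) = (mapEl F x).curry := by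
  simp [mapEl, curry, push, F.map₂_comp, F.associator, F.naturality_left_assoc]

lemma mapEl_unit {b i : S} (s : b ⟶ i) :
    (mapEl F (unit (T := J) s)).push (F.mapId (o i)) = unit s := by
  rw [← cancel_mono (ρ_ _).hom]
  simp only [mapEl, push, unit, Category.assoc]
  erw [← F.rightUnitor (J.map s)]
  simp

variable [J.IsPseudo] [(J.comp F).IsPseudo]

lemma mapEl_pull {a b i k : S} {s : b ⟶ i} {j : b ⟶ k} {X : o i ⟶ o k} (w : a ⟶ b)
    (x : El J s j X) : mapEl F (pull w x) = pull w (mapEl F x) := by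
  rw [eq_pull_iff, ← mapEl_curry, eq_pull_iff.1 rfl]
  simp only [mapEl, push, F.map₂_comp, Category.assoc, F.naturality_right_assoc,
    whiskerLeft_comp]

lemma mapEl_prod {a b i k l : S} {s : b ⟶ i} {j : b ⟶ k} {m : a ⟶ l} {X : o i ⟶ o k}
    {Y : o k ⟶ o l} (r : a ⟶ b) (x : El J s j X) (y : El J (r ≫ j) m Y) :
    (mapEl F (prod r x y)).push (F.mapComp X Y) = prod r (mapEl F x) (mapEl F y) := by
  rw [eq_prod_iff, curry_push, ← mapEl_curry, ← mapEl_curry, eq_prod_iff.1 rfl]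
  simp only [mapEl, push, F.map₂_comp, Category.assoc, F.naturality_right_assoc]
  congr 2
  simp only [← whiskerLeft_comp, F.associator, F.naturality_left_assoc,
    comp_whiskerRight, Category.assoc]

end MapEl

end El

namespace Shape

variable {S : Type u₁} [Bicategory.{w₁, v₁} S] {A : Type u₂} [Bicategory.{w₂, v₂} A]
  {C : Type u₃} [Bicategory.{w₃, v₃} C] (Sh : Shape S A)

section Transfer

variable {D : Type u₄} [Bicategory.{w₄, v₄} D] {o : S → D} {o' : D → C} {J : OplaxOn o}
  {F : OplaxOn o'}

lemma mapEl_unitAt (I : A) :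
    El.push (El.mapEl F (Sh.unitAt J I)) (F.mapId (o (Sh.ob I))) = Sh.unitAt (J.comp F) I := by
  simp only [unitAt, El.mapEl_con, El.push_con, El.mapEl_unit]

variable [J.IsPseudo] [(J.comp F).IsPseudo]

lemma mapEl_res {I K : A} {P Q : I ⟶ K} (φ : P ⟶ Q) {X : o (Sh.ob I) ⟶ o (Sh.ob K)}
    (x : Sh.ElAt J Q X) : El.mapEl F (Sh.res φ x) = Sh.res φ (El.mapEl F x) := by
  simp only [res, El.mapEl_con, El.mapEl_cov, El.mapEl_pull]

lemma mapEl_cprod {I K L : A} {P : I ⟶ K} {Q : K ⟶ L} {X : o (Sh.ob I) ⟶ o (Sh.ob K)}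
    {Y : o (Sh.ob K) ⟶ o (Sh.ob L)} (x : Sh.ElAt J P X) (y : Sh.ElAt J Q Y) :
    El.push (El.mapEl F (Sh.cprod x y)) (F.mapComp X Y) =
      Sh.cprod (El.mapEl F x) (El.mapEl F y) := by
  simp only [cprod, El.mapEl_cov, El.push_cov, El.mapEl_prod, El.mapEl_con, El.mapEl_pull]

/-- Compatibility is equational, hence inherited by images under `F`. Universality is not, which is
why it is kept out of `IsCompat`. -/
lemma IsCompat.map {K : OplaxOn (S := A) (fun I => o (Sh.ob I))}
    {U : ∀ {I J' : A} (P : I ⟶ J'), Sh.ElAt J P (K.map P)} (h : Sh.IsCompat J K U) :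
    Sh.IsCompat (J.comp F) (K.comp F) (fun P => El.mapEl F (U P)) where
  push_map₂ φ := by rw [← El.mapEl_push, h.push_map₂, mapEl_res]
  push_mapComp P Q := by
    rw [← El.push_push, ← El.mapEl_push, h.push_mapComp, mapEl_cprod]
  push_mapId I := by
    rw [← El.push_push, ← El.mapEl_push, h.push_mapId, mapEl_unitAt]

end Transfer

section Criterion

variable {o : S → C} {T : OplaxOn o} [T.IsPseudo] {F : OplaxOn (S := A) (fun I => o (Sh.ob I))}
    {U : ∀ {I J' : A} (P : I ⟶ J'), Sh.ElAt T P (F.map P)}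

/-- The constraint cell is the one induced, out of the extension at `P ≫ Q`, by the product element,
so it is invertible when that product is itself an extension. -/
lemma IsKan.isIso_mapComp_iff (h : Sh.IsKan T F U) {I J K : A} (P : I ⟶ J) (Q : J ⟶ K) :
    IsIso (F.mapComp P Q) ↔ IsUniv (Sh.cprod (U P) (U Q)) :=
  (h.univ _).isIso_iff (h.push_mapComp P Q)

lemma IsKan.isIso_mapId_iff (h : Sh.IsKan T F U) (I : A) :
    IsIso (F.mapId I) ↔ IsUniv (Sh.unitAt T I) :=
  (h.univ _).isIso_iff (h.push_mapId I)

/-- The element which controls the constraint cell of `F` at a composite `P ≫ Q`. -/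
noncomputable def zel {I J K : A} (P : I ⟶ J) {Q : J ⟶ K} {Y : o (Sh.ob J) ⟶ o (Sh.ob K)}
    (y : Sh.ElAt T Q Y) : El T (Sh.cs P Q) (Sh.tgt (P ≫ Q)) (T.map (Sh.tgt P) ≫ Y) :=
  El.curry (El.con (Sh.ct P Q) (El.cov (Sh.cm P Q) (El.pull (Sh.cr P Q) y)))

/-- Invertibility of `cc P Q` makes the last reindexing harmless, and the extension at `P` is
absolute. What is left is a condition on `zel` alone: Beck for spans, distributivity for
polynomials. -/
lemma isUniv_cprod {I J K : A} {P : I ⟶ J} {Q : J ⟶ K} [IsIso (Sh.cc P Q)]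
    {X : o (Sh.ob I) ⟶ o (Sh.ob J)} {Y : o (Sh.ob J) ⟶ o (Sh.ob K)} {x : Sh.ElAt T P X}
    (hx : IsUniv x) (hs : ∃ R, Nonempty (T.map (Sh.src P) ⊣ R)) {y : Sh.ElAt T Q Y}
    (hy : IsUniv (Sh.zel P y)) : IsUniv (Sh.cprod x y) :=
  (isUniv_comp_whiskerRight_iff _ _).2 (El.isUniv_prod hx hs hy)

end Criterion

end Shape

end PolyUniv

namespace PolyUniv

open Bicategory

/-! ### Gregarious functors, adjunctions and universal elements -/

section Zigzag

variable {A : Type u₂} [Bicategory.{w₂, v₂} A] {a b : A} {l : a ⟶ b} {r : b ⟶ a}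

lemma leftZigzag_eq (η : 𝟙 a ⟶ l ≫ r) (c : r ≫ l ⟶ 𝟙 b) :
    leftZigzag η c = η ▷ l ≫ (α_ _ _ _).hom ≫ l ◁ c := by
  dsimp only [leftZigzag]
  bicategory

lemma rightZigzag_eq (η : 𝟙 a ⟶ l ≫ r) (c : r ≫ l ⟶ 𝟙 b) :
    rightZigzag η c = r ◁ η ≫ (α_ _ _ _).inv ≫ c ▷ r := by
  dsimp only [rightZigzag]
  bicategory

lemma unit_counit_left (adj : l ⊣ r) :
    adj.unit ▷ l ≫ (α_ _ _ _).hom ≫ l ◁ adj.counit = (λ_ l).hom ≫ (ρ_ l).inv :=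
  (leftZigzag_eq _ _).symm.trans adj.left_triangle

lemma unit_counit_right (adj : l ⊣ r) :
    r ◁ adj.unit ≫ (α_ _ _ _).inv ≫ adj.counit ▷ r = (ρ_ r).hom ≫ (λ_ r).inv :=
  (rightZigzag_eq _ _).symm.trans adj.right_triangle

end Zigzag

namespace OplaxOn

variable {A : Type u₂} [Bicategory.{w₂, v₂} A] {C : Type u₃} [Bicategory.{w₃, v₃} C] {o : A → C}

/-- The gregarious oplax functors. -/
class IsGreg (F : OplaxOn o) : Prop where
  isIso_mapId (a : A) : IsIso (F.mapId a)
  isIso_mapComp {a b c : A} (f : a ⟶ b) {g : b ⟶ c} {r : c ⟶ b} (adj : g ⊣ r) :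
    IsIso (F.mapComp f g)

attribute [instance] IsGreg.isIso_mapId

instance (F : OplaxOn o) [F.IsPseudo] : F.IsGreg where
  isIso_mapId _ := inferInstance
  isIso_mapComp _ _ _ _ := inferInstance

variable (F : OplaxOn o)

lemma isIso_mapComp_id_right [F.IsGreg] {a b : A} (f : a ⟶ b) : IsIso (F.mapComp f (𝟙 b)) :=
  IsGreg.isIso_mapComp f (Adjunction.id b)

/-- Here the second factor is arbitrary, so gregariousness does not apply; invertibility is forced
by the left unit law, whose other terms are invertible. -/
lemma isIso_mapComp_id_left [F.IsGreg] {a b : A} (f : a ⟶ b) : IsIso (F.mapComp (𝟙 a) f) := by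
  have h := F.leftUnitor f
  have : IsIso (F.mapComp (𝟙 a) f ≫ F.mapId a ▷ F.map f ≫ (λ_ (F.map f)).hom) := by
    rw [← h]
    infer_instance
  exact IsIso.of_isIso_comp_right _ (F.mapId a ▷ F.map f ≫ (λ_ (F.map f)).hom)

/-- Gregarious functors preserve adjunctions. -/
noncomputable def mapAdj [F.IsGreg] {a b : A} {l : a ⟶ b} {r : b ⟶ a} (adj : l ⊣ r) :
    F.map l ⊣ F.map r where
  unit := inv (F.mapId a) ≫ F.map₂ adj.unit ≫ F.mapComp l r
  counit :=
    -- The only inverse constraint at a nontrivial composite is the one at `r ≫ l`. Its second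
    -- factor `l` is a left adjoint, so gregariousness supplies it.
    haveI := IsGreg.isIso_mapComp (F := F) r adj
    inv (F.mapComp r l) ≫ F.map₂ adj.counit ≫ F.mapId b
  left_triangle := by
    have := IsGreg.isIso_mapComp (F := F) r adj
    have := F.isIso_mapComp_id_left l
    have h : F.map₂ (adj.unit ▷ l) ≫ F.map₂ (α_ _ _ _).hom ≫ F.map₂ (l ◁ adj.counit) =
        F.map₂ (λ_ l).hom ≫ F.map₂ (ρ_ l).inv := by
      simp only [← F.map₂_comp]
      exact congrArg F.map₂ (unit_counit_left adj)
    have hr : F.mapComp l (𝟙 b) ≫ F.map l ◁ F.mapId b = F.map₂ (ρ_ l).hom ≫ (ρ_ _).inv := by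
      simp [F.rightUnitor l]
    -- After precomposition with the invertible unit comparison, the zigzag becomes, by naturality
    -- and associativity of constraints, the image of the zigzag of `adj`.
    rw [leftZigzag_eq, ← cancel_epi (F.mapComp (𝟙 a) l ≫ F.mapId a ▷ F.map l)]
    calc _ = F.mapComp (𝟙 a) l ≫ F.map₂ adj.unit ▷ F.map l ≫ F.mapComp l r ▷ F.map l ≫
          (α_ _ _ _).hom ≫ F.map l ◁ inv (F.mapComp r l) ≫ F.map l ◁ F.map₂ adj.counit ≫
            F.map l ◁ F.mapId b := by simp
      _ = F.map₂ (λ_ l).hom ≫ (ρ_ _).inv := by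
        rw [← F.naturality_left_assoc, ← F.associator_assoc, whiskerLeft_isIso_hom_inv_assoc,
          ← F.naturality_right_assoc, reassoc_of% h, hr, F.map₂_inv_hom_assoc]
      _ = _ := by simp [F.leftUnitor]
  right_triangle := by
    have := IsGreg.isIso_mapComp (F := F) r adj
    have := F.isIso_mapComp_id_right r
    have h : F.map₂ (r ◁ adj.unit) ≫ F.map₂ (α_ _ _ _).inv ≫ F.map₂ (adj.counit ▷ r) =
        F.map₂ (ρ_ r).hom ≫ F.map₂ (λ_ r).inv := by
      simp only [← F.map₂_comp]
      exact congrArg F.map₂ (unit_counit_right adj)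
    have hl : F.mapComp (𝟙 b) r ≫ F.mapId b ▷ F.map r = F.map₂ (λ_ r).hom ≫ (λ_ _).inv := by
      simp [F.leftUnitor r]
    have ha : F.mapComp r (l ≫ r) ≫ F.map r ◁ F.mapComp l r ≫ (α_ _ _ _).inv =
        F.map₂ (α_ _ _ _).inv ≫ F.mapComp (r ≫ l) r ≫ F.mapComp r l ▷ F.map r := by
      rw [← cancel_epi (F.map₂ (α_ _ _ _).hom), F.associator_assoc]
      simp
    rw [rightZigzag_eq, ← cancel_epi (F.mapComp r (𝟙 a) ≫ F.map r ◁ F.mapId a)]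
    calc _ = F.mapComp r (𝟙 a) ≫ F.map r ◁ F.map₂ adj.unit ≫ F.map r ◁ F.mapComp l r ≫
          (α_ _ _ _).inv ≫ inv (F.mapComp r l) ▷ F.map r ≫ F.map₂ adj.counit ▷ F.map r ≫
            F.mapId b ▷ F.map r := by simp
      _ = F.map₂ (ρ_ r).hom ≫ (λ_ _).inv := by
        rw [← F.naturality_right_assoc, reassoc_of% ha, isIso_hom_inv_whiskerRight_assoc,
          ← F.naturality_left_assoc, reassoc_of% h, hl, F.map₂_inv_hom_assoc]
      _ = _ := by simp [F.rightUnitor]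

/-- The extension is isomorphic to `r ≫ j`. Since `j` is a left adjoint, `F` preserves this
composite up to isomorphism, and `F.map r` is right adjoint to `F.map s`. -/
lemma isUniv_map₂ [F.IsGreg] {a b c : A} {s : a ⟶ b} {r : b ⟶ a} (adj : s ⊣ r) {j : a ⟶ c}
    {r' : c ⟶ a} (adj' : j ⊣ r') {X : b ⟶ c} {x : j ⟶ s ≫ X} (hx : IsUniv x) :
    IsUniv (F.map₂ x ≫ F.mapComp s X) := by
  have h := isUniv_unit adj j
  have hf : IsIso (h.desc x) := h.isIso (by rwa [h.fac])
  have := IsGreg.isIso_mapComp (F := F) r adj'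
  have e : ((λ_ _).inv ≫ (F.mapAdj adj).unit ▷ F.map j ≫ (α_ _ _ _).hom) ≫
      F.map s ◁ (inv (F.mapComp r j) ≫ F.map₂ (h.desc x)) = F.map₂ x ≫ F.mapComp s X := by
    conv_rhs => rw [← h.fac x]
    rw [← cancel_epi (λ_ _).hom, ← cancel_epi (F.mapId a ▷ F.map j)]
    have := F.isIso_mapComp_id_left j
    rw [← cancel_epi (F.mapComp (𝟙 a) j)]
    simp only [mapAdj, F.map₂_comp, Category.assoc, comp_whiskerRight, F.naturality_right,
      whiskerLeft_comp, Iso.hom_inv_id_assoc, isIso_hom_inv_whiskerRight_assoc]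
    rw [← F.naturality_left_assoc, ← F.associator_assoc, whiskerLeft_isIso_hom_inv_assoc,
      ← reassoc_of% F.leftUnitor j, F.map₂_hom_inv_assoc]
  rw [← e, isUniv_push_iff]
  exact isUniv_unit _ _

end OplaxOn

lemma El.isUniv_mapEl {S : Type u₁} [Bicategory.{w₁, v₁} S] {A : Type u₂} [Bicategory.{w₂, v₂} A]
    {C : Type u₃} [Bicategory.{w₃, v₃} C] {o : S → A} {o' : A → C} {J : OplaxOn o} (F : OplaxOn o')
    [F.IsGreg] {b i k : S} {s : b ⟶ i} {j : b ⟶ k} {r : o i ⟶ o b} {r' : o k ⟶ o b}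
    (adj : J.map s ⊣ r) (adj' : J.map j ⊣ r') {X : o i ⟶ o k} {x : El J s j X} (hx : IsUniv x) :
    IsUniv (El.mapEl F x) :=
  F.isUniv_map₂ adj adj' hx

/-! ### Transport of elements along icons, and extension of icons -/

section IconOn

variable {S : Type u₁} [Bicategory.{w₁, v₁} S] {C : Type u₂} [Bicategory.{w₂, v₂} C] {o : S → C}

/-- An icon between oplax functors with the same action on objects. -/
structure IconOn (F G : OplaxOn o) where
  app {a b : S} (f : a ⟶ b) : F.map f ⟶ G.map f
  naturality {a b : S} {f g : a ⟶ b} (η : f ⟶ g) : F.map₂ η ≫ app g = app f ≫ G.map₂ η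
  map_comp {a b c : S} (f : a ⟶ b) (g : b ⟶ c) :
    app (f ≫ g) ≫ G.mapComp f g = F.mapComp f g ≫ app f ▷ F.map g ≫ G.map f ◁ app g
  map_id (a : S) : app (𝟙 a) ≫ G.mapId a = F.mapId a

namespace IconOn

variable {F G : OplaxOn o}

/-- All components are invertible. -/
class IsInvertible (β : IconOn F G) : Prop where
  isIso_app {a b : S} (f : a ⟶ b) : IsIso (β.app f)

attribute [instance] IsInvertible.isIso_app

variable (β : IconOn F G)

lemma naturality_assoc {a b : S} {f g : a ⟶ b} (η : f ⟶ g) {h : o a ⟶ o b} (k : G.map g ⟶ h) :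
    F.map₂ η ≫ β.app g ≫ k = β.app f ≫ G.map₂ η ≫ k := by
  rw [reassoc_of% β.naturality η]

lemma map_comp_assoc {a b c : S} (f : a ⟶ b) (g : b ⟶ c) {h : o a ⟶ o c}
    (k : G.map f ≫ G.map g ⟶ h) :
    β.app (f ≫ g) ≫ G.mapComp f g ≫ k =
      F.mapComp f g ≫ β.app f ▷ F.map g ≫ G.map f ◁ β.app g ≫ k := by
  rw [reassoc_of% β.map_comp f g]

variable [β.IsInvertible]

/-- The inverse of an invertible icon. -/
noncomputable def symm : IconOn G F where
  app f := inv (β.app f)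
  naturality η := by
    rw [IsIso.eq_inv_comp, ← Category.assoc, IsIso.comp_inv_eq, β.naturality]
  map_comp f g := by
    rw [IsIso.inv_comp_eq, β.map_comp_assoc, whisker_exchange_assoc]
    simp
  map_id a := by rw [IsIso.inv_comp_eq, β.map_id]

/-- Transport of elements along an invertible icon. -/
noncomputable def tr {b i k : S} {s : b ⟶ i} {j : b ⟶ k} {X : o i ⟶ o k} (x : El G s j X) :
    El F s j X :=
  β.app j ≫ x ≫ inv (β.app s) ▷ X

lemma isUniv_tr_iff {b i k : S} {s : b ⟶ i} {j : b ⟶ k} {X : o i ⟶ o k} (x : El G s j X) :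
    IsUniv (β.tr x) ↔ IsUniv x := by
  rw [tr, isUniv_iso_comp_iff, isUniv_comp_whiskerRight_iff]

lemma tr_push {b i k : S} {s : b ⟶ i} {j : b ⟶ k} {X Y : o i ⟶ o k} (x : El G s j X) (f : X ⟶ Y) :
    β.tr (x.push f) = El.push (β.tr x) f := by
  simp [tr, El.push, whisker_exchange]

lemma tr_cov {b i k : S} {s s' : b ⟶ i} {j : b ⟶ k} {X : o i ⟶ o k} (σ : s ⟶ s') (x : El G s j X) :
    β.tr (x.cov σ) = El.cov σ (β.tr x) := by
  simp only [tr, El.cov, Category.assoc, ← comp_whiskerRight]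
  rw [show G.map₂ σ ≫ inv (β.app s') = inv (β.app s) ≫ F.map₂ σ from β.symm.naturality σ]

lemma tr_con {b i k : S} {s : b ⟶ i} {j j' : b ⟶ k} {X : o i ⟶ o k} (τ : j' ⟶ j) (x : El G s j X) :
    β.tr (x.con τ) = El.con τ (β.tr x) := by
  simp [tr, El.con, β.naturality_assoc]

lemma tr_unit {b i : S} (s : b ⟶ i) : β.tr (El.unit s) = El.unit s := by
  simp [tr, El.unit]

/-- The residual factor `inv (β.app s)` records that currying puts the value at `s` into the target
of the element, where transport does not reach. -/
lemma tr_curry {a b i k : S} {r : a ⟶ b} {s : b ⟶ i} {j : a ⟶ k} {X : o i ⟶ o k}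
    (x : El G (r ≫ s) j X) :
    El.push (β.tr x.curry) (inv (β.app s) ▷ X) = (β.tr x).curry := by
  have h := congrArg (· ▷ X) (β.symm.map_comp r s)
  simp only [comp_whiskerRight] at h
  simp only [tr, El.curry, El.push, Category.assoc]
  erw [reassoc_of% h]
  simp [symm]

variable [F.IsPseudo] [G.IsPseudo]

lemma tr_pull {a b i k : S} {s : b ⟶ i} {j : b ⟶ k} {X : o i ⟶ o k} (w : a ⟶ b)
    (x : El G s j X) : β.tr (El.pull w x) = El.pull w (β.tr x) := by
  rw [El.eq_pull_iff, ← tr_curry, El.eq_pull_iff.1 rfl]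
  simp only [tr, El.push, Category.assoc, β.map_comp_assoc, whiskerLeft_comp,
    ← whisker_exchange_assoc, ← whisker_exchange]
  simp

lemma tr_prod {a b i k l : S} {s : b ⟶ i} {j : b ⟶ k} {m : a ⟶ l} {X : o i ⟶ o k}
    {Y : o k ⟶ o l} (r : a ⟶ b) (x : El G s j X) (y : El G (r ≫ j) m Y) :
    β.tr (El.prod r x y) = El.prod r (β.tr x) (β.tr y) := by
  rw [El.eq_prod_iff, ← tr_curry, ← tr_curry, El.eq_prod_iff.1 rfl]
  simp only [tr, El.push, Category.assoc, comp_whiskerRight, whiskerLeft_comp,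
    ← whisker_exchange_assoc, ← whisker_exchange]
  simp

end IconOn

end IconOn

namespace Shape

variable {S : Type u₁} [Bicategory.{w₁, v₁} S] {A : Type u₂} [Bicategory.{w₂, v₂} A]
  {C : Type u₃} [Bicategory.{w₃, v₃} C] (Sh : Shape S A) {o : S → C} {T T' : OplaxOn o}
  (β : IconOn T T') [β.IsInvertible]

lemma tr_unitAt (I : A) : β.tr (Sh.unitAt T' I) = Sh.unitAt T I := by
  simp only [unitAt, β.tr_con, β.tr_unit]

variable [T.IsPseudo] [T'.IsPseudo]

lemma tr_res {I J : A} {P Q : I ⟶ J} (φ : P ⟶ Q) {X : o (Sh.ob I) ⟶ o (Sh.ob J)}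
    (x : Sh.ElAt T' Q X) : β.tr (Sh.res φ x) = Sh.res φ (β.tr x) := by
  simp only [res, β.tr_con, β.tr_cov, β.tr_pull]

lemma tr_cprod {I J K : A} {P : I ⟶ J} {Q : J ⟶ K} {X : o (Sh.ob I) ⟶ o (Sh.ob J)}
    {Y : o (Sh.ob J) ⟶ o (Sh.ob K)} (x : Sh.ElAt T' P X) (y : Sh.ElAt T' Q Y) :
    β.tr (Sh.cprod x y) = Sh.cprod (β.tr x) (β.tr y) := by
  simp only [cprod, β.tr_con, β.tr_cov, β.tr_pull, β.tr_prod]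

variable {F F' : OplaxOn (S := A) (fun I => o (Sh.ob I))}
  {U : ∀ {I J : A} (P : I ⟶ J), Sh.ElAt T P (F.map P)}
  {U' : ∀ {I J : A} (P : I ⟶ J), Sh.ElAt T' P (F'.map P)}

/-- The extension of an invertible icon to left Kan extensions. -/
noncomputable def extendIcon (hF : Sh.IsKan T F U) (hF' : Sh.IsCompat T' F' U') : IconOn F F' where
  -- Only `F` has to be a Kan extension; `F'` enters through its compatible elements, moved to `T`
  -- along `β`.
  app P := (hF.univ P).desc (β.tr (U' P))
  naturality φ := El.push_injective (hF.univ _) (by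
    simp only [← El.push_push, hF.push_map₂, push_res, El.push_desc, ← tr_res, ← hF'.push_map₂,
      β.tr_push])
  map_comp P Q := El.push_injective (hF.univ _) (by
    simp only [← El.push_push, hF.push_mapComp, El.push_desc, ← cprod_push_left,
      ← cprod_push_right, ← tr_cprod, ← hF'.push_mapComp, β.tr_push])
  map_id I := El.push_injective (hF.univ _) (by
    simp only [← El.push_push, hF.push_mapId, El.push_desc, ← tr_unitAt Sh β,
      ← hF'.push_mapId, β.tr_push])

lemma push_extendIcon (hF : Sh.IsKan T F U) (hF' : Sh.IsCompat T' F' U') {I J : A} (P : I ⟶ J) :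
    (U P).push ((Sh.extendIcon β hF hF').app P) = β.tr (U' P) :=
  El.push_desc (hF.univ P) _

/-- Transport preserves universality, so each component compares two extensions of the same 2-cell.
-/
lemma extendIcon_isInvertible (hF : Sh.IsKan T F U) (hF' : Sh.IsKan T' F' U') :
    (Sh.extendIcon β hF hF'.toIsCompat).IsInvertible where
  isIso_app P := ((hF.univ P).isIso_iff (push_extendIcon Sh β hF hF'.toIsCompat P)).2
    ((β.isUniv_tr_iff _).2 (hF'.univ P))

end Shape

section Precomp

variable {S : Type u₁} [Bicategory.{w₁, v₁} S] {A : Type u₂} [Bicategory.{w₂, v₂} A]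
  {C : Type u₃} [Bicategory.{w₃, v₃} C] {o : S → A} {o' : A → C}

/-- Restriction of an icon. -/
def IconOn.precomp (J : OplaxOn o) {F F' : OplaxOn o'} (γ : IconOn F F') :
    IconOn (J.comp F) (J.comp F') where
  app f := γ.app (J.map f)
  naturality η := γ.naturality (J.map₂ η)
  map_comp f g := by
    simp only [Category.assoc, ← γ.naturality_assoc, γ.map_comp]
  map_id a := by
    simp only [← γ.naturality_assoc, γ.map_id]

/-- On a universal element, this identity expresses the component of `γ` at `X` through the
restriction of `γ` alone. It is the source of uniqueness of extensions of icons. -/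
lemma IconOn.tr_mapEl {J : OplaxOn o} {F F' : OplaxOn o'} (γ : IconOn F F')
    [(γ.precomp J).IsInvertible] {b i k : S} {s : b ⟶ i} {j : b ⟶ k} {X : o i ⟶ o k}
    (x : El J s j X) :
    (γ.precomp J).tr (El.mapEl F' x) = El.push (El.mapEl F x) (γ.app X) := by
  rw [← cancel_mono ((γ.precomp J).app s ▷ F'.map X)]
  simp only [tr, El.mapEl, El.push, Category.assoc, isIso_inv_hom_whiskerRight]
  change γ.app (J.map j) ≫ F'.map₂ x ≫ F'.mapComp (J.map s) X ≫ 𝟙 _ =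
    F.map₂ x ≫ F.mapComp (J.map s) X ≫ F.map (J.map s) ◁ γ.app X ≫ γ.app (J.map s) ▷ F'.map X
  rw [Category.comp_id, ← γ.naturality_assoc, γ.map_comp, whisker_exchange]

end Precomp

end PolyUniv

namespace PolyUniv

open Bicategory ChosenPullbacksAlong ChosenDistributivityPullbacks

/-! ### The bicategory of spans -/

section Spans

variable {E : Type u} [Category.{v} E]

/-- A span `I <--l-- apex --r--> J`. -/
structure SpanMor (I J : E) where
  apex : E
  l : apex ⟶ I
  r : apex ⟶ J

namespace SpanMor

variable {I J K L : E}

/-- A morphism of spans. -/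
@[ext]
structure Hom (S S' : SpanMor I J) where
  f : S.apex ⟶ S'.apex
  f_l : f ≫ S'.l = S.l
  f_r : f ≫ S'.r = S.r

instance : Category (SpanMor I J) where
  Hom := Hom
  id S := ⟨𝟙 _, Category.id_comp _, Category.id_comp _⟩
  comp φ ψ := ⟨φ.f ≫ ψ.f, by rw [Category.assoc, ψ.f_l, φ.f_l], by
    rw [Category.assoc, ψ.f_r, φ.f_r]⟩
  id_comp _ := Hom.ext (Category.id_comp _)
  comp_id _ := Hom.ext (Category.comp_id _)
  assoc _ _ _ := Hom.ext (Category.assoc _ _ _)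

@[ext] lemma hom_ext {S S' : SpanMor I J} {φ ψ : S ⟶ S'} (h : φ.f = ψ.f) : φ = ψ := Hom.ext h

@[simp] lemma id_f (S : SpanMor I J) : Hom.f (𝟙 S) = 𝟙 S.apex := rfl

@[simp] lemma comp_f {S S' S'' : SpanMor I J} (φ : S ⟶ S') (ψ : S' ⟶ S'') :
    Hom.f (φ ≫ ψ) = φ.f ≫ ψ.f := rfl

section

variable {S S' : SpanMor I J} (φ : S ⟶ S')

@[simp] lemma f_l' : φ.f ≫ S'.l = S.l := φ.f_l

@[simp] lemma f_r' : φ.f ≫ S'.r = S.r := φ.f_r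

/-- A morphism of spans which is invertible on the apex is invertible. -/
lemma isIso_of_isIso_f (h : IsIso φ.f) : IsIso φ :=
  ⟨⟨inv φ.f, by rw [IsIso.inv_comp_eq, f_l'], by rw [IsIso.inv_comp_eq, f_r']⟩,
    by ext; simp, by ext; simp⟩

end

variable [ChosenPullbacks E]

/-- Composition of spans. -/
def comp (S : SpanMor I J) (S' : SpanMor J K) : SpanMor I K where
  apex := pullbackObj S.r S'.l
  l := fst S.r S'.l ≫ S.l
  r := snd S.r S'.l ≫ S'.r

section CompAPI

variable (S : SpanMor I J) (S' : SpanMor J K)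

/-- The first projection of a composite of spans. -/
def p₁ : (comp S S').apex ⟶ S.apex := fst S.r S'.l

/-- The second projection of a composite of spans. -/
def p₂ : (comp S S').apex ⟶ S'.apex := snd S.r S'.l

@[simp] lemma comp_l : (comp S S').l = p₁ S S' ≫ S.l := rfl

@[simp] lemma comp_r : (comp S S').r = p₂ S S' ≫ S'.r := rfl

@[simp] lemma p₂_l : p₂ S S' ≫ S'.l = p₁ S S' ≫ S.r := condition.symm

@[simp] lemma p₂_l_assoc {Z : E} (k : J ⟶ Z) : p₂ S S' ≫ S'.l ≫ k = p₁ S S' ≫ S.r ≫ k := by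
  rw [← Category.assoc, p₂_l, Category.assoc]

@[simp] lemma p₂_p₁_l (S'' : SpanMor K L) :
    p₂ S (comp S' S'') ≫ p₁ S' S'' ≫ S'.l = p₁ S (comp S' S'') ≫ S.r :=
  p₂_l S (comp S' S'')

lemma isPullback_comp : IsPullback (p₁ S S') (p₂ S S') S.r S'.l :=
  ChosenPullbacksAlong.isPullback S.r S'.l

variable {S S'}

def pair {W : E} (x : W ⟶ S.apex) (y : W ⟶ S'.apex) (h : x ≫ S.r = y ≫ S'.l) :
    W ⟶ (comp S S').apex := lift x y h

section

variable {W : E} (x : W ⟶ S.apex) (y : W ⟶ S'.apex) (h : x ≫ S.r = y ≫ S'.l)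

@[simp] lemma pair_p₁ : pair x y h ≫ p₁ S S' = x := lift_fst x y h

@[simp] lemma pair_p₂ : pair x y h ≫ p₂ S S' = y := lift_snd x y h

@[simp] lemma pair_p₁_assoc {Z : E} (k : S.apex ⟶ Z) : pair x y h ≫ p₁ S S' ≫ k = x ≫ k := by
  rw [← Category.assoc, pair_p₁]

@[simp] lemma pair_p₂_assoc {Z : E} (k : S'.apex ⟶ Z) : pair x y h ≫ p₂ S S' ≫ k = y ≫ k := by
  rw [← Category.assoc, pair_p₂]

end

lemma apex_ext {W : E} {x y : W ⟶ (comp S S').apex} (h₁ : x ≫ p₁ S S' = y ≫ p₁ S S')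
    (h₂ : x ≫ p₂ S S' = y ≫ p₂ S S') : x = y :=
  ChosenPullbacksAlong.hom_ext S.r S'.l h₁ h₂

end CompAPI

/-- The identity span. -/
@[reducible] def idS (X : E) : SpanMor X X := ⟨X, 𝟙 X, 𝟙 X⟩

/-- Left whiskering. -/
def wl (S : SpanMor I J) {S' S'' : SpanMor J K} (φ : S' ⟶ S'') : comp S S' ⟶ comp S S'' where
  f := pair (p₁ S S') (p₂ S S' ≫ φ.f) (by simp)
  f_l := by simp
  f_r := by simp

/-- Right whiskering. -/
def wr {S S' : SpanMor I J} (φ : S ⟶ S') (S'' : SpanMor J K) : comp S S'' ⟶ comp S' S'' where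
  f := pair (p₁ S S'' ≫ φ.f) (p₂ S S'') (by simp)
  f_l := by simp
  f_r := by simp

/-- The associator. -/
def ass (S : SpanMor I J) (S' : SpanMor J K) (S'' : SpanMor K L) :
    comp (comp S S') S'' ≅ comp S (comp S' S'') where
  hom := ⟨pair (p₁ _ _ ≫ p₁ _ _) (pair (p₁ _ _ ≫ p₂ _ _) (p₂ _ _) (by simp)) (by simp), by simp, by simp⟩
  inv := ⟨pair (pair (p₁ _ _) (p₂ _ _ ≫ p₁ _ _) (by simp)) (p₂ _ _ ≫ p₂ _ _) (by simp), by simp, by simp⟩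
  hom_inv_id := by
    ext
    refine apex_ext (apex_ext ?_ ?_) ?_ <;> simp
  inv_hom_id := by
    ext
    refine apex_ext ?_ (apex_ext ?_ ?_) <;> simp

/-- The left unitor. -/
def lu (S : SpanMor I J) : comp (idS I) S ≅ S where
  hom := ⟨p₂ _ _, by simp, rfl⟩
  inv := ⟨pair S.l (𝟙 _) (by simp), by simp, by simp⟩
  hom_inv_id := by
    ext
    refine apex_ext ?_ ?_ <;> simp
  inv_hom_id := by
    ext
    simp

/-- The right unitor. -/
def ru (S : SpanMor I J) : comp S (idS J) ≅ S where
  hom := ⟨p₁ _ _, rfl, by simp [← p₂_l]⟩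
  inv := ⟨pair (𝟙 _) S.r (by simp), by simp, by simp⟩
  hom_inv_id := by
    ext
    refine apex_ext ?_ ?_ <;> simp [← p₂_l]
  inv_hom_id := by
    ext
    simp

end SpanMor

/-- The bicategory of spans: its objects are those of `E`. -/
structure SpanBicat (E : Type u) where
  as : E

variable [ChosenPullbacks E]

open SpanMor

/-- A map into an iterated composite is determined by its projections to the individual apexes, so
each law is an equality of projections. -/
instance : Bicategory (SpanBicat E) where
  Hom I J := SpanMor I.as J.as
  id I := idS I.as
  comp S S' := SpanMor.comp S S'
  homCategory I J := inferInstanceAs (Category (SpanMor I.as J.as))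
  whiskerLeft S _ _ φ := wl S φ
  whiskerRight φ S := wr φ S
  associator S S' S'' := ass S S' S''
  leftUnitor S := lu S
  rightUnitor S := ru S
  whiskerLeft_id S S' := by
    refine SpanMor.hom_ext (apex_ext ?_ ?_) <;> simp [wl]
  whiskerLeft_comp S _ _ _ φ ψ := by
    refine SpanMor.hom_ext (apex_ext ?_ ?_) <;> simp [wl]
  id_whiskerLeft φ := by
    refine SpanMor.hom_ext (apex_ext ?_ ?_) <;> simp [wl, lu]
  comp_whiskerLeft S S' _ _ φ := by
    refine SpanMor.hom_ext (apex_ext (apex_ext ?_ ?_) ?_) <;> simp [wl, ass]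
  id_whiskerRight S S' := by
    refine SpanMor.hom_ext (apex_ext ?_ ?_) <;> simp [wr]
  comp_whiskerRight φ ψ S := by
    refine SpanMor.hom_ext (apex_ext ?_ ?_) <;> simp [wr]
  whiskerRight_id φ := by
    refine SpanMor.hom_ext (apex_ext ?_ ?_) <;> simp [wr, ru, ← p₂_l]
  whiskerRight_comp φ S S' := by
    refine SpanMor.hom_ext (apex_ext ?_ (apex_ext ?_ ?_)) <;> simp [wr, ass]
  whisker_assoc S _ _ φ S' := by
    refine SpanMor.hom_ext (apex_ext (apex_ext ?_ ?_) ?_) <;> simp [wr, wl, ass]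
  whisker_exchange φ ψ := by
    refine SpanMor.hom_ext (apex_ext ?_ ?_) <;> simp [wr, wl]
  pentagon S S' S'' S''' := by
    refine SpanMor.hom_ext (apex_ext ?_ (apex_ext ?_ (apex_ext ?_ ?_))) <;> simp [wr, wl, ass]
  triangle S S' := by
    refine SpanMor.hom_ext (apex_ext ?_ ?_) <;> simp [wr, wl, ass, lu, ru]

/-! ### Generalised elements of apexes, in bicategorical notation -/

namespace SpanBicat

variable {I J K L : SpanBicat E}

/-- The apex of a span. -/
@[reducible] def ax (S : I ⟶ J) : E := SpanMor.apex S

/-- The left leg of a span. -/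
@[reducible] def lg (S : I ⟶ J) : ax S ⟶ I.as := SpanMor.l S

/-- The right leg of a span. -/
@[reducible] def rg (S : I ⟶ J) : ax S ⟶ J.as := SpanMor.r S

/-- The underlying map of a morphism of spans. -/
def hf {S S' : I ⟶ J} (φ : S ⟶ S') : ax S ⟶ ax S' := SpanMor.Hom.f φ

/-- The morphism of spans given by a map of apexes. -/
def mkHom {S S' : I ⟶ J} (f : ax S ⟶ ax S') (h₁ : f ≫ lg S' = lg S) (h₂ : f ≫ rg S' = rg S) :
    S ⟶ S' := SpanMor.Hom.mk f h₁ h₂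

@[simp] lemma hf_mkHom {S S' : I ⟶ J} (f : ax S ⟶ ax S') (h₁ : f ≫ lg S' = lg S)
    (h₂ : f ≫ rg S' = rg S) : hf (mkHom f h₁ h₂) = f := rfl

lemma hf_ext {S S' : I ⟶ J} {φ ψ : S ⟶ S'} (h : hf φ = hf ψ) : φ = ψ := SpanMor.hom_ext h

section

variable {S S' : I ⟶ J} (φ : S ⟶ S')

@[simp] lemma hf_lg : hf φ ≫ lg S' = lg S := SpanMor.f_l' φ

@[simp] lemma hf_rg : hf φ ≫ rg S' = rg S := SpanMor.f_r' φ

lemma isIso_of_isIso_hf (h : IsIso (hf φ)) : IsIso φ := SpanMor.isIso_of_isIso_f φ h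

end

section

variable (S : I ⟶ J) (S' : J ⟶ K)

/-- The first projection of a composite of spans. -/
def pr₁ : ax (S ≫ S') ⟶ ax S := SpanMor.p₁ S S'

def pr₂ : ax (S ≫ S') ⟶ ax S' := SpanMor.p₂ S S'

@[simp] lemma lg_comp : lg (S ≫ S') = pr₁ S S' ≫ lg S := rfl

@[simp] lemma rg_comp : rg (S ≫ S') = pr₂ S S' ≫ rg S' := rfl

lemma isPullback : IsPullback (pr₁ S S') (pr₂ S S') (rg S) (lg S') := SpanMor.isPullback_comp S S'

@[simp] lemma pr₂_lg : pr₂ S S' ≫ lg S' = pr₁ S S' ≫ rg S := SpanMor.p₂_l S S'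

@[simp] lemma pr₂_lg_assoc {Z : E} (k : J.as ⟶ Z) :
    pr₂ S S' ≫ lg S' ≫ k = pr₁ S S' ≫ rg S ≫ k := SpanMor.p₂_l_assoc S S' k

@[simp] lemma pr₂_pr₁_lg (S'' : K ⟶ L) :
    pr₂ S (S' ≫ S'') ≫ pr₁ S' S'' ≫ lg S' = pr₁ S (S' ≫ S'') ≫ rg S :=
  pr₂_lg S (S' ≫ S'')

variable {S S'}

def pr {W : E} (x : W ⟶ ax S) (y : W ⟶ ax S') (h : x ≫ rg S = y ≫ lg S') :
    W ⟶ ax (S ≫ S') := SpanMor.pair x y h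

section

variable {W : E} (x : W ⟶ ax S) (y : W ⟶ ax S') (h : x ≫ rg S = y ≫ lg S')

@[simp] lemma pr_pr₁ : pr x y h ≫ pr₁ S S' = x := SpanMor.pair_p₁ x y h

@[simp] lemma pr_pr₂ : pr x y h ≫ pr₂ S S' = y := SpanMor.pair_p₂ x y h

@[simp] lemma pr_pr₁_assoc {Z : E} (k : ax S ⟶ Z) : pr x y h ≫ pr₁ S S' ≫ k = x ≫ k :=
  SpanMor.pair_p₁_assoc x y h k

@[simp] lemma pr_pr₂_assoc {Z : E} (k : ax S' ⟶ Z) : pr x y h ≫ pr₂ S S' ≫ k = y ≫ k :=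
  SpanMor.pair_p₂_assoc x y h k

end

lemma ax_ext {W : E} {x y : W ⟶ ax (S ≫ S')} (h₁ : x ≫ pr₁ S S' = y ≫ pr₁ S S')
    (h₂ : x ≫ pr₂ S S' = y ≫ pr₂ S S') : x = y :=
  SpanMor.apex_ext h₁ h₂

end

/-- A generalised element of the apex of an identity span. -/
def toId {W : E} (x : W ⟶ I.as) : W ⟶ ax (𝟙 I) := x

@[simp] lemma toId_lg {W : E} (x : W ⟶ I.as) : toId x ≫ lg (𝟙 I) = x := Category.comp_id x

@[simp] lemma rg_id (I : SpanBicat E) : rg (𝟙 I) = lg (𝟙 I) := rfl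

lemma ax_id_ext {W : E} {x y : W ⟶ ax (𝟙 I)} (h : x ≫ lg (𝟙 I) = y ≫ lg (𝟙 I)) : x = y :=
  (Category.comp_id x).symm.trans (h.trans (Category.comp_id y))

@[simp] lemma hf_id (S : I ⟶ J) : hf (𝟙 S) = 𝟙 (ax S) := rfl

@[simp] lemma hf_comp {S S' S'' : I ⟶ J} (φ : S ⟶ S') (ψ : S' ⟶ S'') :
    hf (φ ≫ ψ) = hf φ ≫ hf ψ := rfl

@[simp] lemma hf_whiskerLeft (S : I ⟶ J) {S' S'' : J ⟶ K} (φ : S' ⟶ S'') :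
    hf (S ◁ φ) = pr (pr₁ S S') (pr₂ S S' ≫ hf φ) (by simp) := rfl

@[simp] lemma hf_whiskerRight {S S' : I ⟶ J} (φ : S ⟶ S') (S'' : J ⟶ K) :
    hf (φ ▷ S'') = pr (pr₁ S S'' ≫ hf φ) (pr₂ S S'') (by simp) := rfl

@[simp] lemma hf_associator_hom (S : I ⟶ J) (S' : J ⟶ K) (S'' : K ⟶ L) :
    hf (α_ S S' S'').hom = pr (pr₁ (S ≫ S') S'' ≫ pr₁ S S')
      (pr (pr₁ (S ≫ S') S'' ≫ pr₂ S S') (pr₂ (S ≫ S') S'') (by simp)) (by simp) := rfl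

@[simp] lemma hf_associator_inv (S : I ⟶ J) (S' : J ⟶ K) (S'' : K ⟶ L) :
    hf (α_ S S' S'').inv = pr (pr (pr₁ S (S' ≫ S'')) (pr₂ S (S' ≫ S'') ≫ pr₁ S' S'') (by simp))
      (pr₂ S (S' ≫ S'') ≫ pr₂ S' S'') (by simp) := rfl

@[simp] lemma hf_leftUnitor_hom (S : I ⟶ J) : hf (λ_ S).hom = pr₂ (𝟙 I) S := rfl

@[simp] lemma hf_leftUnitor_inv (S : I ⟶ J) :
    hf (λ_ S).inv = pr (toId (lg S)) (𝟙 _) (by simp) := rfl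

@[simp] lemma hf_rightUnitor_hom (S : I ⟶ J) : hf (ρ_ S).hom = pr₁ S (𝟙 J) := rfl

@[simp] lemma hf_rightUnitor_inv (S : I ⟶ J) :
    hf (ρ_ S).inv = pr (𝟙 _) (toId (rg S)) (by simp) := rfl

/-- The span with given apex and legs. -/
@[reducible] def sp {X : E} (l : X ⟶ I.as) (r : X ⟶ J.as) : I ⟶ J := SpanMor.mk X l r

@[simp] lemma lg_sp {X : E} (l : X ⟶ I.as) (r : X ⟶ J.as) : lg (sp l r) = l := rfl

@[simp] lemma rg_sp {X : E} (l : X ⟶ I.as) (r : X ⟶ J.as) : rg (sp l r) = r := rfl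

/-- The span associated with a morphism. -/
@[reducible] def emb {X Y : E} (f : X ⟶ Y) : (⟨X⟩ : SpanBicat E) ⟶ ⟨Y⟩ := sp (𝟙 X) f

end SpanBicat

end Spans

end PolyUniv

namespace PolyUniv

open Bicategory ChosenPullbacksAlong ChosenDistributivityPullbacks

/-! ### The embedding of the base category into spans -/

section Embedding

variable {E : Type u} [Category.{v} E] [ChosenPullbacks E]

namespace SpanBicat

/-- The morphism of spans associated with an equality. -/
def emb₂ {X Y : E} {f g : X ⟶ Y} (h : f = g) : emb f ⟶ emb g :=
  mkHom (𝟙 X) (by simp) (by simp [h])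

@[simp] lemma hf_emb₂ {X Y : E} {f g : X ⟶ Y} (h : f = g) : hf (emb₂ h) = 𝟙 X := rfl

/-- The composition constraint of the embedding of `E` into spans. -/
def embComp {X Y Z : E} (f : X ⟶ Y) (g : Y ⟶ Z) : emb (f ≫ g) ⟶ emb f ≫ emb g :=
  mkHom (pr (𝟙 X) f (by simp)) (by simp) (by simp)

@[simp] lemma hf_embComp {X Y Z : E} (f : X ⟶ Y) (g : Y ⟶ Z) :
    hf (embComp f g) = pr (𝟙 X) f (by simp) := rfl

/-- The unit constraint of the embedding of `E` into spans. -/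
def embId (X : E) : emb (𝟙 X) ⟶ 𝟙 (⟨X⟩ : SpanBicat E) :=
  mkHom (toId (𝟙 X)) (by simp) (by simp)

@[simp] lemma hf_embId (X : E) : hf (embId X) = toId (𝟙 X) := rfl

/-- The embedding of `E` into spans. -/
def embOn (E : Type u) [Category.{v} E] [ChosenPullbacks E] :
    OplaxOn (fun X : LocallyDiscrete E => SpanBicat.mk X.as) where
  map f := emb f.as
  map₂ η := emb₂ (congrArg (·.as) (LocallyDiscrete.eq_of_hom η))
  mapId X := embId X.as
  mapComp f g := embComp f.as g.as
  map₂_id f := rfl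
  map₂_comp η θ := hf_ext (by simp)
  naturality_left η g := hf_ext (ax_ext (by simp) (by simp [LocallyDiscrete.eq_of_hom η]))
  naturality_right f _ _ η := hf_ext (ax_ext (by simp) (by simp))
  associator f g h := hf_ext (ax_ext (by simp) (ax_ext (by simp) (by simp)))
  leftUnitor f := hf_ext (by simp)
  rightUnitor f := hf_ext (by simp)

end SpanBicat

end Embedding

/-! ### Spans presented by morphisms -/

section LevelOne

variable (E : Type u) [Category.{v} E] [ChosenPullbacks E]

open SpanBicat

/-- The presentation of spans by morphisms of `E`. -/
def spanShape : Shape (LocallyDiscrete E) (SpanBicat E) where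
  ob I := ⟨I.as⟩
  base S := ⟨ax S⟩
  src S := (lg S).toLoc
  tgt S := (rg S).toLoc
  g φ := (hf φ).toLoc
  gt φ := eqToHom (by rw [← Quiver.Hom.comp_toLoc, hf_rg])
  gs φ := eqToHom (by rw [← Quiver.Hom.comp_toLoc, hf_lg])
  cr S S' := (pr₂ S S').toLoc
  cs S S' := (pr₁ S S').toLoc
  ct S S' := eqToHom (by rw [← Quiver.Hom.comp_toLoc, rg_comp])
  cm S S' := eqToHom (by simp only [← Quiver.Hom.comp_toLoc, pr₂_lg])
  cc S S' := eqToHom (by rw [← Quiver.Hom.comp_toLoc, lg_comp])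
  un I := 𝟙 _
  -- The presenting bicategory is locally discrete: all equations between 2-cells hold, and only the
  -- equalities of morphisms needed to form the comparison 2-cells carry content.
  id_eq S := ⟨eqToHom rfl, Subsingleton.elim _ _, Subsingleton.elim _ _⟩
  comp_eq φ ψ := ⟨eqToHom rfl, Subsingleton.elim _ _, Subsingleton.elim _ _⟩
  whiskerRight_eq φ Q :=
    ⟨eqToHom (by simp [← Quiver.Hom.comp_toLoc]), eqToHom (by simp [← Quiver.Hom.comp_toLoc]),
      Subsingleton.elim _ _, Subsingleton.elim _ _, Subsingleton.elim _ _⟩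
  whiskerLeft_eq P _ _ ψ :=
    ⟨eqToHom (by simp [← Quiver.Hom.comp_toLoc]), eqToHom (by simp [← Quiver.Hom.comp_toLoc]),
      Subsingleton.elim _ _, Subsingleton.elim _ _, Subsingleton.elim _ _⟩
  assoc_eq P Q R :=
    ⟨eqToHom (by simp [← Quiver.Hom.comp_toLoc]), eqToHom (by simp [← Quiver.Hom.comp_toLoc]),
      eqToHom (by simp [← Quiver.Hom.comp_toLoc]),
      Subsingleton.elim _ _, Subsingleton.elim _ _, Subsingleton.elim _ _, Subsingleton.elim _ _⟩
  leftUnitor_eq P := ⟨eqToHom rfl, Subsingleton.elim _ _, Subsingleton.elim _ _⟩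
  rightUnitor_eq P := ⟨eqToHom rfl, Subsingleton.elim _ _, Subsingleton.elim _ _⟩

end LevelOne

/-! ### Polynomials presented by spans -/

section LevelTwo

set_option linter.unusedSectionVars false

variable {E : Type u} [Category.{v} E] [ChosenPullbacks E] [ChosenDistributivityPullbacks E]

namespace PolyMor

open SpanBicat

variable {I J K L : E}

section DistElements

variable (P : PolyMor I J) (Q : PolyMor J K)

/-- The apex of the span from the base of `comp P Q` to the base of `P`. -/
abbrev dT : E := (compDPB P Q).T

/-- The left leg of the span from the base of `comp P Q` to the base of `P`. -/
def dq : dT P Q ⟶ (comp P Q).base := (compDPB P Q).q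

/-- The projection of `dT P Q` to the total object of `Q`. -/
def dm : dT P Q ⟶ Q.tot := (compDPB P Q).p ≫ snd P.t Q.s

lemma dq_cr : dq P Q ≫ cr P Q = dm P Q ≫ Q.p := (compDPB P Q).isPullback.w.symm

@[simp] lemma dm_p : dm P Q ≫ Q.p = dq P Q ≫ cr P Q := (dq_cr P Q).symm

/-- The right leg of the span from the base of `comp P Q` to the base of `P`. -/
noncomputable def dpos : dT P Q ⟶ P.base := pos (dq P Q) (dm P Q) (dq_cr P Q)

lemma comp_dpos {W : E} (y : W ⟶ dT P Q) : y ≫ dpos P Q =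
    pos (y ≫ dq P Q) (y ≫ dm P Q) (by simp) := precomp_pos _ _ _ _

lemma dpos_eq : dpos P Q = (compDPB P Q).p ≫ fst P.t Q.s := by
  have h : (compDPB P Q).lft (dq P Q) (dm P Q) (dq_cr P Q) = 𝟙 _ := by
    apply (compDPB P Q).T_ext
    · exact ((compDPB P Q).lft_q _ _ _).trans (Category.id_comp _).symm
    · exact ((compDPB P Q).lft_p_u _ _ _).trans (Category.id_comp _).symm
  rw [dpos, pos, h, Category.id_comp]

variable {P Q}

/-- The generalised element of `dT P Q` lying over `x` and `m`. -/
noncomputable def mkD {W : E} (x : W ⟶ (comp P Q).base) (m : W ⟶ Q.tot)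
    (h : x ≫ cr P Q = m ≫ Q.p) : W ⟶ dT P Q := (compDPB P Q).lft x m h

section

variable {W : E} (x : W ⟶ (comp P Q).base) (m : W ⟶ Q.tot) (h : x ≫ cr P Q = m ≫ Q.p)

@[simp] lemma mkD_dq : mkD x m h ≫ dq P Q = x := (compDPB P Q).lft_q x m h

@[simp] lemma mkD_dm : mkD x m h ≫ dm P Q = m := (compDPB P Q).lft_p_u x m h

@[simp] lemma mkD_dm_assoc {Z : E} (k : Q.tot ⟶ Z) : mkD x m h ≫ dm P Q ≫ k = m ≫ k := by
  rw [← Category.assoc, mkD_dm]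

@[simp] lemma mkD_dpos : mkD x m h ≫ dpos P Q = pos x m h := by
  simp only [comp_dpos, mkD_dq, mkD_dm]

end

lemma dT_ext {W : E} {x y : W ⟶ dT P Q} (h₁ : x ≫ dq P Q = y ≫ dq P Q)
    (h₂ : x ≫ dm P Q = y ≫ dm P Q) : x = y := (compDPB P Q).T_ext h₁ h₂

@[simp] lemma comp_mkD {V W : E} (z : V ⟶ W) (x : W ⟶ (comp P Q).base) (m : W ⟶ Q.tot)
    (h : x ≫ cr P Q = m ≫ Q.p) :
    z ≫ mkD x m h = mkD (z ≫ x) (z ≫ m) (by simp only [Category.assoc, h]) :=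
  dT_ext (by simp) (by simp)

end DistElements

section

variable {P Q R : PolyMor I J}

lemma comp_g (φ : P ⟶ Q) {W : E} (b : W ⟶ P.base) : b ≫ φ.g = φ.ap b := rfl

/-- The span underlying a polynomial. -/
@[reducible] def srcS (P : PolyMor I J) : (⟨P.base⟩ : SpanBicat E) ⟶ ⟨I⟩ := sp P.p P.s

/-- The comparison of targets given by a 2-cell of polynomials. -/
def gtS (φ : P ⟶ Q) : emb P.t ⟶ emb φ.g ≫ emb Q.t :=
  mkHom (pr (𝟙 _) φ.g (by simp)) (by simp) (by simp [φ.g_t])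

lemma gsS_h (φ : P ⟶ Q) : φ.ap (pr₁ (emb φ.g) (srcS Q)) = pr₂ (emb φ.g) (srcS Q) ≫ Q.p :=
  (pr₂_lg (emb φ.g) (srcS Q)).symm

/-- The comparison of sources given by a 2-cell of polynomials. -/
def gsS (φ : P ⟶ Q) : emb φ.g ≫ srcS Q ⟶ srcS P :=
  mkHom (φ.act (pr₁ (emb φ.g) (srcS Q)) (pr₂ (emb φ.g) (srcS Q)) (gsS_h φ))
    ((Hom.act_p φ _ _ _).trans (Category.comp_id _).symm) (Hom.act_s φ _ _ _)

@[simp] lemma hf_gtS (φ : P ⟶ Q) :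
    hf (gtS φ) = pr (S := emb φ.g) (S' := emb Q.t) (𝟙 _) φ.g (by simp) := rfl

@[simp] lemma hf_gsS (φ : P ⟶ Q) : hf (gsS φ) =
    φ.act (pr₁ (emb φ.g) (srcS Q)) (pr₂ (emb φ.g) (srcS Q)) (gsS_h φ) := rfl

end

section

variable (P : PolyMor I J) (Q : PolyMor J K)

/-- The span from the base of a composite of polynomials to the base of the first factor. -/
@[reducible] noncomputable def csS : (⟨(comp P Q).base⟩ : SpanBicat E) ⟶ ⟨P.base⟩ :=
  sp (dq P Q) (dpos P Q)

lemma cmS_h : pr₁ (emb (cr P Q)) (srcS Q) ≫ cr P Q = pr₂ (emb (cr P Q)) (srcS Q) ≫ Q.p :=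
  (pr₂_lg (emb (cr P Q)) (srcS Q)).symm

lemma ccS_h : pr₂ (csS P Q) (srcS P) ≫ P.p = pos (pr₁ (csS P Q) (srcS P) ≫ dq P Q)
    (pr₁ (csS P Q) (srcS P) ≫ dm P Q) (by simp) :=
  (pr₂_lg (csS P Q) (srcS P)).trans (comp_dpos _ _ _)

/-- The comparison between the target of the composite and the target of `Q`. -/
def ctS : emb (comp P Q).t ⟶ emb (cr P Q) ≫ emb Q.t := embComp (cr P Q) Q.t

@[simp] lemma hf_ctS :
    hf (ctS P Q) = pr (S := emb (cr P Q)) (S' := emb Q.t) (𝟙 _) (cr P Q) (by simp) := rfl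

/-- The comparison between the source of `Q` and the target of `P`. -/
noncomputable def cmS : emb (cr P Q) ≫ srcS Q ⟶ csS P Q ≫ emb P.t :=
  mkHom (pr (mkD (pr₁ (emb (cr P Q)) (srcS Q)) (pr₂ (emb (cr P Q)) (srcS Q)) (cmS_h P Q))
    (pos (pr₁ (emb (cr P Q)) (srcS Q)) (pr₂ (emb (cr P Q)) (srcS Q)) (cmS_h P Q)) (by simp))
    (by simp) (by simp)

/-- The comparison between the source of `P` and the source of the composite. -/
noncomputable def ccS : csS P Q ≫ srcS P ⟶ srcS (comp P Q) :=
  mkHom (mkTot (pr₁ (csS P Q) (srcS P) ≫ dq P Q) (pr₁ (csS P Q) (srcS P) ≫ dm P Q)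
    (pr₂ (csS P Q) (srcS P)) (by simp)
    (ccS_h P Q)) (by simp) (by simp)

@[simp] lemma hf_cmS : hf (cmS P Q) = pr (mkD (pr₁ (emb (cr P Q)) (srcS Q))
    (pr₂ (emb (cr P Q)) (srcS Q)) (cmS_h P Q))
    (pos (pr₁ (emb (cr P Q)) (srcS Q)) (pr₂ (emb (cr P Q)) (srcS Q)) (cmS_h P Q))
    (by simp) := rfl

@[simp] lemma hf_ccS : hf (ccS P Q) = mkTot (pr₁ (csS P Q) (srcS P) ≫ dq P Q)
    (pr₁ (csS P Q) (srcS P) ≫ dm P Q) (pr₂ (csS P Q) (srcS P)) (by simp)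
    (ccS_h P Q) := rfl

end

section

lemma shape_id (P : PolyMor I J) : ∃ ζ : emb (Hom.g (𝟙 P)) ⟶ 𝟙 (⟨P.base⟩ : SpanBicat E),
    gsS (𝟙 P) = ζ ▷ srcS P ≫ (λ_ _).hom ∧ gtS (𝟙 P) ≫ ζ ▷ emb P.t ≫ (λ_ _).hom = 𝟙 _ := by
  refine ⟨mkHom (toId (𝟙 _)) (by simp) (by simp; rfl), hf_ext ?_, hf_ext ?_⟩
  · simp [-comp_t]
  · simp; rfl

lemma shape_comp {P Q R : PolyMor I J} (φ : P ⟶ Q) (ψ : Q ⟶ R) :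
    ∃ ζ : emb (Hom.g (φ ≫ ψ)) ⟶ emb φ.g ≫ emb ψ.g,
    gsS (φ ≫ ψ) = ζ ▷ srcS R ≫ (α_ _ _ _).hom ≫ emb φ.g ◁ gsS ψ ≫ gsS φ ∧
    gtS (φ ≫ ψ) ≫ ζ ▷ emb R.t ≫ (α_ _ _ _).hom = gtS φ ≫ emb φ.g ◁ gtS ψ := by
  refine ⟨mkHom (pr (𝟙 _) φ.g (by simp)) (by simp) (by simp; rfl), hf_ext ?_, hf_ext ?_⟩
  · simp [-comp_t]
    rfl
  · exact ax_ext (by simp) (ax_ext (by simp) (by simp; rfl))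

/-- Right whiskering leaves the fibres of `Q` alone: `ζ₁` forgets the image of the base point, and
`ζ₂` keeps the point of the fibre of `Q` while remembering its former position in `P.base`. -/
lemma shape_whiskerRight {P P' : PolyMor I J} (φ : P ⟶ P') (Q : PolyMor J K) :
    ∃ (ζ₁ : emb (whiskerRight φ Q).g ≫ emb (cr P' Q) ⟶ emb (cr P Q))
      (ζ₂ : emb (whiskerRight φ Q).g ≫ csS P' Q ⟶ csS P Q ≫ emb φ.g),
      gtS (whiskerRight φ Q) ≫ emb (whiskerRight φ Q).g ◁ ctS P' Q ≫ (α_ _ _ _).inv ≫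
        ζ₁ ▷ emb Q.t = ctS P Q ∧
      (α_ _ _ _).hom ≫ emb (whiskerRight φ Q).g ◁ cmS P' Q ≫ (α_ _ _ _).inv ≫ ζ₂ ▷ emb P'.t =
        ζ₁ ▷ srcS Q ≫ cmS P Q ≫ csS P Q ◁ gtS φ ≫ (α_ _ _ _).inv ∧
      ζ₂ ▷ srcS P' ≫ (α_ _ _ _).hom ≫ csS P Q ◁ gsS φ ≫ ccS P Q =
        (α_ _ _ _).hom ≫ emb (whiskerRight φ Q).g ◁ ccS P' Q ≫ gsS (whiskerRight φ Q) := by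
  -- In a composite with an embedded morphism on the left, the second projection is constrained by
  -- the first. These equations let `simp` remove the redundant coordinates.
  have e₁ : pr₂ (emb (whiskerRight φ Q).g) (emb (cr P' Q)) = (whiskerRight φ Q).ap (pr₁ _ _) :=
    (Category.comp_id _).symm.trans (pr₂_lg _ _)
  have e₂ : pr₂ (emb (whiskerRight φ Q).g) (csS P' Q) ≫ dq P' Q = (whiskerRight φ Q).ap (pr₁ _ _) := pr₂_lg (emb (whiskerRight φ Q).g) (csS P' Q)
  have e₃ : pr₁ (emb (whiskerRight φ Q).g) (csS P' Q) ≫ cr P Q = (pr₂ (emb (whiskerRight φ Q).g) (csS P' Q) ≫ dm P' Q) ≫ Q.p := by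
    rw [Category.assoc, dm_p, ← Category.assoc, e₂, whiskerRight_ap_cr]
  refine ⟨mkHom (pr₁ _ _) (by simp) (by simp [e₁]),
    mkHom (pr (mkD _ _ e₃) (pos _ _ e₃) (by simp)) (by simp) ?_,
    hf_ext ?_, hf_ext ?_, hf_ext ?_⟩
  · simp [comp_g, comp_dpos, e₂]
  · refine ax_ext ?_ ?_
    · simp [-comp_t]
    · simp [-comp_t]
      exact wrBase_cr φ
  · refine ax_ext (ax_ext (dT_ext ?_ ?_) ?_) ?_
    · simp [-comp_t]
    · simp [-comp_t]
    · simp [-comp_t]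
    · simp [-comp_t, comp_g, e₁]
  · refine tot_ext ?_ ?_ ?_
    · simp [-comp_t]
    · simp [-comp_t]
    · simp [-comp_t]

/-- The 2-cell `ψ` acts contravariantly on fibres, so `ζ₂` carries a point of the fibre of `Q'` back
to the fibre of `Q`. It need not be invertible. -/
lemma shape_whiskerLeft (P : PolyMor I J) {Q Q' : PolyMor J K} (ψ : Q ⟶ Q') :
    ∃ (ζ₁ : emb (whiskerLeft P ψ).g ≫ emb (cr P Q') ⟶ emb (cr P Q) ≫ emb ψ.g)
      (ζ₂ : emb (whiskerLeft P ψ).g ≫ csS P Q' ⟶ csS P Q),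
      gtS (whiskerLeft P ψ) ≫ emb (whiskerLeft P ψ).g ◁ ctS P Q' ≫ (α_ _ _ _).inv ≫
        ζ₁ ▷ emb Q'.t = ctS P Q ≫ emb (cr P Q) ◁ gtS ψ ≫ (α_ _ _ _).inv ∧
      (α_ _ _ _).hom ≫ emb (whiskerLeft P ψ).g ◁ cmS P Q' ≫ (α_ _ _ _).inv ≫ ζ₂ ▷ emb P.t =
        ζ₁ ▷ srcS Q' ≫ (α_ _ _ _).hom ≫ emb (cr P Q) ◁ gsS ψ ≫ cmS P Q ∧
      ζ₂ ▷ srcS P ≫ ccS P Q =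
        (α_ _ _ _).hom ≫ emb (whiskerLeft P ψ).g ◁ ccS P Q' ≫ gsS (whiskerLeft P ψ) := by
  have e₁ : pr₂ (emb (whiskerLeft P ψ).g) (emb (cr P Q')) = (whiskerLeft P ψ).ap (pr₁ _ _) :=
    (Category.comp_id _).symm.trans (pr₂_lg _ _)
  have e₂ : pr₂ (emb (whiskerLeft P ψ).g) (csS P Q') ≫ dq P Q' = (whiskerLeft P ψ).ap (pr₁ _ _) :=
    pr₂_lg (emb (whiskerLeft P ψ).g) (csS P Q')
  have e₃ : ψ.ap (pr₁ (emb (whiskerLeft P ψ).g) (csS P Q') ≫ cr P Q) =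
      (pr₂ (emb (whiskerLeft P ψ).g) (csS P Q') ≫ dm P Q') ≫ Q'.p := by
    rw [Category.assoc, dm_p, ← Category.assoc, e₂, whiskerLeft_ap_cr]
  refine ⟨mkHom (pr (pr₁ _ _) (pr₁ _ _ ≫ cr P Q) (by simp)) (by simp)
      (by simp [comp_g, e₁]),
    mkHom (mkD (pr₁ _ _) (ψ.act _ _ e₃) (Hom.act_p ψ _ _ _).symm) (by simp) ?_,
    hf_ext ?_, hf_ext ?_, hf_ext ?_⟩
  · simp [comp_dpos, e₂]
  · refine ax_ext (ax_ext ?_ ?_) ?_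
    · simp [-comp_t]
    · simp [-comp_t]
    · simp [-comp_t]
      exact mkBase_cr _ _ _
  · refine ax_ext (dT_ext ?_ ?_) ?_
    · simp [-comp_t]
    · simp [-comp_t]
    · simp [-comp_t, e₁]
  · refine tot_ext ?_ ?_ ?_
    · simp [-comp_t]
    · simp [-comp_t]
    · simp [-comp_t]

/-- A point of the total object of the composite of `Q` and `R` gives a point of `R.tot` and a point
of `Q.tot`. The 2-cell `ζ₃` separates these two pieces into two successive fibre choices; `ζ₁` and
`ζ₂` are the corresponding maps for the other coordinates. -/
lemma shape_assoc (P : PolyMor I J) (Q : PolyMor J K) (R : PolyMor K L) :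
    ∃ (ζ₁ : (emb (assocHom P Q R).g ≫ emb (cr P (comp Q R))) ≫ emb (cr Q R) ⟶
        emb (cr (comp P Q) R))
      (ζ₂ : (emb (assocHom P Q R).g ≫ emb (cr P (comp Q R))) ≫ csS Q R ⟶
        csS (comp P Q) R ≫ emb (cr P Q))
      (ζ₃ : emb (assocHom P Q R).g ≫ csS P (comp Q R) ⟶ csS (comp P Q) R ≫ csS P Q),
      gtS (assocHom P Q R) ≫ emb (assocHom P Q R).g ◁ ctS P (comp Q R) ≫ (α_ _ _ _).inv ≫
        (emb (assocHom P Q R).g ≫ emb (cr P (comp Q R))) ◁ ctS Q R ≫ (α_ _ _ _).inv ≫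
        ζ₁ ▷ emb R.t = ctS (comp P Q) R ∧
      ζ₁ ▷ srcS R ≫ cmS (comp P Q) R ≫ csS (comp P Q) R ◁ ctS P Q ≫ (α_ _ _ _).inv =
        (α_ _ _ _).hom ≫ (emb (assocHom P Q R).g ≫ emb (cr P (comp Q R))) ◁ cmS Q R ≫
          (α_ _ _ _).inv ≫ ζ₂ ▷ emb Q.t ∧
      ζ₂ ▷ srcS Q ≫ (α_ _ _ _).hom ≫ csS (comp P Q) R ◁ cmS P Q ≫ (α_ _ _ _).inv =
        (α_ _ _ _).hom ≫ (emb (assocHom P Q R).g ≫ emb (cr P (comp Q R))) ◁ ccS Q R ≫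
          (α_ _ _ _).hom ≫ emb (assocHom P Q R).g ◁ cmS P (comp Q R) ≫ (α_ _ _ _).inv ≫
          ζ₃ ▷ emb P.t ∧
      ζ₃ ▷ srcS P ≫ (α_ _ _ _).hom ≫ csS (comp P Q) R ◁ ccS P Q ≫ ccS (comp P Q) R =
        (α_ _ _ _).hom ≫ emb (assocHom P Q R).g ◁ ccS P (comp Q R) ≫ gsS (assocHom P Q R) := by
  have e₀ : pr₂ (emb (assocHom P Q R).g) (emb (cr P (comp Q R))) = (assocHom P Q R).ap (pr₁ _ _) :=
    (Category.comp_id _).symm.trans (pr₂_lg _ _)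
  have e₁ : pr₂ (emb (assocHom P Q R).g ≫ emb (cr P (comp Q R))) (emb (cr Q R)) =
      (assocHom P Q R).ap (pr₁ _ _ ≫ pr₁ _ _) ≫ cr P (comp Q R) := by
    refine (Category.comp_id _).symm.trans ((pr₂_lg _ _).trans ?_)
    simp [e₀]
  have e₂ : pr₂ (emb (assocHom P Q R).g ≫ emb (cr P (comp Q R))) (csS Q R) ≫ dq Q R =
      (assocHom P Q R).ap (pr₁ _ _ ≫ pr₁ _ _) ≫ cr P (comp Q R) := by
    refine (pr₂_lg _ (csS Q R)).trans ?_
    simp [e₀]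
  have h₂ : (pr₁ (emb (assocHom P Q R).g ≫ emb (cr P (comp Q R))) (csS Q R) ≫ pr₁ _ _) ≫
      cr (comp P Q) R = (pr₂ (emb (assocHom P Q R).g ≫ emb (cr P (comp Q R))) (csS Q R) ≫
        dm Q R) ≫ R.p := by
    rw [Category.assoc _ (dm Q R), dm_p, ← Category.assoc _ (dq Q R), e₂]
    simp
  have e₃ : pr₂ (emb (assocHom P Q R).g) (csS P (comp Q R)) ≫ dq P (comp Q R) =
      (assocHom P Q R).ap (pr₁ _ _) := pr₂_lg _ (csS P (comp Q R))
  have h₃ : (assocHom P Q R).ap (pr₁ (emb (assocHom P Q R).g) (csS P (comp Q R))) ≫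
      cr P (comp Q R) = (pr₂ (emb (assocHom P Q R).g) (csS P (comp Q R)) ≫ dm P (comp Q R)) ≫
        (comp Q R).p := by
    rw [Category.assoc, dm_p, ← Category.assoc, e₃]
  refine ⟨mkHom (pr₁ _ _ ≫ pr₁ _ _) (by simp) (by simp [e₁]),
    mkHom (pr (mkD _ _ h₂) (pos _ _ h₂) (by simp)) (by simp) ?_,
    mkHom (pr (mkD _ _ (ah_h (cr_of_eq (ah_k h₃)))) (mkD _ _ (ah_h' (ah_k h₃))) (by simp))
      (by simp) ?_, hf_ext ?_, hf_ext ?_, hf_ext ?_, hf_ext ?_⟩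
  · simp [comp_dpos, e₂]
  · simp [comp_dpos, e₃]
  · refine ax_ext ?_ ?_
    · simp [-comp_t]
    · simpa [-comp_t, Hom.ap] using assocHom_ap_cr_cr (P := P) (Q := Q) (R := R) (𝟙 _)
  · refine ax_ext (ax_ext (dT_ext ?_ ?_) ?_) ?_
    · simp [-comp_t]
    · simp [-comp_t]
    · simp [-comp_t]
    · simp [-comp_t, e₁]
  · refine ax_ext (ax_ext (dT_ext ?_ ?_) (dT_ext ?_ ?_)) ?_
    · simp [-comp_t]
    · simp [-comp_t]
    · simp [-comp_t]
    · simp [-comp_t]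
    · simp [-comp_t, e₀]
  · refine tot_ext ?_ ?_ (tot_ext ?_ ?_ ?_)
    · simp [-comp_t]
    · simp [-comp_t]
    · simp [-comp_t]
    · simp [-comp_t]
    · simp [-comp_t]

lemma shape_leftUnitor (P : PolyMor I J) : ∃ ζ : emb (luHom P).g ⟶ emb (cr (idP I) P),
    gsS (luHom P) = ζ ▷ srcS P ≫ cmS (idP I) P ≫ csS (idP I) P ◁ 𝟙 (emb (𝟙 I)) ≫
      ccS (idP I) P ∧
    gtS (luHom P) ≫ ζ ▷ emb P.t = ctS (idP I) P := by
  refine ⟨mkHom (𝟙 _) (by simp) (by rw [Category.id_comp]; rfl), hf_ext ?_, hf_ext ?_⟩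
  · simp [-comp_t]
    rfl
  · exact ax_ext (by simp [-comp_t]) (by simp [-comp_t]; rfl)

/-- The fibre of the identity polynomial over a point is that point itself, so `ζ` chooses the only
available fibre point, namely `cr P (idP J)`. -/
lemma shape_rightUnitor (P : PolyMor I J) : ∃ ζ : emb (ruHom P).g ⟶ csS P (idP J),
    gsS (ruHom P) = ζ ▷ srcS P ≫ ccS P (idP J) ∧
    gtS (ruHom P) ≫ ζ ▷ emb P.t =
      ctS P (idP J) ≫ emb (cr P (idP J)) ◁ 𝟙 (emb (𝟙 J)) ≫ cmS P (idP J) := by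
  refine ⟨mkHom (mkD (𝟙 _) (cr P (idP J)) (by simp)) (by simp) ?_, hf_ext ?_, hf_ext ?_⟩
  · simp [Hom.ap]
  · refine tot_ext ?_ ?_ ?_
    · simp [-comp_t]
    · simp [-comp_t]
    · simp [-comp_t]
  · refine ax_ext (dT_ext ?_ ?_) ?_
    · simp [-comp_t]
    · simp [-comp_t]
    · simp [-comp_t, Hom.ap]

end

-- The total object of a composite was defined as a pullback along the right leg of `csS P Q`, so
-- the span of the composite is, up to this isomorphism, a composite of spans.
variable (P : PolyMor I J) (Q : PolyMor J K) in
lemma isIso_ccS : IsIso (ccS P Q) := by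
  have e : ctx P Q ≫ P.p = mkD (comp P Q).p (ctm P Q) (comp_p_cr P Q) ≫ dpos P Q := by simp
  refine isIso_of_isIso_hf _ ⟨pr (S := csS P Q) (S' := srcS P) (mkD (comp P Q).p (ctm P Q)
    (comp_p_cr P Q)) (ctx P Q) e.symm, ?_, ?_⟩
  · exact ax_ext (dT_ext (by simp) (by simp)) (by simp)
  · exact tot_ext (by simp) (by simp) (by simp)

end PolyMor

open SpanBicat PolyMor in
/-- The presentation of polynomials by spans. -/
noncomputable def polyShape (E : Type u) [Category.{v} E] [ChosenPullbacks E]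
    [ChosenDistributivityPullbacks E] : Shape (SpanBicat E) (PolyBicat E) where
  ob I := ⟨I.as⟩
  base P := ⟨PolyMor.base P⟩
  src P := srcS P
  tgt P := emb (PolyMor.t P)
  g φ := emb (PolyMor.Hom.g φ)
  gt φ := gtS φ
  gs φ := gsS φ
  cr P Q := emb (PolyMor.cr P Q)
  cs P Q := csS P Q
  ct P Q := ctS P Q
  cm P Q := cmS P Q
  cc P Q := ccS P Q
  un I := 𝟙 (emb (𝟙 I.as))
  id_eq P := shape_id P
  comp_eq φ ψ := shape_comp φ ψ
  whiskerRight_eq φ Q := shape_whiskerRight φ Q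
  whiskerLeft_eq P _ _ ψ := shape_whiskerLeft P ψ
  assoc_eq P Q R := shape_assoc P Q R
  leftUnitor_eq P := shape_leftUnitor P
  rightUnitor_eq P := shape_rightUnitor P

instance {I J K : PolyBicat E} (P : I ⟶ J) (Q : J ⟶ K) : IsIso ((polyShape E).cc P Q) :=
  PolyMor.isIso_ccS P Q

instance {I J K : SpanBicat E} (P : I ⟶ J) (Q : J ⟶ K) : IsIso ((spanShape E).cc P Q) :=
  ⟨⟨eqToHom (LocallyDiscrete.eq_of_hom ((spanShape E).cc P Q)).symm, Subsingleton.elim _ _,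
    Subsingleton.elim _ _⟩⟩

end LevelTwo

end PolyUniv

namespace PolyUniv

open Bicategory ChosenPullbacksAlong ChosenDistributivityPullbacks

/-! ### The embedding of spans into polynomials -/

section LinearPolynomials

variable {E : Type u} [Category.{v} E] [ChosenPullbacks E] [ChosenDistributivityPullbacks E]

set_option linter.unusedSectionVars false

namespace PolyMor

open SpanBicat

variable {I J K : E}

/-- The linear polynomial associated with a span. -/
@[reducible] def lin {I J : SpanBicat E} (S : I ⟶ J) : PolyMor I.as J.as where
  tot := ax S
  base := ax S
  s := lg S
  p := 𝟙 _
  t := rg S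

section

variable {I J K : SpanBicat E}

lemma act_lin {S : I ⟶ J} {Q : PolyMor I.as J.as} (φ : lin S ⟶ Q) {W : E} (b : W ⟶ ax S)
    (m : W ⟶ Q.tot) (h : φ.ap b = m ≫ Q.p) : φ.act b m h = b :=
  (Category.comp_id _).symm.trans (Hom.act_p φ b m h)

/-- The fibres of a linear polynomial are single points, so a 2-cell out of one has no freedom in
its fibre action. -/
lemma lin_hom_ext {S : I ⟶ J} {Q : PolyMor I.as J.as} {φ ψ : lin S ⟶ Q}
    (h : ∀ {W : E} (b : W ⟶ ax S), φ.ap b = ψ.ap b) : φ = ψ :=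
  hom_ext h fun b m h₁ h₂ => (act_lin φ b m h₁).trans (act_lin ψ b m h₂).symm

/-- The 2-cell of linear polynomials given by a morphism of spans. -/
def linHom {S S' : I ⟶ J} (φ : S ⟶ S') : lin S ⟶ lin S' :=
  Hom.ofAct (hf φ) (hf_rg φ) (fun _ b _ _ => b) (fun _ _ _ _ => Category.comp_id _)
    (fun _ b m h => by
      have h' : b ≫ hf φ = m := h.trans (Category.comp_id _)
      simp [← h'])

@[simp] lemma linHom_ap {S S' : I ⟶ J} (φ : S ⟶ S') {W : E} (b : W ⟶ ax S) :
    (linHom φ).ap b = b ≫ hf φ := rfl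

lemma lin_h {P : PolyMor I.as J.as} {S : J ⟶ K} {W : E} (x : W ⟶ (comp P (lin S)).base) :
    x ≫ cr P (lin S) = (x ≫ cr P (lin S)) ≫ (lin S).p := (Category.comp_id _).symm

lemma pos_lin {P : PolyMor I.as J.as} {S : J ⟶ K} {W : E}
    (x : W ⟶ (comp P (lin S)).base) (m : W ⟶ ax S)
    (h : x ≫ cr P (lin S) = m ≫ (lin S).p) :
    pos x m h = pos x (x ≫ cr P (lin S)) (lin_h x) := by
  obtain rfl : x ≫ cr P (lin S) = m := h.trans (Category.comp_id _)
  rfl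

section

variable (S : I ⟶ J) (S' : J ⟶ K)

/-- The action of `linComp` on bases. -/
def linCompBase : ax (S ≫ S') ⟶ (comp (lin S) (lin S')).base :=
  mkBase (Q := lin S') (pr₂ S S') (fun _ z _ _ => z ≫ pr₁ S S') (fun _ z m h => by
    have h' : z ≫ pr₂ S S' = m := h.trans (Category.comp_id _)
    simp [← h'])

variable {S S'}

lemma linCompBase_cr {W : E} (b : W ⟶ ax (S ≫ S')) :
    (b ≫ linCompBase S S') ≫ cr (lin S) (lin S') = b ≫ pr₂ S S' :=
  (Category.assoc _ _ _).trans (congrArg (b ≫ ·) (mkBase_cr _ _ _))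

lemma pos_linCompBase {W : E} (b : W ⟶ ax (S ≫ S')) (m : W ⟶ ax S')
    (h : (b ≫ linCompBase S S') ≫ cr (lin S) (lin S') = m ≫ (lin S').p) :
    pos (b ≫ linCompBase S S') m h = b ≫ pr₁ S S' :=
  pos_precomp_mkBase _ _ _ (by simp) _ _ ((linCompBase_cr b).symm.trans h)

variable (S S')

/-- On bases, a pair of matching points becomes the element that assigns the first point to the
unique fibre point over the second. -/
noncomputable def linComp : lin (S ≫ S') ⟶ comp (lin S) (lin S') :=
  Hom.ofAct (linCompBase S S')
    ((Category.assoc _ _ _).symm.trans (congrArg (· ≫ rg S') (mkBase_cr _ _ _)))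
    (fun _ b _ _ => b) (fun _ _ _ _ => Category.comp_id _)
    (fun _ b m h => by
      have h₁ := pos_of_eq h
      rw [pos_linCompBase] at h₁
      have h₂ : b ≫ pr₁ S S' = m ≫ ctx _ _ := h₁.trans (Category.comp_id _)
      simp [reassoc_of% h₂])

lemma linCompInv_h₀ : pos (𝟙 _) (𝟙 _ ≫ cr (lin S) (lin S')) (lin_h _) ≫ rg S =
    cr (lin S) (lin S') ≫ lg S' := (pos_t _ _ _).trans (by simp)

/-- The inverse of `linComp`. -/
noncomputable def linCompInv : comp (lin S) (lin S') ⟶ lin (S ≫ S') :=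
  Hom.ofAct (pr (pos (𝟙 _) (𝟙 _ ≫ cr (lin S) (lin S')) (lin_h _)) (cr (lin S) (lin S'))
      (linCompInv_h₀ S S')) (by simp)
    (fun _ b _ _ => mkTot b (b ≫ cr (lin S) (lin S'))
      (pos b (b ≫ cr (lin S) (lin S')) (lin_h _)) (lin_h _) (Category.comp_id _))
    (by simp) (fun _ b m h => by
      have h' : _ = m := h.trans (Category.comp_id _)
      simp [← h'])

variable {S S'}

@[simp] lemma linComp_ap_cr {W : E} (b : W ⟶ ax (S ≫ S')) :
    (linComp S S').ap b ≫ cr (lin S) (lin S') = b ≫ pr₂ S S' := linCompBase_cr b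

@[simp] lemma pos_linComp_ap {W : E} (b : W ⟶ ax (S ≫ S')) (m : W ⟶ ax S')
    (h : (linComp S S').ap b ≫ cr (lin S) (lin S') = m ≫ (lin S').p) :
    pos ((linComp S S').ap b) m h = b ≫ pr₁ S S' := pos_linCompBase b m h

lemma linCompInv_h {W : E} (b : W ⟶ (comp (lin S) (lin S')).base) :
    pos b (b ≫ cr (lin S) (lin S')) (lin_h _) ≫ rg S = (b ≫ cr (lin S) (lin S')) ≫ lg S' :=
  pos_t _ _ _

@[simp] lemma linCompInv_ap {W : E} (b : W ⟶ (comp (lin S) (lin S')).base) :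
    (linCompInv S S').ap b = pr (pos b (b ≫ cr (lin S) (lin S')) (lin_h _))
      (b ≫ cr (lin S) (lin S')) (linCompInv_h b) := by
  refine ax_ext ?_ ?_
  · refine (Category.assoc _ _ _).trans ((congrArg (b ≫ ·) (pr_pr₁ _ _ (linCompInv_h₀ S S'))).trans ?_)
    simp
  · refine (Category.assoc _ _ _).trans ((congrArg (b ≫ ·) (pr_pr₂ _ _ (linCompInv_h₀ S S'))).trans ?_)
    simp

@[simp] lemma linCompInv_act {W : E} (b : W ⟶ (comp (lin S) (lin S')).base) (m : W ⟶ ax (S ≫ S'))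
    (h : (linCompInv S S').ap b = m ≫ (lin (S ≫ S')).p) :
    (linCompInv S S').act b m h = mkTot b (b ≫ cr (lin S) (lin S'))
      (pos b (b ≫ cr (lin S) (lin S')) (lin_h _)) (lin_h _) (Category.comp_id _) :=
  Hom.ofAct_act _ _ _ _ _ (by intros; simp) _ _ _

variable (S S')

lemma linComp_linCompInv : linComp S S' ≫ linCompInv S S' = 𝟙 _ :=
  lin_hom_ext fun b => ax_ext (by simp) (by simp)

lemma ctm_lin {P : PolyMor I.as J.as} : ctm P (lin S') = (comp P (lin S')).p ≫ cr P (lin S') :=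
  (Category.comp_id _).symm.trans (ctm_p P (lin S'))

lemma ctx_lin : ctx (lin S) (lin S') =
    pos (comp (lin S) (lin S')).p ((comp (lin S) (lin S')).p ≫ cr _ _) (lin_h _) := by
  refine (Category.comp_id _).symm.trans ((ctx_p (lin S) (lin S')).trans ?_)
  exact pos_lin _ _ _

/-- The source is a composite polynomial, linear only up to isomorphism, so `lin_hom_ext` does not
apply and the fibre action has to be checked too. -/
lemma linCompInv_linComp : linCompInv S S' ≫ linComp S S' = 𝟙 _ := by
  refine hom_ext (fun x => ?_) (fun x y h h' => ?_)
  · refine base_ext (by simp) (fun z m h₁ h₂ => ?_)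
    have e := (pos_lin (z ≫ x) m (by simpa using h₂)).symm
    simpa using e
  · obtain rfl : x = y ≫ _ := by simpa using h'
    exact tot_ext (by simp) (by simp [ctm_lin]) (by simp [ctx_lin])

end

lemma lin_naturality_left {S S₁ : I ⟶ J} (φ : S ⟶ S₁) (S' : J ⟶ K) :
    linHom (φ ▷ S') ≫ linComp S₁ S' = linComp S S' ≫ whiskerRight (linHom φ) (lin S') := by
  refine lin_hom_ext fun b => base_ext ?_ fun z m h₁ h₂ => ?_
  · simp
  · simp

lemma lin_naturality_right (S : I ⟶ J) {S' S₁ : J ⟶ K} (φ : S' ⟶ S₁) :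
    linHom (S ◁ φ) ≫ linComp S S₁ = linComp S S' ≫ whiskerLeft (lin S) (linHom φ) := by
  refine lin_hom_ext fun b => base_ext ?_ fun z m h₁ h₂ => ?_
  · simp
  · simp

lemma lin_associator {L : SpanBicat E} (S : I ⟶ J) (S' : J ⟶ K) (S'' : K ⟶ L) :
    linHom (α_ S S' S'').hom ≫ linComp S (S' ≫ S'') ≫ whiskerLeft (lin S) (linComp S' S'') =
      linComp (S ≫ S') S'' ≫ whiskerRight (linComp S S') (lin S'') ≫
        assocHom (lin S) (lin S') (lin S'') := by
  refine lin_hom_ext fun b => base_ext (base_ext ?_ fun z m h₁ h₂ => ?_) fun z m h₁ h₂ => ?_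
  · simp
  · simp
  · simp

lemma lin_leftUnitor (S : I ⟶ J) : linHom (λ_ S).hom =
    linComp (𝟙 I) S ≫ whiskerRight (𝟙 (idP I.as)) (lin S) ≫ luHom (lin S) := by
  have e : whiskerRight (𝟙 (idP I.as)) (lin S) = 𝟙 _ := id_whiskerRight' _ _
  refine lin_hom_ext fun b => ?_
  erw [e, Category.id_comp]
  exact (linComp_ap_cr b).symm.trans
    (comp_ap (Q := comp (idP I.as) (lin S)) (linComp (𝟙 I) S) (luHom (lin S)) b).symm

lemma lin_rightUnitor (S : I ⟶ J) : linHom (ρ_ S).hom =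
    linComp S (𝟙 J) ≫ whiskerLeft (lin S) (𝟙 (idP J.as)) ≫ ruHom (lin S) := by
  have e : whiskerLeft (lin S) (𝟙 (idP J.as)) = 𝟙 _ := whiskerLeft_id' _ _
  refine lin_hom_ext fun b => ?_
  erw [e, Category.id_comp]
  exact (pos_linComp_ap b _ (lin_h _)).symm.trans ((ruHom_ap (P := lin S) _).symm.trans
    (comp_ap (Q := comp (lin S) (idP J.as)) (linComp S (𝟙 J)) (ruHom (lin S)) b).symm)

end

end PolyMor

open SpanBicat PolyMor

variable (E) in
/-- The embedding of spans into polynomials. -/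
noncomputable def linOn : OplaxOn (fun I : SpanBicat E => PolyBicat.mk I.as) where
  map S := lin S
  map₂ φ := linHom φ
  mapId I := 𝟙 (idP I.as)
  mapComp S S' := linComp S S'
  map₂_id S := lin_hom_ext (I := _) (J := _) fun b => by
    exact (Category.comp_id b).trans (id_ap (P := lin S) b).symm
  map₂_comp φ ψ := lin_hom_ext fun b => by
    exact (Category.assoc _ _ _).symm.trans (comp_ap (linHom φ) (linHom ψ) b).symm
  naturality_left φ S' := lin_naturality_left φ S'
  naturality_right S _ _ φ := lin_naturality_right S φ
  associator S S' S'' := lin_associator S S' S''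
  leftUnitor S := lin_leftUnitor S
  rightUnitor S := lin_rightUnitor S

instance : (linOn E).IsPseudo where
  isIso_mapId I := inferInstanceAs (IsIso (𝟙 (idP I.as)))
  isIso_mapComp S S' := ⟨linCompInv S S', linComp_linCompInv S S', linCompInv_linComp S S'⟩

end LinearPolynomials

end PolyUniv

namespace PolyUniv

open Bicategory ChosenPullbacksAlong ChosenDistributivityPullbacks

/-! ### Polynomials as Kan extensions of linear polynomials -/

section Evaluation

variable {E : Type u} [Category.{v} E] [ChosenPullbacks E] [ChosenDistributivityPullbacks E]

open SpanBicat

namespace PolyMor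

variable {a b i k l : SpanBicat E} {s s' : b ⟶ i} {j j' : b ⟶ k}
  {X X' : PolyMor i.as k.as} {Y : PolyMor k.as l.as}

/-- The generalised element of the base of `X` determined by an element of `X`. -/
def val (x : lin j ⟶ comp (lin s) X) {W : E} (w : W ⟶ ax j) : W ⟶ X.base :=
  x.ap w ≫ cr (lin s) X

/-- The lifting of points of the fibres of `X` determined by an element of `X`. -/
noncomputable def lif (x : lin j ⟶ comp (lin s) X) {W : E} (w : W ⟶ ax j) (m : W ⟶ X.tot)
    (h : val x w = m ≫ X.p) : W ⟶ ax s :=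
  pos (x.ap w) m h

section

variable (x : lin j ⟶ comp (lin s) X)

@[simp] lemma comp_val {V W : E} (z : V ⟶ W) (w : W ⟶ ax j) :
    z ≫ val x w = val x (z ≫ w) := by
  simp [val]

@[simp] lemma comp_lif {V W : E} (z : V ⟶ W) (w : W ⟶ ax j) (m : W ⟶ X.tot)
    (h : val x w = m ≫ X.p) :
    z ≫ lif x w m h = lif x (z ≫ w) (z ≫ m) (by rw [← comp_val, h, Category.assoc]) := by
  refine (precomp_pos (P := lin s) (Q := X) z _ m h).trans ?_
  simp only [Hom.precomp_ap]
  rfl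

@[simp] lemma val_t {W : E} (w : W ⟶ ax j) : val x w ≫ X.t = w ≫ rg j :=
  (Category.assoc _ _ _).trans (Hom.ap_t x w)

@[simp] lemma lif_rg {W : E} (w : W ⟶ ax j) (m : W ⟶ X.tot) (h : val x w = m ≫ X.p) :
    lif x w m h ≫ rg s = m ≫ X.s :=
  pos_t (P := lin s) (Q := X) _ _ _

@[simp] lemma lif_lg {W : E} (w : W ⟶ ax j) (m : W ⟶ X.tot) (h : val x w = m ≫ X.p) :
    lif x w m h ≫ lg s = w ≫ lg j := by
  -- The condition on left legs is hidden in the fibre action of `x`: on the total point built from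
  -- the lift, that action returns `w`, because the source of `x` is linear.
  have e := x.act_s w (mkTot (x.ap w) m (lif x w m h) h (Category.comp_id _))
    (mkTot_p _ _ _ _ _).symm
  rw [act_lin] at e
  rw [e, comp_s]
  exact (mkTot_ctx_assoc (P := lin s) (Q := X) _ _ _ _ _ _).symm

end

/-- An element of `X` over the linear polynomials of `j` and `s` is a generalised element of
`X.base` together with a lift of each point of its fibre to the apex of `s`; the rest of the 2-cell
is forced by linearity. -/
lemma ext_val {x y : lin j ⟶ comp (lin s) X} (h : ∀ {W : E} (w : W ⟶ ax j), val x w = val y w)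
    (h' : ∀ {W : E} (w : W ⟶ ax j) (m : W ⟶ X.tot) (h₁ : val x w = m ≫ X.p)
      (h₂ : val y w = m ≫ X.p), lif x w m h₁ = lif y w m h₂) : x = y := by
  refine lin_hom_ext (Q := comp (lin s) X) fun w => base_ext (h w) fun z m h₁ h₂ => ?_
  have e := h' (z ≫ w) m (by rw [← comp_val, ← h₁, Category.assoc]; rfl)
    (by rw [← comp_val, ← h₂, Category.assoc]; rfl)
  simpa [lif] using e

section

variable (v : ax j ⟶ X.base) (hv : v ≫ X.t = rg j)
  (k : ∀ (W : E) (w : W ⟶ ax j) (m : W ⟶ X.tot), w ≫ v = m ≫ X.p → (W ⟶ ax s))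
  (kl : ∀ (W : E) (w : W ⟶ ax j) (m : W ⟶ X.tot) (h : w ≫ v = m ≫ X.p),
    k W w m h ≫ lg s = w ≫ lg j)
  (kr : ∀ (W : E) (w : W ⟶ ax j) (m : W ⟶ X.tot) (h : w ≫ v = m ≫ X.p),
    k W w m h ≫ rg s = m ≫ X.s)
  (nat : ∀ (U V : E) (w : U ⟶ V) (z : V ⟶ ax j) (m : V ⟶ X.tot)
    (h : z ≫ v = m ≫ X.p),
    w ≫ k V z m h = k U (w ≫ z) (w ≫ m) (by simp only [Category.assoc, h]))

/-- The element given by generalised elements of the base and of the fibres. -/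
noncomputable def mkEl : lin j ⟶ comp (lin s) X :=
  Hom.ofAct (mkBase (P := lin s) (Q := X) v k kr)
    ((Category.assoc _ _ _).symm.trans ((congrArg (· ≫ X.t) (mkBase_cr _ _ _)).trans hv))
    (fun _ w _ _ => w) (fun _ _ _ _ => Category.comp_id _) (fun W w m h => by
      have h₁ := pos_of_eq h
      have h₂ := cr_of_eq h
      rw [Category.assoc, mkBase_cr] at h₂
      have h₃ : _ = m ≫ ctx _ _ :=
        (pos_precomp_mkBase (P := lin s) (Q := X) v k kr nat w _ h₂).symm.trans
          (h₁.trans (Category.comp_id _))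
      rw [comp_s, ← Category.assoc, ← h₃]
      exact (kl _ _ _ _).symm)

@[simp] lemma val_mkEl {W : E} (w : W ⟶ ax j) : val (mkEl v hv k kl kr nat) w = w ≫ v :=
  (Category.assoc _ _ _).trans (congrArg (w ≫ ·) (mkBase_cr _ _ _))

@[simp] lemma lif_mkEl {W : E} (w : W ⟶ ax j) (m : W ⟶ X.tot)
    (h : val (mkEl v hv k kl kr nat) w = m ≫ X.p) :
    lif (mkEl v hv k kl kr nat) w m h = k W w m ((val_mkEl v hv k kl kr nat w).symm.trans h) :=
  pos_precomp_mkBase (P := lin s) (Q := X) v k kr nat w m _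

end

/-- Postcomposition of an element with a 2-cell. -/
noncomputable def pushE (x : lin j ⟶ comp (lin s) X) (f : X ⟶ X') : lin j ⟶ comp (lin s) X' :=
  x ≫ whiskerLeft (lin s) f

/-- Reindexing of an element. -/
noncomputable def covE (σ : s ⟶ s') (x : lin j ⟶ comp (lin s) X) : lin j ⟶ comp (lin s') X :=
  x ≫ whiskerRight (linHom σ) X

/-- Reindexing of an element. -/
noncomputable def conE (τ : j' ⟶ j) (x : lin j ⟶ comp (lin s) X) : lin j' ⟶ comp (lin s) X :=
  linHom τ ≫ x

/-- Restriction of an element. -/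
noncomputable def pullE (w : a ⟶ b) (x : lin j ⟶ comp (lin s) X) :
    lin (w ≫ j) ⟶ comp (lin (w ≫ s)) X :=
  linComp w j ≫ whiskerLeft (lin w) x ≫ assocInv (lin w) (lin s) X ≫ whiskerRight (linCompInv w s) X

/-- The product of elements. -/
noncomputable def prodE {m : a ⟶ l} (r : a ⟶ b) (x : lin j ⟶ comp (lin s) X)
    (y : lin m ⟶ comp (lin (r ≫ j)) Y) : lin m ⟶ comp (lin (r ≫ s)) (comp X Y) :=
  y ≫ whiskerRight (linComp r j) Y ≫ assocHom (lin r) (lin j) Y ≫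
    whiskerLeft (lin r) (whiskerRight x Y ≫ assocHom (lin s) X Y) ≫
      assocInv (lin r) (lin s) (comp X Y) ≫ whiskerRight (linCompInv r s) (comp X Y)

section

variable (x : lin j ⟶ comp (lin s) X) {W : E}

@[simp] lemma val_pushE (f : X ⟶ X') (w : W ⟶ ax j) : val (pushE x f) w = f.ap (val x w) := by
  simp [pushE, val]

@[simp] lemma lif_pushE (f : X ⟶ X') (w : W ⟶ ax j) (m : W ⟶ X'.tot)
    (h : val (pushE x f) w = m ≫ X'.p) : lif (pushE x f) w m h =
      lif x w (f.act (val x w) m ((val_pushE x f w).symm.trans h)) (Hom.act_p f _ _ _).symm := by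
  simp [pushE, lif, val]

@[simp] lemma val_covE (σ : s ⟶ s') (w : W ⟶ ax j) : val (covE σ x) w = val x w := by
  simp [covE, val]

@[simp] lemma lif_covE (σ : s ⟶ s') (w : W ⟶ ax j) (m : W ⟶ X.tot)
    (h : val (covE σ x) w = m ≫ X.p) : lif (covE σ x) w m h =
      lif x w m ((val_covE x σ w).symm.trans h) ≫ hf σ := by
  simp [covE, lif]

@[simp] lemma val_conE (τ : j' ⟶ j) (w : W ⟶ ax j') : val (conE τ x) w = val x (w ≫ hf τ) := by
  simp [conE, val]

@[simp] lemma lif_conE (τ : j' ⟶ j) (w : W ⟶ ax j') (m : W ⟶ X.tot)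
    (h : val (conE τ x) w = m ≫ X.p) : lif (conE τ x) w m h =
      lif x (w ≫ hf τ) m ((val_conE x τ w).symm.trans h) := by
  simp [conE, lif]

@[simp] lemma val_pullE (r : a ⟶ b) (w : W ⟶ ax (r ≫ j)) :
    val (pullE r x) w = val x (w ≫ pr₂ r j) := by
  simp [pullE, val]

lemma lif_pullE_h (r : a ⟶ b) (w : W ⟶ ax (r ≫ j)) (m : W ⟶ X.tot)
    (h : val x (w ≫ pr₂ r j) = m ≫ X.p) :
    (w ≫ pr₁ r j) ≫ rg r = lif x (w ≫ pr₂ r j) m h ≫ lg s := by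
  simp

@[simp] lemma lif_pullE (r : a ⟶ b) (w : W ⟶ ax (r ≫ j)) (m : W ⟶ X.tot)
    (h : val (pullE r x) w = m ≫ X.p) : lif (pullE r x) w m h =
      pr (w ≫ pr₁ r j) (lif x (w ≫ pr₂ r j) m ((val_pullE x r w).symm.trans h))
        (lif_pullE_h x r w m _) := by
  refine ax_ext ?_ ?_
  · simp [pullE, lif]
  · simp [pullE, lif]

end

section

variable {m : a ⟶ l} (r : a ⟶ b) (x : lin j ⟶ comp (lin s) X)
    (y : lin m ⟶ comp (lin (r ≫ j)) Y) {W : E} (w : W ⟶ ax m)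

@[simp] lemma val_prodE_cr : val (prodE r x y) w ≫ cr X Y = val y w := by
  simp [prodE, val]

lemma val_prodE_h {n : W ⟶ Y.tot} (h : val (prodE r x y) w ≫ cr X Y = n ≫ Y.p) :
    val y w = n ≫ Y.p := (val_prodE_cr r x y w).symm.trans h

@[simp] lemma pos_val_prodE (n : W ⟶ Y.tot) (h : val (prodE r x y) w ≫ cr X Y = n ≫ Y.p) :
    pos (val (prodE r x y) w) n h = val x (lif y w n (val_prodE_h r x y w h) ≫ pr₂ r j) := by
  simp [prodE, val, lif]

lemma lif_prodE_h {n : W ⟶ (comp X Y).tot} (h : val (prodE r x y) w = n ≫ (comp X Y).p) :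
    val y w = (n ≫ ctm X Y) ≫ Y.p := val_prodE_h r x y w (cr_of_eq h)

lemma lif_prodE_h₂ {n : W ⟶ (comp X Y).tot} (h : val (prodE r x y) w = n ≫ (comp X Y).p) :
    val x (lif y w (n ≫ ctm X Y) (lif_prodE_h r x y w h) ≫ pr₂ r j) = (n ≫ ctx X Y) ≫ X.p :=
  (pos_val_prodE r x y w _ (cr_of_eq h)).symm.trans (pos_of_eq h)

lemma lif_prodE_h₃ {n : W ⟶ (comp X Y).tot} (h : val (prodE r x y) w = n ≫ (comp X Y).p) :
    (lif y w (n ≫ ctm X Y) (lif_prodE_h r x y w h) ≫ pr₁ r j) ≫ rg r =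
      lif x (lif y w (n ≫ ctm X Y) (lif_prodE_h r x y w h) ≫ pr₂ r j) (n ≫ ctx X Y)
        (lif_prodE_h₂ r x y w h) ≫ lg s := by
  simp

@[simp] lemma lif_prodE (n : W ⟶ (comp X Y).tot) (h : val (prodE r x y) w = n ≫ (comp X Y).p) :
    lif (prodE r x y) w n h = pr (lif y w (n ≫ ctm X Y) (lif_prodE_h r x y w h) ≫ pr₁ r j)
      (lif x (lif y w (n ≫ ctm X Y) (lif_prodE_h r x y w h) ≫ pr₂ r j) (n ≫ ctx X Y)
        (lif_prodE_h₂ r x y w h)) (lif_prodE_h₃ r x y w h) := by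
  refine ax_ext ?_ ?_
  · simp [prodE, lif]
  · simp [prodE, lif]

end

/-- The universal element of a polynomial. -/
noncomputable def uEl {I J : E} (P : PolyMor I J) : lin (emb P.t) ⟶ comp (lin (srcS P)) P :=
  mkEl (s := srcS P) (j := emb P.t) (X := P) (𝟙 _) (Category.id_comp _) (fun _ _ m _ => m)
    (fun _ w m h => by
      have : m ≫ P.p = w := h.symm.trans (Category.comp_id _)
      simp [this])
    (fun _ _ _ _ => rfl) (fun _ _ _ _ _ _ => rfl)

section

variable {I J K : E}

@[simp] lemma val_uEl (P : PolyMor I J) {W : E} (w : W ⟶ P.base) : val (uEl P) w = w :=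
  (val_mkEl _ _ _ _ _ _ _).trans (Category.comp_id _)

@[simp] lemma lif_uEl (P : PolyMor I J) {W : E} (w : W ⟶ P.base) (m : W ⟶ P.tot)
    (h : val (uEl P) w = m ≫ P.p) : lif (uEl P) w m h = m :=
  lif_mkEl _ _ _ _ _ _ _ _ _

lemma pushE_uEl {P Q : PolyMor I J} (φ : P ⟶ Q) :
    pushE (uEl P) φ = conE (gtS φ) (covE (gsS φ) (pullE (emb φ.g) (uEl Q))) := by
  refine ext_val (fun w => ?_) (fun w m h₁ h₂ => ?_)
  · simp [Hom.ap]
  · simp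

/-- In coordinates, the universal element names a base point and returns every fibre point
unchanged. The product on the right reassembles a base point of the composite from its projections,
so both sides return the same point. -/
lemma uEl_comp (P : PolyMor I J) (Q : PolyMor J K) :
    uEl (comp P Q) = covE (ccS P Q) (prodE (csS P Q) (uEl P)
      (conE (ctS P Q) (covE (cmS P Q) (pullE (emb (cr P Q)) (uEl Q))))) := by
  refine ext_val (fun w => base_ext ?_ fun z m h₁ h₂ => ?_) (fun w m h₁ h₂ => ?_)
  · simp [-comp_t]
  · simp [-comp_t]
  · obtain rfl : w = m ≫ (comp P Q).p := (val_uEl _ _).symm.trans h₁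
    simp only [lif_uEl, lif_covE, lif_prodE, hf_ccS]
    refine tot_ext ?_ ?_ ?_
    · simp [-comp_t]
    · simp [-comp_t]
    · simp [-comp_t]

lemma val_eq (P Z : PolyMor I J) (z : lin (emb P.t) ⟶ comp (lin (srcS P)) Z) {W : E}
    (w : W ⟶ P.base) : w ≫ val z (𝟙 _) = val z w := by
  simp

/-- The 2-cell of polynomials induced by an element. -/
noncomputable def descE (P Z : PolyMor I J) (z : lin (emb P.t) ⟶ comp (lin (srcS P)) Z) : P ⟶ Z :=
  Hom.ofAct (val z (𝟙 _)) ((val_t z _).trans (Category.id_comp _))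
    (fun _ w m h => lif z w m ((val_eq P Z z w).symm.trans h))
    (fun _ w m h => (lif_lg z w m _).trans (Category.comp_id _))
    (fun _ w m h => lif_rg z w m _)

lemma descE_ap (P Z : PolyMor I J) (z : lin (emb P.t) ⟶ comp (lin (srcS P)) Z) {W : E}
    (w : W ⟶ P.base) : (descE P Z z).ap w = val z w := val_eq P Z z w

lemma descE_act (P Z : PolyMor I J) (z : lin (emb P.t) ⟶ comp (lin (srcS P)) Z) {W : E}
    (w : W ⟶ P.base) (m : W ⟶ Z.tot) (h : (descE P Z z).ap w = m ≫ Z.p) :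
    (descE P Z z).act w m h = lif z w m ((descE_ap P Z z w).symm.trans h) :=
  Hom.ofAct_act _ _ _ _ _ (fun _ _ _ _ _ _ => comp_lif z _ _ _ _) _ _ _

/-- For indices `srcS P` and `emb P.t`, the pair of `val` and `lif` is a map of bases with a
contravariant map of fibres, which is exactly a 2-cell out of `P`. Pushing `uEl P` along a 2-cell
reads off this pair. -/
lemma pushE_uEl_bijective (P Z : PolyMor I J) :
    Function.Bijective (fun φ : P ⟶ Z => pushE (uEl P) φ) := by
  have ev : ∀ (φ : P ⟶ Z) {W : E} (w : W ⟶ P.base), val (pushE (uEl P) φ) w = φ.ap w :=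
    fun φ _ w => (val_pushE _ _ _).trans (congrArg _ (val_uEl P w))
  have el : ∀ (φ : P ⟶ Z) {W : E} (w : W ⟶ P.base) (m : W ⟶ Z.tot)
      (h : val (pushE (uEl P) φ) w = m ≫ Z.p), lif (pushE (uEl P) φ) w m h =
        φ.act w m ((ev φ w).symm.trans h) := fun φ _ w m h => by simp
  refine ⟨fun φ ψ h => hom_ext (fun w => ?_) (fun w m h₁ h₂ => ?_),
    fun z => ⟨descE P Z z, ext_val (fun w => ?_) (fun w m h₁ h₂ => ?_)⟩⟩
  · rw [← ev φ, ← ev ψ]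
    exact congrArg (val · w) h
  · have e₁ := el φ w m ((ev φ w).trans h₁)
    have e₂ := el ψ w m ((ev ψ w).trans h₂)
    rw [← e₁, ← e₂]
    dsimp only at h
    simp only [h]
  · exact (ev _ w).trans (descE_ap P Z z w)
  · exact (el _ w m h₁).trans (descE_act P Z z w m _)

lemma val_ruInv (s : b ⟶ i) {W : E} (w : W ⟶ ax s) :
    val (X := idP i.as) (ruInv (lin s)) w = w ≫ rg s :=
  ruInv_ap_cr (P := lin s) w

lemma lif_ruInv (s : b ⟶ i) {W : E} (w : W ⟶ ax s) (m : W ⟶ i.as)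
    (h : val (X := idP i.as) (ruInv (lin s)) w = m ≫ (idP i.as).p) :
    lif (X := idP i.as) (ruInv (lin s)) w m h = w :=
  (pos_idRight (P := lin s) _ _ _).trans (ruHom_ruInv_ap (P := lin s) w)

lemma uEl_idP (I : E) : uEl (idP I) = conE (𝟙 (emb (𝟙 I))) (ruInv (lin (emb (𝟙 I)))) := by
  have e : ∀ {W : E} (w : W ⟶ I), val (X := idP I) (conE (𝟙 (emb (𝟙 I))) (ruInv (lin (emb (𝟙 I))))) w
      = w := fun w => by
    refine (val_conE _ _ _).trans ((val_ruInv _ _).trans ?_)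
    simp
  refine ext_val (fun w => ?_) (fun w m h₁ h₂ => ?_)
  · exact (val_uEl (idP I) w).trans (e w).symm
  · have h : w = m := (e w).symm.trans (h₂.trans (Category.comp_id _))
    refine (lif_uEl (idP I) w m h₁).trans (h.symm.trans ?_)
    refine Eq.symm ((lif_conE _ _ _ _ _).trans ((lif_ruInv _ _ _ _).trans (Category.comp_id _)))

end

end PolyMor

open PolyMor

lemma inv_linOn_mapComp {a b c : SpanBicat E} (f : a ⟶ b) (g : b ⟶ c) :
    inv ((linOn E).mapComp f g) = linCompInv f g :=
  IsIso.inv_eq_of_hom_inv_id (linComp_linCompInv f g)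

/-- Identifies the abstract inverse constraint in `El.pull` with the explicit `linCompInv`, so that
the coordinate formulas for `pullE` become available. -/
lemma pull_linOn {a b i k : SpanBicat E} {s : b ⟶ i} {j : b ⟶ k} {X : PolyMor i.as k.as}
    (w : a ⟶ b) (x : El (linOn E) s j X) : El.pull w x = pullE w x := by
  rw [El.pull, inv_linOn_mapComp]
  rfl

lemma prod_linOn {a b i k l : SpanBicat E} {s : b ⟶ i} {j : b ⟶ k} {m : a ⟶ l}
    {X : PolyMor i.as k.as} {Y : PolyMor k.as l.as} (r : a ⟶ b) (x : El (linOn E) s j X)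
    (y : El (linOn E) (r ≫ j) m Y) : El.prod r x y = prodE r x y := by
  rw [El.prod, inv_linOn_mapComp]
  rfl

lemma isUniv_uEl {I J : PolyBicat E} (P : I ⟶ J) :
    IsUniv (C := PolyBicat E) (s := lin (srcS P)) (j := lin (emb (PolyMor.t P))) (X := P) (uEl P) :=
  fun Z => pushE_uEl_bijective P Z

/-- The identity functor of the bicategory of polynomials is a left Kan extension of the embedding
of spans. -/
lemma isKan_idOn_linOn : (polyShape E).IsKan (linOn E) (OplaxOn.idOn (PolyBicat E))
    (fun P => uEl P) where
  push_map₂ φ := by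
    exact (pushE_uEl φ).trans (congrArg (fun z => conE (gtS φ) (covE (gsS φ) z))
      (pull_linOn (emb (Hom.g φ)) (uEl _)).symm)
  push_mapComp P Q := by
    -- The constraint cell of the identity functor is an identity, so the left side is the universal
    -- element itself.
    exact (El.push_id _).trans ((uEl_comp P Q).trans
      ((congrArg (fun z => covE (ccS P Q) (prodE (csS P Q) (uEl P) (conE (ctS P Q)
        (covE (cmS P Q) z)))) (pull_linOn (emb (cr P Q)) (uEl Q)).symm).trans
      (congrArg (covE (ccS P Q)) (prod_linOn (csS P Q) (uEl P) _).symm)))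
  push_mapId I := (El.push_id _).trans (uEl_idP I.as)
  univ P := isUniv_uEl P

end Evaluation

end PolyUniv

namespace PolyUniv

open Bicategory ChosenPullbacksAlong ChosenDistributivityPullbacks

/-! ### Spans as Kan extensions of embedded morphisms -/

section SpanKan

variable {E : Type u} [Category.{v} E] [ChosenPullbacks E]

namespace SpanBicat

lemma isIso_embComp {X Y Z : E} (f : X ⟶ Y) (g : Y ⟶ Z) : IsIso (embComp f g) :=
  isIso_of_isIso_hf _ ⟨pr₁ (emb f) (emb g), by simp, ax_ext (by simp) (by
    have h : pr₂ (emb f) (emb g) = pr₁ (emb f) (emb g) ≫ f :=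
      (Category.comp_id _).symm.trans (pr₂_lg (emb f) (emb g))
    simp [h])⟩

instance : (embOn E).IsPseudo where
  isIso_mapId X := isIso_of_isIso_hf _ (inferInstanceAs (IsIso (𝟙 X.as)))
  isIso_mapComp f g := isIso_embComp f.as g.as

variable {I J K : SpanBicat E}

/-- A criterion for a 2-cell of spans to be universal. -/
lemma isUniv_of_isIso {s : I ⟶ J} {j : I ⟶ K} {X : J ⟶ K} (x : j ⟶ s ≫ X) [Mono (lg s)]
    (h : IsIso (hf x ≫ pr₂ s X)) : IsUniv x := by
  intro Z
  have h₀ : ∀ {Z : J ⟶ K} (z : j ⟶ s ≫ Z), hf z ≫ pr₁ s Z ≫ lg s = lg j :=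
    fun z => hf_lg z
  have h₁ : ∀ {Z : J ⟶ K} (z : j ⟶ s ≫ Z), hf z ≫ pr₂ s Z ≫ rg Z = rg j :=
    fun z => hf_rg z
  -- Because the left leg of `s` is monic, the first coordinate of every element is the same; a
  -- 2-cell out of `X` is thus determined by second coordinates, where `x` is invertible.
  have h₂ : ∀ {Z : J ⟶ K} (z : j ⟶ s ≫ Z), hf z ≫ pr₁ s Z = hf x ≫ pr₁ s X := fun z => by
    rw [← cancel_mono (lg s), Category.assoc, Category.assoc, h₀, h₀]
  refine ⟨fun f g e => hf_ext ?_, fun z => ⟨mkHom (inv (hf x ≫ pr₂ s X) ≫ hf z ≫ pr₂ s Z) ?_ ?_,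
    hf_ext (ax_ext ?_ ?_)⟩⟩
  · have := congrArg (fun z => hf z ≫ pr₂ s Z) e
    simp only [hf_comp, hf_whiskerLeft, Category.assoc, pr_pr₂] at this
    simpa only [← Category.assoc, cancel_epi] using this
  · rw [Category.assoc, IsIso.inv_comp_eq, Category.assoc, Category.assoc, pr₂_lg, pr₂_lg,
      reassoc_of% h₂ z]
  · rw [Category.assoc, IsIso.inv_comp_eq, Category.assoc, Category.assoc, h₁, h₁]
  · simp [h₂ z]
  · simp only [hf_comp, hf_whiskerLeft, hf_mkHom, Category.assoc, pr_pr₂]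
    rw [← Category.assoc (hf x), IsIso.hom_inv_id_assoc]

lemma adjInv_h (S : I ⟶ J) : pr₁ (sp (rg S) (lg S) : J ⟶ I) S ≫ lg S = pr₂ _ S ≫ lg S :=
  (pr₂_lg _ S).symm

/-- The right adjoint of a span whose left leg is invertible. -/
noncomputable def adjInv (S : I ⟶ J) [IsIso (lg S)] : S ⊣ (sp (rg S) (lg S) : J ⟶ I) where
  unit := mkHom (lg (𝟙 I) ≫ pr (inv (lg S)) (inv (lg S)) (by simp)) (by simp) (by simp)
  counit := mkHom (toId (pr₁ _ S ≫ rg S)) (by simp) (by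
    have h := adjInv_h S
    rw [cancel_mono] at h
    simp [h])
  left_triangle := by
    rw [leftZigzag_eq]
    refine hf_ext (ax_ext ?_ ?_)
    · rw [← cancel_mono (lg S)]
      simp
    · refine ax_id_ext ?_
      have h : pr₁ (𝟙 I) S ≫ lg (𝟙 I) = pr₂ (𝟙 I) S ≫ lg S := (pr₂_lg _ _).symm
      simp
      rw [reassoc_of% h, IsIso.hom_inv_id_assoc]
  right_triangle := by
    rw [rightZigzag_eq]
    refine hf_ext (ax_ext ?_ ?_)
    · refine ax_id_ext ?_
      simp
    · rw [← cancel_mono (lg S)]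
      simp

/-- The universal element of a span. -/
def uSp (S : I ⟶ J) : emb (rg S) ⟶ emb (lg S) ≫ S :=
  mkHom (pr (𝟙 _) (𝟙 _) (by simp)) (by simp) (by simp)

@[simp] lemma hf_uSp (S : I ⟶ J) : hf (uSp S) = pr (S := emb (lg S)) (𝟙 _) (𝟙 _) (by simp) := rfl

lemma isUniv_uSp (S : I ⟶ J) : IsUniv (uSp S) := by
  refine isUniv_of_isIso _ ?_
  simp only [hf_uSp, pr_pr₂]
  infer_instance

section Evaluation

variable {A B I J K : E} {s : A ⟶ I} {j : A ⟶ J} {X : (⟨I⟩ : SpanBicat E) ⟶ ⟨J⟩}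

/-- The generalised element of the apex of `X` determined by an element of `X`. -/
def ev (x : emb j ⟶ emb s ≫ X) : A ⟶ ax X := hf x ≫ pr₂ (emb s) X

/-- With embedded indices the first coordinate is an identity, so an element of a span is just a map
into its apex, and the element calculus becomes precomposition. -/
lemma ev_ext {x y : emb j ⟶ emb s ≫ X} (h : ev x = ev y) : x = y := by
  have h₀ : ∀ z : emb j ⟶ emb s ≫ X, hf z ≫ pr₁ (emb s) X = 𝟙 A := fun z =>
    (Category.comp_id _).symm.trans ((Category.assoc _ _ _).trans (hf_lg z))
  exact hf_ext (ax_ext ((h₀ x).trans (h₀ y).symm) h)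

lemma ev_push (x : emb j ⟶ emb s ≫ X) {Y : (⟨I⟩ : SpanBicat E) ⟶ ⟨J⟩} (f : X ⟶ Y) :
    ev (x ≫ emb s ◁ f) = ev x ≫ hf f := by
  simp [ev]

lemma ev_cov (x : emb j ⟶ emb s ≫ X) {s' : A ⟶ I} (σ : emb s ⟶ emb s') :
    ev (x ≫ σ ▷ X) = ev x := by
  simp [ev]

lemma ev_con (x : emb j ⟶ emb s ≫ X) {j' : A ⟶ J} (τ : emb j' ⟶ emb j) :
    ev (τ ≫ x) = ev x := by
  have h : hf τ = 𝟙 A := (Category.comp_id _).symm.trans (hf_lg τ)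
  simp [ev, h]

lemma ev_pull {s' : B ⟶ I} (w : B ⟶ A) (c : emb w ≫ emb s ⟶ emb s') (x : emb j ⟶ emb s ≫ X) :
    ev (embComp w j ≫ emb w ◁ x ≫ (α_ _ _ _).inv ≫ c ▷ X) = w ≫ ev x := by
  simp [ev]

section

variable {m : B ⟶ K} (r : B ⟶ A) {s' : B ⟶ I} (c : emb r ≫ emb s ⟶ emb s')
    {Y : (⟨J⟩ : SpanBicat E) ⟶ ⟨K⟩} (x : emb j ⟶ emb s ≫ X) (y : emb m ⟶ emb (r ≫ j) ≫ Y)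

lemma ev_prod_pr₁ : ev (y ≫ embComp r j ▷ Y ≫ (α_ _ _ _).hom ≫ emb r ◁ (x ▷ Y ≫ (α_ _ _ _).hom) ≫
    (α_ _ _ _).inv ≫ c ▷ (X ≫ Y)) ≫ pr₁ X Y = r ≫ ev x := by
  have h₀ : hf y ≫ pr₁ (emb (r ≫ j)) Y = 𝟙 B :=
    (Category.comp_id _).symm.trans ((Category.assoc _ _ _).trans (hf_lg y))
  simp [ev, reassoc_of% h₀]

lemma ev_prod_pr₂ : ev (y ≫ embComp r j ▷ Y ≫ (α_ _ _ _).hom ≫ emb r ◁ (x ▷ Y ≫ (α_ _ _ _).hom) ≫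
    (α_ _ _ _).inv ≫ c ▷ (X ≫ Y)) ≫ pr₂ X Y = ev y := by
  simp [ev]

end

@[simp] lemma ev_uSp {I J : SpanBicat E} (S : I ⟶ J) : ev (uSp S) = 𝟙 _ := by
  simp [ev]

lemma ev_unit (A : E) : ev (X := 𝟙 (⟨A⟩ : SpanBicat E)) (ρ_ (emb (𝟙 A))).inv = 𝟙 A := by
  rw [ev, hf_rightUnitor_inv, pr_pr₂]
  rfl

end Evaluation

/-- The identity functor of the bicategory of spans is a left Kan extension of the embedding
of `E`. -/
lemma isKan_idOn_embOn : (spanShape E).IsKan (embOn E) (OplaxOn.idOn (SpanBicat E))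
    (fun S => uSp S) where
  push_map₂ {I J P Q} φ := by
    refine ev_ext ((ev_push (uSp P) φ).trans (Eq.symm ((ev_con _ _).trans ((ev_cov _ _).trans
      ((ev_pull (hf φ) _ (uSp Q)).trans ?_)))))
    simp
  push_mapComp {I J K} P Q := by
    refine (El.push_id _).trans (ev_ext ((ev_uSp _).trans (Eq.symm ((ev_cov _ _).trans (ax_ext
      ((ev_prod_pr₁ _ _ _ _).trans ?_) ((ev_prod_pr₂ _ _ _ _).trans ?_))))))
    · exact (congrArg (pr₁ P Q ≫ ·) (ev_uSp P)).trans (by simp)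
    · refine (ev_con _ _).trans ((ev_cov _ _).trans ((ev_pull _ _ (uSp Q)).trans ?_))
      exact (congrArg (pr₂ P Q ≫ ·) (ev_uSp Q)).trans (by simp)
  push_mapId I := by
    refine (El.push_id _).trans (ev_ext ((ev_uSp _).trans (Eq.symm ((ev_con _ _).trans ?_))))
    exact ev_unit I.as
  univ P := isUniv_uSp P

end SpanBicat

end SpanKan

end PolyUniv

namespace PolyUniv

open Bicategory ChosenPullbacksAlong ChosenDistributivityPullbacks

/-! ### Left adjoints in the bicategory of polynomials -/

section PolyAdjunctions

variable {E : Type u} [Category.{v} E] [ChosenPullbacks E] [ChosenDistributivityPullbacks E]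

open SpanBicat PolyMor

lemma embOn_comp_linOn_mapComp {X Y Z : E} (f : X ⟶ Y) (g : Y ⟶ Z) :
    linHom (embComp f g) ≫ linComp (emb f) (emb g) = postInv (sig f) g := by
  refine lin_hom_ext (I := ⟨X⟩) (J := ⟨Z⟩) (S := emb (f ≫ g)) fun b => ?_
  refine (comp_ap (linHom (embComp f g)) (linComp (emb f) (emb g)) b).trans ?_
  refine base_ext (P := sig f) (Q := sig g) ?_ fun z m h₁ h₂ => ?_
  · refine Eq.trans ?_ (postInv_ap_cr (P := sig f) (f := g) b).symm
    refine (linComp_ap_cr (S := emb f) (S' := emb g) _).trans ?_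
    simp
  · simp only [Hom.precomp_ap] at h₁ h₂ ⊢
    refine (pos_linComp_ap (S := emb f) (S' := emb g) _ m h₁).trans
      (Eq.trans ?_ (pos_postInv_ap (P := sig f) (f := g) _ m h₂).symm)
    simp

/-- The two-stage embedding equals `sigmaEmb` strictly, not just up to an icon. Statements proved
through spans can therefore be transported by rewriting. -/
lemma embOn_comp_linOn : (embOn E).comp (linOn E) = OplaxOn.ofOplax (sigmaEmb E).toOplax := by
  simp only [OplaxOn.comp, OplaxOn.ofOplax]
  congr 1
  · funext a b f g η
    obtain rfl := LocallyDiscrete.eq_of_hom η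
    rw [Subsingleton.elim η (𝟙 f)]
    refine Eq.trans ?_ ((sigmaEmb E).toOplax.map₂_id f).symm
    exact ((embOn E).comp (linOn E)).map₂_id f
  · funext a
    refine (Category.comp_id _).trans (lin_hom_ext (I := ⟨a.as⟩) (J := ⟨a.as⟩) (S := emb (𝟙 a.as))
      fun b => ?_)
    exact Eq.trans (Category.comp_id b) (id_ap (P := idP a.as) b).symm
  · funext a b c f g
    exact embOn_comp_linOn_mapComp f.as g.as

namespace PolyMor

variable {I J : SpanBicat E}

/-- The right adjoint of the linear polynomial of a span. -/
@[reducible] def radj (S : I ⟶ J) : PolyMor J.as I.as where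
  tot := ax S
  base := I.as
  s := rg S
  p := lg S
  t := 𝟙 _

section

variable (S : I ⟶ J)

/-- The action on bases of the unit of `linAdj`. -/
def linUnitBase : I.as ⟶ (comp (lin S) (radj S)).base :=
  mkBase (P := lin S) (Q := radj S) (𝟙 I.as) (fun _ _ m _ => m) (fun _ _ _ _ => rfl)

variable {S}

lemma linUnitBase_cr {W : E} (b : W ⟶ I.as) :
    (b ≫ linUnitBase S) ≫ cr (lin S) (radj S) = b :=
  (Category.assoc _ _ _).trans ((congrArg (b ≫ ·) (mkBase_cr _ _ _)).trans (Category.comp_id _))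

lemma pos_linUnitBase {W : E} (b : W ⟶ I.as) (m : W ⟶ ax S)
    (h : (b ≫ linUnitBase S) ≫ cr (lin S) (radj S) = m ≫ (radj S).p) :
    pos (b ≫ linUnitBase S) m h = m :=
  pos_precomp_mkBase (P := lin S) (Q := radj S) _ _ _ (fun _ _ _ _ _ _ => rfl) _ _
    ((Category.comp_id _).trans ((linUnitBase_cr b).symm.trans h))

variable (S)

lemma linUnitBase_t : linUnitBase S ≫ (comp (lin S) (radj S)).t = 𝟙 I.as := by
  refine (Category.assoc _ _ _).symm.trans ((Category.comp_id _).trans ?_)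
  exact mkBase_cr (P := lin S) (Q := radj S) _ _ _

/-- The unit of `linAdj`. -/
noncomputable def linUnit : idP I.as ⟶ comp (lin S) (radj S) :=
  Hom.ofAct (linUnitBase S)
    (linUnitBase_t S)
    (fun _ b _ _ => b) (fun _ _ _ _ => Category.comp_id _) (fun _ b y h => by
      have h₁ := pos_of_eq h
      have h₂ := cr_of_eq h
      rw [pos_linUnitBase] at h₁
      rw [linUnitBase_cr] at h₂
      have h₃ : _ = y ≫ ctx _ _ := h₁.trans (Category.comp_id _)
      rw [comp_s, ← Category.assoc, ← h₃]
      exact (Category.comp_id _).trans h₂)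

/-- The counit of `linAdj`. -/
noncomputable def linCounit : comp (radj S) (lin S) ⟶ idP J.as :=
  Hom.ofAct (cr (radj S) (lin S) ≫ rg S) (Category.comp_id _)
    (fun _ x _ _ => mkTot (P := radj S) (Q := lin S) x (x ≫ cr _ _) (x ≫ cr _ _) (lin_h x)
      ((pos_t (P := radj S) (Q := lin S) x _ (lin_h x)).symm.trans (Category.comp_id _)))
    (by simp) (fun _ x m h => by
      have h' : x ≫ _ = m := h.trans (Category.comp_id _)
      refine Eq.trans ?_ (h'.trans (Category.comp_id _).symm)
      simp)

variable {S}

@[simp] lemma linUnit_ap_cr {W : E} (b : W ⟶ I.as) :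
    (linUnit S).ap b ≫ cr (lin S) (radj S) = b := linUnitBase_cr b

@[simp] lemma pos_linUnit_ap {W : E} (b : W ⟶ I.as) (m : W ⟶ ax S)
    (h : (linUnit S).ap b ≫ cr (lin S) (radj S) = m ≫ (radj S).p) :
    pos ((linUnit S).ap b) m h = m := pos_linUnitBase b m h

@[simp] lemma linUnit_act {W : E} (b : W ⟶ I.as) (y : W ⟶ (comp (lin S) (radj S)).tot)
    (h : (linUnit S).ap b = y ≫ (comp (lin S) (radj S)).p) : (linUnit S).act b y h = b :=
  Hom.ofAct_act _ _ _ _ _ (fun _ _ _ _ _ _ => rfl) _ _ _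

@[simp] lemma linCounit_ap {W : E} (x : W ⟶ (comp (radj S) (lin S)).base) :
    (linCounit S).ap x = x ≫ cr (radj S) (lin S) ≫ rg S := rfl

lemma linCounit_act_h {W : E} (x : W ⟶ (comp (radj S) (lin S)).base) :
    (x ≫ cr (radj S) (lin S)) ≫ (radj S).p = pos x (x ≫ cr (radj S) (lin S)) (lin_h x) :=
  ((pos_t (P := radj S) (Q := lin S) x _ (lin_h x)).symm.trans (Category.comp_id _))

@[simp] lemma linCounit_act {W : E} (x : W ⟶ (comp (radj S) (lin S)).base) (m : W ⟶ J.as)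
    (h : (linCounit S).ap x = m ≫ (idP J.as).p) : (linCounit S).act x m h =
      mkTot x (x ≫ cr _ _) (x ≫ cr _ _) (lin_h x) (linCounit_act_h x) :=
  Hom.ofAct_act _ _ _ _ _ (by intros; simp) _ _ _

variable (S)

lemma lin_left_triangle : whiskerRight (linUnit S) (lin S) ≫ assocHom _ _ _ ≫
    whiskerLeft (lin S) (linCounit S) = luHom (lin S) ≫ ruInv (lin S) := by
  refine hom_ext (fun x => base_ext ?_ fun z m h₁ h₂ => ?_) fun x y h h' => tot_ext ?_ ?_ ?_
  · simp
  · simp only [Hom.precomp_ap, comp_ap, luHom_ap] at h₁ h₂ ⊢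
    rw [pos_idRight _ _ h₂, ruHom_ruInv_ap, pos_whiskerLeft_ap]
    simp
  · simp
  · have h₃ := pos_of_eq h'
    have h₄ : x ≫ cr (idP I.as) (lin S) = y ≫ ctx (lin S) (idP J.as) := by
      rw [pos_idRight, comp_ap, ruHom_ruInv_ap] at h₃
      exact h₃.trans (Category.comp_id _)
    simpa using h₄
  · have h₃ := pos_of_eq h'
    have h₄ : x ≫ cr (idP I.as) (lin S) = y ≫ ctx (lin S) (idP J.as) := by
      rw [pos_idRight, comp_ap, ruHom_ruInv_ap] at h₃
      exact h₃.trans (Category.comp_id _)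
    simp [reassoc_of% h₄]

lemma lin_right_triangle : whiskerLeft (radj S) (linUnit S) ≫ assocInv _ _ _ ≫
    whiskerRight (linCounit S) (radj S) = ruHom (radj S) ≫ luInv (radj S) := by
  refine hom_ext (fun x => base_ext ?_ fun z m h₁ h₂ => ?_) fun x y h h' => tot_ext ?_ ?_ ?_
  · simp only [comp_ap, whiskerRight_ap_cr, assocInv_ap_cr, luInv_ap_cr]
    rw [whiskerLeft_ap_cr_assoc, linUnit_ap_cr]
    exact (cr_idRight x).trans (Category.comp_id _)
  · simp
  · simp
  · simp
  · simp

end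

end PolyMor

open PolyMor in
/-- The linear polynomial of a span has a right adjoint. -/
noncomputable def linAdj {I J : SpanBicat E} (S : I ⟶ J) :
    Bicategory.Adjunction (B := PolyBicat E) (a := ⟨I.as⟩) (b := ⟨J.as⟩) (lin S) (radj S) where
  unit := linUnit S
  counit := linCounit S
  left_triangle := by
    rw [leftZigzag_eq]
    exact lin_left_triangle S
  right_triangle := by
    rw [rightZigzag_eq]
    exact lin_right_triangle S

namespace PolyMor

/-- The fibre action of the counit, followed by a projection, selects a point in each fibre of
`Q.p`, naturally in the base point. This is a section, and the fibre part of the triangle identity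
shows that it takes a base point `y ≫ Q.p` back to `y`. So each fibre has exactly one point. -/
lemma isIso_p_of_triangle {I J : E} {Q : PolyMor I J} {R : PolyMor J I} (η : idP I ⟶ comp Q R)
    (ζ : comp R Q ⟶ idP J) (H : whiskerRight η Q ≫ assocHom Q R Q ≫ whiskerLeft Q ζ =
      luHom Q ≫ ruInv Q) : IsIso Q.p := by
  let c {W : E} (b : W ⟶ Q.base) : W ⟶ (comp Q (comp R Q)).base :=
    (assocHom Q R Q).ap ((whiskerRight η Q).ap ((luInv Q).ap b))
  have hc {W : E} (b : W ⟶ Q.base) : c b ≫ cr Q (comp R Q) ≫ cr R Q = b := by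
    simp [c]
  have hm {W : E} (b : W ⟶ Q.base) :
      ζ.ap (c b ≫ cr Q (comp R Q)) = (b ≫ Q.t) ≫ (idP _).p := by
    have := ζ.ap_t (c b ≫ cr Q (comp R Q))
    refine (Category.comp_id _).symm.trans (this.trans (Eq.trans ?_ (Category.comp_id _).symm))
    simp [reassoc_of% hc]
  -- The base point is sent through the unit and the associator; the counit then returns a total
  -- point over it, whose component in `Q.tot` is the chosen point.
  let σ {W : E} (b : W ⟶ Q.base) : W ⟶ Q.tot :=
    ζ.act (c b ≫ cr Q (comp R Q)) (b ≫ Q.t) (hm b) ≫ ctm R Q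
  have hσ {W : E} (b : W ⟶ Q.base) : σ b ≫ Q.p = b := by
    simp [σ, hc]
  have hn {V W : E} (z : V ⟶ W) (b : W ⟶ Q.base) : z ≫ σ b = σ (z ≫ b) := by
    simp [σ, c]
  refine ⟨σ (𝟙 _), ?_, hσ _⟩
  rw [hn, Category.comp_id]
  -- The generic point of `Q.tot`, viewed in the composite with the identity: evaluating the
  -- triangle there compares `σ Q.p` with the identity of `Q.tot`.
  let y : Q.tot ⟶ (comp Q (idP J)).tot := mkTot (P := Q) (Q := idP J) ((ruInv Q).ap Q.p)
    (Q.p ≫ Q.t) (𝟙 _) ((ruInv_ap_cr _).trans (Category.comp_id _).symm) (by simp)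
  have hy : (ruInv Q).ap Q.p = y ≫ (comp Q (idP J)).p := (mkTot_p _ _ _ _ _).symm
  have hR : (luHom Q ≫ ruInv Q).ap ((luInv Q).ap Q.p) = y ≫ (comp Q (idP J)).p := by
    simpa using hy
  have hL := hR
  rw [← H] at hL
  have key : Hom.act (whiskerRight η Q ≫ assocHom Q R Q ≫ whiskerLeft Q ζ)
      ((luInv Q).ap Q.p) y hL = (luHom Q ≫ ruInv Q).act ((luInv Q).ap Q.p) y hR := by
    congr 1
  have := congrArg (· ≫ ctm _ _) key
  simpa [σ, c, y] using this

end PolyMor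

/-- A left adjoint in the bicategory of polynomials is linear up to isomorphism. -/
lemma isIso_p_of_adjunction {a b : PolyBicat E} {Q : a ⟶ b} {R : b ⟶ a} (adj : Q ⊣ R) :
    IsIso (PolyMor.p Q) :=
  isIso_p_of_triangle adj.unit adj.counit (unit_counit_left adj)

end PolyAdjunctions

end PolyUniv

namespace PolyUniv

open Bicategory ChosenPullbacksAlong ChosenDistributivityPullbacks

/-! ### Elements given by 2-cells of the source bicategory -/

section OfTwoCells

variable {S : Type u₁} [Bicategory.{w₁, v₁} S] {C : Type u₂} [Bicategory.{w₂, v₂} C] {o : S → C}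

namespace El

variable (T : OplaxOn o)

/-- The element given by a 2-cell of `S`. -/
def of {b i k : S} {s : b ⟶ i} {j : i ⟶ k} {m : b ⟶ k} (τ : m ⟶ s ≫ j) : El T s m (T.map j) :=
  T.map₂ τ ≫ T.mapComp s j

variable {T} {b i k : S} {s s' : b ⟶ i} {j j' : i ⟶ k} {m m' : b ⟶ k}

lemma of_push (τ : m ⟶ s ≫ j) (f : j ⟶ j') : (of T τ).push (T.map₂ f) = of T (τ ≫ s ◁ f) := by
  simp [of, push, T.map₂_comp, T.naturality_right]

lemma cov_of (σ : s ⟶ s') (τ : m ⟶ s ≫ j) : cov σ (of T τ) = of T (τ ≫ σ ▷ j) := by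
  simp [of, cov, T.map₂_comp, T.naturality_left]

lemma con_of (ρ : m' ⟶ m) (τ : m ⟶ s ≫ j) : con ρ (of T τ) = of T (ρ ≫ τ) := by
  simp [of, con, T.map₂_comp]

lemma curry_of {a : S} {r : a ⟶ b} {m : a ⟶ k} (τ : m ⟶ (r ≫ s) ≫ j) :
    (of T τ).curry = (of T (τ ≫ (α_ _ _ _).hom)).push (T.mapComp s j) := by
  simp [of, curry, push, T.map₂_comp, T.associator]

variable [T.IsPseudo]

lemma pull_of {a : S} (w : a ⟶ b) (τ : m ⟶ s ≫ j) :
    pull w (of T τ) = of T (w ◁ τ ≫ (α_ _ _ _).inv) := by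
  symm
  rw [eq_pull_iff, curry_of]
  simp only [of, push, Category.assoc, T.naturality_right_assoc, whiskerLeft_comp, Iso.inv_hom_id, Category.comp_id]

lemma prod_of {a l : S} {r : a ⟶ b} {Y : k ⟶ l} {n : a ⟶ l} (τ : m ⟶ s ≫ j)
    (τ' : n ⟶ (r ≫ m) ≫ Y) :
    prod r (of T τ) (of T τ') = (of T (τ' ≫ (α_ _ _ _).hom ≫ r ◁ (τ ▷ Y ≫ (α_ _ _ _).hom) ≫
      (α_ _ _ _).inv)).push (T.mapComp j Y) := by
  symm
  rw [eq_prod_iff, curry_push, curry_of, curry_of]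
  simp only [of, push, T.map₂_comp, Category.assoc, Iso.inv_hom_id, Category.comp_id,
    T.naturality_right_assoc]
  congr 3
  simp only [← whiskerLeft_comp, T.associator, T.naturality_left_assoc, comp_whiskerRight,
    Category.assoc]

lemma isUniv_of {b i k : S} {s : b ⟶ i} {j : i ⟶ k} {m : b ⟶ k} {r : i ⟶ b} {r' : k ⟶ b}
    (adj : s ⊣ r) (adj' : m ⊣ r') {τ : m ⟶ s ≫ j} (h : IsUniv τ) : IsUniv (of T τ) :=
  T.isUniv_map₂ adj adj' h

end El

lemma Shape.zel_of {A : Type u₃} [Bicategory.{w₃, v₃} A] (Sh : Shape S A) {T : OplaxOn o}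
    [T.IsPseudo] {I J K : A} (P : I ⟶ J) (Q : J ⟶ K) {j : Sh.ob J ⟶ Sh.ob K}
    (τ : Sh.tgt Q ⟶ Sh.src Q ≫ j) :
    Sh.zel P (El.of T τ) = (El.of T (Sh.ct P Q ≫ (Sh.cr P Q ◁ τ ≫ (α_ _ _ _).inv) ≫
      Sh.cm P Q ▷ j ≫ (α_ _ _ _).hom)).push (T.mapComp (Sh.tgt P) j) := by
  simp only [Shape.zel, El.pull_of, El.cov_of, El.con_of, El.curry_of, Category.assoc]

lemma IconOn.tr_of {F G : OplaxOn o} (β : IconOn F G) [β.IsInvertible] {b i k : S} {s : b ⟶ i}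
    {j : i ⟶ k} {m : b ⟶ k} (τ : m ⟶ s ≫ j) :
    β.tr (El.of G τ) = (El.of F τ).push (β.app j) := by
  simp only [tr, El.of, El.push, Category.assoc]
  rw [← β.naturality_assoc, β.map_comp_assoc, whisker_exchange]
  simp

lemma El.mapEl_of {A : Type u₃} [Bicategory.{w₃, v₃} A] {o' : C → A} {J : OplaxOn o}
    (F : OplaxOn o') {b i k : S} {s : b ⟶ i} {j : i ⟶ k} {m : b ⟶ k} (τ : m ⟶ s ≫ j) :
    El.mapEl F (El.of J τ) = El.of (J.comp F) τ := by
  simp [El.mapEl, El.of, F.map₂_comp]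

end OfTwoCells

/-! ### The Beck condition in terms of universal elements -/

section Beck

variable {C : Type u₂} [Bicategory.{w₂, v₂} C] {a b c d : C} {f' : a ⟶ b} {g' : a ⟶ c}
  {g : b ⟶ d} {f : c ⟶ d} {u' : c ⟶ a} {u : d ⟶ b}

/-- The source `u' ≫ f'` of the mate is the extension of `f'` along `g'`, and the displayed element
is the transpose of the mate. -/
lemma isIso_mateEquiv_iff (adj' : g' ⊣ u') (adj : g ⊣ u) (θ : f' ≫ g ⟶ g' ≫ f) :
    IsIso (mateEquiv adj' adj θ) ↔
      IsUniv ((ρ_ _).inv ≫ f' ◁ adj.unit ≫ (α_ _ _ _).inv ≫ θ ▷ u ≫ (α_ _ _ _).hom) := by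
  have h := (mateEquiv_eq_iff adj' adj θ _).1 rfl
  rw [Adjunction.homEquiv₁_symm_apply, Adjunction.homEquiv₂_apply] at h
  rw [(isUniv_unit adj' f').isIso_iff (y := _)]
  simpa using h

/-- Any extension along `g` is isomorphic to `u ≫ j`, and the extension witnessed by the Beck 2-cell
is absolute. Hence the Beck condition makes every universal element along `g` stay universal after
base change. -/
lemma isUniv_beck_whiskerRight {adj' : g' ⊣ u'} {adj : g ⊣ u} {θ : f' ≫ g ⟶ g' ≫ f}
    (h : IsIso (mateEquiv adj' adj θ)) {k : C} {j : b ⟶ k} {Y : d ⟶ k} {y : j ⟶ g ≫ Y}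
    (hy : IsUniv y) : IsUniv (f' ◁ y ≫ (α_ _ _ _).inv ≫ θ ▷ Y ≫ (α_ _ _ _).hom) := by
  rw [isIso_mateEquiv_iff] at h
  have hu := isUniv_unit adj j
  have hf : IsIso (hu.desc y) := hu.isIso (by rwa [hu.fac])
  have e : (((ρ_ _).inv ≫ f' ◁ adj.unit ≫ (α_ _ _ _).inv ≫ θ ▷ u ≫ (α_ _ _ _).hom) ▷ j ≫
      (α_ _ _ _).hom) ≫ g' ◁ ((α_ _ _ _).hom ≫ f ◁ hu.desc y) =
      f' ◁ y ≫ (α_ _ _ _).inv ≫ θ ▷ Y ≫ (α_ _ _ _).hom := by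
    conv_rhs => rw [← hu.fac y]
    have h₁ : θ ▷ (u ≫ j) ≫ (g' ≫ f) ◁ hu.desc y = (f' ≫ g) ◁ hu.desc y ≫ θ ▷ Y :=
      (whisker_exchange _ _).symm
    calc _ = 𝟙 _ ⊗≫ f' ◁ adj.unit ▷ j ⊗≫ (θ ▷ (u ≫ j) ≫ (g' ≫ f) ◁ hu.desc y) ⊗≫ 𝟙 _ := by
          bicategory
      _ = _ := by
          rw [h₁]
          bicategory
  rw [← e, isUniv_push_iff]
  exact h.whiskerRight adj' j

end Beck

section BeckEl

variable {S : Type u₁} [Bicategory.{w₁, v₁} S] {C : Type u₂} [Bicategory.{w₂, v₂} C] {o : S → C}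
  {T : OplaxOn o} [T.IsPseudo] {a b c d : S} {f' : a ⟶ b} {g' : a ⟶ c} {g : b ⟶ d} {f : c ⟶ d}
  {u' : o c ⟶ o a} {u : o d ⟶ o b}

lemma El.curry_cov_pull (θ : f' ≫ g ⟶ g' ≫ f) {k : S} {j : b ⟶ k} {Y : o d ⟶ o k}
    (y : El T g j Y) : (El.cov θ (El.pull f' y)).curry = T.mapComp f' j ≫ T.map f' ◁ y ≫
      (α_ _ _ _).inv ≫ (inv (T.mapComp f' g) ≫ T.map₂ θ ≫ T.mapComp g' f) ▷ Y ≫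
        (α_ _ _ _).hom := by
  simp [El.curry, El.cov, El.pull]

lemma isUniv_curry_cov_pull {adj' : T.map g' ⊣ u'} {adj : T.map g ⊣ u} {θ : f' ≫ g ⟶ g' ≫ f}
    (h : IsIso (mateEquiv adj' adj (inv (T.mapComp f' g) ≫ T.map₂ θ ≫ T.mapComp g' f)))
    {k : S} {j : b ⟶ k} {Y : o d ⟶ o k} {y : El T g j Y} (hy : IsUniv y) :
    IsUniv (El.cov θ (El.pull f' y)).curry := by
  rw [El.curry_cov_pull, isUniv_iso_comp_iff]
  exact isUniv_beck_whiskerRight h hy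

/-- One universal element suffices to recover the Beck condition: an extension of the identity along
the left adjoint at `g` is its right adjoint `u`, and the element is then its unit up to
isomorphism. -/
lemma isIso_mateEquiv_of_isUniv (adj' : T.map g' ⊣ u') (adj : T.map g ⊣ u) {θ : f' ≫ g ⟶ g' ≫ f}
    {Y : o d ⟶ o b} {y : El T g (𝟙 b) Y} (hy : IsUniv y)
    (h : IsUniv (El.cov θ (El.pull f' y)).curry) :
    IsIso (mateEquiv adj' adj (inv (T.mapComp f' g) ≫ T.map₂ θ ≫ T.mapComp g' f)) := by
  rw [isIso_mateEquiv_iff]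
  rw [El.curry_cov_pull, isUniv_iso_comp_iff] at h
  have hu : IsUniv adj.unit := by
    have := isUniv_unit adj (𝟙 _)
    have e : adj.unit = ((λ_ _).inv ≫ adj.unit ▷ 𝟙 _ ≫ (α_ _ _ _).hom) ≫
      T.map g ◁ (ρ_ u).hom := by simp
    rwa [e, isUniv_push_iff]
  have hy' : IsUniv (inv (T.mapId b) ≫ y) := (isUniv_iso_comp_iff _ _).2 hy
  have hf : IsIso (hu.desc (inv (T.mapId b) ≫ y)) := hu.isIso (by rwa [hu.fac])
  rw [← isUniv_push_iff _ (T.map f ◁ hu.desc (inv (T.mapId b) ≫ y)),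
    ← isUniv_iso_comp_iff _ (T.map f' ◁ T.mapId b ≫ (ρ_ _).hom)]
  convert h using 1
  have h₁ := congrArg (T.map f' ◁ ·) (hu.fac (inv (T.mapId b) ≫ y))
  simp only [whiskerLeft_comp] at h₁
  have h₂ := congrArg (T.map f' ◁ T.mapId b ≫ ·) h₁
  simp only [whiskerLeft_isIso_hom_inv_assoc] at h₂
  generalize inv (T.mapComp f' g) ≫ T.map₂ θ ≫ T.mapComp g' f = θ'
  rw [← h₂]
  calc _ = 𝟙 _ ⊗≫ T.map f' ◁ T.mapId b ≫ T.map f' ◁ adj.unit ⊗≫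
        (θ' ▷ u ≫ (T.map g' ≫ T.map f) ◁ hu.desc (inv (T.mapId b) ≫ y)) ⊗≫ 𝟙 _ := by bicategory
    _ = _ := by
        rw [← whisker_exchange]
        bicategory

end BeckEl

end PolyUniv

namespace PolyUniv

open Bicategory ChosenPullbacksAlong ChosenDistributivityPullbacks

lemma El.curry_con {S : Type u₁} [Bicategory.{w₁, v₁} S] {C : Type u₂} [Bicategory.{w₂, v₂} C]
    {o : S → C} {T : OplaxOn o} {a b i k : S} {r : a ⟶ b} {s : b ⟶ i} {j j' : a ⟶ k}
    {X : o i ⟶ o k} (τ : j' ⟶ j) (x : El T (r ≫ s) j X) :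
    (El.con τ x).curry = El.con τ x.curry := by
  simp [El.con, El.curry]

namespace Shape

variable {S : Type u₁} [Bicategory.{w₁, v₁} S] {A : Type u₂} [Bicategory.{w₂, v₂} A]
  {C : Type u₃} [Bicategory.{w₃, v₃} C] {Sh : Shape S A} {o : S → C} {T : OplaxOn o} [T.IsPseudo]
  {F : OplaxOn (S := A) (fun I => o (Sh.ob I))} {U : ∀ {I J : A} (P : I ⟶ J), Sh.ElAt T P (F.map P)}

/-- Both sides are 2-cells out of `T.map jR`, an extension by `hR`, and after pushing they involve
only elements coming from 2-cells. The comparison is thereby reduced to the equation `e` in the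
presenting bicategory. -/
lemma IsCompat.comp_mapComp_of_eq_push (h : Sh.IsCompat T F U) {I J K : A} {P : I ⟶ J} {Q : J ⟶ K}
    {R : I ⟶ K} (φ : R ⟶ P ≫ Q) {jP : Sh.ob I ⟶ Sh.ob J} {jQ : Sh.ob J ⟶ Sh.ob K}
    {jR : Sh.ob I ⟶ Sh.ob K} {τP : Sh.tgt P ⟶ Sh.src P ≫ jP} {τQ : Sh.tgt Q ⟶ Sh.src Q ≫ jQ}
    {τR : Sh.tgt R ⟶ Sh.src R ≫ jR} (hR : IsUniv (El.of T τR)) {fP : T.map jP ⟶ F.map P}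
    {fQ : T.map jQ ⟶ F.map Q} {fR : T.map jR ⟶ F.map R} (eP : (El.of T τP).push fP = U P)
    (eQ : (El.of T τQ).push fQ = U Q) (eR : (El.of T τR).push fR = U R) (ξ : jR ⟶ jP ≫ jQ)
    (e : τR ≫ Sh.src R ◁ ξ = Sh.gt φ ≫ (Sh.g φ ◁ (((Sh.ct P Q ≫ (Sh.cr P Q ◁ τQ ≫
      (α_ _ _ _).inv) ≫ Sh.cm P Q ▷ jQ) ≫ (α_ _ _ _).hom ≫ Sh.cs P Q ◁ (τP ▷ jQ ≫
      (α_ _ _ _).hom) ≫ (α_ _ _ _).inv) ≫ Sh.cc P Q ▷ (jP ≫ jQ)) ≫ (α_ _ _ _).inv) ≫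
      Sh.gs φ ▷ (jP ≫ jQ)) :
    fR ≫ F.map₂ φ ≫ F.mapComp P Q = T.map₂ ξ ≫ T.mapComp jP jQ ≫ fP ▷ T.map jQ ≫ F.map P ◁ fQ := by
  refine El.push_injective hR ?_
  rw [← El.push_push, eR, ← El.push_push, h.push_map₂, Sh.push_res, h.push_mapComp, ← eP, ← eQ,
    Sh.cprod_push, ← El.push_push (El.of T τR), El.of_push, e,
    ← El.push_push (El.of T _) (T.mapComp jP jQ), ← Sh.push_res]
  congr 1
  simp only [cprod, El.pull_of, El.cov_of, El.con_of, El.prod_of]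
  rw [← El.push_cov, ← Sh.push_res]
  simp only [res, El.pull_of, El.cov_of, El.con_of]

lemma IsCompat.comp_mapId_of_eq_push (h : Sh.IsCompat T F U) {I : A}
    {R : I ⟶ I} (φ : R ⟶ 𝟙 I) {jR : Sh.ob I ⟶ Sh.ob I}
    {τR : Sh.tgt R ⟶ Sh.src R ≫ jR} (hR : IsUniv (El.of T τR)) {fR : T.map jR ⟶ F.map R}
    (eR : (El.of T τR).push fR = U R) (ξ : jR ⟶ 𝟙 (Sh.ob I))
    (e : τR ≫ Sh.src R ◁ ξ = Sh.gt φ ≫ (Sh.g φ ◁ (Sh.un I ≫ (ρ_ _).inv) ≫ (α_ _ _ _).inv) ≫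
      Sh.gs φ ▷ 𝟙 (Sh.ob I)) :
    fR ≫ F.map₂ φ ≫ F.mapId I = T.map₂ ξ ≫ T.mapId (Sh.ob I) := by
  refine El.push_injective hR ?_
  -- The unit element comes from a 2-cell too, by the right unit law for `T`.
  have hu : El.unit (T := T) (Sh.src (𝟙 I)) = (El.of T (ρ_ (Sh.src (𝟙 I))).inv).push (T.mapId _) := by
    rw [El.of, El.push, El.unit, ← cancel_epi (T.map₂ (ρ_ _).hom)]
    rw [Category.assoc, T.map₂_hom_inv_assoc, T.rightUnitor]
    simp
  rw [← El.push_push, eR, ← El.push_push, h.push_map₂, Sh.push_res, h.push_mapId,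
    ← El.push_push, El.of_push, e, unitAt, hu, ← El.push_con, ← Sh.push_res]
  congr 1
  simp only [res, El.pull_of, El.cov_of, El.con_of]

end Shape

/-- Composition of icons. -/
def IconOn.trans {S : Type u₁} [Bicategory.{w₁, v₁} S] {C : Type u₂} [Bicategory.{w₂, v₂} C]
    {o : S → C} {F G H : OplaxOn o} (β : IconOn F G) (γ : IconOn G H) : IconOn F H where
  app f := β.app f ≫ γ.app f
  naturality η := by rw [β.naturality_assoc, γ.naturality, Category.assoc]
  map_comp f g := by
    rw [Category.assoc, γ.map_comp, β.map_comp_assoc, comp_whiskerRight, whiskerLeft_comp,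
      Category.assoc, whisker_exchange_assoc]
  map_id a := by rw [Category.assoc, γ.map_id, β.map_id]

/-! ### Extension of 2-Beck pseudofunctors to spans -/

section SpanExtension

variable {E : Type u} [Category.{v} E] {C : Type u₂} [Bicategory.{w₂, v₂} C]
  {o : LocallyDiscrete E → C}

/-- The 2-Beck condition. -/
structure OplaxOn.IsBeck (F : OplaxOn o) [F.IsPseudo] : Prop where
  exists_adj {X Y : LocallyDiscrete E} (f : X ⟶ Y) :
    ∃ (r : o Y ⟶ o X) (r' : o X ⟶ o Y), Nonempty (F.map f ⊣ r) ∧ Nonempty (r ⊣ r')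
  beck {a b c d : LocallyDiscrete E} {f' : a ⟶ b} {g' : a ⟶ c} {g : b ⟶ d} {f : c ⟶ d}
    (h : IsPullback f'.as g'.as g.as f.as) (θ : f' ≫ g ⟶ g' ≫ f) {u' : o c ⟶ o a}
    {u : o d ⟶ o b} (adj' : F.map g' ⊣ u') (adj : F.map g ⊣ u) :
    IsIso (mateEquiv adj' adj (inv (F.mapComp f' g) ≫ F.map₂ θ ≫ F.mapComp g' f))

variable [ChosenPullbacks E] {F : OplaxOn o} [F.IsPseudo]

open SpanBicat

instance {a b : LocallyDiscrete E} {f g : a ⟶ b} (η : f ⟶ g) : IsIso η :=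
  ⟨eqToHom (LocallyDiscrete.eq_of_hom η).symm, Subsingleton.elim _ _, Subsingleton.elim _ _⟩

/-- For composable spans, `zel` is the base change of the universal element of the second span along
the pullback square that defines the composite. The Beck condition keeps it universal. -/
lemma OplaxOn.IsBeck.isPseudo_of_isKan (hF : F.IsBeck)
    {T : OplaxOn (S := SpanBicat E) (fun I => o ((spanShape E).ob I))}
    {U : ∀ {I J : SpanBicat E} (P : I ⟶ J), (spanShape E).ElAt F P (T.map P)}
    (hT : (spanShape E).IsKan F T U) : T.IsPseudo where
  isIso_mapId I := by
    rw [hT.isIso_mapId_iff]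
    refine (El.isUniv_iff_isIso_toHom (T := F) (b := ⟨I.as⟩) (j := 𝟙 _)
      ((spanShape E).unitAt F I)).2 ?_
    change IsIso ((F.map₂ (𝟙 (𝟙 (⟨I.as⟩ : LocallyDiscrete E))) ≫ (ρ_ (F.map (𝟙 _))).inv) ≫
      F.mapId _ ▷ 𝟙 _ ≫ (λ_ (𝟙 _)).hom)
    infer_instance
  isIso_mapComp P Q := by
    rw [hT.isIso_mapComp_iff]
    obtain ⟨r, _, ⟨adj⟩, _⟩ := hF.exists_adj ((spanShape E).src P)
    obtain ⟨r', _, ⟨adj'⟩, _⟩ := hF.exists_adj ((spanShape E).cs P Q)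
    obtain ⟨r₁, _, ⟨adj₁⟩, _⟩ := hF.exists_adj ((spanShape E).src Q)
    refine (spanShape E).isUniv_cprod (hT.univ P) ⟨_, ⟨adj⟩⟩ ?_
    rw [Shape.zel, El.curry_con]
    refine (isUniv_iso_comp_iff _ (F.map₂ ((spanShape E).ct P Q))).2 ?_
    exact isUniv_curry_cov_pull (adj' := adj') (adj := adj₁)
      (hF.beck (SpanBicat.isPullback P Q).flip _ _ _) (hT.univ Q)

lemma OplaxOn.IsBeck.exists_isKan (hF : F.IsBeck) :
    ∃ (T : OplaxOn (S := SpanBicat E) (fun I => o ((spanShape E).ob I)))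
      (U : ∀ {I J : SpanBicat E} (P : I ⟶ J), (spanShape E).ElAt F P (T.map P)),
      (spanShape E).IsKan F T U ∧ ∀ {I J : SpanBicat E} (P : I ⟶ J), ∃ R, Nonempty (T.map P ⊣ R) := by
  choose r r' adj adj' using @OplaxOn.IsBeck.exists_adj _ _ _ _ _ _ _ hF
  refine ⟨(spanShape E).kanOplax F (fun P => r ((spanShape E).src P) ≫ F.map ((spanShape E).tgt P))
    (fun P => _) (fun P => isUniv_unit (adj ((spanShape E).src P)).some _), fun P => _,
    Shape.isKan_kanOplax _ _ _ _ _, fun P => ?_⟩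
  -- This is where the second right adjoint is used: it makes the value at every span a left
  -- adjoint, which is what the extension to polynomials requires.
  exact ⟨_, ⟨(adj' ((spanShape E).src P)).some.comp (adj ((spanShape E).tgt P)).some⟩⟩

/-- The canonical 2-cell exhibiting `f` as a left Kan extension along an identity. -/
def embτ {a b : LocallyDiscrete E} (f : a ⟶ b) :
    (spanShape E).tgt (emb f.as) ⟶ (spanShape E).src (emb f.as) ≫ f := (λ_ f).inv

lemma isUniv_of_embτ {a b : LocallyDiscrete E} (f : a ⟶ b) : IsUniv (El.of F (embτ f)) := by
  refine (El.isUniv_iff_isIso_toHom (T := F) (b := a) (j := f) (El.of F (embτ f))).2 ?_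
  change IsIso ((F.map₂ (λ_ f).inv ≫ F.mapComp (𝟙 a) f) ≫ F.mapId a ▷ F.map f ≫ (λ_ (F.map f)).hom)
  infer_instance

/-- The comparison of `F` with the restriction of its extension to spans. -/
lemma exists_icon_embOn_comp
    {T : OplaxOn (S := SpanBicat E) (fun I => o ((spanShape E).ob I))}
    {U : ∀ {I J : SpanBicat E} (P : I ⟶ J), (spanShape E).ElAt F P (T.map P)}
    (hT : (spanShape E).IsKan F T U) :
    ∃ β : IconOn F ((embOn E).comp (o' := fun I => o ((spanShape E).ob I)) T), β.IsInvertible := by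
  let app {a b : LocallyDiscrete E} (f : a ⟶ b) : F.map f ⟶ T.map (emb f.as) :=
    (isUniv_of_embτ f).desc (U (emb f.as))
  have happ {a b : LocallyDiscrete E} (f : a ⟶ b) : (El.of F (embτ f)).push (app f) = U (emb f.as) :=
    El.push_desc _ _
  refine ⟨⟨app, ?_, ?_, ?_⟩, ⟨fun f => ?_⟩⟩
  · intro a b f g η
    obtain rfl := LocallyDiscrete.eq_of_hom η
    rw [Subsingleton.elim η (𝟙 f)]
    exact ((congrArg (· ≫ app f) (F.map₂_id f)).trans (Category.id_comp _)).trans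
      ((congrArg (app f ≫ ·) (((embOn E).comp T).map₂_id f)).trans (Category.comp_id _)).symm
  · intro a b c f g
    have := hT.comp_mapComp_of_eq_push (embComp f.as g.as) (isUniv_of_embτ (F := F) (f ≫ g))
      (happ f) (happ g) (happ (f ≫ g)) (𝟙 (f ≫ g)) (Subsingleton.elim _ _)
    refine this.trans ?_
    exact (congrArg (· ≫ _) (F.map₂_id (f ≫ g))).trans (Category.id_comp _)
  · intro a
    have := hT.comp_mapId_of_eq_push (embId a.as) (isUniv_of_embτ (F := F) (𝟙 a))
      (happ (𝟙 a)) (𝟙 (𝟙 a)) (Subsingleton.elim _ _)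
    refine this.trans ?_
    exact (congrArg (· ≫ _) (F.map₂_id (𝟙 a))).trans (Category.id_comp _)
  · exact ((isUniv_of_embτ f).isIso_iff (happ f)).2 (hT.univ (emb f.as))

end SpanExtension

end PolyUniv

namespace PolyUniv

open Bicategory ChosenPullbacksAlong ChosenDistributivityPullbacks

/-! ### Restrictions of gregarious functors -/

section GregariousRestriction

open SpanBicat PolyMor

variable {E : Type u} [Category.{v} E] [ChosenPullbacks E] {C : Type u₂} [Bicategory.{w₂, v₂} C]

section Spans

/-- On apexes, the second coordinate of any such 2-cell is forced to be the canonical comparison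
between two pullbacks of the same cospan. -/
lemma isUniv_of_isPullback {A B B' D : E} {j : A ⟶ B} {s : A ⟶ B'} {g : B ⟶ D} {f : B' ⟶ D}
    (h : IsPullback j s g f)
    (y : emb j ⟶ emb s ≫ emb f ≫ (sp g (𝟙 B) : (⟨D⟩ : SpanBicat E) ⟶ ⟨B⟩)) : IsUniv y := by
  refine isUniv_of_isIso _ ?_
  let S : (⟨D⟩ : SpanBicat E) ⟶ ⟨B⟩ := sp g (𝟙 B)
  have h₀ : hf y ≫ pr₁ (emb s) (emb f ≫ S) = 𝟙 A :=
    (Category.comp_id _).symm.trans ((Category.assoc _ _ _).trans (hf_lg y))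
  have h₁ : (hf y ≫ pr₂ (emb s) (emb f ≫ S)) ≫ pr₁ (emb f) S = s := by
    have := congrArg (hf y ≫ ·) (pr₂_lg (emb s) (emb f ≫ S))
    simp only [reassoc_of% h₀] at this
    simpa using this
  have h₂ : (hf y ≫ pr₂ (emb s) (emb f ≫ S)) ≫ pr₂ (emb f) S = j := by
    have := hf_rg y
    simp only [rg_comp] at this
    simpa [S] using this
  have e : hf y ≫ pr₂ (emb s) (emb f ≫ S) =
      (h.flip.isoIsPullback _ _ (SpanBicat.isPullback (emb f) S)).hom :=
    (SpanBicat.isPullback (emb f) S).hom_ext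
      (h₁.trans (IsPullback.isoIsPullback_hom_fst _ _ _ _).symm)
      (h₂.trans (IsPullback.isoIsPullback_hom_snd _ _ _ _).symm)
  change IsIso (hf y ≫ pr₂ (emb s) (emb f ≫ S))
  rw [e]
  infer_instance

variable {o : SpanBicat E → C} (T : OplaxOn o) [T.IsPseudo]

/-- A pseudofunctor on spans is a left Kan extension of its restriction to `E`. -/
lemma isKan_embOn_comp : (spanShape E).IsKan ((embOn E).comp T) T
    (fun S => El.mapEl T (J := embOn E) (uSp S)) where
  push_map₂ φ := (isKan_idOn_embOn.toIsCompat.map (F := T)).push_map₂ φ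
  push_mapComp P Q := by
    -- The composite of the identity functor with `T` has the constraints of `T` up to composition
    -- with the image of an identity 2-cell, which has to be removed.
    refine Eq.trans ?_ ((isKan_idOn_embOn.toIsCompat.map (F := T)).push_mapComp P Q)
    exact congrArg _ ((congrArg (· ≫ T.mapComp P Q) (T.map₂_id (P ≫ Q))).trans
      (Category.id_comp _)).symm
  push_mapId I := by
    refine Eq.trans ?_ ((isKan_idOn_embOn.toIsCompat.map (F := T)).push_mapId I)
    exact congrArg _ ((congrArg (· ≫ T.mapId I) (T.map₂_id (𝟙 I))).trans
      (Category.id_comp _)).symm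
  univ S := El.isUniv_mapEl T (J := embOn E) (adjInv (emb (lg S))) (adjInv (emb (rg S)))
    (isUniv_uSp S)

end Spans

variable [ChosenDistributivityPullbacks E] {o : PolyBicat E → C} (F : OplaxOn o) [F.IsGreg]

/-- Linear polynomials are left adjoints, so gregariousness covers all composites of spans. -/
instance isPseudo_linOn_comp : ((linOn E).comp F).IsPseudo where
  isIso_mapId I :=
    haveI := OplaxOn.IsGreg.isIso_mapId (F := F) ⟨I.as⟩
    inferInstanceAs (IsIso (F.map₂ ((linOn E).mapId I) ≫ F.mapId ⟨I.as⟩))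
  isIso_mapComp S S' :=
    haveI := OplaxOn.IsGreg.isIso_mapComp (F := F) ((linOn E).map S) (linAdj S')
    @IsIso.comp_isIso _ _ _ _ _ (F.map₂ ((linOn E).mapComp S S')) _ inferInstance this

/-- A gregarious functor on polynomials is a left Kan extension of its restriction to spans. -/
lemma isKan_linOn_comp : (polyShape E).IsKan ((linOn E).comp F) F
    (fun P => El.mapEl F (J := linOn E) (uEl P)) where
  push_map₂ φ := (isKan_idOn_linOn.toIsCompat.map (F := F)).push_map₂ φ
  push_mapComp P Q := by
    refine Eq.trans ?_ ((isKan_idOn_linOn.toIsCompat.map (F := F)).push_mapComp P Q)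
    exact congrArg _ ((congrArg (· ≫ F.mapComp P Q) (F.map₂_id (P ≫ Q))).trans
      (Category.id_comp _)).symm
  push_mapId I := by
    refine Eq.trans ?_ ((isKan_idOn_linOn.toIsCompat.map (F := F)).push_mapId I)
    exact congrArg _ ((congrArg (· ≫ F.mapId I) (F.map₂_id (𝟙 I))).trans
      (Category.id_comp _)).symm
  univ P := El.isUniv_mapEl F (J := linOn E) (linAdj (srcS P)) (linAdj (emb (PolyMor.t P)))
    (isUniv_uEl P)

/-- The restriction to `E` of a gregarious functor on polynomials is 2-Beck. -/
lemma isBeck_embOn_comp : ((embOn E).comp ((linOn E).comp F)).IsBeck where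
  -- The right adjoint of an embedded morphism is the reversed span, and the linear polynomial of
  -- that span is again a left adjoint; both adjunctions are preserved by `F`.
  exists_adj {X Y} f := ⟨_, _, ⟨((linOn E).comp F).mapAdj (adjInv (emb f.as))⟩,
    ⟨F.mapAdj (linAdj (sp (I := ⟨Y.as⟩) (J := ⟨X.as⟩) f.as (𝟙 _)))⟩⟩
  beck {a b c d f' g' g f} h θ u' u adj' adj := by
    -- The reversed span of `g` extends the identity along `g`. It is enough to base change its
    -- universal element, which can be done among spans before applying `F`.
    let S : (⟨d.as⟩ : SpanBicat E) ⟶ ⟨b.as⟩ := sp g.as (𝟙 _)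
    let x : El (embOn E) g (𝟙 b) S := uSp S
    refine isIso_mateEquiv_of_isUniv adj' adj (y := El.mapEl ((linOn E).comp F) x)
      (El.isUniv_mapEl _ (adjInv (emb (lg S))) (adjInv (emb (rg S))) (isUniv_uSp S)) ?_
    rw [← El.mapEl_pull, ← El.mapEl_cov, ← El.mapEl_curry]
    refine (isUniv_push_iff _ (((linOn E).comp F).mapComp ((embOn E).map f) S)).2 ?_
    refine El.isUniv_mapEl (J := embOn E) (s := g') (j := f' ≫ 𝟙 b)
      ((linOn E).comp F) (adjInv (emb g'.as)) (adjInv (emb (f' ≫ 𝟙 b).as)) ?_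
    refine isUniv_of_isPullback (j := (f' ≫ 𝟙 b).as) (s := g'.as) (f := f.as) (g := g.as) ?_ _
    have e : (f' ≫ 𝟙 b).as = f'.as := Category.comp_id _
    rw [e]
    exact h

end GregariousRestriction

end PolyUniv

namespace PolyUniv

open Bicategory ChosenPullbacksAlong ChosenDistributivityPullbacks

/-! ### Second factors with invertible constraint cells -/

namespace OplaxOn

variable {A : Type u₁} [Bicategory.{w₁, v₁} A] {C : Type u₂} [Bicategory.{w₂, v₂} C] {o : A → C}

/-- All constraint cells at composites with second factor `Q` are invertible. -/
def IsGood (F : OplaxOn o) {b c : A} (Q : b ⟶ c) : Prop :=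
  ∀ ⦃a : A⦄ (P : a ⟶ b), IsIso (F.mapComp P Q)

variable {F : OplaxOn o}

/-- The associativity law expresses the constraint at `P` and `Q ≫ Q'` through constraints whose
second factor is `Q` or `Q'`. -/
lemma IsGood.comp {b c d : A} {Q : b ⟶ c} {Q' : c ⟶ d} (h : F.IsGood Q) (h' : F.IsGood Q') :
    F.IsGood (Q ≫ Q') := fun a P => by
  have := h' Q
  have := h' (P ≫ Q)
  have := h P
  have e : F.mapComp P (Q ≫ Q') = inv (F.map₂ (α_ P Q Q').hom) ≫ F.mapComp (P ≫ Q) Q' ≫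
      F.mapComp P Q ▷ F.map Q' ≫ (α_ _ _ _).hom ≫ inv (F.map P ◁ F.mapComp Q Q') := by
    rw [IsIso.eq_inv_comp, ← cancel_mono (F.map P ◁ F.mapComp Q Q')]
    simpa using F.associator P Q Q'
  rw [e]
  infer_instance

lemma IsGood.of_iso {b c : A} {Q Q' : b ⟶ c} (h : F.IsGood Q) (e : Q ⟶ Q') (_ : IsIso e) :
    F.IsGood Q' := fun a P => by
  have := h P
  have e' := F.naturality_right P e
  have : IsIso (F.map₂ (P ◁ e) ≫ F.mapComp P Q') := by
    rw [e']
    infer_instance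
  exact IsIso.of_isIso_comp_left (F.map₂ (P ◁ e)) _

end OplaxOn

lemma Shape.zel_push {S : Type u₁} [Bicategory.{w₁, v₁} S] {A : Type u₂} [Bicategory.{w₂, v₂} A]
    {C : Type u₃} [Bicategory.{w₃, v₃} C] (Sh : Shape S A) {o : S → C} {T : OplaxOn o} [T.IsPseudo]
    {I J K : A} (P : I ⟶ J) {Q : J ⟶ K} {Y Y' : o (Sh.ob J) ⟶ o (Sh.ob K)} (y : Sh.ElAt T Q Y)
    (f : Y ⟶ Y') : Sh.zel P (y.push f) = (Sh.zel P y).push (T.map (Sh.tgt P) ◁ f) := by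
  rw [zel, zel, ← El.curry_push, El.push_con, El.push_cov, El.push_pull]

open SpanBicat PolyMor

variable {E : Type u} [Category.{v} E] [ChosenPullbacks E] [ChosenDistributivityPullbacks E]

section Linear

instance isIso_dq_lin {I J K : E} (P : PolyMor I J) (S : (⟨J⟩ : SpanBicat E) ⟶ ⟨K⟩) :
    IsIso (dq P (lin S)) :=
  IsPullback.isIso_snd_of_isIso (compDPB P (lin S)).isPullback (inferInstanceAs (IsIso (𝟙 _)))

/-- For a linear second factor, an element of the base of the composite is a pair of points of
`P.base` and of the apex of `S` with the same image. So the base is the pullback of `P.t` and the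
left leg of `S`; `mkBase` gives the inverse. -/
lemma isUniv_zel_uSp {I J K : E} (P : PolyMor I J) (S : (⟨J⟩ : SpanBicat E) ⟶ ⟨K⟩) :
    IsUniv (ctS P (lin S) ≫ (emb (cr P (lin S)) ◁ (uSp S) ≫ (α_ _ _ _).inv) ≫
      cmS P (lin S) ▷ S ≫ (α_ (csS P (lin S)) (emb P.t) S).hom) := by
  refine isUniv_of_isIso _ ?_
  have h₀ : pos (P := P) (Q := lin S) (𝟙 _) (𝟙 _ ≫ cr P (lin S)) (lin_h _) ≫ P.t =
    cr P (lin S) ≫ lg S := (pos_t _ _ _).trans (by simp)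
  have e : hf (ctS P (lin S) ≫ (emb (cr P (lin S)) ◁ (uSp S) ≫ (α_ _ _ _).inv) ≫
      cmS P (lin S) ▷ S ≫ (α_ (csS P (lin S)) (emb P.t) S).hom) ≫ pr₂ _ _ =
      pr (S := emb P.t) (S' := S) _ _ h₀ := by
    refine ax_ext ?_ ?_
    · rw [pr_pr₁]
      simp [-comp_t]
    · rw [pr_pr₂]
      simp [-comp_t]
  have hk : ∀ {V : E} (z : V ⟶ ax (emb P.t ≫ S)) (m : V ⟶ ax S),
      z ≫ pr₂ (emb P.t) S = m ≫ 𝟙 _ → (z ≫ pr₁ (emb P.t) S) ≫ P.t = m ≫ lg S := fun z m h => by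
    have h' : z ≫ pr₂ (emb P.t) S = m := h.trans (Category.comp_id _)
    simp [← h']
  have hp {V : E} (z : V ⟶ ax (emb P.t ≫ S)) (m : V ⟶ ax S) (h : z ≫ pr₂ (emb P.t) S = m ≫ 𝟙 _) :=
    pos_precomp_mkBase (P := P) (Q := lin S) (pr₂ (emb P.t) S)
      (fun _ z _ _ => z ≫ pr₁ (emb P.t) S) (fun _ z m h => hk z m h) (by simp) z m h
  refine (congrArg IsIso e).mpr ⟨mkBase (Q := lin S) (pr₂ (emb P.t) S)
    (fun _ z _ _ => z ≫ pr₁ (emb P.t) S) (fun _ z m h => hk z m h), ?_, ?_⟩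
  · refine base_ext (Q := lin S) (by simp) fun z m h₁ h₂ => ?_
    have h₂' : z ≫ cr P (lin S) = m := by
      have := h₂.trans (Category.comp_id _)
      simpa using this
    have := hp (z ≫ pr (S := emb P.t) (S' := S) _ _ h₀) m (by simpa using h₂')
    simp only [Category.assoc] at this h₁ ⊢
    refine this.trans ?_
    simp [h₂']
  · refine ax_ext ?_ (by simp)
    have := hp (𝟙 _) (pr₂ (emb P.t) S) (by simp)
    simp only [Category.id_comp] at this
    simpa [-comp_t] using this

variable {C : Type u₂} [Bicategory.{w₂, v₂} C] {o : SpanBicat E → C} {T : OplaxOn o} [T.IsPseudo]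

/-- The value at $(s,p,t)$ is the right adjoint of the value at the span with legs $p$, $s$,
followed by the value at $t$. When $T$ extends $F$ this is $F_\Delta s$, $F_\Pi p$, $Ft$. -/
lemma exists_isKan_poly (hT : ∀ {I J : SpanBicat E} (S : I ⟶ J), ∃ R, Nonempty (T.map S ⊣ R)) :
    ∃ (L : OplaxOn (S := PolyBicat E) (fun I => o ((polyShape E).ob I)))
      (U : ∀ {I J : PolyBicat E} (P : I ⟶ J), (polyShape E).ElAt T P (L.map P)),
      (polyShape E).IsKan T L U := by
  choose r adj using @hT
  exact ⟨(polyShape E).kanOplax T (fun P => r ((polyShape E).src P) ≫ T.map ((polyShape E).tgt P))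
    (fun P => _) (fun P => isUniv_unit (adj ((polyShape E).src P)).some _), fun P => _,
    Shape.isKan_kanOplax _ _ _ _ _⟩

variable {L : OplaxOn (S := PolyBicat E) (fun I => o ((polyShape E).ob I))}
  {U : ∀ {I J : PolyBicat E} (P : I ⟶ J), (polyShape E).ElAt T P (L.map P)}

set_option linter.unusedSectionVars false in
lemma isUniv_of_uSp {I J : SpanBicat E} (S : I ⟶ J) : IsUniv (El.of T (uSp S)) :=
  El.isUniv_of (adjInv (emb (lg S))) (adjInv (emb (rg S))) (isUniv_uSp S)

lemma isIso_mapId_of_isKan (hL : (polyShape E).IsKan T L U) (I : PolyBicat E) :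
    IsIso (L.mapId I) := by
  rw [hL.isIso_mapId_iff]
  refine (El.isUniv_iff_isIso_toHom (T := T) (b := ⟨I.as⟩) (j := emb (𝟙 I.as))
    ((polyShape E).unitAt T I)).2 ?_
  change IsIso ((T.map₂ (𝟙 (emb (𝟙 I.as))) ≫ (ρ_ (T.map _)).inv) ≫
    T.mapId _ ▷ 𝟙 _ ≫ (λ_ (𝟙 _)).hom)
  infer_instance

/-- The canonical element of a span, regarded as an element of a linear polynomial. -/
noncomputable def linEl (T : OplaxOn o) {J K : SpanBicat E} (S : J ⟶ K) :
    (polyShape E).ElAt T (I := ⟨J.as⟩) (J := ⟨K.as⟩) (lin S) (T.map S) := El.of T (uSp S)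

lemma isUniv_linEl {J K : SpanBicat E} (S : J ⟶ K) : IsUniv (linEl T S) := isUniv_of_uSp S

lemma isUniv_zel_linEl {I : PolyBicat E} {J K : SpanBicat E} (P : I ⟶ ⟨J.as⟩) (S : J ⟶ K) :
    IsUniv ((polyShape E).zel P (linEl T S)) := by
  have e := (polyShape E).zel_of (T := T) P (K := ⟨K.as⟩) (lin S) (j := S) (uSp S)
  rw [linEl, e]
  refine (@isUniv_push_iff _ _ _ _ _ _ _ _ _ _ _
    (OplaxOn.IsPseudo.isIso_mapComp (T := T) (emb (PolyMor.t P)) S)).2 ?_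
  exact El.isUniv_of (T := T) (adjInv (csS P (lin S))) (adjInv (emb (PolyMor.comp P (lin S)).t))
    (isUniv_zel_uSp P S)

/-- The relevant element is already universal among spans, with left adjoint indices, so every
pseudofunctor `T` keeps it universal. No distributivity is involved. -/
lemma isGood_lin (hT : ∀ {I J : SpanBicat E} (S : I ⟶ J), ∃ R, Nonempty (T.map S ⊣ R))
    (hL : (polyShape E).IsKan T L U) {J K : SpanBicat E} (S : J ⟶ K) :
    L.IsGood (b := ⟨J.as⟩) (c := ⟨K.as⟩) (lin S) := fun I P => by
  rw [hL.isIso_mapComp_iff]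
  refine (polyShape E).isUniv_cprod (hL.univ P) (hT _) ?_
  have e : (linEl T S).push ((isUniv_linEl S).desc (U (I := ⟨J.as⟩) (J := ⟨K.as⟩) (lin S))) =
    U (I := ⟨J.as⟩) (J := ⟨K.as⟩) (lin S) := El.push_desc _ _
  have := ((isUniv_linEl S).isIso_iff e).2 (hL.univ _)
  rw [← e, Shape.zel_push]
  exact (isUniv_push_iff _ _).2 (isUniv_zel_linEl P S)

end Linear

end PolyUniv

namespace PolyUniv

open Bicategory ChosenPullbacksAlong ChosenDistributivityPullbacks

open SpanBicat PolyMor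

variable {E : Type u} [Category.{v} E] [ChosenPullbacks E] [ChosenDistributivityPullbacks E]

/-! ### Factorisation of polynomials -/

namespace PolyMor

/-- The linear polynomial isomorphic to a polynomial whose middle map is invertible. -/
noncomputable def ofLin {I J : E} (Q : PolyMor I J) [IsIso Q.p] :
    lin (sp (inv Q.p ≫ Q.s) Q.t : (⟨I⟩ : SpanBicat E) ⟶ ⟨J⟩) ⟶ Q :=
  Hom.ofAct (𝟙 _) (Category.id_comp _) (fun _ b _ _ => b) (fun _ _ _ _ => Category.comp_id _)
    (fun _ b m h => by
      have h' : b = m ≫ Q.p := (Category.comp_id _).symm.trans h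
      simp [h'])

noncomputable def toLin {I J : E} (Q : PolyMor I J) [IsIso Q.p] :
    Q ⟶ lin (sp (inv Q.p ≫ Q.s) Q.t : (⟨I⟩ : SpanBicat E) ⟶ ⟨J⟩) :=
  Hom.ofAct (𝟙 _) (Category.id_comp _) (fun _ b _ _ => b ≫ inv Q.p) (fun _ _ _ _ => by simp)
    (fun _ b m h => by
      have h' : b = m := (Category.comp_id _).symm.trans (h.trans (Category.comp_id _))
      simp [h'])

instance {I J : E} (Q : PolyMor I J) [IsIso Q.p] : IsIso (ofLin Q) := by
  refine ⟨toLin Q, lin_hom_ext fun b => ?_, hom_ext (fun b => ?_) fun b m h₁ h₂ => ?_⟩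
  · exact (comp_ap (ofLin Q) (toLin Q) b).trans (((Category.comp_id _).trans
      (Category.comp_id _)).trans (id_ap (P := lin (sp (inv Q.p ≫ Q.s) Q.t)) b).symm)
  · exact (comp_ap (toLin Q) (ofLin Q) b).trans (((Category.comp_id _).trans
      (Category.comp_id _)).trans (id_ap b).symm)
  · rw [← cancel_mono Q.p, Hom.act_p, Hom.act_p]

variable {I J : E} (Q : PolyMor I J)

/-- The polynomial obtained by deleting the source of `Q`. -/
@[reducible] def tail : PolyMor Q.tot J := ⟨Q.tot, Q.base, 𝟙 _, Q.p, Q.t⟩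

/-- The linear polynomial given by pulling back along the source of `Q`. -/
@[reducible] def head : PolyMor I Q.tot := lin (sp Q.s (𝟙 _) : (⟨I⟩ : SpanBicat E) ⟶ ⟨Q.tot⟩)

/-- The polynomial given by pushing forward along `f`. -/
@[reducible] def pi {A B : E} (f : A ⟶ B) : PolyMor A B := ⟨A, B, 𝟙 _, f, 𝟙 _⟩

lemma pos_head {W : E} (x : W ⟶ (comp (head Q) (tail Q)).base) (m : W ⟶ Q.tot)
    (h : x ≫ cr (head Q) (tail Q) = m ≫ Q.p) : pos (Q := tail Q) x m h = m :=
  (Category.comp_id _).symm.trans ((pos_t x m h).trans (Category.comp_id _))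

/-- Factorization of a polynomial. -/
noncomputable def headTail : comp (head Q) (tail Q) ⟶ Q :=
  Hom.ofAct (cr (head Q) (tail Q)) rfl
    (fun _ x m h => mkTot (P := head Q) (Q := tail Q) x m m h ((Category.comp_id _).trans (pos_head Q x m h).symm))
    (fun _ x m h => mkTot_p _ _ _ _ _) (fun _ x m h => by simp)

lemma ctx_head : ctx (head Q) (tail Q) = ctm (head Q) (tail Q) := by
  have := ctx_p (head Q) (tail Q)
  rw [pos_head] at this
  exact (Category.comp_id _).symm.trans this

/-- The inverse of `headTail`. -/
noncomputable def headTailInv : Q ⟶ comp (head Q) (tail Q) :=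
  Hom.ofAct (mkBase (P := head Q) (Q := tail Q) (𝟙 _) (fun _ _ m _ => m) (fun _ _ _ _ => rfl)) (by simp)
    (fun _ b y h => y ≫ ctm (head Q) (tail Q)) (fun _ b y h => by
      have := congrArg (· ≫ cr (head Q) (tail Q)) h
      simpa using this.symm) (fun _ b y h => by
      rw [comp_s, ctx_head, Category.assoc])

variable {Q}

lemma headTail_ap {W : E} (x : W ⟶ (comp (head Q) (tail Q)).base) :
    (headTail Q).ap x = x ≫ cr (head Q) (tail Q) := rfl

lemma headTail_act {W : E} (x : W ⟶ (comp (head Q) (tail Q)).base) (m : W ⟶ Q.tot)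
    (h : x ≫ cr (head Q) (tail Q) = m ≫ Q.p) :
    (headTail Q).act x m h = mkTot (P := head Q) (Q := tail Q) x m m h
      ((Category.comp_id _).trans (pos_head Q x m h).symm) :=
  Hom.ofAct_act _ _ _ _ _ (by intros; simp) _ _ _

lemma headTailInv_ap_cr {W : E} (x : W ⟶ Q.base) :
    (headTailInv Q).ap x ≫ cr (head Q) (tail Q) = x :=
  (Category.assoc _ _ _).trans ((congrArg (x ≫ ·) (mkBase_cr _ _ _)).trans (Category.comp_id _))

lemma headTailInv_act {W : E} (x : W ⟶ Q.base) (y : W ⟶ (comp (head Q) (tail Q)).tot)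
    (h : (headTailInv Q).ap x = y ≫ (comp (head Q) (tail Q)).p) :
    (headTailInv Q).act x y h = y ≫ ctm (head Q) (tail Q) :=
  Hom.ofAct_act _ _ _ _ _ (by intros; simp) _ _ _

variable (Q)

instance : IsIso (headTail Q) := by
  refine ⟨headTailInv Q, hom_ext (fun x => ?_) fun x y h₁ h₂ => ?_, hom_ext (fun x => ?_)
    fun x y h₁ h₂ => ?_⟩
  · refine (comp_ap (headTail Q) (headTailInv Q) x).trans (Eq.trans ?_ (id_ap x).symm)
    refine base_ext (P := head Q) (Q := tail Q) ?_ fun z m h₁ h₂ => ?_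
    · rw [headTailInv_ap_cr, headTail_ap]
    · rw [pos_head, pos_head]
  · have h₂' : x = y ≫ (comp (head Q) (tail Q)).p := (id_ap x).symm.trans h₂
    refine (comp_act (headTail Q) (headTailInv Q) x y h₁).trans (Eq.trans ?_ (id_act x y h₂).symm)
    refine (headTail_act _ _ _).trans (tot_ext (P := head Q) (Q := tail Q) ?_ ?_ ?_)
    · exact (mkTot_p _ _ _ _ _).trans h₂'
    · exact (mkTot_ctm _ _ _ _ _).trans (headTailInv_act _ _ _)
    · exact (mkTot_ctx _ _ _ _ _).trans ((headTailInv_act _ _ _).trans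
        (congrArg (y ≫ ·) (ctx_head Q).symm))
  · refine (comp_ap (headTailInv Q) (headTail Q) x).trans (Eq.trans ?_ (id_ap x).symm)
    rw [headTail_ap, headTailInv_ap_cr]
  · refine (comp_act (headTailInv Q) (headTail Q) x y h₁).trans (Eq.trans ?_ (id_act x y h₂).symm)
    rw [headTailInv_act]
    refine (congrArg (· ≫ ctm _ _) (headTail_act _ _ _)).trans ?_
    exact mkTot_ctm _ _ _ _ _

set_option linter.unusedSectionVars false in
lemma post_pi : post (pi Q.p) Q.t = tail Q := by
  simp only [tail, post, Category.id_comp]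

instance {I J K : E} (P : PolyMor I J) (f : J ⟶ K) : IsIso (postHom P f) :=
  ⟨postInv P f, postHom_postInv P f, postInv_postHom P f⟩

end PolyMor

section

variable {C : Type u₂} [Bicategory.{w₂, v₂} C] {o : SpanBicat E → C} {T : OplaxOn o} [T.IsPseudo]
  {L : OplaxOn (S := PolyBicat E) (fun I => o ((polyShape E).ob I))}
  {U : ∀ {I J : PolyBicat E} (P : I ⟶ J), (polyShape E).ElAt T P (L.map P)}

/-- A left adjoint has invertible middle map, hence is isomorphic to a linear polynomial, and
invertibility of constraints is invariant under isomorphism of the second factor. -/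
lemma isGreg_of_isKan (hT : ∀ {I J : SpanBicat E} (S : I ⟶ J), ∃ R, Nonempty (T.map S ⊣ R))
    (hL : (polyShape E).IsKan T L U) : L.IsGreg where
  isIso_mapId I := isIso_mapId_of_isKan hL I
  isIso_mapComp {a b c} P Q R adj := by
    have := isIso_p_of_adjunction adj
    exact (isGood_lin hT hL (J := ⟨b.as⟩) (K := ⟨c.as⟩) (sp (inv (PolyMor.p Q) ≫ PolyMor.s Q)
      (PolyMor.t Q))).of_iso (Q' := Q) (ofLin Q) (inferInstanceAs (IsIso (ofLin Q))) P

/-- Up to isomorphism, $(s,p,t)$ is the pullback along $s$, then the pushforward along $p$, then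
composition with $t$. The outer two are linear, and good second factors are closed under
composition. -/
lemma isPseudo_of_isGood_pi (hT : ∀ {I J : SpanBicat E} (S : I ⟶ J), ∃ R, Nonempty (T.map S ⊣ R))
    (hL : (polyShape E).IsKan T L U)
    (h : ∀ {A B : E} (f : A ⟶ B), L.IsGood (b := ⟨A⟩) (c := ⟨B⟩) (pi f)) :
    L.IsPseudo where
  isIso_mapId I := isIso_mapId_of_isKan hL I
  isIso_mapComp {a b c} P Q := by
    have h₁ : L.IsGood (b := ⟨Q.tot⟩) (c := c) (tail Q) := by
      have h₀ := (h Q.p).comp (isGood_lin hT hL (emb Q.t))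
      exact h₀.of_iso (Q' := tail Q) (postHom (pi Q.p) Q.t ≫ eqToHom (post_pi Q))
        (inferInstanceAs (IsIso (postHom (pi Q.p) Q.t ≫ eqToHom (post_pi Q))))
    have h₂ := (isGood_lin hT hL (sp (I := ⟨b.as⟩) (J := ⟨Q.tot⟩) Q.s (𝟙 _))).comp h₁
    exact h₂.of_iso (Q' := Q) (headTail Q) (inferInstanceAs (IsIso (headTail Q))) P

end

end PolyUniv

namespace PolyUniv

open Bicategory ChosenPullbacksAlong ChosenDistributivityPullbacks

open SpanBicat PolyMor

/-! ### Comparison with the restriction of the extension -/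

section

variable {E : Type u} [Category.{v} E] [ChosenPullbacks E]

namespace SpanBicat

instance {I J K : SpanBicat E} (S : I ⟶ J) (S' : J ⟶ K) [IsIso (lg S)] [IsIso (lg S')] :
    IsIso (lg (S ≫ S')) := by
  have : IsIso (pr₁ S S') := (SpanBicat.isPullback S S').isIso_fst_of_isIso
  rw [lg_comp]
  infer_instance

/-- A map into a span with monic left leg is determined by its left leg. This discharges the
equations between 2-cells of spans in `Shape.IsCompat.comp_mapComp_of_eq_push`. -/
lemma hom_eq_of_mono {I J : SpanBicat E} {S S' : I ⟶ J} [Mono (lg S')] (φ ψ : S ⟶ S') : φ = ψ :=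
  hf_ext ((cancel_mono (lg S')).1 ((hf_lg φ).trans (hf_lg ψ).symm))

end SpanBicat

variable [ChosenDistributivityPullbacks E] {C : Type u₂} [Bicategory.{w₂, v₂} C]
  {o : SpanBicat E → C} {T : OplaxOn o} [T.IsPseudo]
  {L : OplaxOn (S := PolyBicat E) (fun I => o ((polyShape E).ob I))}
  {U : ∀ {I J : PolyBicat E} (P : I ⟶ J), (polyShape E).ElAt T P (L.map P)}

/-- The comparison of the restriction of `T` with the restriction of its extension to
polynomials. -/
lemma exists_icon_linOn_comp (hL : (polyShape E).IsKan T L U) :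
    ∃ β : IconOn ((embOn E).comp T) ((embOn E).comp ((linOn E).comp
      (o' := fun I => o ((polyShape E).ob I)) L)), β.IsInvertible := by
  let V {I J : SpanBicat E} (S : I ⟶ J) :
    (polyShape E).ElAt T (I := ⟨I.as⟩) (J := ⟨J.as⟩) (lin S) (L.map (lin S)) :=
    U (I := ⟨I.as⟩) (J := ⟨J.as⟩) (lin S)
  let app {a b : LocallyDiscrete E} (f : a ⟶ b) :
    T.map (emb f.as) ⟶ L.map (a := ⟨a.as⟩) (b := ⟨b.as⟩) (lin (emb f.as)) :=
    (isUniv_linEl (T := T) (emb f.as)).desc (V (emb f.as))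
  have happ {a b : LocallyDiscrete E} (f : a ⟶ b) :
    (linEl T (emb f.as)).push (app f) = V (emb f.as) := El.push_desc _ _
  refine ⟨⟨app, ?_, ?_, ?_⟩, ⟨fun f => ?_⟩⟩
  · intro a b f g η
    obtain rfl := LocallyDiscrete.eq_of_hom η
    rw [Subsingleton.elim η (𝟙 f)]
    exact ((congrArg (· ≫ app f) (((embOn E).comp T).map₂_id f)).trans (Category.id_comp _)).trans
      ((congrArg (app f ≫ ·) (((embOn E).comp ((linOn E).comp
      (o' := fun I => o ((polyShape E).ob I)) L)).map₂_id f)).trans (Category.comp_id _)).symm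
  · intro a b c f g
    have := hL.comp_mapComp_of_eq_push (((embOn E).comp (linOn E)).mapComp f g)
      (isUniv_linEl (T := T) (emb (f ≫ g).as))
      (happ f) (happ g) (happ (f ≫ g)) (embComp f.as g.as) (SpanBicat.hom_eq_of_mono (S' := emb (𝟙 _) ≫ emb f.as ≫ emb g.as) _ _)
    refine Eq.trans (congrArg (app (f ≫ g) ≫ ·) ?_) (this.trans (Category.assoc _ _ _).symm)
    exact (Category.assoc _ _ _).symm.trans (congrArg (· ≫ L.mapComp _ _) (L.map₂_comp _ _).symm)
  · intro a
    have : IsIso (lg (𝟙 (⟨a.as⟩ : SpanBicat E))) := inferInstanceAs (IsIso (𝟙 a.as))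
    have := hL.comp_mapId_of_eq_push (((embOn E).comp (linOn E)).mapId a)
      (isUniv_linEl (T := T) (emb (𝟙 a.as)))
      (happ (𝟙 a)) (embId a.as) (SpanBicat.hom_eq_of_mono (S' := emb (𝟙 a.as) ≫ 𝟙 (⟨a.as⟩ : SpanBicat E)) _ _)
    refine Eq.trans (congrArg (app (𝟙 a) ≫ ·) ?_) this
    exact (Category.assoc _ _ _).symm.trans (congrArg (· ≫ L.mapId _) (L.map₂_comp _ _).symm)
  · exact ((isUniv_linEl (T := T) (emb f.as)).isIso_iff (happ f)).2 (hL.univ _)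

end

end PolyUniv

namespace PolyUniv

open Bicategory ChosenPullbacksAlong ChosenDistributivityPullbacks

/-! ### Distributivity data, independent of chosen adjoints -/

section DistributivityData

variable {S : Type u₁} [Bicategory.{w₁, v₁} S] {C : Type u₂} [Bicategory.{w₂, v₂} C] {o : S → C}

/-- Composition of an element with the value at a 1-cell. -/
def El.act {T : OplaxOn o} {b i k l : S} {s : b ⟶ i} {j : b ⟶ k} {X : o i ⟶ o k} (x : El T s j X)
    (h : k ⟶ l) : El T s (j ≫ h) (X ≫ T.map h) :=
  T.mapComp j h ≫ x ▷ T.map h ≫ (α_ _ _ _).hom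

lemma El.push_act {T : OplaxOn o} {b i k l : S} {s : b ⟶ i} {j : b ⟶ k} {X Y : o i ⟶ o k}
    (x : El T s j X) (g : X ⟶ Y) (h : k ⟶ l) :
    (x.push g).act h = (x.act h).push (g ▷ T.map h) := by
  simp [El.push, El.act]

lemma IsUniv.act {T : OplaxOn o} [T.IsPseudo] {b i k l : S} {s : b ⟶ i} {j : b ⟶ k}
    {X : o i ⟶ o k} {x : El T s j X} (hx : IsUniv x) {r : o i ⟶ o b} (adj : T.map s ⊣ r)
    (h : k ⟶ l) : IsUniv (x.act h) :=
  (isUniv_iso_comp_iff _ (T.mapComp j h)).2 (hx.whiskerRight adj (T.map h))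

lemma IconOn.tr_act {F G : OplaxOn o} (β : IconOn F G) [β.IsInvertible] {b i k l : S} {s : b ⟶ i}
    {j : b ⟶ k} {X : o i ⟶ o k} (x : El G s j X) (h : k ⟶ l) :
    (β.tr (x.act h)) = El.push (El.act (β.tr x) h) (X ◁ β.app h) := by
  simp only [IconOn.tr, El.act, El.push, β.map_comp_assoc, Category.assoc, comp_whiskerRight]
  rw [whisker_exchange_assoc, comp_whiskerLeft_assoc]
  have := whisker_exchange (inv (β.app s)) (X ◁ β.app h)
  simp only [whiskerRight_comp, Category.assoc] at this
  simp [this]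

/-- Data controlling the distributivity morphism of a square
`θ : (p ≫ u) ≫ f ⟶ q ≫ r`. -/
structure DistData (F : OplaxOn o) [F.IsPseudo] {t x a b y : S} {p : t ⟶ x} {u : x ⟶ a}
    {f : a ⟶ b} {q : t ⟶ y} {r : y ⟶ b} (θ : (p ≫ u) ≫ f ⟶ q ≫ r) where
  X : o b ⟶ o a
  ef : El F f (𝟙 a) X
  W : o y ⟶ o x
  ew : El F q p W
  κ : W ≫ F.map u ⟶ F.map r ≫ X
  Y : o a ⟶ o b
  e : 𝟙 (o b) ⟶ X ≫ Y
  hf : IsUniv ef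
  hw : IsUniv ew
  he : IsUniv e
  isIso_κ : IsIso κ
  -- This makes `κ` the inverse-free description of the Beck 2-cell: it is determined by the two
  -- universal elements `ef` and `ew`.
  act_push : (ew.act u).push κ = El.con (ρ_ (p ≫ u)).inv (El.cov θ (El.pull (p ≫ u) ef)).curry

namespace DistData

variable {F : OplaxOn o} [F.IsPseudo] {t x a b y : S} {p : t ⟶ x} {u : x ⟶ a}
    {f : a ⟶ b} {q : t ⟶ y} {r : y ⟶ b} {θ : (p ≫ u) ≫ f ⟶ q ≫ r}

attribute [instance] DistData.isIso_κ

/-- The element whose universality is equivalent to invertibility of the distributivity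
morphism. -/
noncomputable def z (d : DistData F θ) : F.map r ⟶ d.W ≫ F.map u ≫ d.Y :=
  (ρ_ _).inv ≫ F.map r ◁ d.e ≫ (α_ _ _ _).inv ≫ inv d.κ ▷ d.Y ≫ (α_ _ _ _).hom

/-- Kan extensions are unique up to unique isomorphism, so any two data are related by `γ`, `ω` and
`π`, and these carry one element `z` to the other. The distributivity condition may therefore be
tested on any convenient data. -/
lemma isUniv_z {l : o y ⟶ o t} (adj : F.map q ⊣ l) (d d' : DistData F θ) (h : IsUniv d.z) :
    IsUniv d'.z := by
  let γ := d.hf.desc d'.ef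
  have hγ : d.ef.push γ = d'.ef := El.push_desc _ _
  have : IsIso γ := (d.hf.isIso_iff hγ).2 d'.hf
  let ω := d.hw.desc d'.ew
  have hω : d.ew.push ω = d'.ew := El.push_desc _ _
  have : IsIso ω := (d.hw.isIso_iff hω).2 d'.hw
  -- Both sides are 2-cells out of `d.W ≫ F.map u`, which is an extension along `F.map q` because
  -- the extension `d.W` is absolute.
  have e₁ : d.κ ≫ F.map r ◁ γ = ω ▷ F.map u ≫ d'.κ := by
    refine El.push_injective (d.hw.act adj u) ?_
    rw [← El.push_push, ← El.push_push, d.act_push, ← El.push_act, hω, d'.act_push, ← hγ,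
      El.push_con, ← El.curry_push, El.push_cov, El.push_pull]
  have e₂ : inv d.κ ≫ ω ▷ F.map u = F.map r ◁ γ ≫ inv d'.κ := by
    rw [IsIso.inv_comp_eq, reassoc_of% e₁]
    simp
  have h₁ : IsUniv (d.e ≫ γ ▷ d.Y) := (isUniv_comp_whiskerRight_iff _ _).2 d.he
  let π := h₁.desc d'.e
  have hπ : (d.e ≫ γ ▷ d.Y) ≫ d'.X ◁ π = d'.e := h₁.fac _
  have : IsIso π := (h₁.isIso_iff hπ).2 d'.he
  have e₃ : d'.z = (d.z ≫ ω ▷ (F.map u ≫ d.Y)) ≫ d'.W ◁ F.map u ◁ π := by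
    have e₂' := congrArg (· ▷ d.Y) e₂
    simp only [comp_whiskerRight] at e₂'
    calc d'.z = 𝟙 _ ⊗≫ F.map r ◁ d.e ⊗≫ F.map r ◁ γ ▷ d.Y ⊗≫
          ((F.map r ≫ d'.X) ◁ π ≫ inv d'.κ ▷ d'.Y) ⊗≫ 𝟙 _ := by
          rw [z, ← hπ]
          bicategory
      _ = 𝟙 _ ⊗≫ F.map r ◁ d.e ⊗≫ (F.map r ◁ γ ≫ inv d'.κ) ▷ d.Y ⊗≫
          d'.W ◁ F.map u ◁ π ⊗≫ 𝟙 _ := by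
          rw [whisker_exchange]
          bicategory
      _ = _ := by
          rw [← e₂, z]
          bicategory
  rw [e₃, isUniv_push_iff, isUniv_comp_whiskerRight_iff]
  exact h

/-- Transport along an invertible icon. -/
noncomputable def tr {G : OplaxOn o} [G.IsPseudo] (β : IconOn F G) [β.IsInvertible]
    (d : DistData G θ) : DistData F θ where
  X := d.X
  ef := β.tr d.ef
  W := d.W
  ew := β.tr d.ew
  κ := d.W ◁ β.app u ≫ d.κ ≫ inv (β.app r) ▷ d.X
  Y := d.Y
  e := d.e
  hf := (β.isUniv_tr_iff _).2 d.hf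
  hw := (β.isUniv_tr_iff _).2 d.hw
  he := d.he
  isIso_κ := inferInstance
  act_push := by
    have := congrArg β.tr d.act_push
    rw [β.tr_push, β.tr_act, β.tr_con] at this
    rw [← El.push_push, ← El.push_push, this, ← β.tr_pull, ← β.tr_cov, ← β.tr_curry, El.push_con]

lemma isUniv_tr_z_iff {G : OplaxOn o} [G.IsPseudo] (β : IconOn F G) [β.IsInvertible]
    (d : DistData G θ) : IsUniv (d.tr β).z ↔ IsUniv d.z := by
  have h : inv (d.tr β).κ = β.app r ▷ d.X ≫ inv d.κ ≫ d.W ◁ inv (β.app u) := by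
    refine IsIso.inv_eq_of_hom_inv_id ?_
    simp [tr]
  let w : F.map r ⟶ d.W ≫ F.map u ≫ d.Y := (d.tr β).z
  change IsUniv w ↔ _
  have e : w = β.app r ≫ d.z ≫ d.W ◁ inv (β.app u) ▷ d.Y := by
    calc w = (ρ_ _).inv ≫ F.map r ◁ d.e ≫ (α_ _ _ _).inv ≫
          (β.app r ▷ d.X ≫ inv d.κ ≫ d.W ◁ inv (β.app u)) ▷ d.Y ≫ (α_ _ _ _).hom := by
          simp only [w, z, h]
          rfl
      _ = 𝟙 _ ⊗≫ (F.map r ◁ d.e ≫ β.app r ▷ (d.X ≫ d.Y)) ⊗≫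
          (inv d.κ ≫ d.W ◁ inv (β.app u)) ▷ d.Y ⊗≫ 𝟙 _ := by bicategory
      _ = _ := by
          rw [whisker_exchange, z]
          bicategory
  rw [e, isUniv_iso_comp_iff, isUniv_push_iff]

end DistData

end DistributivityData

end PolyUniv

namespace PolyUniv

open Bicategory ChosenPullbacksAlong ChosenDistributivityPullbacks

/-! ### The distributivity morphism as a transpose -/

section Mates

variable {C : Type u₂} [Bicategory.{w₂, v₂} C]

lemma unit_comp_conjugateEquiv {c d : C} {l₁ l₂ : c ⟶ d} {r₁ r₂ : d ⟶ c} (adj₁ : l₁ ⊣ r₁)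
    (adj₂ : l₂ ⊣ r₂) (φ : l₂ ⟶ l₁) :
    adj₁.unit ≫ l₁ ◁ conjugateEquiv adj₁ adj₂ φ = adj₂.unit ≫ φ ▷ r₂ := by
  rw [conjugateEquiv_apply']
  calc _ = 𝟙 _ ⊗≫ (adj₁.unit ▷ 𝟙 _ ≫ (l₁ ≫ r₁) ◁ (adj₂.unit ≫ φ ▷ r₂)) ⊗≫
        l₁ ◁ adj₁.counit ▷ r₂ ⊗≫ 𝟙 _ := by bicategory
    _ = 𝟙 _ ⊗≫ adj₂.unit ⊗≫ φ ▷ r₂ ⊗≫ leftZigzag adj₁.unit adj₁.counit ▷ r₂ ⊗≫ 𝟙 _ := by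
      rw [← whisker_exchange]
      bicategory
    _ = _ := by
      rw [adj₁.left_triangle]
      bicategory

variable {t x a b y : C} {p : t ⟶ x} {u : x ⟶ a} {r : y ⟶ b} {p' : x ⟶ t} {u' : a ⟶ x}
  {f' : b ⟶ a} {q' : y ⟶ t} {f'' : a ⟶ b} {q'' : t ⟶ y} {r' : b ⟶ y}

/-- Transposing the distributivity morphism across the composite adjunction for `q' ≫ p` cancels the
unit of `u`, by the defining property of the conjugate, and the zigzag of `r`. Only the unit for
`f''` and the 2-cell `ν` survive. -/
lemma unit_comp_distributivity (adjp : p ⊣ p') (adju : u ⊣ u') (adjr : r ⊣ r') (adjq : q' ⊣ q'')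
    (adjf : f' ⊣ f'') (ν : r ≫ f' ⟶ q' ≫ p ≫ u) :
    ((λ_ r).inv ≫ (adjq.comp adjp).unit ▷ r ≫ (α_ _ _ _).hom) ≫ (q' ≫ p) ◁ ((α_ _ _ _).hom ≫
      (𝟙 _ ⊗≫ adju.unit ▷ (p' ≫ q'' ≫ r) ⊗≫
        u ◁ conjugateEquiv (adjq.comp (adjp.comp adju)) (adjr.comp adjf) ν ▷ r ⊗≫
        (u ≫ f'') ◁ adjr.counit ⊗≫ 𝟙 _)) =
    (ρ_ r).inv ≫ r ◁ adjf.unit ≫ (α_ _ _ _).inv ≫ (ν ≫ (α_ _ _ _).inv) ▷ f'' ≫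
      (α_ _ _ _).hom := by
  have h := unit_comp_conjugateEquiv (adjq.comp (adjp.comp adju)) (adjr.comp adjf) ν
  calc _ = 𝟙 _ ⊗≫ ((adjq.comp (adjp.comp adju)).unit ≫ (q' ≫ p ≫ u) ◁
          conjugateEquiv (adjq.comp (adjp.comp adju)) (adjr.comp adjf) ν) ▷ r ⊗≫
        (q' ≫ p ≫ u ≫ f'') ◁ adjr.counit ⊗≫ 𝟙 _ := by
        simp only [Bicategory.Adjunction.comp, Adjunction.compUnit]
        bicategory
    _ = 𝟙 _ ⊗≫ adjr.unit ▷ r ⊗≫ r ◁ adjf.unit ▷ (r' ≫ r) ⊗≫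
        (ν ▷ (f'' ≫ r' ≫ r) ≫ (q' ≫ p ≫ u) ◁ f'' ◁ adjr.counit) ⊗≫ 𝟙 _ := by
        rw [h]
        simp only [Bicategory.Adjunction.comp, Adjunction.compUnit]
        bicategory
    _ = 𝟙 _ ⊗≫ adjr.unit ▷ r ⊗≫ r ◁ (adjf.unit ▷ (r' ≫ r) ≫ (f' ≫ f'') ◁ adjr.counit) ⊗≫
        ν ▷ (f'' ≫ 𝟙 _) ⊗≫ 𝟙 _ := by
        rw [← whisker_exchange]
        bicategory
    _ = 𝟙 _ ⊗≫ leftZigzag adjr.unit adjr.counit ⊗≫ r ◁ adjf.unit ⊗≫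
        ν ▷ (f'' ≫ 𝟙 _) ⊗≫ 𝟙 _ := by
        rw [← whisker_exchange]
        bicategory
    _ = _ := by
      rw [adjr.left_triangle]
      bicategory

end Mates

section OfAdjunctions

variable {S : Type u₁} [Bicategory.{w₁, v₁} S] {C : Type u₂} [Bicategory.{w₂, v₂} C] {o : S → C}
  {F : OplaxOn o} [F.IsPseudo] {t x a b y : S} {p : t ⟶ x} {u : x ⟶ a}
  {f : a ⟶ b} {q : t ⟶ y} {r : y ⟶ b} {θ : (p ≫ u) ≫ f ⟶ q ≫ r}

/-- Distributivity data given by adjunctions. -/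
noncomputable def DistData.ofAdj {X : o b ⟶ o a} {Y : o a ⟶ o b} {w : o y ⟶ o t}
    (adjf : F.map f ⊣ X) (adjf' : X ⊣ Y) (adjq : F.map q ⊣ w)
    (h : IsIso (mateEquiv adjq adjf (inv (F.mapComp (p ≫ u) f) ≫ F.map₂ θ ≫ F.mapComp q r))) :
    DistData F θ where
  X := X
  ef := F.mapId a ≫ adjf.unit
  W := w ≫ F.map p
  ew := (λ_ _).inv ≫ adjq.unit ▷ F.map p ≫ (α_ _ _ _).hom
  κ := (α_ _ _ _).hom ≫ w ◁ inv (F.mapComp p u) ≫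
    mateEquiv adjq adjf (inv (F.mapComp (p ≫ u) f) ≫ F.map₂ θ ≫ F.mapComp q r)
  Y := Y
  e := adjf'.unit
  hf := by
    rw [isUniv_iso_comp_iff]
    have e : adjf.unit = ((λ_ _).inv ≫ adjf.unit ▷ 𝟙 _ ≫ (α_ _ _ _).hom) ≫
      F.map f ◁ (ρ_ X).hom := by simp
    rw [e, isUniv_push_iff]
    exact isUniv_unit adjf _
  hw := isUniv_unit adjq _
  he := by
    have e : adjf'.unit = ((λ_ _).inv ≫ adjf'.unit ▷ 𝟙 _ ≫ (α_ _ _ _).hom) ≫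
      X ◁ (ρ_ Y).hom := by simp
    rw [e, isUniv_push_iff]
    exact isUniv_unit adjf' _
  isIso_κ := inferInstance
  act_push := by
    have e := (mateEquiv_eq_iff adjq adjf (inv (F.mapComp (p ≫ u) f) ≫ F.map₂ θ ≫
      F.mapComp q r) _).1 rfl
    rw [Adjunction.homEquiv₁_symm_apply, Adjunction.homEquiv₂_apply] at e
    have e' : F.map₂ (ρ_ (p ≫ u)).inv ≫ F.mapComp (p ≫ u) (𝟙 a) ≫
        F.map (p ≫ u) ◁ F.mapId a = (ρ_ _).inv := by
      rw [← cancel_epi (F.map₂ (ρ_ (p ≫ u)).hom), F.map₂_hom_inv_assoc, F.rightUnitor]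
      simp
    rw [El.curry_cov_pull]
    simp only [El.con, El.act, El.push, whiskerLeft_comp, Category.assoc]
    simp only [Category.assoc] at e
    rw [reassoc_of% e', ← e]
    calc _ = F.mapComp p u ⊗≫ (adjq.unit ▷ (F.map p ≫ F.map u) ≫
          (F.map q ≫ w) ◁ inv (F.mapComp p u)) ⊗≫
          F.map q ◁ (mateEquiv adjq adjf (inv (F.mapComp (p ≫ u) f) ≫ F.map₂ θ ≫
            F.mapComp q r)) := by bicategory
      _ = 𝟙 _ ⊗≫ (F.mapComp p u ≫ inv (F.mapComp p u)) ⊗≫ adjq.unit ▷ F.map (p ≫ u) ⊗≫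
          F.map q ◁ (mateEquiv adjq adjf (inv (F.mapComp (p ≫ u) f) ≫ F.map₂ θ ≫
            F.mapComp q r)) := by
          rw [← whisker_exchange]
          bicategory
      _ = _ := by
          rw [IsIso.hom_inv_id]
          bicategory

/-- Up to an associator, the source of the distributivity morphism is the extension of `F.map r`
along `w ≫ F.map p`, and `z` is the element the morphism corresponds to. -/
lemma DistData.isIso_iff_isUniv_z_ofAdj {X : o b ⟶ o a} {Y : o a ⟶ o b} {w : o y ⟶ o t}
    {w' : o t ⟶ o y} {p' : o x ⟶ o t} {u' : o a ⟶ o x} {r' : o b ⟶ o y}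
    (adjf : F.map f ⊣ X) (adjf' : X ⊣ Y) (adjq : F.map q ⊣ w) (adjq' : w ⊣ w')
    (adjp : F.map p ⊣ p') (adju : F.map u ⊣ u') (adjr : F.map r ⊣ r')
    (h : IsIso (mateEquiv adjq adjf (inv (F.mapComp (p ≫ u) f) ≫ F.map₂ θ ≫ F.mapComp q r))) :
    IsIso (𝟙 (p' ≫ w' ≫ F.map r) ⊗≫ adju.unit ▷ (p' ≫ w' ≫ F.map r) ⊗≫
        F.map u ◁ conjugateEquiv (adjq'.comp (adjp.comp adju)) (adjr.comp adjf')
          (inv (mateEquiv adjq adjf (inv (F.mapComp (p ≫ u) f) ≫ F.map₂ θ ≫ F.mapComp q r)) ≫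
            w ◁ F.mapComp p u) ▷ F.map r ⊗≫
        (F.map u ≫ Y) ◁ adjr.counit ⊗≫ 𝟙 (F.map u ≫ Y)) ↔
      IsUniv (DistData.ofAdj adjf adjf' adjq h).z := by
  let ν := inv (mateEquiv adjq adjf (inv (F.mapComp (p ≫ u) f) ≫ F.map₂ θ ≫ F.mapComp q r)) ≫
            w ◁ F.mapComp p u
  have e := unit_comp_distributivity adjp adju adjr adjq' adjf' ν
  have hu := isUniv_unit (adjq'.comp adjp) (F.map r)
  have hz : (DistData.ofAdj adjf adjf' adjq h).z = (ρ_ (F.map r)).inv ≫ F.map r ◁ adjf'.unit ≫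
      (α_ _ _ _).inv ≫ (ν ≫ (α_ _ _ _).inv) ▷ Y ≫ (α_ _ _ _).hom := by
    simp [z, ofAdj, ν]
  exact (isIso_comp_left_iff (α_ p' w' (F.map r)).hom _).symm.trans
    (hu.isIso_iff (e.trans hz.symm))

end OfAdjunctions

/-! ### The Beck and distributivity conditions of the statement -/

section TwoBeckOplaxOn

variable {E : Type u} [Category.{v} E] {C : Type u₂} [Bicategory.{w₂, v₂} C]
  (F : LocallyDiscrete E ⥤ᵖ C)

instance isPseudo_ofOplax : (OplaxOn.ofOplax F.toOplax).IsPseudo where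
  isIso_mapId a := inferInstanceAs (IsIso (F.mapId a).hom)
  isIso_mapComp f g := inferInstanceAs (IsIso (F.mapComp f g).hom)

lemma isoMapOfCommSq_hom {a b c d : LocallyDiscrete E} {f' : a ⟶ b} {g' : a ⟶ c} {g : b ⟶ d}
    {f : c ⟶ d} (h : CommSq f' g' g f) (θ : f' ≫ g ⟶ g' ≫ f) :
    (F.isoMapOfCommSq h).hom = inv ((OplaxOn.ofOplax F.toOplax).mapComp f' g) ≫
      (OplaxOn.ofOplax F.toOplax).map₂ θ ≫ (OplaxOn.ofOplax F.toOplax).mapComp g' f := by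
  refine (IsIso.eq_inv_comp ((OplaxOn.ofOplax F.toOplax).mapComp f' g)).2 ?_
  change (F.mapComp f' g).hom ≫ (F.mapComp f' g).inv ≫ _ = _
  rw [Iso.hom_inv_id_assoc]
  have : θ = eqToHom h.w := Subsingleton.elim _ _
  subst this
  rfl

lemma isTwoBeck_iff_isBeck : IsTwoBeck F ↔ (OplaxOn.ofOplax F.toOplax).IsBeck := by
  refine ⟨fun h => ⟨fun f => h.exists_adj f.as, fun {a b c d f' g' g f} hsq θ u' u adj' adj => ?_⟩,
    fun h => ⟨fun f => h.exists_adj f.toLoc, fun {X Y Z W f' g' g f} hsq u' u adj' adj => ?_⟩⟩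
  · have e := congrArg (Bicategory.mateEquiv adj' adj)
      (isoMapOfCommSq_hom F (commSq_toLoc hsq.toCommSq) θ)
    exact (congrArg (fun k => IsIso k) e).mp (h.beck hsq (u' := u') (u := u) adj' adj)
  · let θ : f'.toLoc ≫ g.toLoc ⟶ g'.toLoc ≫ f.toLoc := eqToHom (commSq_toLoc hsq.toCommSq).w
    have e := congrArg (Bicategory.mateEquiv adj' adj)
      (isoMapOfCommSq_hom F (commSq_toLoc hsq.toCommSq) θ)
    exact (congrArg (fun k => IsIso k) e).mpr (h.beck (f' := f'.toLoc) (g' := g'.toLoc)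
      (g := g.toLoc) (f := f.toLoc) hsq θ adj' adj)

variable {F} {X A B : E} {f : A ⟶ B} {u : X ⟶ A} (D : PullbackAround f u)

/-- The 2-cell of the square underlying a pullback around a composable pair. -/
def PullbackAround.cell : (D.p.toLoc ≫ u.toLoc) ≫ f.toLoc ⟶ D.q.toLoc ≫ D.r.toLoc :=
  eqToHom (commSq_toLoc D.isPullback.toCommSq).w

lemma isIso_distributivityMor_iff (hF : IsTwoBeck F) (tf : AdjTriple F f) (tu : AdjTriple F u)
    (tp : AdjTriple F D.p) (tq : AdjTriple F D.q) (tr : AdjTriple F D.r) :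
    IsIso (distributivityMor hF D tf tu tp tq tr) ↔
      IsUniv (DistData.ofAdj (F := OplaxOn.ofOplax F.toOplax) (θ := D.cell) tf.adj tf.adj' tq.adj
        (((isTwoBeck_iff_isBeck F).1 hF).beck D.isPullback _ _ _)).z := by
  have e := congrArg (Bicategory.mateEquiv tq.adj tf.adj)
    (isoMapOfCommSq_hom F (commSq_toLoc D.isPullback.toCommSq) D.cell)
  -- The Beck 2-cell occurs inside an inverse, so it is generalised together with its invertibility
  -- before being replaced by the equal 2-cell.
  have key (M : tq.pull ≫ mapHom F (D.p ≫ u) ⟶ mapHom F D.r ≫ tf.pull) (hM : IsIso M)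
      (h : beckCell F D.isPullback.toCommSq tq.adj tf.adj = M) :
      distributivityMor hF D tf tu tp tq tr =
      𝟙 (tp.pull ≫ tq.push ≫ mapHom F D.r) ⊗≫
        tu.adj.unit ▷ (tp.pull ≫ tq.push ≫ mapHom F D.r) ⊗≫
        mapHom F u ◁ Bicategory.conjugateEquiv (tq.adj'.comp (tp.adj.comp tu.adj))
          (tr.adj.comp tf.adj') (inv M ≫ tq.pull ◁ (F.mapComp D.p.toLoc u.toLoc).hom) ▷
            mapHom F D.r ⊗≫
        (mapHom F u ≫ tf.push) ◁ tr.adj.counit ⊗≫ 𝟙 (mapHom F u ≫ tf.push) := by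
    subst h
    rfl
  refine Iff.trans ?_ (DistData.isIso_iff_isUniv_z_ofAdj (F := OplaxOn.ofOplax F.toOplax)
    (θ := D.cell) tf.adj tf.adj' tq.adj tq.adj' tp.adj tu.adj tr.adj
    (((isTwoBeck_iff_isBeck F).1 hF).beck D.isPullback _ _ _))
  exact iff_of_eq (congrArg (fun k => IsIso k) (key _
    (((isTwoBeck_iff_isBeck F).1 hF).beck D.isPullback D.cell tq.adj tf.adj) e))

/-- Chosen adjoints give one instance of distributivity data, and by `DistData.isUniv_z` one
instance decides all of them. -/
lemma isDistBeck_iff (hF : IsTwoBeck F) : IsDistBeck F ↔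
    ∀ ⦃X A B : E⦄ ⦃f : A ⟶ B⦄ ⦃u : X ⟶ A⦄ (D : PullbackAround f u),
      D.IsDistributivityPullback →
        ∀ d : DistData (OplaxOn.ofOplax F.toOplax) D.cell, IsUniv d.z := by
  have key {X Y : E} (g : X ⟶ Y) : Nonempty (AdjTriple F g) := by
    obtain ⟨r, r', ⟨h⟩, ⟨h'⟩⟩ := hF.exists_adj g
    exact ⟨⟨r, r', h, h'⟩⟩
  refine ⟨fun h X A B f u D hD d => ?_, fun h => ⟨hF, fun D hD tf tu tp tq tr => ?_⟩⟩
  · obtain ⟨tf⟩ := key f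
    obtain ⟨tu⟩ := key u
    obtain ⟨tp⟩ := key D.p
    obtain ⟨tq⟩ := key D.q
    obtain ⟨tr⟩ := key D.r
    exact DistData.isUniv_z tq.adj _ _ ((isIso_distributivityMor_iff D hF tf tu tp tq tr).1
      (h.isIso_distributivityMor D hD tf tu tp tq tr))
  · exact (isIso_distributivityMor_iff D hF tf tu tp tq tr).2 (h D hD _)

end TwoBeckOplaxOn

end PolyUniv

namespace PolyUniv

open Bicategory ChosenPullbacksAlong ChosenDistributivityPullbacks

lemma El.mapEl_act {S : Type u₁} [Bicategory.{w₁, v₁} S] {A : Type u₂} [Bicategory.{w₂, v₂} A]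
    {C : Type u₃} [Bicategory.{w₃, v₃} C] {o : S → A} {o' : A → C} {J : OplaxOn o}
    (F : OplaxOn o') {b i k l : S} {s : b ⟶ i} {j : b ⟶ k} {X : o i ⟶ o k} (x : El J s j X)
    (h : k ⟶ l) :
    (mapEl F (x.act h)).push (F.mapComp X (J.map h)) = (mapEl F x).act h := by
  simp [mapEl, act, push, F.map₂_comp, F.associator, F.naturality_left_assoc]

/-! ### Distributivity data coming from spans -/

section

open SpanBicat PolyMor

variable {E : Type u} [Category.{v} E] [ChosenPullbacks E]

namespace PullbackAround

variable {X A B : E} {f : A ⟶ B} {u : X ⟶ A} (D : PullbackAround f u)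

/-- The span given by a pullback around a composable pair. -/
@[reducible] def span : (⟨D.Y⟩ : SpanBicat E) ⟶ ⟨X⟩ := sp D.q D.p

/-- The span given by a morphism, in the reverse direction. -/
@[reducible] def rev {A B : E} (f : A ⟶ B) : (⟨B⟩ : SpanBicat E) ⟶ ⟨A⟩ := sp f (𝟙 A)

lemma spanIso_h : pr₁ (emb D.r) (rev f) ≫ D.r = pr₂ (emb D.r) (rev f) ≫ f :=
  (pr₂_lg (emb D.r) (rev f)).symm

/-- The comparison 2-cell of spans of a pullback around a composable pair. -/
noncomputable def spanIso : emb D.r ≫ rev f ⟶ D.span ≫ emb u :=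
  mkHom (pr (D.lft _ _ D.spanIso_h) (D.lft _ _ D.spanIso_h ≫ D.p) (by simp))
    (by simp [D.lft_q]) (by simp [D.lft_p_u])

/-- The pullback condition says that `D.q` and `D.p ≫ u` are jointly monic, and these are the legs
of the target span. -/
lemma span_ext {S : (⟨D.Y⟩ : SpanBicat E) ⟶ ⟨A⟩} (φ ψ : S ⟶ D.span ≫ emb u) : φ = ψ := by
  have h (χ : S ⟶ D.span ≫ emb u) : hf χ ≫ pr₂ D.span (emb u) = (hf χ ≫ pr₁ D.span (emb u)) ≫ D.p :=
    (Category.comp_id _).symm.trans (by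
      have := pr₂_lg D.span (emb u)
      simpa using congrArg (hf χ ≫ ·) this)
  have h' (χ : S ⟶ D.span ≫ emb u) : (hf χ ≫ pr₁ D.span (emb u)) ≫ D.p ≫ u = rg S := by
    rw [← Category.assoc, ← h, Category.assoc]
    exact hf_rg χ
  have e : hf φ ≫ pr₁ D.span (emb u) = hf ψ ≫ pr₁ D.span (emb u) := by
    refine D.T_ext ?_ ((h' φ).trans (h' ψ).symm)
    rw [Category.assoc, Category.assoc]
    exact (hf_lg φ).trans (hf_lg ψ).symm
  exact hf_ext (ax_ext e (by rw [h, h, e]))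

instance : IsIso D.spanIso := by
  have w : (pr₁ D.span (emb u) ≫ D.q) ≫ D.r = (pr₂ D.span (emb u) ≫ u) ≫ f := by
    have h : pr₂ D.span (emb u) = pr₁ D.span (emb u) ≫ D.p :=
      (Category.comp_id _).symm.trans (pr₂_lg D.span (emb u))
    rw [h, Category.assoc, Category.assoc, ← D.isPullback.w]
    simp
  refine ⟨mkHom (pr (S := emb D.r) (S' := rev f) (pr₁ D.span (emb u) ≫ D.q)
    (pr₂ D.span (emb u) ≫ u) w) (by simp) (by simp), ?_, D.span_ext _ _⟩
  refine hf_ext (ax_ext ?_ ?_)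
  · change (hf D.spanIso ≫ pr (S := emb D.r) (S' := rev f) _ _ w) ≫ _ = _
    simp [spanIso, D.lft_q]
  · change (hf D.spanIso ≫ pr (S := emb D.r) (S' := rev f) _ _ w) ≫ _ = _
    simp [spanIso, D.lft_p_u]

/-- The inverse of `spanIso`. -/
noncomputable def spanInv : D.span ≫ emb u ⟶ emb D.r ≫ rev f := inv D.spanIso

end PullbackAround

namespace SpanBicat

lemma hom_ext_emb {W A B Z : E} {s : W ⟶ Z} {f : A ⟶ B} {r : Z ⟶ B} {j : W ⟶ A}
    (φ ψ : emb j ⟶ emb s ≫ emb r ≫ PullbackAround.rev f) : φ = ψ := by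
  let S := PullbackAround.rev f
  have h₀ (χ : emb j ⟶ emb s ≫ emb r ≫ S) : hf χ ≫ pr₁ (emb s) (emb r ≫ S) = 𝟙 W :=
    (Category.comp_id _).symm.trans ((Category.assoc _ _ _).trans (hf_lg χ))
  have h₁ (χ : emb j ⟶ emb s ≫ emb r ≫ S) :
      (hf χ ≫ pr₂ (emb s) (emb r ≫ S)) ≫ pr₁ (emb r) S = s := by
    have := congrArg (hf χ ≫ ·) (pr₂_lg (emb s) (emb r ≫ S))
    simp only [reassoc_of% h₀] at this
    simpa using this
  have h₂ (χ : emb j ⟶ emb s ≫ emb r ≫ S) :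
      (hf χ ≫ pr₂ (emb s) (emb r ≫ S)) ≫ pr₂ (emb r) S = j := by
    have := hf_rg χ
    simp only [rg_comp] at this
    simpa [S] using this
  exact hf_ext (ax_ext ((h₀ φ).trans (h₀ ψ).symm)
    (ax_ext ((h₁ φ).trans (h₁ ψ).symm) ((h₂ φ).trans (h₂ ψ).symm)))

end SpanBicat

section

open PullbackAround

variable {C : Type u₂} [Bicategory.{w₂, v₂} C] {o : SpanBicat E → C} {T : OplaxOn o} [T.IsPseudo]
  {X A B : E} {f : A ⟶ B} {u : X ⟶ A}

variable (T) in
/-- The image of the comparison 2-cell of spans under a pseudofunctor. -/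
noncomputable def mapSpanIso (D : PullbackAround f u) :
    T.map (emb D.r) ≫ T.map (rev f) ⟶ T.map D.span ≫ T.map (emb u) :=
  inv (T.mapComp (emb D.r) (rev f)) ≫ T.map₂ D.spanIso ≫ T.mapComp D.span (emb u)

instance (D : PullbackAround f u) : IsIso (mapSpanIso T D) := by
  unfold mapSpanIso
  infer_instance

variable (T) in
/-- The inverse of `mapSpanIso`. -/
noncomputable def mapSpanInv (D : PullbackAround f u) :
    T.map D.span ≫ T.map (emb u) ⟶ T.map (emb D.r) ≫ T.map (rev f) :=
  inv (mapSpanIso T D)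

instance (D : PullbackAround f u) : IsIso (mapSpanInv T D) := by
  unfold mapSpanInv
  infer_instance

lemma inv_mapSpanInv (D : PullbackAround f u) : inv (mapSpanInv T D) = mapSpanIso T D := by
  simp [mapSpanInv]

lemma mapComp_mapSpanInv (D : PullbackAround f u) :
    T.mapComp D.span (emb u) ≫ mapSpanInv T D =
      T.map₂ D.spanInv ≫ T.mapComp (emb D.r) (rev f) := by
  rw [← cancel_mono (mapSpanIso T D), Category.assoc, mapSpanInv, spanInv, IsIso.inv_hom_id, mapSpanIso]
  simp only [Category.assoc, IsIso.hom_inv_id_assoc, Category.comp_id]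
  rw [← Category.assoc, ← T.map₂_comp, IsIso.inv_hom_id, T.map₂_id, Category.id_comp]

/-- Distributivity data for the restriction of a pseudofunctor on spans. -/
noncomputable def DistData.ofSpan (D : PullbackAround f u) {Y : o ⟨A⟩ ⟶ o ⟨B⟩}
    (e : 𝟙 (o ⟨B⟩) ⟶ T.map (rev f) ≫ Y) (he : IsUniv e) :
    DistData ((embOn E).comp T) D.cell where
  X := T.map (rev f)
  ef := El.mapEl T (J := embOn E) (uSp (rev f))
  W := T.map D.span
  ew := El.mapEl T (J := embOn E) (uSp D.span)
  κ := mapSpanInv T D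
  Y := Y
  e := e
  hf := El.isUniv_mapEl T (J := embOn E) (adjInv (emb f)) (adjInv (emb (𝟙 A))) (isUniv_uSp (rev f))
  hw := El.isUniv_mapEl T (J := embOn E) (adjInv (emb D.q)) (adjInv (emb D.p)) (isUniv_uSp D.span)
  he := he
  isIso_κ := inferInstanceAs (IsIso (mapSpanInv T D))
  act_push := by
    let x : El (embOn E) f.toLoc (𝟙 (⟨A⟩ : LocallyDiscrete E)) (rev f) := uSp (rev f)
    let w : El (embOn E) D.q.toLoc D.p.toLoc D.span := uSp D.span
    let pu : (⟨D.T⟩ : LocallyDiscrete E) ⟶ ⟨A⟩ := D.p.toLoc ≫ u.toLoc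
    have h₁ := El.mapEl_act T w u.toLoc
    have h₂ := El.mapEl_curry T (El.cov D.cell (El.pull pu x))
    rw [El.mapEl_cov, El.mapEl_pull] at h₂
    -- Among spans the equation holds because the target admits at most one such 2-cell. The rest
    -- applies `T`.
    have h₃ : (w.act u.toLoc).push D.spanInv =
      El.con (j' := pu) (ρ_ pu).inv (El.cov D.cell (El.pull pu x)).curry :=
      SpanBicat.hom_ext_emb (j := D.p ≫ u) (s := D.q) (r := D.r) _ _
    have h₄ := congrArg (fun z : El (embOn E) D.q.toLoc pu (emb D.r ≫ rev f) =>
      (El.mapEl T z).push (T.mapComp (emb D.r) (rev f))) h₃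
    refine Eq.trans (congrArg (fun z => El.push z (mapSpanInv T D)) h₁.symm) ?_
    refine Eq.trans ?_ (congrArg (El.con (j' := pu) (ρ_ pu).inv) h₂)
    let Φ (z : El ((embOn E).comp T) D.q.toLoc pu (T.map (emb D.r ≫ rev f))) :
      El ((embOn E).comp T) D.q.toLoc pu (T.map (emb D.r) ≫ T.map (rev f)) :=
      El.push z (T.mapComp (emb D.r) (rev f))
    let k : El (embOn E) D.q.toLoc (pu ≫ 𝟙 _) (emb D.r ≫ rev f) := (El.cov D.cell (El.pull pu x)).curry
    let m : El (embOn E) D.q.toLoc pu (D.span ≫ emb u) := w.act u.toLoc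
    refine Eq.trans ?_ ((congrArg Φ
      (El.mapEl_con T (ρ_ pu).inv k)).trans (El.push_con (ρ_ pu).inv (El.mapEl T k) _))
    refine Eq.trans ?_ h₄
    refine Eq.trans ?_ (congrArg Φ
      (El.mapEl_push T m D.spanInv).symm)
    refine (El.push_push (El.mapEl T m) (T.mapComp D.span (emb u)) (mapSpanInv T D)).trans ?_
    exact (congrArg (El.push (El.mapEl T m)) (mapComp_mapSpanInv D)).trans
      (El.push_push (El.mapEl T m) (T.map₂ D.spanInv) (T.mapComp (emb D.r) (rev f))).symm

end

end

end PolyUniv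

namespace PolyUniv

open Bicategory ChosenPullbacksAlong ChosenDistributivityPullbacks

/-! ### Universality and equivalences -/

section Equivalences

variable {C : Type u₂} [Bicategory.{w₂, v₂} C] {a b c d : C}

lemma whiskerLeft_injective_of_iso {n : a ⟶ b} {t : b ⟶ a} (m : n ≫ t ≅ 𝟙 a) {x y : a ⟶ c}
    {f g : x ⟶ y} (h : t ◁ f = t ◁ g) : f = g := by
  have key (k : x ⟶ y) : k = (λ_ x).inv ≫ m.inv ▷ x ≫ (α_ _ _ _).hom ≫ n ◁ t ◁ k ≫
      (α_ _ _ _).inv ≫ m.hom ▷ y ≫ (λ_ y).hom := by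
    rw [← comp_whiskerLeft_assoc, ← whisker_exchange_assoc]
    simp
  rw [key f, key g, h]

lemma whiskerLeft_bijective_of_iso {n : a ⟶ b} {t : b ⟶ a} (m : n ≫ t ≅ 𝟙 a) (m' : t ≫ n ≅ 𝟙 b)
    (x y : a ⟶ c) : Function.Bijective (fun f : x ⟶ y => t ◁ f) := by
  refine ⟨fun f g h => whiskerLeft_injective_of_iso m h, fun h => ⟨(λ_ x).inv ≫ m.inv ▷ x ≫
    (α_ _ _ _).hom ≫ n ◁ h ≫ (α_ _ _ _).inv ≫ m.hom ▷ y ≫ (λ_ y).hom, ?_⟩⟩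
  refine whiskerLeft_injective_of_iso m' ?_
  generalize hg : (λ_ x).inv ≫ m.inv ▷ x ≫ (α_ _ _ _).hom ≫ n ◁ h ≫ (α_ _ _ _).inv ≫
    m.hom ▷ y ≫ (λ_ y).hom = g
  have e : n ◁ t ◁ g = (α_ _ _ _).inv ≫ m.hom ▷ x ≫ (λ_ x).hom ≫ g ≫ (λ_ y).inv ≫ m.inv ▷ y ≫
      (α_ _ _ _).hom := by
    rw [leftUnitor_inv_naturality_assoc, Iso.hom_inv_id_assoc, whisker_exchange_assoc]
    simp
  rw [e, ← hg]
  simp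

/-- Whiskering by an equivalence is bijective on 2-cells, so it preserves the defining bijection. -/
lemma isUniv_whiskerLeft_of_iso {n : a ⟶ b} {t : b ⟶ a} (m : n ≫ t ≅ 𝟙 a) (m' : t ≫ n ≅ 𝟙 b)
    {s : a ⟶ c} {j : a ⟶ d} {X : c ⟶ d} {x : j ⟶ s ≫ X} (hx : IsUniv x) :
    IsUniv (t ◁ x ≫ (α_ _ _ _).inv) := by
  intro Z
  have e : (fun g : X ⟶ Z => (t ◁ x ≫ (α_ _ _ _).inv) ≫ (t ≫ s) ◁ g) =
      (· ≫ (α_ t s Z).inv) ∘ (fun k : j ⟶ s ≫ Z => t ◁ k) ∘ (fun g : X ⟶ Z => x ≫ s ◁ g) := by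
    funext g
    simp
  rw [e]
  refine Function.Bijective.comp ?_ ((whiskerLeft_bijective_of_iso m m' _ _).comp (hx Z))
  exact ⟨fun f g h => (cancel_mono _).1 h, fun f => ⟨f ≫ (α_ t s Z).hom, by simp⟩⟩

end Equivalences

namespace PullbackAround

variable {E : Type u} [Category.{v} E] {X A B : E} {f : A ⟶ B} {u : X ⟶ A}
  {D D' : PullbackAround f u}

lemma s_hom_inv (i : D ≅ D') : i.hom.s ≫ i.inv.s = 𝟙 _ :=
  congrArg Hom.s i.hom_inv_id

lemma s_inv_hom (i : D ≅ D') : i.inv.s ≫ i.hom.s = 𝟙 _ :=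
  congrArg Hom.s i.inv_hom_id

lemma t_hom_inv (i : D ≅ D') : i.hom.t ≫ i.inv.t = 𝟙 _ :=
  congrArg Hom.t i.hom_inv_id

lemma t_inv_hom (i : D ≅ D') : i.inv.t ≫ i.hom.t = 𝟙 _ :=
  congrArg Hom.t i.inv_hom_id

end PullbackAround

/-! ### Pushforward polynomials and distributivity pullbacks -/

section

open SpanBicat PolyMor PullbackAround

variable {E : Type u} [Category.{v} E] [ChosenPullbacks E]

section

variable {C : Type u₂} [Bicategory.{w₂, v₂} C] {o : SpanBicat E → C} {T : OplaxOn o} [T.IsPseudo]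
  {X A B : E} {f : A ⟶ B} {u : X ⟶ A} {D D' : PullbackAround f u}

/-- The comparison of the bases of isomorphic pullbacks around a composable pair. -/
def isoBase (i : D ≅ D') : emb D.r ⟶ emb i.hom.t ≫ emb D'.r :=
  mkHom (pr (𝟙 _) i.hom.t (by simp)) (by simp) (by simp [i.hom.t_r])

/-- The comparison of the spans of isomorphic pullbacks around a composable pair. -/
def isoSpan (i : D ≅ D') : D.span ⟶ emb i.hom.t ≫ D'.span :=
  mkHom (pr D.q i.hom.s (by simp [i.hom.s_q])) (by simp) (by simp [i.hom.s_p])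

instance (i : D ≅ D') : IsIso (isoBase i) := by
  refine isIso_of_isIso_hf _ ⟨pr₁ (emb i.hom.t) (emb D'.r), by simp [isoBase], ?_⟩
  have h : pr₂ (emb i.hom.t) (emb D'.r) = pr₁ (emb i.hom.t) (emb D'.r) ≫ i.hom.t :=
    (Category.comp_id _).symm.trans (pr₂_lg (emb i.hom.t) (emb D'.r))
  exact ax_ext (by simp [isoBase]) (by simp [isoBase, h])

instance (i : D ≅ D') : IsIso (isoSpan i) := by
  have h : pr₁ (emb i.hom.t) D'.span ≫ i.hom.t = pr₂ (emb i.hom.t) D'.span ≫ D'.q :=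
    (pr₂_lg (emb i.hom.t) D'.span).symm
  have h' : pr₂ (emb i.hom.t) D'.span ≫ i.inv.s ≫ D.q = pr₁ (emb i.hom.t) D'.span := by
    rw [i.inv.s_q, ← Category.assoc, ← h, Category.assoc, t_hom_inv, Category.comp_id]
  refine isIso_of_isIso_hf _ ⟨pr₂ (emb i.hom.t) D'.span ≫ i.inv.s, ?_, ?_⟩
  · simp [isoSpan, s_hom_inv]
  · refine ax_ext ?_ ?_
    · simp [isoSpan, h']
    · simp [isoSpan, s_inv_hom]

lemma isoBase_spanIso (i : D ≅ D') : isoBase i ▷ rev f ≫ (α_ _ _ _).hom ≫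
    emb i.hom.t ◁ D'.spanIso = D.spanIso ≫ isoSpan i ▷ emb u ≫ (α_ _ _ _).hom := by
  rw [← cancel_mono (inv (isoSpan i ▷ emb u ≫ (α_ _ _ _).hom))]
  exact D.span_ext _ _

/-- The invertible 2-cell given by a section. -/
noncomputable def embIso {Y Z : E} {t : Y ⟶ Z} {n : Z ⟶ Y} (h : t ≫ n = 𝟙 Y) :
    T.map (emb t) ≫ T.map (emb n) ≅ 𝟙 (o ⟨Y⟩) :=
  have := isIso_embComp t n
  have : IsIso (emb₂ h) := isIso_of_isIso_hf _ (inferInstanceAs (IsIso (𝟙 Y)))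
  (asIso (T.mapComp (emb t) (emb n))).symm ≪≫ (asIso (T.map₂ (embComp t n))).symm ≪≫
    asIso (T.map₂ (emb₂ h)) ≪≫ asIso (T.mapId ⟨Y⟩)

/-- An isomorphism of pullbacks around the pair has invertible `t`. The element of `D` is that of
`D'` restricted along the resulting equivalence, up to the invertible 2-cells `τ` and `ω`. -/
lemma isUniv_z_ofSpan_of_iso (i : D ≅ D') {Y : o ⟨A⟩ ⟶ o ⟨B⟩}
    {e : 𝟙 (o ⟨B⟩) ⟶ T.map (rev f) ≫ Y} (he : IsUniv e) (h : IsUniv (DistData.ofSpan D' e he).z) :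
    IsUniv (DistData.ofSpan D e he).z := by
  let τ := T.map₂ (isoBase i) ≫ T.mapComp (emb i.hom.t) (emb D'.r)
  let ω := T.map₂ (isoSpan i) ≫ T.mapComp (emb i.hom.t) D'.span
  have key : τ ▷ T.map (rev f) ≫ (α_ _ _ _).hom ≫ T.map (emb i.hom.t) ◁ mapSpanIso T D' =
      mapSpanIso T D ≫ ω ▷ T.map (emb u) ≫ (α_ _ _ _).hom := by
    rw [← cancel_epi (T.mapComp (emb D.r) (rev f))]
    have h₁ := congrArg T.map₂ (isoBase_spanIso i)
    simp only [T.map₂_comp] at h₁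
    simp only [mapSpanIso, IsIso.hom_inv_id_assoc, τ, ω, comp_whiskerRight, Category.assoc,
      whiskerLeft_comp]
    rw [← T.naturality_left_assoc, ← T.naturality_left_assoc, ← T.associator_assoc, ← T.associator,
      ← reassoc_of% h₁, whiskerLeft_isIso_hom_inv_assoc, T.naturality_right_assoc]
  let z : T.map (emb D.r) ⟶ T.map D.span ≫ T.map (emb u) ≫ Y := (DistData.ofSpan D e he).z
  let z' : T.map (emb D'.r) ⟶ T.map D'.span ≫ T.map (emb u) ≫ Y := (DistData.ofSpan D' e he).z
  have hz : z = (ρ_ _).inv ≫ T.map (emb D.r) ◁ e ≫ (α_ _ _ _).inv ≫ mapSpanIso T D ▷ Y ≫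
      (α_ _ _ _).hom := by
    rw [← inv_mapSpanInv]
    rfl
  have hz' : z' = (ρ_ _).inv ≫ T.map (emb D'.r) ◁ e ≫ (α_ _ _ _).inv ≫ mapSpanIso T D' ▷ Y ≫
      (α_ _ _ _).hom := by
    rw [← inv_mapSpanInv]
    rfl
  have e' : z ≫ ω ▷ (T.map (emb u) ≫ Y) = τ ≫ T.map (emb i.hom.t) ◁ z' ≫ (α_ _ _ _).inv := by
    rw [hz, hz']
    calc _ = 𝟙 _ ⊗≫ T.map (emb D.r) ◁ e ⊗≫ (mapSpanIso T D ≫ ω ▷ T.map (emb u) ≫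
          (α_ _ _ _).hom) ▷ Y ⊗≫ 𝟙 _ := by bicategory
      _ = 𝟙 _ ⊗≫ (T.map (emb D.r) ◁ e ≫ τ ▷ (T.map (rev f) ≫ Y)) ⊗≫
          T.map (emb i.hom.t) ◁ mapSpanIso T D' ▷ Y ⊗≫ 𝟙 _ := by
          rw [← key]
          bicategory
      _ = _ := by
          rw [whisker_exchange]
          bicategory
  have hu : IsUniv (τ ≫ T.map (emb i.hom.t) ◁ z' ≫ (α_ _ _ _).inv) :=
    (isUniv_iso_comp_iff _ _).2 (isUniv_whiskerLeft_of_iso (embIso (t_inv_hom i))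
      (embIso (t_hom_inv i)) h)
  rw [← e', isUniv_comp_whiskerRight_iff] at hu
  exact hu

instance (B : E) : IsIso (embId B) := isIso_of_isIso_hf _ (inferInstanceAs (IsIso (𝟙 B)))

/-- The 2-cell underlying an element at `pi f`. -/
noncomputable def piUnit {A B : E} {f : A ⟶ B} {Y : o ⟨A⟩ ⟶ o ⟨B⟩}
    (y : El T (rev f) (emb (𝟙 B)) Y) : 𝟙 (o ⟨B⟩) ⟶ T.map (rev f) ≫ Y :=
  inv (T.map₂ (embId B) ≫ T.mapId ⟨B⟩) ≫ y

lemma isUniv_piUnit {A B : E} {f : A ⟶ B} {Y : o ⟨A⟩ ⟶ o ⟨B⟩}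
    {y : El T (rev f) (emb (𝟙 B)) Y} (hy : IsUniv y) : IsUniv (piUnit y) :=
  (isUniv_iso_comp_iff _ _).2 hy

lemma isUniv_curry_con_iff {X A B : E} {f : A ⟶ B} {u : X ⟶ A} (D : PullbackAround f u)
    {m : (⟨D.Y⟩ : SpanBicat E) ⟶ ⟨B⟩} (ct : m ⟶ emb D.r ≫ emb (𝟙 B)) (_ : IsIso ct)
    {Y : o ⟨A⟩ ⟶ o ⟨B⟩} {y : El T (rev f) (emb (𝟙 B)) Y} (hy : IsUniv y) :
    IsUniv (El.con ct (El.cov D.spanIso (El.pull (emb D.r) y))).curry ↔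
      IsUniv (DistData.ofSpan D (piUnit y) (isUniv_piUnit hy)).z := by
  let z : T.map (emb D.r) ⟶ T.map D.span ≫ T.map (emb u) ≫ Y :=
    (DistData.ofSpan D (piUnit y) (isUniv_piUnit hy)).z
  have hz : z = (ρ_ _).inv ≫ T.map (emb D.r) ◁ piUnit y ≫ (α_ _ _ _).inv ≫
      mapSpanIso T D ▷ Y ≫ (α_ _ _ _).hom := by
    rw [← inv_mapSpanInv]
    rfl
  have e : (El.con ct (El.cov D.spanIso (El.pull (emb D.r) y))).curry =
      (T.map₂ ct ≫ T.mapComp (emb D.r) (emb (𝟙 B)) ≫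
      T.map (emb D.r) ◁ (T.map₂ (embId B) ≫ T.mapId ⟨B⟩) ≫ (ρ_ _).hom) ≫ z := by
    rw [hz, El.curry_con, El.con, El.curry_cov_pull]
    simp only [Category.assoc, Iso.hom_inv_id_assoc, piUnit, mapSpanIso]
    rw [← whiskerLeft_comp_assoc (T.map (emb D.r)) (T.map₂ (embId B) ≫ T.mapId _),
      IsIso.hom_inv_id_assoc]
  change _ ↔ IsUniv z
  rw [e, isUniv_iso_comp_iff]

end

variable [ChosenDistributivityPullbacks E]

/-- The pullback around `(f, P.t)` underlying the composite of `P` and `pi f`. -/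
noncomputable def piAround {I A B : E} (P : PolyMor I A) (f : A ⟶ B) : PullbackAround f P.t where
  T := dT P (pi f)
  Y := (comp P (pi f)).base
  p := dpos P (pi f)
  q := dq P (pi f)
  r := cr P (pi f)
  isPullback := by
    have : dpos P (pi f) ≫ P.t = dm P (pi f) := (pos_t _ _ _).trans (Category.comp_id _)
    rw [this]
    exact (compDPB P (pi f)).isPullback

/-- Composition with `pi f` uses a distributivity pullback around `f` and the projection from the
pullback of `P.t` along an identity. That projection is `P.t` up to isomorphism, and pullbacks
around the two pairs correspond. -/
lemma isDistributivityPullback_piAround {I A B : E} (P : PolyMor I A) (f : A ⟶ B) :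
    (piAround P f).IsDistributivityPullback := by
  have hw (Z : PullbackAround f P.t) : Z.p ≫ P.t = (Z.p ≫ P.t) ≫ (pi f).s :=
    (Category.comp_id _).symm
  let Z' (Z : PullbackAround f P.t) : PullbackAround (pi f).p (snd P.t (pi f).s) :=
    { T := Z.T, Y := Z.Y, p := lift Z.p (Z.p ≫ P.t) (hw Z), q := Z.q, r := Z.r
      isPullback := by
        rw [lift_snd _ _ (hw Z)]
        exact Z.isPullback }
  have hT : IsTerminal (compDPB P (pi f)) := isTerminal _ _
  have hmap (Z : PullbackAround f P.t) (s : Z.T ⟶ dT P (pi f))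
      (hs : s ≫ dpos P (pi f) = Z.p) : s ≫ (compDPB P (pi f)).p = (Z' Z).p := by
    have h₁ : (s ≫ (compDPB P (pi f)).p) ≫ fst P.t (pi f).s = Z.p := by
      rw [Category.assoc, ← dpos_eq, hs]
    apply ChosenPullbacksAlong.hom_ext
    · rw [h₁]
      exact (lift_fst _ _ (hw Z)).symm
    · refine Eq.trans ?_ (lift_snd _ _ (hw Z)).symm
      rw [← h₁, Category.assoc]
      simp only [Category.assoc]
      rw [condition]
      exact congrArg (fun k => s ≫ (compDPB P (pi f)).p ≫ k) (Category.comp_id _).symm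
  refine ⟨IsTerminal.ofUniqueHom (fun Z => ?_) (fun Z m => ?_)⟩
  · refine ⟨(hT.from (Z' Z)).s, (hT.from (Z' Z)).t, ?_, (hT.from (Z' Z)).s_q, (hT.from (Z' Z)).t_r⟩
    refine (congrArg ((hT.from (Z' Z)).s ≫ ·) (dpos_eq P (pi f))).trans ?_
    rw [← Category.assoc, (hT.from (Z' Z)).s_p]
    exact lift_fst _ _ (hw Z)
  · let m' : Z' Z ⟶ compDPB P (pi f) := ⟨m.s, m.t, hmap Z m.s m.s_p, m.s_q, m.t_r⟩
    have := hT.hom_ext m' (hT.from (Z' Z))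
    exact Hom.ext (congrArg (fun k : Z' Z ⟶ _ => Hom.s k) this)
      (congrArg (fun k : Z' Z ⟶ _ => Hom.t k) this)

section

variable {C : Type u₂} [Bicategory.{w₂, v₂} C] {o : SpanBicat E → C} {T : OplaxOn o} [T.IsPseudo]

/-- The comparison 2-cell `cmS` is the canonical one by uniqueness (`PullbackAround.span_ext`), and
the remaining discrepancy is an invertible constraint. -/
lemma isUniv_zel_pi_iff {I A B : E} (P : PolyMor I A) (f : A ⟶ B) {Y : o ⟨A⟩ ⟶ o ⟨B⟩}
    {y : (polyShape E).ElAt T (I := ⟨A⟩) (J := ⟨B⟩) (pi f) Y} (hy : IsUniv y) :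
    IsUniv ((polyShape E).zel (T := T) (I := ⟨I⟩) (J := ⟨A⟩) (K := ⟨B⟩) P y) ↔
      IsUniv (DistData.ofSpan (piAround P f) (piUnit y) (isUniv_piUnit hy)).z := by
  let D := piAround P f
  let y' : El T (rev f) (emb (𝟙 B)) Y := y
  let ct : emb (comp P (pi f)).t ⟶ emb D.r ≫ emb (𝟙 B) := ctS P (pi f)
  have hct : IsIso ct := isIso_embComp _ _
  have hσ : cmS P (pi f) = D.spanIso := D.span_ext _ _
  refine Iff.trans (iff_of_eq ?_) (isUniv_curry_con_iff D ct hct (y := y') hy)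
  exact congrArg (fun σ : emb D.r ≫ rev f ⟶ D.span ≫ emb P.t =>
    IsUniv (El.con ct (El.cov σ (El.pull (emb D.r) y'))).curry) hσ

end

end

end PolyUniv

namespace PolyUniv

open Bicategory ChosenPullbacksAlong ChosenDistributivityPullbacks

/-! ### Distributivity and pseudofunctoriality -/

section

open SpanBicat PolyMor PullbackAround

variable {E : Type u} [Category.{v} E] {C : Type u₂} [Bicategory.{w₂, v₂} C]

/-- The distributivity condition. -/
def OplaxOn.IsDist {o : LocallyDiscrete E → C} (F : OplaxOn o) [F.IsPseudo] : Prop :=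
  ∀ ⦃X A B : E⦄ ⦃f : A ⟶ B⦄ ⦃u : X ⟶ A⦄ (D : PullbackAround f u),
    D.IsDistributivityPullback → ∀ d : DistData F D.cell, IsUniv d.z

variable [ChosenPullbacks E] [ChosenDistributivityPullbacks E]

/-- Only pushforwards remain after `isPseudo_of_isGood_pi`. For these, the condition on `zel` is
distributivity at the pullback used in composition, transported from `F` along `β`. -/
lemma isPseudo_of_isDist {o : LocallyDiscrete E → C} {F : OplaxOn o} [F.IsPseudo] (hF : F.IsDist)
    {T : OplaxOn (S := SpanBicat E) (fun I => o ((spanShape E).ob I))} [T.IsPseudo]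
    (hT : ∀ {I J : SpanBicat E} (S : I ⟶ J), ∃ R, Nonempty (T.map S ⊣ R))
    (β : IconOn F ((embOn E).comp (o' := fun I => o ((spanShape E).ob I)) T)) [β.IsInvertible]
    {L : OplaxOn (S := PolyBicat E) (fun I => o ((spanShape E).ob ((polyShape E).ob I)))}
    {U : ∀ {I J : PolyBicat E} (P : I ⟶ J), (polyShape E).ElAt T P (L.map P)}
    (hL : (polyShape E).IsKan T L U) : L.IsPseudo := by
  let G : OplaxOn o := (embOn E).comp (o' := fun I => o ((spanShape E).ob I)) T
  have : G.IsPseudo := inferInstanceAs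
    (((embOn E).comp (o' := fun I => o ((spanShape E).ob I)) T).IsPseudo)
  let β' : IconOn F G := β
  have : β'.IsInvertible := inferInstanceAs β.IsInvertible
  refine isPseudo_of_isGood_pi hT hL fun {A B} f I P => ?_
  rw [hL.isIso_mapComp_iff]
  refine (polyShape E).isUniv_cprod (hL.univ P) (hT _) ?_
  refine (isUniv_zel_pi_iff (I := I.as) P f (hL.univ _)).2 ?_
  exact (DistData.isUniv_tr_z_iff (G := G) β' _).1 (hF _ (isDistributivityPullback_piAround _ f) _)

/-- The constraint of `G` at `sig u` and `pi f` is invertible. The source span of `sig u` is an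
identity, so the product can be undone, giving distributivity for one distributivity pullback around
`(f, u)`; all others are isomorphic to it. -/
lemma isDist_embOn_comp {o : PolyBicat E → C} (G : OplaxOn o) [G.IsPseudo] :
    ((embOn E).comp ((linOn E).comp G)).IsDist := by
  intro X A B f u D hD d
  let T := (linOn E).comp G
  let U {I J : PolyBicat E} (P : I ⟶ J) : (polyShape E).ElAt T P (G.map P) :=
    El.mapEl G (J := linOn E) (uEl P)
  have hL : (polyShape E).IsKan T G U := isKan_linOn_comp G
  obtain ⟨hD⟩ := hD
  obtain ⟨hD'⟩ := isDistributivityPullback_piAround (sig u) f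
  have h : IsUniv ((polyShape E).cprod (U (I := ⟨X⟩) (J := ⟨A⟩) (sig u))
    (U (I := ⟨A⟩) (J := ⟨B⟩) (pi f))) := (Shape.IsKan.isIso_mapComp_iff (polyShape E) hL _ _).1
      (OplaxOn.IsPseudo.isIso_mapComp (T := G) (a := ⟨X⟩) (b := ⟨A⟩) (c := ⟨B⟩) (sig u) (pi f))
  have h₁ := (isUniv_comp_whiskerRight_iff _ _).1 h
  have h₂ := El.isUniv_curry_of_prod (T := T) (b := ⟨X⟩)
    (hL.univ (I := ⟨X⟩) (J := ⟨A⟩) (sig u)) h₁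
  have h₃ := (isUniv_zel_pi_iff (I := X) (sig u) f (hL.univ _)).1 h₂
  exact DistData.isUniv_z (F := (embOn E).comp T) (q := D.q.toLoc) (T.mapAdj (adjInv (emb D.q))) _ d
    (isUniv_z_ofSpan_of_iso (hD.uniqueUpToIso hD') _ h₃)

end

end PolyUniv

namespace PolyUniv

open Bicategory ChosenPullbacksAlong ChosenDistributivityPullbacks

/-! ### Restriction and extension of icons -/

section

variable {A : Type u₁} [Bicategory.{w₁, v₁} A] {C : Type u₂} [Bicategory.{w₂, v₂} C] {o : A → C}
  {F G : OplaxOn o} [F.IsGreg] [G.IsGreg]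

lemma IconOn.ext {S : Type u₁} [Bicategory.{w₁, v₁} S] {o : S → C} {F G : OplaxOn o}
    {β γ : IconOn F G} (h : ∀ {a b : S} (f : a ⟶ b), β.app f = γ.app f) : β = γ := by
  obtain ⟨β, _, _, _⟩ := β
  obtain ⟨γ, _, _, _⟩ := γ
  obtain rfl : @β = @γ := by
    funext a b f
    exact h f
  rfl

/-- An icon between gregarious functors is invertible at left adjoints. -/
lemma IconOn.isIso_app_of_adjunction (β : IconOn F G) {a b : A} {l : a ⟶ b} {r : b ⟶ a}
    (adj : l ⊣ r) : IsIso (β.app l) := by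
  let aF := F.mapAdj adj
  let aG := G.mapAdj adj
  have hη : aF.unit ≫ β.app l ▷ F.map r ≫ G.map l ◁ β.app r = aG.unit := by
    change (inv (F.mapId a) ≫ F.map₂ adj.unit ≫ F.mapComp l r) ≫ _ =
      inv (G.mapId a) ≫ G.map₂ adj.unit ≫ G.mapComp l r
    rw [Category.assoc, IsIso.inv_comp_eq, Category.assoc, ← β.map_comp, β.naturality_assoc,
      ← β.map_id, Category.assoc, IsIso.hom_inv_id_assoc]
  have hε : β.app r ▷ F.map l ≫ G.map r ◁ β.app l ≫ aG.counit = aF.counit := by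
    have := OplaxOn.IsGreg.isIso_mapComp (F := F) r adj
    have := OplaxOn.IsGreg.isIso_mapComp (F := G) r adj
    change _ ≫ _ ≫ (inv (G.mapComp r l) ≫ G.map₂ adj.counit ≫ G.mapId b) =
      inv (F.mapComp r l) ≫ F.map₂ adj.counit ≫ F.mapId b
    rw [IsIso.eq_inv_comp, ← β.map_comp_assoc, IsIso.hom_inv_id_assoc, ← β.naturality_assoc,
      β.map_id]
  -- The inverse is the mate of `β.app r`. The identities `hη` and `hε` say that the icon respects
  -- unit and counit.
  refine ⟨(λ_ _).inv ≫ aF.unit ▷ G.map l ≫ (α_ _ _ _).hom ≫ F.map l ◁ β.app r ▷ G.map l ≫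
    F.map l ◁ aG.counit ≫ (ρ_ _).hom, ?_, ?_⟩
  · calc _ = 𝟙 _ ⊗≫ (𝟙 _ ◁ β.app l ≫ aF.unit ▷ G.map l) ⊗≫ F.map l ◁ β.app r ▷ G.map l ⊗≫
          F.map l ◁ aG.counit ⊗≫ 𝟙 _ := by bicategory
      _ = 𝟙 _ ⊗≫ aF.unit ▷ F.map l ⊗≫ F.map l ◁ (F.map r ◁ β.app l ≫ β.app r ▷ G.map l) ⊗≫
          F.map l ◁ aG.counit ⊗≫ 𝟙 _ := by
          rw [whisker_exchange]
          bicategory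
      _ = 𝟙 _ ⊗≫ leftZigzag aF.unit aF.counit ⊗≫ 𝟙 _ := by
          rw [whisker_exchange, ← hε]
          bicategory
      _ = _ := by
          rw [aF.left_triangle]
          bicategory
  · calc _ = 𝟙 _ ⊗≫ aF.unit ▷ G.map l ⊗≫ (F.map l ◁ (β.app r ▷ G.map l ≫ aG.counit) ≫
          β.app l ▷ _) ⊗≫ 𝟙 _ := by bicategory
      _ = 𝟙 _ ⊗≫ (aF.unit ≫ β.app l ▷ F.map r ≫ G.map l ◁ β.app r) ▷ G.map l ⊗≫
          G.map l ◁ aG.counit ⊗≫ 𝟙 _ := by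
          rw [whisker_exchange]
          bicategory
      _ = 𝟙 _ ⊗≫ leftZigzag aG.unit aG.counit ⊗≫ 𝟙 _ := by
          rw [hη]
          bicategory
      _ = _ := by
          rw [aG.left_triangle]
          bicategory

end

section

open SpanBicat

variable {E : Type u} [Category.{v} E] [ChosenPullbacks E]

/-- The universal element of an embedded morphism comes from the 2-cell `embτ f`, so it is available
to `IconOn.tr_of`. `uEl_lin` plays the same role for linear polynomials. -/
lemma uSp_emb {a b : LocallyDiscrete E} (f : a ⟶ b) :
    uSp (emb f.as) = emb₂ (congrArg (·.as) (LocallyDiscrete.eq_of_hom (embτ f))) ≫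
      embComp (𝟙 a.as) f.as := by
  have h : hf (emb₂ (congrArg (·.as) (LocallyDiscrete.eq_of_hom (embτ f))) ≫
      embComp (𝟙 a.as) f.as) = pr (𝟙 a.as) (𝟙 a.as) (by simp) :=
    (hf_comp _ _).trans (Category.id_comp _)
  refine hf_ext (ax_ext ?_ ?_)
  · refine Eq.trans ?_ (congrArg (· ≫ pr₁ (emb (𝟙 a.as)) (emb f.as)) h).symm
    exact (show hf (uSp (emb f.as)) ≫ pr₁ (emb (lg (emb f.as))) (emb f.as) = 𝟙 _ by simp).trans
      (pr_pr₁ (S := emb (𝟙 a.as)) (S' := emb f.as) _ _ _).symm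
  · refine Eq.trans ?_ (congrArg (· ≫ pr₂ (emb (𝟙 a.as)) (emb f.as)) h).symm
    exact (show hf (uSp (emb f.as)) ≫ pr₂ (emb (lg (emb f.as))) (emb f.as) = 𝟙 _ by simp).trans
      (pr_pr₂ (S := emb (𝟙 a.as)) (S' := emb f.as) _ _ _).symm

end

section

open SpanBicat PolyMor

variable {E : Type u} [Category.{v} E] [ChosenPullbacks E] [ChosenDistributivityPullbacks E]
  {C : Type u₂} [Bicategory.{w₂, v₂} C] {o : PolyBicat E → C} {F G : OplaxOn o}
  [F.IsGreg] [G.IsGreg]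

lemma uEl_lin {I J : SpanBicat E} (S : I ⟶ J) :
    uEl (lin S) = linHom (uSp S) ≫ linComp (emb (lg S)) S := by
  have hc {W : E} (w : W ⟶ ax (emb (rg S))) :
      Hom.ap (linHom (uSp S) ≫ linComp (emb (lg S)) S) w =
        Hom.ap (linComp (emb (lg S)) S) (w ≫ hf (uSp S)) :=
    comp_ap (linHom (uSp S)) (linComp (emb (lg S)) S) w
  have hp {W : E} (w : W ⟶ ax (emb (lg S) ≫ S)) (x : W ⟶ (comp (lin (emb (lg S))) (lin S)).base)
      (hx : x = Hom.ap (linComp (emb (lg S)) S) w) (m : W ⟶ ax S)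
      (h : x ≫ cr (lin (emb (lg S))) (lin S) = m ≫ (lin S).p) :
      pos x m h = w ≫ pr₁ (emb (lg S)) S := by
    subst hx
    exact pos_linComp_ap _ _ _
  refine ext_val (s := emb (lg S)) (j := emb (rg S)) (X := lin S) (fun w => ?_)
    (fun w m h₁ h₂ => ?_)
  · refine (val_uEl (lin S) w).trans (Eq.symm ?_)
    refine (congrArg (· ≫ cr (lin (emb (lg S))) (lin S)) (hc w)).trans
      ((linComp_ap_cr (S := emb (lg S)) (S' := S) _).trans ?_)
    simp
  · refine (lif_uEl (lin S) w m h₁).trans (Eq.symm ?_)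
    refine (hp _ _ (hc w) m h₂).trans ?_
    have h : w = m := ((val_uEl (lin S) w).symm.trans h₁).trans (Category.comp_id _)
    simp [h]

instance isInvertible_precomp_linOn (γ : IconOn F G) : (γ.precomp (linOn E)).IsInvertible where
  isIso_app S := γ.isIso_app_of_adjunction (linAdj S)

instance isInvertible_precomp_embOn (γ : IconOn F G) :
    ((γ.precomp (linOn E)).precomp (embOn E)).IsInvertible where
  isIso_app f := inferInstanceAs (IsIso ((γ.precomp (linOn E)).app (emb f.as)))

/-- An icon between gregarious functors is determined by its restriction to `E`. -/
lemma IconOn.ext_of_precomp {γ γ' : IconOn F G}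
    (h : (γ.precomp (linOn E)).precomp (embOn E) = (γ'.precomp (linOn E)).precomp (embOn E)) :
    γ = γ' := by
  have h₁ : γ.precomp (linOn E) = γ'.precomp (linOn E) := IconOn.ext fun S => by
    -- Components are tested on universal elements, where `IconOn.tr_mapEl` sees only the restricted
    -- icon: first from morphisms to spans, then from spans to polynomials.
    refine El.push_injective ((isKan_embOn_comp ((linOn E).comp F)).univ S) ?_
    have e := (γ.precomp (linOn E)).tr_mapEl (J := embOn E)
      (s := (lg S).toLoc) (j := (rg S).toLoc) (X := S) (uSp S)
    have e' := (γ'.precomp (linOn E)).tr_mapEl (J := embOn E)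
      (s := (lg S).toLoc) (j := (rg S).toLoc) (X := S) (uSp S)
    refine e.symm.trans (Eq.trans ?_ e')
    simp only [h]
  refine IconOn.ext fun P => ?_
  refine El.push_injective ((isKan_linOn_comp F).univ P) ?_
  have e := γ.tr_mapEl (J := linOn E) (uEl P)
  have e' := γ'.tr_mapEl (J := linOn E) (uEl P)
  refine e.symm.trans (Eq.trans ?_ e')
  simp only [h₁]

/-- Every invertible icon between the restrictions of gregarious functors extends. -/
lemma exists_icon_precomp (β : IconOn ((embOn E).comp ((linOn E).comp F))
    ((embOn E).comp ((linOn E).comp G))) [β.IsInvertible] :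
    ∃ γ : IconOn F G, (γ.precomp (linOn E)).precomp (embOn E) = β := by
  have kF := isKan_embOn_comp ((linOn E).comp F)
  have kG := isKan_embOn_comp ((linOn E).comp G)
  let γ₁ : IconOn ((linOn E).comp F) ((linOn E).comp G) :=
    (spanShape E).extendIcon β kF kG.toIsCompat
  have : γ₁.IsInvertible := (spanShape E).extendIcon_isInvertible β kF kG
  -- The extension restricts to `β` on the nose: on an embedded morphism both push the universal
  -- element to the same transported element.
  have h₁ : γ₁.precomp (embOn E) = β := IconOn.ext fun {a b} f => by
    have e := (spanShape E).push_extendIcon β kF kG.toIsCompat (emb f.as)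
    refine El.push_injective (kF.univ (emb f.as)) (e.trans ?_)
    have h (H : OplaxOn o) : El.mapEl ((linOn E).comp H) (J := embOn E) (s := 𝟙 a) (j := f)
        (X := emb f.as) (uSp (emb f.as)) =
        El.of ((embOn E).comp ((linOn E).comp H)) (embτ f) :=
      (congrArg (El.mapEl ((linOn E).comp H) (J := embOn E) (s := 𝟙 a) (j := f)
        (X := emb f.as)) (uSp_emb f)).trans (El.mapEl_of _ _)
    exact (congrArg β.tr (h G)).trans ((β.tr_of (embτ f)).trans
      (congrArg (El.push · (β.app f)) (h F).symm))
  let γ : IconOn F G := (polyShape E).extendIcon γ₁ (isKan_linOn_comp F)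
    (isKan_linOn_comp G).toIsCompat
  have h₂ : γ.precomp (linOn E) = γ₁ := IconOn.ext fun {a b} S => by
    have e := (polyShape E).push_extendIcon γ₁ (isKan_linOn_comp F) (isKan_linOn_comp G).toIsCompat
      (I := ⟨a.as⟩) (J := ⟨b.as⟩) (lin S)
    refine El.push_injective ((isKan_linOn_comp F).univ (I := ⟨a.as⟩) (J := ⟨b.as⟩) (lin S))
      (e.trans ?_)
    have h (H : OplaxOn o) : El.mapEl H (J := linOn E) (s := emb (lg S)) (j := emb (rg S))
        (X := lin S) (uEl (lin S)) = El.of ((linOn E).comp H) (uSp S) :=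
      (congrArg (El.mapEl H (J := linOn E) (s := emb (lg S)) (j := emb (rg S))
        (X := lin S)) (uEl_lin S)).trans (El.mapEl_of _ _)
    exact (congrArg γ₁.tr (h G)).trans ((γ₁.tr_of (uSp S)).trans
      (congrArg (El.push · (γ₁.app S)) (h F).symm))
  exact ⟨γ, by rw [h₂, h₁]⟩

end

end PolyUniv

namespace PolyUniv

open Bicategory ChosenPullbacksAlong ChosenDistributivityPullbacks

/-! ### Passage to functors and icons with propositional equality on objects -/

section

variable {B : Type u₁} [Bicategory.{w₁, v₁} B] {C : Type u₂} [Bicategory.{w₂, v₂} C]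

/-- An icon between functors with the same action on objects. -/
def IconOn.toIcon {o : B → C} {F G : OplaxOn o} (β : IconOn F G) : Icon F.toOplax G.toOplax where
  obj_eq _ := rfl
  app f := β.app f
  naturality η := β.naturality η
  map_comp f g := (congrArg (β.app (f ≫ g) ≫ ·) (Category.comp_id (G.mapComp f g))).trans
    (β.map_comp f g)
  map_id a := (congrArg (β.app (𝟙 a) ≫ ·) (Category.comp_id (G.mapId a))).trans (β.map_id a)

/-- An icon between functors with the same action on objects. -/
def Icon.toIconOn {o : B → C} {F G : OplaxOn o} (α : Icon F.toOplax G.toOplax) : IconOn F G where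
  app f := α.app f
  naturality η := α.naturality η
  map_comp f g := (congrArg (α.app (f ≫ g) ≫ ·)
    (Category.comp_id (G.mapComp f g)).symm).trans (α.map_comp f g)
  map_id a := (congrArg (α.app (𝟙 a) ≫ ·) (Category.comp_id (G.mapId a)).symm).trans (α.map_id a)

/-- An icon supplies equalities of objects; substituting them once makes the two actions on objects
the same function, after which no transports occur. -/
lemma exists_oplaxOn {F G : B ⥤ᵒᵖᴸ C} (h : ∀ a, F.obj a = G.obj a) :
    ∃ (o : B → C) (F' G' : OplaxOn o), F = F'.toOplax ∧ G = G'.toOplax := by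
  obtain ⟨⟨⟨⟨Gobj, Gmap⟩, Gmap₂⟩, h1, h2⟩, Gi, Gc, h5, h6, h7, h8, h9⟩ := G
  obtain rfl : F.obj = Gobj := funext h
  exact ⟨F.obj, OplaxOn.ofOplax F, OplaxOn.ofOplax
    ⟨⟨⟨⟨F.obj, Gmap⟩, Gmap₂⟩, h1, h2⟩, Gi, Gc, h5, h6, h7, h8, h9⟩, rfl, rfl⟩

/-- All components are invertible. -/
def Icon.IsInvertible {F G : B ⥤ᵒᵖᴸ C} (α : Icon F G) : Prop :=
  ∀ ⦃a b : B⦄ (f : a ⟶ b), IsIso (α.app f)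

lemma Icon.IsInvertible.exists_inv {F G : B ⥤ᵒᵖᴸ C} {α : Icon F G} (hα : α.IsInvertible) :
    ∃ β : Icon G F, α.comp β = Icon.id F ∧ β.comp α = Icon.id G := by
  obtain ⟨o, F, G, rfl, rfl⟩ := exists_oplaxOn α.obj_eq
  have : α.toIconOn.IsInvertible := ⟨fun f => hα f⟩
  refine ⟨α.toIconOn.symm.toIcon, Icon.ext_app fun f => ?_, Icon.ext_app fun f => ?_⟩
  · exact (congrArg (α.toIconOn.app f ≫ ·) (Category.comp_id (inv (α.toIconOn.app f)))).trans
      (IsIso.hom_inv_id _)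
  · exact (congrArg (inv (α.toIconOn.app f) ≫ ·) (Category.comp_id (α.toIconOn.app f))).trans
      (IsIso.inv_hom_id _)

lemma Icon.isInvertible_of_inv {F G : B ⥤ᵒᵖᴸ C} {α : Icon F G} {β : Icon G F}
    (h₁ : α.comp β = Icon.id F) (h₂ : β.comp α = Icon.id G) : α.IsInvertible := by
  obtain ⟨o, F, G, rfl, rfl⟩ := exists_oplaxOn α.obj_eq
  intro a b f
  refine ⟨β.toIconOn.app f, ?_, ?_⟩
  · exact (congrArg (α.toIconOn.app f ≫ ·) (Category.comp_id (β.toIconOn.app f))).symm.trans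
      (congrArg (fun γ => γ.toIconOn.app f) h₁)
  · exact (congrArg (β.toIconOn.app f ≫ ·) (Category.comp_id (α.toIconOn.app f))).symm.trans
      (congrArg (fun γ => γ.toIconOn.app f) h₂)

lemma IsGregarious.isGreg {o : B → C} {F : OplaxOn o} (hF : IsGregarious F.toOplax) : F.IsGreg where
  isIso_mapId a := hF.isIso_mapId a
  isIso_mapComp f _ r adj := hF.isIso_mapComp f _ ⟨r, ⟨adj⟩⟩

lemma OplaxOn.IsGreg.isGregarious {o : B → C} {F : OplaxOn o} (hF : F.IsGreg) :
    IsGregarious F.toOplax where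
  isIso_mapId a := hF.isIso_mapId a
  isIso_mapComp f _ h := hF.isIso_mapComp f h.choose_spec.some

end

/-! ### Restriction along the canonical embedding -/

section

open SpanBicat PolyMor

variable {E : Type u} [Category.{v} E] [ChosenPullbacks E] [ChosenDistributivityPullbacks E]
  {C : Type u₂} [Bicategory.{w₂, v₂} C]

lemma embOn_comp_linOn_comp {o : PolyBicat E → C} (F : OplaxOn o) :
    (embOn E).comp ((linOn E).comp F) =
      OplaxOn.ofOplax ((sigmaEmb E).toOplax.comp F.toOplax) :=
  (OplaxOn.comp_assoc (embOn E) (linOn E) F).symm.trans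
    (congrArg (fun J : OplaxOn (sigmaEmb E).obj => J.comp F) embOn_comp_linOn)

/-- Embedded morphisms are left adjoints among polynomials, and icons between gregarious functors
are invertible there. This is why the target category has only invertible icons. -/
lemma Icon.isInvertible_precomp {F G : PolyBicat E ⥤ᵒᵖᴸ C} (hF : IsGregarious F)
    (hG : IsGregarious G) (α : Icon F G) : (α.precomp (sigmaEmb E)).IsInvertible := by
  obtain ⟨o, F, G, rfl, rfl⟩ := exists_oplaxOn α.obj_eq
  have := hF.isGreg
  have := hG.isGreg
  intro a b f
  exact (isInvertible_precomp_embOn α.toIconOn).isIso_app f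

lemma Icon.precomp_injective {F G : PolyBicat E ⥤ᵒᵖᴸ C} (hF : IsGregarious F)
    (hG : IsGregarious G) {α β : Icon F G}
    (h : α.precomp (sigmaEmb E) = β.precomp (sigmaEmb E)) : α = β := by
  obtain ⟨o, F, G, rfl, rfl⟩ := exists_oplaxOn α.obj_eq
  have := hF.isGreg
  have := hG.isGreg
  have e : α.toIconOn = β.toIconOn := IconOn.ext_of_precomp <| IconOn.ext fun {a b} f =>
    congrArg (fun γ => (Icon.toIconOn
      (F := OplaxOn.ofOplax ((sigmaEmb E).toOplax.comp F.toOplax))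
      (G := OplaxOn.ofOplax ((sigmaEmb E).toOplax.comp G.toOplax)) γ).app f) h
  exact Icon.ext_app fun f => congrArg (fun γ => γ.app f) e

lemma Icon.exists_precomp_eq {F G : PolyBicat E ⥤ᵒᵖᴸ C} (hF : IsGregarious F)
    (hG : IsGregarious G)
    (β : Icon ((sigmaEmb E).toOplax.comp F) ((sigmaEmb E).toOplax.comp G)) (hβ : β.IsInvertible) :
    ∃ α : Icon F G, α.precomp (sigmaEmb E) = β := by
  obtain ⟨o, F, G, rfl, rfl⟩ := exists_oplaxOn (F := F) (G := G) fun a => β.obj_eq ⟨a.as⟩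
  have := hF.isGreg
  have := hG.isGreg
  -- The restrictions equal the two-stage composites only propositionally. Generalising them allows
  -- substitution, and the resulting equality of components is heterogeneous.
  have key : ∀ X Y, X = (embOn E).comp ((linOn E).comp F) → Y = (embOn E).comp ((linOn E).comp G) →
      ∀ β : IconOn X Y, β.IsInvertible → ∃ γ : IconOn F G, ∀ {a b : LocallyDiscrete E} (f : a ⟶ b),
        HEq (γ.app ((sigmaEmb E).map f)) (β.app f) := by
    rintro _ _ rfl rfl β hβ
    obtain ⟨γ, rfl⟩ := exists_icon_precomp β
    exact ⟨γ, fun f => HEq.rfl⟩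
  let β' : IconOn (OplaxOn.ofOplax ((sigmaEmb E).toOplax.comp F.toOplax))
    (OplaxOn.ofOplax ((sigmaEmb E).toOplax.comp G.toOplax)) := Icon.toIconOn β
  obtain ⟨γ, hγ⟩ := key _ _ (embOn_comp_linOn_comp F).symm (embOn_comp_linOn_comp G).symm β'
    ⟨fun f => hβ f⟩
  exact ⟨γ.toIcon, Icon.ext_app fun f => eq_of_heq (hγ f)⟩

/-- The restriction of a gregarious functor along the canonical embedding. -/
noncomputable def sigmaRestrict {F : PolyBicat E ⥤ᵒᵖᴸ C} (hF : IsGregarious F) :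
    LocallyDiscrete E ⥤ᵖ C :=
  have h : ((embOn E).comp ((linOn E).comp (OplaxOn.ofOplax F))).IsPseudo :=
    have : (OplaxOn.ofOplax F).IsGreg := IsGregarious.isGreg (F := OplaxOn.ofOplax F) hF
    inferInstance
  have h' : (OplaxOn.ofOplax ((sigmaEmb E).toOplax.comp F)).IsPseudo :=
    (congrArg OplaxOn.IsPseudo (embOn_comp_linOn_comp (OplaxOn.ofOplax F))).mp h
  have : ∀ a, IsIso (((sigmaEmb E).toOplax.comp F).mapId a) := h'.isIso_mapId
  have : ∀ {a b c : LocallyDiscrete E} (f : a ⟶ b) (g : b ⟶ c),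
    IsIso (((sigmaEmb E).toOplax.comp F).mapComp f g) := h'.isIso_mapComp
  Pseudofunctor.mkOfOplax' ((sigmaEmb E).toOplax.comp F)

lemma isTwoBeck_sigmaRestrict {F : PolyBicat E ⥤ᵒᵖᴸ C} (hF : IsGregarious F) :
    IsTwoBeck (sigmaRestrict hF) := by
  have : (OplaxOn.ofOplax F).IsGreg := IsGregarious.isGreg (F := OplaxOn.ofOplax F) hF
  -- The functor is generalised along with its invertible constraints, so that the equality with the
  -- two-stage restriction can be substituted.
  have key : ∀ (X : OplaxOn fun a : LocallyDiscrete E => F.obj ⟨a.as⟩) (_ : X.IsPseudo),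
      X = (embOn E).comp ((linOn E).comp (OplaxOn.ofOplax F)) → X.IsBeck := by
    rintro _ _ rfl
    exact isBeck_embOn_comp (OplaxOn.ofOplax F)
  exact (isTwoBeck_iff_isBeck _).2 (key _ (isPseudo_ofOplax (sigmaRestrict hF))
    (embOn_comp_linOn_comp (OplaxOn.ofOplax F)).symm)

lemma isDistBeck_sigmaRestrict (F : PolyBicat E ⥤ᵖ C) :
    IsDistBeck (sigmaRestrict (isGregarious_of_pseudofunctor F)) := by
  have : (OplaxOn.ofOplax F.toOplax).IsPseudo :=
    ⟨fun a => inferInstanceAs (IsIso (F.mapId a).hom),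
      fun f g => inferInstanceAs (IsIso (F.mapComp f g).hom)⟩
  have key : ∀ (X : OplaxOn fun a : LocallyDiscrete E => F.obj ⟨a.as⟩) (_ : X.IsPseudo),
      X = (embOn E).comp ((linOn E).comp (OplaxOn.ofOplax F.toOplax)) → X.IsDist := by
    rintro _ _ rfl
    exact isDist_embOn_comp (OplaxOn.ofOplax F.toOplax)
  exact (isDistBeck_iff (isTwoBeck_sigmaRestrict _)).2
    (key _ (isPseudo_ofOplax (sigmaRestrict (isGregarious_of_pseudofunctor F)))
      (embOn_comp_linOn_comp (OplaxOn.ofOplax F.toOplax)).symm)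

/-- Every 2-Beck pseudofunctor is the restriction of a gregarious functor, which is a
pseudofunctor if the distributivity condition holds. -/
lemma exists_extension {F : LocallyDiscrete E ⥤ᵖ C} (hF : IsTwoBeck F) :
    ∃ (L : PolyBicat E ⥤ᵒᵖᴸ C) (_ : IsGregarious L)
      (β : Icon ((sigmaEmb E).toOplax.comp L) F.toOplax), β.IsInvertible ∧
      (IsDistBeck F → ∃ L' : PolyBicat E ⥤ᵖ C, L'.toOplax = L) := by
  -- Two successive Kan extensions: to spans, then to polynomials. The right adjoints `adj` of the
  -- values on spans are what makes the second one exist.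
  obtain ⟨T, U, hT, adj⟩ := ((isTwoBeck_iff_isBeck F).1 hF).exists_isKan
  have := ((isTwoBeck_iff_isBeck F).1 hF).isPseudo_of_isKan hT
  obtain ⟨L, V, hL⟩ := exists_isKan_poly (T := T) adj
  obtain ⟨β, hβ⟩ := exists_icon_embOn_comp hT
  obtain ⟨γ, hγ⟩ := exists_icon_linOn_comp hL
  have key : ∀ X : OplaxOn F.obj, (embOn E).comp ((linOn E).comp
      (o' := fun I => F.obj ((spanShape E).ob ((polyShape E).ob I))) L) = X →
      ∃ δ : IconOn X (OplaxOn.ofOplax F.toOplax), δ.IsInvertible := by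
    rintro _ rfl
    let δ : IconOn (OplaxOn.ofOplax F.toOplax) ((embOn E).comp ((linOn E).comp
      (o' := fun I => F.obj ((spanShape E).ob ((polyShape E).ob I))) L)) := β.trans γ
    have hδ : δ.IsInvertible := ⟨fun f =>
      IsIso.comp_isIso' (hβ.isIso_app f) (hγ.isIso_app f)⟩
    exact ⟨δ.symm, ⟨fun f => @IsIso.inv_isIso _ _ _ _ (δ.app f) (hδ.isIso_app f)⟩⟩
  obtain ⟨δ, hδ⟩ := key _ (embOn_comp_linOn_comp
    (o := fun I => F.obj ((spanShape E).ob ((polyShape E).ob I))) L)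
  refine ⟨L.toOplax, (isGreg_of_isKan adj hL).isGregarious, δ.toIcon, fun a b f => hδ.isIso_app f,
    fun h => ?_⟩
  have hp := isPseudo_of_isDist ((isDistBeck_iff hF).1 h) adj β hL
  have : ∀ a, IsIso (L.toOplax.mapId a) := hp.isIso_mapId
  have : ∀ {a b c : PolyBicat E} (f : a ⟶ b) (g : b ⟶ c),
    IsIso (L.toOplax.mapComp f g) := hp.isIso_mapComp
  exact ⟨Pseudofunctor.mkOfOplax' L.toOplax, rfl⟩

end

end PolyUniv

namespace PolyUniv

open Bicategory

/-! ### The equivalences of categories -/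

section

variable {B : Type u₁} [Bicategory.{w₁, v₁} B] {C : Type u₂} [Bicategory.{w₂, v₂} C]

/-- An invertible icon, as an isomorphism in a full subcategory of pseudofunctors and icons. -/
noncomputable def Icon.IsInvertible.iso {P : ObjectProperty (PseudoIcon B C)}
    {F G : P.FullSubcategory} {α : Icon F.obj.functor.toOplax G.obj.functor.toOplax}
    (hα : α.IsInvertible) : F ≅ G where
  hom := ObjectProperty.homMk α
  inv := ObjectProperty.homMk hα.exists_inv.choose
  hom_inv_id := ObjectProperty.hom_ext _ hα.exists_inv.choose_spec.1
  inv_hom_id := ObjectProperty.hom_ext _ hα.exists_inv.choose_spec.2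

/-- An isomorphism in the category of icons has invertible components, so morphisms of the core
satisfy the hypothesis under which icons extend. -/
lemma isInvertible_hom {P : ObjectProperty (PseudoIcon B C)} {F G : P.FullSubcategory}
    (e : F ≅ G) : Icon.IsInvertible (F := F.obj.functor.toOplax) (G := G.obj.functor.toOplax)
      e.hom.hom :=
  Icon.isInvertible_of_inv (β := e.inv.hom) (congrArg (·.hom) e.hom_inv_id)
    (congrArg (·.hom) e.inv_hom_id)

end

variable (E : Type u) [Category.{v} E] [ChosenPullbacks E] [ChosenDistributivityPullbacks E]
  (C : Type u₂) [Bicategory.{w₂, v₂} C]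

/-- Restriction of gregarious functors along the canonical embedding. -/
noncomputable def gregToTwoBeck : Greg (PolyBicat E) C ⥤ TwoBeck E C where
  obj F := ⟨⟨⟨sigmaRestrict F.property⟩, isTwoBeck_sigmaRestrict F.property⟩⟩
  map {F G} α := ⟨Icon.IsInvertible.iso (Icon.isInvertible_precomp F.property G.property α.hom)⟩
  map_id _ := Core.hom_ext (ObjectProperty.hom_ext _ rfl)
  map_comp _ _ := Core.hom_ext (ObjectProperty.hom_ext _ rfl)

instance : (gregToTwoBeck E C).Faithful where
  map_injective {F G _ _} h := ObjectProperty.hom_ext _ <|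
    Icon.precomp_injective F.property G.property (congrArg (fun γ => γ.iso.hom.hom) h)

instance : (gregToTwoBeck E C).Full where
  map_surjective {F G} e := by
    obtain ⟨α, hα⟩ := Icon.exists_precomp_eq F.property G.property e.iso.hom.hom
      (isInvertible_hom e.iso)
    exact ⟨ObjectProperty.homMk α, Core.hom_ext (ObjectProperty.hom_ext _ hα)⟩

instance : (gregToTwoBeck E C).EssSurj where
  mem_essImage F := by
    obtain ⟨L, hL, β, hβ, -⟩ := exists_extension F.of.property
    exact ⟨⟨⟨L⟩, hL⟩, ⟨Core.isoMk (Icon.IsInvertible.iso hβ)⟩⟩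

instance : (gregToTwoBeck E C).IsEquivalence where

/-- Restriction of pseudofunctors along the canonical embedding. -/
noncomputable def pseudoToDistBeck : PseudoIcon (PolyBicat E) C ⥤ DistBeck E C where
  obj F := ⟨⟨⟨sigmaRestrict (isGregarious_of_pseudofunctor F.functor)⟩,
    isDistBeck_sigmaRestrict F.functor⟩⟩
  map {F G} α := ⟨Icon.IsInvertible.iso (Icon.isInvertible_precomp
    (isGregarious_of_pseudofunctor F.functor) (isGregarious_of_pseudofunctor G.functor) α)⟩
  map_id _ := Core.hom_ext (ObjectProperty.hom_ext _ rfl)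
  map_comp _ _ := Core.hom_ext (ObjectProperty.hom_ext _ rfl)

instance : (pseudoToDistBeck E C).Faithful where
  map_injective {F G _ _} h := Icon.precomp_injective (isGregarious_of_pseudofunctor F.functor)
    (isGregarious_of_pseudofunctor G.functor) (congrArg (fun γ => γ.iso.hom.hom) h)

instance : (pseudoToDistBeck E C).Full where
  map_surjective {F G} e := by
    obtain ⟨α, hα⟩ := Icon.exists_precomp_eq (isGregarious_of_pseudofunctor F.functor)
      (isGregarious_of_pseudofunctor G.functor) e.iso.hom.hom (isInvertible_hom e.iso)
    exact ⟨α, Core.hom_ext (ObjectProperty.hom_ext _ hα)⟩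

instance : (pseudoToDistBeck E C).EssSurj where
  mem_essImage F := by
    obtain ⟨L, hL, β, hβ, h⟩ := exists_extension F.of.property.isTwoBeck
    obtain ⟨L, rfl⟩ := h F.of.property
    exact ⟨⟨L⟩, ⟨Core.isoMk (Icon.IsInvertible.iso hβ)⟩⟩

instance : (pseudoToDistBeck E C).IsEquivalence where

lemma gregToTwoBeck_comp_twoBeckToOplax : gregToTwoBeck E C ⋙ twoBeckToOplax E C =
    gregToOplax (PolyBicat E) C ⋙ restrictSigma E C :=
  rfl

lemma pseudoToDistBeck_comp_distBeckToTwoBeck : pseudoToDistBeck E C ⋙ distBeckToTwoBeck E C =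
    pseudoToGreg (PolyBicat E) C ⋙ gregToTwoBeck E C :=
  CategoryTheory.Functor.hext (fun _ => rfl) fun _ _ _ =>
    heq_of_eq (Core.hom_ext (ObjectProperty.hom_ext _ rfl))

end PolyUniv

theorem theorem5 {E : Type u} [Category.{v} E] [ChosenPullbacks E]
    [ChosenDistributivityPullbacks E]
    (hE : ∀ ⦃A B : E⦄ (f : A ⟶ B), IsExponentiable f)
    (C : Type u₂) [Bicategory.{w₂, v₂} C] :
    ∃ Φ : Greg (PolyBicat E) C ⥤ TwoBeck E C,
      Φ.IsEquivalence ∧ Φ ⋙ twoBeckToOplax E C = gregToOplax (PolyBicat E) C ⋙ restrictSigma E C ∧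
      ∃ Ψ : PseudoIcon (PolyBicat E) C ⥤ DistBeck E C,
        Ψ.IsEquivalence ∧ Ψ ⋙ distBeckToTwoBeck E C = pseudoToGreg (PolyBicat E) C ⋙ Φ := by
  exact ⟨gregToTwoBeck E C, inferInstance, gregToTwoBeck_comp_twoBeckToOplax E C,
    pseudoToDistBeck E C, inferInstance, pseudoToDistBeck_comp_distBeckToTwoBeck E C⟩
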